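/- Let $k$ be a field of characteristic different from $2$, let $D$ be a central division algebra over $k$ of degree $n=2^d\ge 2$ (so $\dim_k D=n^2$), and let $\sigma$ be a symplectic involution of $D$: a $k$-linear involutive anti-automorphism which over an algebraic closure of $k$ becomes the adjoint involution of a nonsingular alternating bilinear form. Let $X$ be the Severi–Brauer variety of $n$-dimensional left ideals of $D$, i.e. the $k$-scheme representing the functor that sends a commutative $k$-algebra $R$ to the set of left ideals of $D_R=D\otimes_k R$ which are direct summands of rank $n$ of the $R$-module $D_R$. Then $X$ is integral. Let $F=k(X)$ be its function field, let $T\subset D_F$ be the left ideal corresponding to the generic point $\operatorname{Spec}F\to X$, let $\sigma(T)$ be the image of $T$ under $\sigma\otimes\mathrm{id}_F$, and put $L_\sigma=T\cap\sigma(T)$. Let $\mathcal D=D\otimes_k\mathcal O_X$ and consider the following subsheaves of $\mathcal D$, the intersections being taken in the constant sheaf $D_F$: $$\mathcal T=T\cap\mathcal D,\qquad \sigma(\mathcal T)=\sigma(T)\cap\mathcal D,\qquad \mathcal L_\sigma=L_\sigma\cap\mathcal D .$$ 1. The $\mathcal O_X$-module $\mathcal L_\sigma$ is invertible. 2. For every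 field extension $\ell/k$ that splits $D$, the $\ell$-scheme $X_\ell=X\times_k\operatorname{Spec}\ell$ is isomorphic to $\mathbb P^{n-1}_\ell$, and under every $\ell$-isomorphism $X_\ell\cong\mathbb P^{n-1}_\ell$ the inverse image of $\mathcal L_\sigma$ on $X_\ell$ is isomorphic to $\mathcal O(-2)$. 3. The class of $\mathcal L_\sigma$ generates $\operatorname{Pic}(X)$: for every invertible $\mathcal O_X$-module $\mathcal N$ there is an integer $m\ge 0$ with $\mathcal N\cong\mathcal L_\sigma^{\otimes m}$ or $\mathcal N\otimes\mathcal L_\sigma^{\otimes m}\cong\mathcal O_X$. 4. Over the generic point there are isomorphisms of $F$-vector spaces $$\mathrm{mult}\colon \sigma(T)\otimes_{D_F}T\xrightarrow{\ \sim\ }L_\sigma,\quad s\otimes t\mapsto st,\qquad \mathrm{can}\colon T\otimes_F\sigma(T)\xrightarrow{\ \sim\ }L_\sigma\otimes_F D_F,\quad t\otimes s\mapsto\lambda\otimes t\mu s,$$ where $\lambda\in L_\sigma$ and $\mu\in D_F$ are any elements with $\operatorname{Trd}(\lambda\mu)=1$; such elements exist, and $\mathrm{can}$ does not depend on their choice.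 Moreover there are isomorphisms of $\mathcal O_X$-modules $$\mathrm{mult}_X\colon \sigma(\mathcal T)\otimes_{\mathcal D}\mathcal T\xrightarrow{\ \sim\ }\mathcal L_\sigma,\qquad \mathrm{can}_X\colon \mathcal T\otimes_{\mathcal O_X}\sigma(\mathcal T)\xrightarrow{\ \sim\ }\mathcal L_\sigma\otimes_{\mathcal O_X}\mathcal D$$ which on the generic fiber are $\mathrm{mult}$ and $\mathrm{can}$, the generic fibers of the sheaves being canonically $\sigma(T)\otimes_{D_F}T$, $L_\sigma$, $T\otimes_F\sigma(T)$ and $L_\sigma\otimes_F D_F$ respectively. -/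

import Mathlib

open CategoryTheory AlgebraicGeometry TensorProduct Opposite
universe u
noncomputable section

namespace SeveriBrauer

section Modules
variable {X : Scheme.{u}}

/-- A subpresheaf of modules of a sheaf of modules is a sheaf when membership can be checked
locally. -/
lemma isSheaf_submodule (M : X.PresheafOfModules)
    (hM : TopCat.Presheaf.IsSheaf (X := X) M.presheaf) (N : M.Submodule)
    (hN : ∀ (U : X.Opens) (s : M.obj (op U)), (∀ x ∈ U, ∃ (V : X.Opens) (i : V ⟶ U), x ∈ V ∧
      M.map i.op s ∈ N.obj (op V)) → s ∈ N.obj (op U)) :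
    TopCat.Presheaf.IsSheaf (X := X) N.toPresheafOfModules.presheaf := by
  rw [TopCat.Presheaf.isSheaf_iff_isSheafUniqueGluing] at hM ⊢
  intro ι U sf hsf
  have hc : TopCat.Presheaf.IsCompatible (X := X) M.presheaf U (fun i ↦ (sf i).1) := by
    intro i j
    exact congrArg Subtype.val (hsf i j)
  obtain ⟨s, hs, hu⟩ := hM U _ hc
  refine ⟨⟨s, hN (iSup U) s fun x hx ↦ ?_⟩, fun i ↦ Subtype.ext (hs i), fun t ht ↦ Subtype.ext
    (hu t.1 fun i ↦ congrArg Subtype.val (ht i))⟩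
  obtain ⟨i, hi⟩ := TopologicalSpace.Opens.mem_iSup.1 hx
  refine ⟨U i, TopologicalSpace.Opens.leSupr U i, hi, ?_⟩
  have := hs i
  change M.map (TopologicalSpace.Opens.leSupr U i).op s = (sf i).1 at this
  rw [this]
  exact (sf i).2

/-- The structure sheaf `𝒪_X`, as an `𝒪_X`-module. -/
def structureModule (X : Scheme.{u}) : X.Modules := SheafOfModules.unit X.ringCatSheaf

/-- The `𝒪_X`-module associated with a presheaf of `𝒪_X`-modules. -/
def sheafify (P : X.PresheafOfModules) : X.Modules :=
  (PresheafOfModules.sheafification (𝟙 X.ringCatSheaf.obj)).obj P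

/-- The canonical map from the sections of a presheaf of modules to those of its sheafification. -/
def toSheafify (P : X.PresheafOfModules) (U : X.Opens) : P.obj (op U) →+ Γ(sheafify P, U) :=
  ((CategoryTheory.toSheafify (Opens.grothendieckTopology X) P.presheaf).app (op U)).hom

/-- The presheaf `U ↦ M(U) ⊗_{𝒪(U)} N(U)`. -/
def tensorPresheaf (M N : X.Modules) : X.PresheafOfModules :=
  PresheafOfModules.Monoidal.tensorObj (R := X.presheaf) M.val N.val

/-- The tensor product `M ⊗_{𝒪_X} N`: the sheafification of `U ↦ M(U) ⊗_{𝒪(U)} N(U)`. -/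
def tensor (M N : X.Modules) : X.Modules := sheafify (tensorPresheaf M N)

/-- An invertible `𝒪_X`-module: locally isomorphic to `𝒪_X`. -/
def IsInvertible (M : X.Modules) : Prop :=
  ∀ x : X, ∃ U : X.Opens, x ∈ U ∧ Nonempty (M.restrict U.ι ≅ structureModule U)

/-- The tensor powers `L^{⊗ m}`, `m ≥ 0`. -/
def tensorPow (L : X.Modules) : ℕ → X.Modules
  | 0 => structureModule X
  | m + 1 => tensor (tensorPow L m) L

/-- The class of `L` generates `Pic X`, the group of isomorphism classes of invertible `𝒪_X`-modules
under the tensor product: `L` is invertible, and the class of every invertible module `N` is a power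
of the class of `L`, with exponent `m ≥ 0` (`N ≅ L^{⊗ m}`) or `-m ≤ 0` (`N ⊗ L^{⊗ m} ≅ 𝒪_X`). -/
def GeneratesPic (L : X.Modules) : Prop :=
  IsInvertible L ∧ ∀ N : X.Modules, IsInvertible N → ∃ m : ℕ,
    Nonempty (N ≅ tensorPow L m) ∨ Nonempty (tensor N (tensorPow L m) ≅ structureModule X)

end Modules

section Balanced
variable {R A : Type*} [CommRing R] [Ring A] [Algebra R A]

/-- For a right ideal `I` and a left ideal `J` of the `R`-algebra `A`: the submodule of `I ⊗_R J`
spanned by the elements `x a ⊗ y - x ⊗ a y` with `x ∈ I`, `a ∈ A`, `y ∈ J`. -/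
def balancedRel (I J : Submodule R A) : Submodule R (I ⊗[R] J) :=
  Submodule.span R {z | ∃ (x x' : I) (y y' : J) (a : A),
    (x' : A) = x * a ∧ (y' : A) = a * y ∧ z = x' ⊗ₜ[R] y - x ⊗ₜ[R] y'}

/-- The quotient of `M ⊗_R N` by a submodule. -/
abbrev TensorQuotient {M N : Type*} [AddCommGroup M] [AddCommGroup N] [Module R M] [Module R N]
    (K : Submodule R (M ⊗[R] N)) : Type _ := (M ⊗[R] N) ⧸ K

/-- The class of `x ⊗ y` in a quotient of `M ⊗_R N`. -/
def TensorQuotient.tmul {M N : Type*} [AddCommGroup M] [AddCommGroup N] [Module R M] [Module R N]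
    (K : Submodule R (M ⊗[R] N)) (x : M) (y : N) : TensorQuotient K :=
  Submodule.Quotient.mk (x ⊗ₜ[R] y)

/-- For a right ideal `I` and a left ideal `J` of the `R`-algebra `A`: the tensor product
`I ⊗_A J`. -/
abbrev BalancedTensor (I J : Submodule R A) : Type _ := TensorQuotient (balancedRel I J)

/-- The element `x ⊗ y` of `I ⊗_A J`. -/
def BalancedTensor.tmul {I J : Submodule R A} (x : I) (y : J) : BalancedTensor I J :=
  TensorQuotient.tmul (balancedRel I J) x y

end Balanced

section Twist
variable {A : Type u} [CommRing A] {S : Type*} [SetLike S A] [AddSubgroupClass S A]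
  (𝒜 : ℕ → S) [GradedRing 𝒜]

/-- The localization `A_𝔭` of `A` at a point `𝔭` of `Proj 𝒜`. -/
abbrev fracStalk (x : ProjectiveSpectrum 𝒜) : Type u :=
  Localization.AtPrime x.asHomogeneousIdeal.toIdeal

/-- Families `(f_𝔭)` with `f_𝔭 ∈ A_𝔭` for `𝔭 ∈ U`. -/
abbrev FracSec (U : (Proj 𝒜).Opens) : Type u := ∀ x : U, fracStalk 𝒜 x.1

lemma exists_homogeneous_notMem (x : ProjectiveSpectrum 𝒜) :
    ∃ (d : ℕ) (b : A), 0 < d ∧ b ∈ 𝒜 d ∧ b ∉ x.asHomogeneousIdeal := by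
  classical
  by_contra! h
  refine x.not_irrelevant_le fun z hz ↦ ?_
  rw [← DirectSum.sum_support_decompose 𝒜 z]
  refine x.asHomogeneousIdeal.toIdeal.sum_mem fun j hj ↦ h j _ ?_ (SetLike.coe_mem _)
  by_contra h0
  obtain rfl : j = 0 := by omega
  rw [HomogeneousIdeal.mem_irrelevant_iff] at hz
  exact (DFinsupp.mem_support_iff.1 hj) (Subtype.ext hz)

/-- Sections of the structure sheaf of `Proj 𝒜` are such families: the ring `𝒪(U)` maps to the
product of the `A_𝔭`. -/
def secVal {U : (Proj 𝒜).Opens} : Γ(Proj 𝒜, U) →+* FracSec 𝒜 U where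
  toFun r x := HomogeneousLocalization.val (r.1 x)
  map_one' := by ext x; exact HomogeneousLocalization.val_one
  map_mul' r s := by ext x; exact HomogeneousLocalization.val_mul _ _
  map_zero' := by ext x; exact HomogeneousLocalization.val_zero
  map_add' r s := by ext x; exact HomogeneousLocalization.val_add _ _

instance (U : (Proj 𝒜).Opens) : Module Γ(Proj 𝒜, U) (FracSec 𝒜 U) :=
  Module.compHom _ (secVal 𝒜)

/-- The presheaf of all families `(f_𝔭)`. -/
def fracAb : TopCat.Presheaf Ab.{u} (Proj 𝒜) where
  obj U := AddCommGrpCat.of (FracSec 𝒜 U.unop)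
  map {U V} i := AddCommGrpCat.ofHom
    { toFun f x := f ⟨x.1, i.unop.le x.2⟩
      map_zero' := rfl
      map_add' _ _ := rfl }

instance (U : (Proj 𝒜).Opensᵒᵖ) :
    Module ((Proj 𝒜).ringCatSheaf.obj.obj U) ((fracAb 𝒜).obj U) :=
  inferInstanceAs (Module Γ(Proj 𝒜, U.unop) (FracSec 𝒜 U.unop))

/-- The presheaf of all families `(f_𝔭)`, as a presheaf of modules over `Proj 𝒜`. -/
def fracPresheaf : (Proj 𝒜).PresheafOfModules :=
  PresheafOfModules.ofPresheaf (fracAb 𝒜) (fun _U _V _i _r _m ↦ rfl)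

lemma isSheaf_fracAb : (fracAb 𝒜).IsSheaf := by
  rw [TopCat.Presheaf.isSheaf_iff_isSheaf_comp (forget Ab)]
  exact TopCat.Presheaf.toTypes_isSheaf (Proj 𝒜).toTopCat (fun x ↦ fracStalk 𝒜 x)

/-- The family is `a / b` on all of `V`, for fixed homogeneous `a`, `b` with `deg a - deg b = m` and
`b ∉ 𝔭` for all `𝔭 ∈ V`. -/
def IsFracOfDegree (m : ℤ) {V : (Proj 𝒜).Opens} (f : FracSec 𝒜 V) : Prop :=
  ∃ (i j : ℕ) (a b : A), (i : ℤ) = j + m ∧ a ∈ 𝒜 i ∧ b ∈ 𝒜 j ∧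
    ∀ x : V, b ∉ ProjectiveSpectrum.asHomogeneousIdeal (𝒜 := 𝒜) x.1 ∧
      f x * algebraMap A (fracStalk 𝒜 x.1) b = algebraMap A (fracStalk 𝒜 x.1) a

/-- Restriction of families. -/
def resFrac {U V : (Proj 𝒜).Opens} (i : V ≤ U) (f : FracSec 𝒜 U) : FracSec 𝒜 V :=
  fun y ↦ f ⟨y.1, i y.2⟩

/-- The family is locally of the form `a / b` with `a`, `b` homogeneous and `deg a - deg b = m`. -/
def IsLocallyFracOfDegree (m : ℤ) {U : (Proj 𝒜).Opens} (f : FracSec 𝒜 U) : Prop :=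
  ∀ x ∈ U, ∃ (V : (Proj 𝒜).Opens) (i : V ≤ U), x ∈ V ∧ IsFracOfDegree 𝒜 m (resFrac 𝒜 i f)

variable {𝒜} {m : ℤ} {U : (Proj 𝒜).Opens}

lemma IsFracOfDegree.res {V : (Proj 𝒜).Opens} (i : V ≤ U) {f : FracSec 𝒜 U}
    (hf : IsFracOfDegree 𝒜 m f) : IsFracOfDegree 𝒜 m (resFrac 𝒜 i f) := by
  obtain ⟨p, q, a, b, h, ha, hb, hx⟩ := hf
  exact ⟨p, q, a, b, h, ha, hb, fun x ↦ hx ⟨x.1, i x.2⟩⟩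

lemma isLocallyFrac_zero : IsLocallyFracOfDegree 𝒜 m (0 : FracSec 𝒜 U) := by
  intro x hx
  obtain ⟨d, b, hd, hb, hbx⟩ := exists_homogeneous_notMem 𝒜 x
  have hx' : x ∈ U ⊓ ProjectiveSpectrum.basicOpen 𝒜 b := ⟨hx, hbx⟩
  refine ⟨U ⊓ ProjectiveSpectrum.basicOpen 𝒜 b, inf_le_left, hx',
    (m.natAbs * d + m).toNat, m.natAbs * d, 0, b ^ m.natAbs, ?_, zero_mem _, ?_, fun y ↦ ⟨?_, ?_⟩⟩
  · have h1 : (m.natAbs : ℤ) ≤ m.natAbs * d := by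
      exact_mod_cast Nat.le_mul_of_pos_right _ hd
    push_cast at h1 ⊢
    rw [Int.toNat_of_nonneg]
    have := neg_abs_le m
    omega
  · simpa using SetLike.pow_mem_graded m.natAbs hb
  · intro h
    exact y.2.2 ((ProjectiveSpectrum.isPrime (𝒜 := 𝒜) y.1).mem_of_pow_mem _ h)
  · simp [resFrac]

lemma IsLocallyFracOfDegree.add {f g : FracSec 𝒜 U} (hf : IsLocallyFracOfDegree 𝒜 m f)
    (hg : IsLocallyFracOfDegree 𝒜 m g) : IsLocallyFracOfDegree 𝒜 m (f + g) := by
  intro x hx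
  obtain ⟨V, hV, hxV, p, q, a, b, h, ha, hb, hy⟩ := hf x hx
  obtain ⟨V', hV', hxV', p', q', a', b', h', ha', hb', hy'⟩ := hg x hx
  refine ⟨V ⊓ V', inf_le_left.trans hV, ⟨hxV, hxV'⟩, p + q', q + q', a * b' + a' * b, b * b', ?_,
    add_mem (SetLike.mul_mem_graded ha hb') ?_, SetLike.mul_mem_graded hb hb', fun y ↦ ⟨?_, ?_⟩⟩
  · push_cast; omega
  · have : p + q' = p' + q := by omega
    exact this ▸ SetLike.mul_mem_graded ha' hb
  · intro h
    exact ((ProjectiveSpectrum.isPrime (𝒜 := 𝒜) y.1).mem_or_mem h).elim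
      (hy ⟨y.1, y.2.1⟩).1 (hy' ⟨y.1, y.2.2⟩).1
  · have e := (hy ⟨y.1, y.2.1⟩).2
    have e' := (hy' ⟨y.1, y.2.2⟩).2
    simp only [resFrac] at e e'
    simp only [resFrac, Pi.add_apply, map_add, map_mul, ← e, ← e']
    ring

lemma mk_mul_algebraMap (x : ProjectiveSpectrum 𝒜) (c : A)
    (d : x.asHomogeneousIdeal.toIdeal.primeCompl) :
    (Localization.mk c d : fracStalk 𝒜 x) * algebraMap A (fracStalk 𝒜 x) d =
      algebraMap A (fracStalk 𝒜 x) c := by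
  rw [Localization.mk_eq_mk', IsLocalization.mk'_spec]

lemma IsLocallyFracOfDegree.smul {f : FracSec 𝒜 U} (r : Γ(Proj 𝒜, U))
    (hf : IsLocallyFracOfDegree 𝒜 m f) : IsLocallyFracOfDegree 𝒜 m (r • f) := by
  intro x hx
  obtain ⟨V, hV, hxV, p, q, a, b, h, ha, hb, hy⟩ := hf x hx
  obtain ⟨V', hxV', i', j, ⟨c, hc⟩, ⟨d, hd⟩, hnin, hr⟩ := r.2 ⟨x, hx⟩
  refine ⟨V ⊓ V', inf_le_left.trans hV, ⟨hxV, hxV'⟩, j + p, j + q, c * a, d * b, ?_,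
    SetLike.mul_mem_graded hc ha, SetLike.mul_mem_graded hd hb, fun y ↦ ⟨?_, ?_⟩⟩
  · push_cast; omega
  · intro h
    exact ((ProjectiveSpectrum.isPrime (𝒜 := 𝒜) y.1).mem_or_mem h).elim
      (hnin ⟨y.1, y.2.2⟩) (hy ⟨y.1, y.2.1⟩).1
  · have e := (hy ⟨y.1, y.2.1⟩).2
    have e' := congrArg HomogeneousLocalization.val (hr ⟨y.1, y.2.2⟩)
    rw [HomogeneousLocalization.val_mk] at e'
    have e2 : (HomogeneousLocalization.val (r.1 ⟨y.1, hV y.2.1⟩)) *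
        algebraMap A (fracStalk 𝒜 y.1) d = algebraMap A (fracStalk 𝒜 y.1) c := by
      refine (congrArg (· * algebraMap A (fracStalk 𝒜 y.1) d) e').trans ?_
      exact mk_mul_algebraMap y.1 c ⟨d, hnin ⟨y.1, y.2.2⟩⟩
    simp only [resFrac] at e
    change (HomogeneousLocalization.val (r.1 ⟨y.1, hV y.2.1⟩) * f ⟨y.1, hV y.2.1⟩) * _ = _
    rw [map_mul, map_mul, ← e, ← e2]
    ring

variable (𝒜)

/-- The families that are locally fractions of degree `m`. -/
def twistSubmodule (m : ℤ) : (fracPresheaf 𝒜).Submodule where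
  obj U :=
    { carrier := {f : FracSec 𝒜 U.unop | IsLocallyFracOfDegree 𝒜 m f}
      zero_mem' := isLocallyFrac_zero
      add_mem' := IsLocallyFracOfDegree.add
      smul_mem' := fun r _ hf ↦ IsLocallyFracOfDegree.smul r hf }
  map {U V} i f hf x hx := by
    obtain ⟨W, hW, hxW, h⟩ := hf x (i.unop.le hx)
    exact ⟨W ⊓ V.unop, inf_le_right, ⟨hxW, hx⟩, h.res inf_le_left⟩

/-- The Serre twist `𝒪(m)` on `Proj 𝒜`, for `m ∈ ℤ`: its sections over `U` are the families of
elements of the localizations `A_𝔭`, `𝔭 ∈ U`, that are locally fractions of degree `m`. -/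
def twist (m : ℤ) : (Proj 𝒜).Modules where
  val := (twistSubmodule 𝒜 m).toPresheafOfModules
  isSheaf := isSheaf_submodule (fracPresheaf 𝒜) (isSheaf_fracAb 𝒜) _ fun U f hf x hx ↦ by
    obtain ⟨V, i, hxV, h⟩ := hf x hx
    obtain ⟨W, hW, hxW, h⟩ := h x hxV
    exact ⟨W, hW.trans i.le, hxW, h⟩
end Twist
section Base
variable {k : Type u} [Field k]

/-- The structure map `k → 𝒪(U)` of a `k`-scheme. -/
def structureRingHom (X : Over (Spec (.of k))) (U : X.left.Opens) : k →+* Γ(X.left, U) :=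
  ((Scheme.ΓSpecIso (.of k)).inv ≫ X.hom.appTop ≫
    X.left.presheaf.map (homOfLE (le_top : U ≤ ⊤)).op).hom

instance (X : Over (Spec (.of k))) (U : X.left.Opens) : Algebra k Γ(X.left, U) :=
  (structureRingHom X U).toAlgebra

instance (X : Over (Spec (.of k))) (x : X.left) : Algebra k (X.left.presheaf.stalk x) :=
  ((Scheme.ΓSpecIso (.of k)).inv ≫ X.hom.appTop ≫
    X.left.presheaf.germ ⊤ x trivial).hom.toAlgebra

/-- Restriction `𝒪(U) → 𝒪(V)` as a `k`-algebra homomorphism. -/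
def resHom (X : Over (Spec (.of k))) {U V : X.left.Opens} (i : V ⟶ U) :
    Γ(X.left, U) →ₐ[k] Γ(X.left, V) where
  __ := (X.left.presheaf.map i.op).hom
  commutes' a := by
    change (X.left.presheaf.map i.op) (structureRingHom X U a) = structureRingHom X V a
    simp only [structureRingHom, CommRingCat.hom_comp, RingHom.comp_apply]
    rw [← CommRingCat.comp_apply, ← Functor.map_comp]
    rfl

/-- The germ map `𝒪(U) → 𝒪_x` as a `k`-algebra homomorphism. -/
def germHom (X : Over (Spec (.of k))) (U : X.left.Opens) (x : X.left) (hx : x ∈ U) :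
    Γ(X.left, U) →ₐ[k] X.left.presheaf.stalk x where
  __ := (X.left.presheaf.germ U x hx).hom
  commutes' a := by
    refine congrArg (fun f : CommRingCat.of k ⟶ X.left.presheaf.stalk x ↦ f.hom a)
      (?_ : ((Scheme.ΓSpecIso (.of k)).inv ≫ X.hom.appTop ≫
        X.left.presheaf.map (homOfLE (le_top : U ≤ ⊤)).op) ≫ X.left.presheaf.germ U x hx =
        (Scheme.ΓSpecIso (.of k)).inv ≫ X.hom.appTop ≫ X.left.presheaf.germ ⊤ x trivial)
    rw [Category.assoc, Category.assoc, TopCat.Presheaf.germ_res]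

/-- `Spec R` as a `k`-scheme, for a `k`-algebra `R`. -/
abbrev specOver (k : Type u) [Field k] (R : Type u) [CommRing R] [Algebra k R] :
    Over (Spec (.of k)) :=
  Over.mk (Spec.map (CommRingCat.ofHom (algebraMap k R)))

/-- `Spec` of a `k`-algebra homomorphism. -/
def specOverMap {R S : Type u} [CommRing R] [Algebra k R] [CommRing S] [Algebra k S]
    (f : R →ₐ[k] S) : specOver k S ⟶ specOver k R :=
  Over.homMk (Spec.map (CommRingCat.ofHom f.toRingHom)) (by
    simp only [Over.mk_left, Over.mk_hom, ← Spec.map_comp, ← CommRingCat.ofHom_comp]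
    congr 2
    exact f.comp_algebraMap)

/-- The canonical morphism `Spec 𝒪_x → X` of `k`-schemes. -/
def stalkPoint (X : Over (Spec (.of k))) (x : X.left) :
    specOver k (X.left.presheaf.stalk x) ⟶ X :=
  Over.homMk (X.left.fromSpecStalk x) (by
    have h1 := Scheme.fromSpecStalk_toSpecΓ X.left x
    have h2 := Scheme.toSpecΓ_naturality X.hom
    change X.left.fromSpecStalk x ≫ X.hom = Spec.map ((Scheme.ΓSpecIso (.of k)).inv ≫
      X.hom.appTop ≫ X.left.presheaf.germ ⊤ x trivial)
    rw [Spec.map_comp, Spec.map_comp, Category.assoc, ← h1, Category.assoc, ← reassoc_of% h2]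
    erw [toSpecΓ_SpecMap_ΓSpecIso_inv, Category.comp_id])

variable (D : Type u) [DivisionRing D] [Algebra k D]

/-- The sections `𝒪(U) ⊗_k D` over `U` of the sheaf `𝒟 = D ⊗_k 𝒪_X`. -/
abbrev Sec (X : Over (Spec (.of k))) (U : X.left.Opens) : Type u := Γ(X.left, U) ⊗[k] D

/-- Restriction `𝒟(U) → 𝒟(V)`. -/
def resD (X : Over (Spec (.of k))) {U V : X.left.Opens} (i : V ⟶ U) : Sec D X U →ₐ[k] Sec D X V :=
  Algebra.TensorProduct.map (resHom X i) (AlgHom.id k D)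

/-- The map `𝒟(U) → D ⊗_k 𝒪_x`. -/
def germD (X : Over (Spec (.of k))) (U : X.left.Opens) (x : X.left) (hx : x ∈ U) :
    Sec D X U →ₐ[k] (X.left.presheaf.stalk x ⊗[k] D) :=
  Algebra.TensorProduct.map (germHom X U x hx) (AlgHom.id k D)

lemma resD_smul (X : Over (Spec (.of k))) {U V : X.left.Opens} (i : V ⟶ U)
    (r : Γ(X.left, U)) (s : Sec D X U) : resD D X i (r • s) = resHom X i r • resD D X i s := by
  simp only [Algebra.smul_def, map_mul]
  simp [resD, Algebra.TensorProduct.algebraMap_apply]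

lemma germD_smul (X : Over (Spec (.of k))) (U : X.left.Opens) (x : X.left) (hx : x ∈ U)
    (r : Γ(X.left, U)) (s : Sec D X U) :
    germD D X U x hx (r • s) = germHom X U x hx r • germD D X U x hx s := by
  simp only [Algebra.smul_def, map_mul]
  simp [germD, Algebra.TensorProduct.algebraMap_apply]

lemma germD_resD (X : Over (Spec (.of k))) {U V : X.left.Opens} (i : V ⟶ U) (x : X.left)
    (hx : x ∈ V) (s : Sec D X U) :
    germD D X V x hx (resD D X i s) = germD D X U x (i.le hx) s := by
  change ((germD D X V x hx).comp (resD D X i)) s = _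
  congr 1
  ext a
  · simp only [germD, resD, AlgHom.comp_apply, Algebra.TensorProduct.includeLeft_apply,
      Algebra.TensorProduct.map_tmul, map_one]
    congr 1
    exact X.left.presheaf.germ_res_apply i x hx a
  · simp [germD, resD]

/-- The presheaf of groups `𝒟 = D ⊗_k 𝒪_X`. -/
def azumayaAb (X : Over (Spec (.of k))) : TopCat.Presheaf Ab.{u} X.left where
  obj U := AddCommGrpCat.of (Sec D X U.unop)
  map i := AddCommGrpCat.ofHom (resD D X i.unop).toRingHom.toAddMonoidHom
  map_id U := by
    ext s
    change resD D X (𝟙 U.unop) s = s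
    have : resD D X (𝟙 U.unop) = AlgHom.id k _ := by
      ext a
      · simp [resD, resHom]
      · simp [resD]
    rw [this]; rfl
  map_comp i j := by
    ext s
    change resD D X (j.unop ≫ i.unop) s = resD D X j.unop (resD D X i.unop s)
    rw [← AlgHom.comp_apply]
    congr 1
    ext a
    · simp [resD, resHom]
    · simp [resD]

instance (X : Over (Spec (.of k))) (U : X.left.Opensᵒᵖ) :
    Module (X.left.ringCatSheaf.obj.obj U) ((azumayaAb D X).obj U) :=
  inferInstanceAs (Module Γ(X.left, U.unop) (Sec D X U.unop))

/-- The presheaf of modules `𝒟 = D ⊗_k 𝒪_X`. -/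
def azumayaPresheaf (X : Over (Spec (.of k))) : X.left.PresheafOfModules :=
  PresheafOfModules.ofPresheaf (azumayaAb D X) (fun _ _ i r m ↦ resD_smul D X i.unop r m)

lemma repr_resD {ι : Type*} (b : Module.Basis ι k D) (X : Over (Spec (.of k))) {U V : X.left.Opens}
    (i : V ⟶ U) (s : Sec D X U) (j : ι) :
    (Algebra.TensorProduct.basis Γ(X.left, V) b).repr (resD D X i s) j =
      resHom X i ((Algebra.TensorProduct.basis Γ(X.left, U) b).repr s j) := by
  induction s using TensorProduct.induction_on with
  | zero => simp
  | tmul a d => simp [resD]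
  | add x y hx hy => simp [hx, hy]

lemma repr_sum_tmul {ι : Type*} [Fintype ι] (b : Module.Basis ι k D) (X : Over (Spec (.of k)))
    {U : X.left.Opens} (t : ι → Γ(X.left, U)) (j : ι) :
    (Algebra.TensorProduct.basis Γ(X.left, U) b).repr (∑ j, t j ⊗ₜ b j) j = t j := by
  have : (∑ j, t j ⊗ₜ b j : Sec D X U) =
      ∑ j, t j • Algebra.TensorProduct.basis Γ(X.left, U) b j := by
    simp [TensorProduct.smul_tmul']
  rw [this, Module.Basis.repr_sum_self]

lemma isSheaf_azumayaAb [FiniteDimensional k D] (X : Over (Spec (.of k))) :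
    (azumayaAb D X).IsSheaf := by
  rw [TopCat.Presheaf.isSheaf_iff_isSheafUniqueGluing]
  intro ι U sf hsf
  let b := Module.finBasis k D
  have hcompat (j) : TopCat.Presheaf.IsCompatible X.left.presheaf U
      (fun i ↦ (Algebra.TensorProduct.basis Γ(X.left, U i) b).repr (sf i) j) := by
    intro i i'
    have := congrArg (fun s : Sec D X (U i ⊓ U i') ↦
      (Algebra.TensorProduct.basis Γ(X.left, U i ⊓ U i') b).repr s j) (hsf i i')
    exact (repr_resD D b X _ (sf i) j).symm.trans (this.trans (repr_resD D b X _ (sf i') j))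
  have key := fun j ↦ (X.left.sheaf.existsUnique_gluing U _ (hcompat j))
  choose t ht hu using key
  refine ⟨(∑ j, t j ⊗ₜ b j : Sec D X (iSup U)), fun i ↦ ?_, fun s hs ↦ ?_⟩
  · refine (Algebra.TensorProduct.basis Γ(X.left, U i) b).ext_elem fun j ↦ ?_
    refine (repr_resD D b X (TopologicalSpace.Opens.leSupr U i) _ j).trans ?_
    refine Eq.trans ?_ (ht j i)
    refine congrArg (resHom X (TopologicalSpace.Opens.leSupr U i)) ?_
    exact repr_sum_tmul D b X t j
  · refine (Algebra.TensorProduct.basis Γ(X.left, iSup U) b).ext_elem fun j ↦ ?_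
    refine (hu j _ fun i ↦ ?_).trans ?_
    · refine (repr_resD D b X (TopologicalSpace.Opens.leSupr U i) s j).symm.trans ?_
      exact congrArg (fun s : Sec D X (U i) ↦
        (Algebra.TensorProduct.basis Γ(X.left, U i) b).repr s j) (hs i)
    · exact (repr_sum_tmul D b X t j).symm

variable {D}

/-- The sections `s` of `𝒟` such that the image of `s` in `D ⊗_k 𝒪_x` lies in `W` (no condition if
`x ∉ U`). -/
def interSubmodule (X : Over (Spec (.of k))) (x : X.left)
    (W : Submodule (X.left.presheaf.stalk x) (X.left.presheaf.stalk x ⊗[k] D)) :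
    (azumayaPresheaf D X).Submodule where
  obj U :=
    { carrier := {s : Sec D X U.unop | ∀ hx : x ∈ U.unop, germD D X U.unop x hx s ∈ W}
      zero_mem' := fun hx ↦ by
        erw [map_zero]
        exact W.zero_mem
      add_mem' := fun {a b} ha hb hx ↦ by
        erw [map_add]
        exact W.add_mem (ha hx) (hb hx)
      smul_mem' := fun r a ha hx ↦ by
        erw [germD_smul]
        exact W.smul_mem _ (ha hx) }
  map {U V} i s hs hx := by
    change germD D X V.unop x hx (resD D X i.unop s) ∈ W
    exact (germD_resD D X i.unop x hx s).symm ▸ hs _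

/-- The `𝒪_X`-module `𝒟 = D ⊗_k 𝒪_X`. -/
def azumaya (D : Type u) [DivisionRing D] [Algebra k D] [FiniteDimensional k D]
    (X : Over (Spec (.of k))) : X.left.Modules where
  val := azumayaPresheaf D X
  isSheaf := isSheaf_azumayaAb D X

/-- The subsheaf of the `s` in `𝒟` whose image in `D ⊗_k 𝒪_x` lies in `W`. When `X` is integral and
`x` is its generic point, with function field `F`, then `𝒟(U) ⊆ D_F = D ⊗_k F` for `U ≠ ∅` and
this is the intersection `W ∩ 𝒟` inside the constant sheaf `D_F`. -/
def inter [FiniteDimensional k D] (X : Over (Spec (.of k))) (x : X.left)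
    (W : Submodule (X.left.presheaf.stalk x) (X.left.presheaf.stalk x ⊗[k] D)) : X.left.Modules where
  val := (interSubmodule X x W).toPresheafOfModules
  isSheaf := isSheaf_submodule (azumayaPresheaf D X) (isSheaf_azumayaAb D X) _ fun U s hs hx ↦ by
    obtain ⟨V, i, hV, h⟩ := hs x hx
    have := h hV
    change germD D X V x hV (resD D X i s) ∈ W at this
    exact germD_resD D X i x hV s ▸ this

end Base

section Algebra
variable (k D : Type u) [Field k] [DivisionRing D] [Algebra k D]

/-- `σ` is a symplectic involution of the central simple `k`-algebra `D` of degree `n`: a `k`-linear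
anti-automorphism of order at most `2` that becomes, over an algebraic closure of `k`, the adjoint
involution `M ↦ B⁻¹ Mᵀ B` of a nonsingular alternating bilinear form `(v, w) ↦ vᵀ B w`. -/
structure IsSymplecticInvolution (n : ℕ) (σ : D →ₗ[k] D) : Prop where
  map_mul (x y : D) : σ (x * y) = σ y * σ x
  involutive (x : D) : σ (σ x) = x
  symplectic : ∃ (φ : (AlgebraicClosure k ⊗[k] D) ≃ₐ[AlgebraicClosure k]
      Matrix (Fin n) (Fin n) (AlgebraicClosure k))
    (B : Matrix (Fin n) (Fin n) (AlgebraicClosure k)),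
    IsUnit B.det ∧ B.transpose = -B ∧ (∀ i, B i i = 0) ∧
      ∀ x, φ (σ.baseChange (AlgebraicClosure k) x) = B⁻¹ * (φ x).transpose * B

/-- The extension field `ℓ` of `k` splits `D`, an algebra of degree `n`. -/
def IsSplittingField (n : ℕ) (ℓ : Type u) [Field ℓ] [Algebra k ℓ] : Prop :=
  Nonempty ((ℓ ⊗[k] D) ≃ₐ[ℓ] Matrix (Fin n) (Fin n) ℓ)

/-- The left ideals `I` of `D_R = R ⊗_k D` for which `D_R / I` is a projective `R`-module of constant
rank `n² - n`; for `D` of dimension `n²` these are the left ideals that are direct summands of rank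
`n` as `R`-modules. -/
def leftIdeals (n : ℕ) (R : Type u) [CommRing R] [Algebra k R] :
    Set (Module.Grassmannian R (R ⊗[k] D) (n ^ 2 - n)) :=
  {I | ∀ (a x : R ⊗[k] D), x ∈ I.toSubmodule → a * x ∈ I.toSubmodule}

/-- `X` is the Severi–Brauer variety of `n`-dimensional left ideals of `D`: the `k`-scheme that
represents, on `k`-algebras `R`, the functor of left ideals of `D_R` that are direct summands of rank
`n`, functorial by extension of scalars. -/
structure SeveriBrauerVariety (n : ℕ) (X : Over (Spec (.of k))) : Type (u + 1) where
  ideal (R : Type u) [CommRing R] [Algebra k R] : (specOver k R ⟶ X) ≃ leftIdeals k D n R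
  ideal_comp {R S : Type u} [CommRing R] [Algebra k R] [CommRing S] [Algebra k S]
    (f : R →ₐ[k] S) (x : specOver k R ⟶ X) :
    (ideal S (specOverMap f ≫ x)).1 = Module.Grassmannian.map f (ideal R x).1

end Algebra

/-- `Trd a = e` in the split algebra `A ≅ M_n(E)`: the trace of the matrix of `a`, which does not
depend on the isomorphism. -/
def HasReducedTrace {E A : Type*} [CommRing E] [Ring A] [Algebra E A] (n : ℕ) (a : A) (e : E) :
    Prop :=
  ∃ φ : A ≃ₐ[E] Matrix (Fin n) (Fin n) E, (φ a).trace = e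

section Main
variable {k D : Type u} [Field k] [DivisionRing D] [Algebra k D]
  {X : Over (Spec (.of k))}

/-- The function field `F = k(X)`, the stalk at the generic point. -/
abbrev FunField (X : Over (Spec (.of k))) [IrreducibleSpace X.left] : Type u :=
  X.left.presheaf.stalk (genericPoint X.left)

variable [IrreducibleSpace X.left]

namespace SeveriBrauerVariety
variable {n : ℕ} (P : SeveriBrauerVariety k D n X) (σ : D →ₗ[k] D)

/-- The left ideal `T` of `D_F` that is the generic point of `X`: it corresponds to
`Spec F → X`. -/
def T : Submodule (FunField X) (FunField X ⊗[k] D) :=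
  (P.ideal (FunField X) (stalkPoint X (genericPoint X.left))).1.toSubmodule

/-- The right ideal `σ(T)` of `D_F`. -/
def sigmaT : Submodule (FunField X) (FunField X ⊗[k] D) := P.T.map (σ.baseChange (FunField X))

/-- `L_σ = T ∩ σ(T)`. -/
def L : Submodule (FunField X) (FunField X ⊗[k] D) := P.T ⊓ P.sigmaT σ

end SeveriBrauerVariety

variable [FiniteDimensional k D]

/-- The sheaf `W ∩ 𝒟 ⊆ D_F`, for an `F`-subspace `W` of `D_F`. -/
abbrev interGen (W : Submodule (FunField X) (FunField X ⊗[k] D)) : X.left.Modules :=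
  inter X (genericPoint X.left) W

namespace SeveriBrauerVariety
variable {n : ℕ} (P : SeveriBrauerVariety k D n X) (σ : D →ₗ[k] D)

/-- The sheaf `𝒯 = T ∩ 𝒟`. -/
abbrev sheafT : X.left.Modules := interGen P.T

/-- The sheaf `σ(𝒯)`. It equals `σ(T) ∩ 𝒟`, since `σ` is bijective on `𝒟` and on `D_F`. -/
abbrev sheafSigmaT : X.left.Modules := interGen (P.sigmaT σ)

/-- The sheaf `ℒ_σ = L_σ ∩ 𝒟`. -/
abbrev sheafL : X.left.Modules := interGen (P.L σ)

end SeveriBrauerVariety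

/-- The inclusion `(W ∩ 𝒟)(U) → W`, for `U ≠ ∅`. -/
def interGerm (W : Submodule (FunField X) (FunField X ⊗[k] D)) (U : X.left.Opens)
    (hU : genericPoint X.left ∈ U) (s : Γ(interGen W, U)) : W :=
  ⟨germD D X U (genericPoint X.left) hU s.1, s.2 hU⟩

/-- The inclusion `𝒟(U) → D_F`, for `U ≠ ∅`. -/
def azumayaGerm (U : X.left.Opens)
    (hU : genericPoint X.left ∈ U) (s : Γ(azumaya D X, U)) : FunField X ⊗[k] D :=
  germD D X U (genericPoint X.left) hU s

/-- For a right ideal `W` and a left ideal `W'` of `D_F`, with `ℳ = W ∩ 𝒟` and `𝒩 = W' ∩ 𝒟`: the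
subpresheaf of `U ↦ ℳ(U) ⊗_{𝒪(U)} 𝒩(U)` spanned by the sections `x a ⊗ y - x ⊗ a y` with
`a ∈ 𝒟(U)`. -/
def balancedSubmodule (W W' : Submodule (FunField X) (FunField X ⊗[k] D)) :
    (tensorPresheaf (interGen W) (interGen W')).Submodule where
  obj U := balancedRel (R := Γ(X.left, U.unop)) (A := Sec D X U.unop)
    ((interSubmodule X (genericPoint X.left) W).obj U)
    ((interSubmodule X (genericPoint X.left) W').obj U)
  map {U V} i := by
    refine Submodule.span_le.2 ?_
    rintro _ ⟨x, x', y, y', a, hx, hy, rfl⟩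
    refine Submodule.subset_span ⟨(interGen W).val.map i x, (interGen W).val.map i x',
      (interGen W').val.map i y, (interGen W').val.map i y', resD D X i.unop a, ?_, ?_, ?_⟩
    · exact (congrArg (resD D X i.unop) hx).trans (map_mul (resD D X i.unop) _ _)
    · exact (congrArg (resD D X i.unop) hy).trans (map_mul (resD D X i.unop) _ _)
    · exact map_sub ((tensorPresheaf (interGen W) (interGen W')).restrictₛₗ i) _ _

/-- The tensor product `(W ∩ 𝒟) ⊗_𝒟 (W' ∩ 𝒟)`: the sheafification of
`U ↦ (W ∩ 𝒟)(U) ⊗_{𝒟(U)} (W' ∩ 𝒟)(U)`. -/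
def balancedTensor (W W' : Submodule (FunField X) (FunField X ⊗[k] D)) : X.left.Modules :=
  sheafify (Limits.cokernel (balancedSubmodule W W').ι)

/-- The section `s ⊗ t` of `(W ∩ 𝒟) ⊗_𝒟 (W' ∩ 𝒟)`. -/
def balancedTmul (W W' : Submodule (FunField X) (FunField X ⊗[k] D)) (U : X.left.Opens)
    (s : Γ(interGen W, U)) (t : Γ(interGen W', U)) : Γ(balancedTensor W W', U) :=
  toSheafify _ U ((Limits.cokernel.π (balancedSubmodule W W').ι).app (op U)
    (s ⊗ₜ[Γ(X.left, U)] t : Γ(interGen W, U) ⊗[Γ(X.left, U)] Γ(interGen W', U)))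

/-- The section `s ⊗ t` of `M ⊗_{𝒪} N`. -/
def tmul {Y : Scheme.{u}} (M N : Y.Modules) (U : Y.Opens) (s : Γ(M, U)) (t : Γ(N, U)) :
    Γ(tensor M N, U) :=
  toSheafify (tensorPresheaf M N) U (s ⊗ₜ[Γ(Y, U)] t : Γ(M, U) ⊗[Γ(Y, U)] Γ(N, U))

/-- The stalk of a sheaf of modules. -/
abbrev modStalk {Y : Scheme.{u}} (M : Y.Modules) (y : Y) : Ab.{u} :=
  TopCat.Presheaf.stalk (C := Ab.{u}) M.presheaf y

/-- The map induced on stalks. -/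
def modStalkMap {Y : Scheme.{u}} {M N : Y.Modules} (f : M ⟶ N) (y : Y) :
    modStalk M y →+ modStalk N y :=
  ((TopCat.Presheaf.stalkFunctor Ab.{u} y).map f.mapPresheaf).hom

/-- The germ of a section. -/
def modGerm {Y : Scheme.{u}} (M : Y.Modules) (U : Y.Opens) (y : Y) (hy : y ∈ U) :
    Γ(M, U) →+ modStalk M y :=
  (TopCat.Presheaf.germ (C := Ab.{u}) M.presheaf U y hy).hom

attribute [local instance] MvPolynomial.gradedAlgebra

/-- The projective space `ℙ^{n-1}` over `ℓ`, as `Proj ℓ[x_1, …, x_n]`. -/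
def projSpace (ℓ : Type u) [Field ℓ] (n : ℕ) : Scheme.{u} :=
  Proj (MvPolynomial.homogeneousSubmodule (Fin n) ℓ)

/-- The structure morphism of `ℙ^{n-1}` over `ℓ`. -/
def projSpaceHom (ℓ : Type u) [Field ℓ] (n : ℕ) : projSpace ℓ n ⟶ Spec (.of ℓ) :=
  Proj.toSpecZero (MvPolynomial.homogeneousSubmodule (Fin n) ℓ) ≫ Spec.map (CommRingCat.ofHom
    (algebraMap ℓ (MvPolynomial.homogeneousSubmodule (Fin n) ℓ 0)))

/-- The sheaf `𝒪(m)` on `ℙ^{n-1}` over `ℓ`. -/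
def serreTwist (ℓ : Type u) [Field ℓ] (n : ℕ) (m : ℤ) : (projSpace ℓ n).Modules :=
  twist (MvPolynomial.homogeneousSubmodule (Fin n) ℓ) m

/-- `X_ℓ = X ×_k Spec ℓ`. -/
abbrev baseChange (X : Over (Spec (.of k))) (ℓ : Type u) [Field ℓ] [Algebra k ℓ] : Scheme.{u} :=
  Limits.pullback X.hom (Spec.map (CommRingCat.ofHom (algebraMap k ℓ)))

/-- `M_ℓ ≅ 𝒪_{X_ℓ}(m)`, where `M_ℓ` is the inverse image of `M` on `X_ℓ`: the `ℓ`-scheme `X_ℓ` is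
isomorphic to `ℙ^{n-1}`, and under every such isomorphism `M_ℓ` corresponds to `𝒪(m)`. -/
def IsTwistAfter (M : X.left.Modules) (n : ℕ) (ℓ : Type u) [Field ℓ] [Algebra k ℓ] (m : ℤ) : Prop :=
  (∃ e : baseChange X ℓ ≅ projSpace ℓ n, e.hom ≫ projSpaceHom ℓ n = Limits.pullback.snd _ _) ∧
  ∀ e : baseChange X ℓ ≅ projSpace ℓ n, e.hom ≫ projSpaceHom ℓ n = Limits.pullback.snd _ _ →
    Nonempty ((Scheme.Modules.pullback (Limits.pullback.fst _ _)).obj M ≅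
      (Scheme.Modules.pullback e.hom).obj (serreTwist ℓ n m))

end Main
end SeveriBrauer

end

open SeveriBrauer

/-!
All sheaves that occur are subsheaves of constant sheaves on an integral scheme. They are described
by families of lattices: for every point `x` a subgroup, stable under `𝒪_x`, of a vector space over
the function field. A morphism from a sheaf to the sheaf of a family of lattices is given by its
values in the vector space (`LatHom`), and it is an isomorphism as soon as it is bijective on a
basis of open sets. Invertible modules are the sheaves of Cartier divisors
(`exists_iso_divSheaf`); isomorphisms, tensor products and inverse images become linear
equivalence, products and inverse images of divisors.

Near every point of `X` the algebra `D` acts by left multiplication on the tautological ideal, which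
is a free module of rank `n` (`exists_rep`). This identifies `𝒟` with `M_n(𝒪)` in such a way that `T`
consists of the matrices `v w` for a unimodular row `w`, and `σ(T)` of the matrices `u v` for a
unimodular column `u` (`exists_frame`). Hence `ℒ` is locally generated by `u w`, and the
isomorphisms `mult` and `can` can be read off from products of basis elements (`exists_mult_can`).

Over a splitting field `ℓ` the map that takes a row `w` to the ideal of the matrices `v w` is an
isomorphism of `ℙ^{n-1}_ℓ` with `X_ℓ` (`isIso_splitMap`). In particular `X` is the image of an
integral scheme under a flat surjective morphism, hence integral. In terms of matrices `σ` is the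
transposition followed by a conjugation, so that `ℒ` becomes the sheaf of the multiples of `(w C) w`,
which is quadratic in `w`: the sheaf `𝒪(-2)` (`linEquiv_pullDiv_sheafL`). This holds for every
isomorphism of `X_ℓ` with `ℙ^{n-1}_ℓ`, because automorphisms of projective space preserve the class
of a hyperplane, the generator of the Picard group with nonzero sections (`pullDiv_hyperplane`).

Every divisor on `ℙ^{n-1}_ℓ` is equivalent to a multiple of a hyperplane, by unique factorization in
the polynomial ring (`exists_linEquiv_zpow`). It remains to see that `Pic X` maps injectively to
`Pic ℙ^{n-1}_ℓ = ℤ`, and that `1` is not in the image. Both follow from the expansion of sections over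
`ℙ^{n-1}_ℓ` with respect to a basis of `ℓ` over `k`, whose coefficients are sections over `X`
(`exists_expand_eq_of_divisor`). A coefficient of a trivializing section is again trivializing
(`linEquiv_one_of_pullDiv`). If `𝒪(1)` came from `X`, the ideal `𝒯` twisted by it would have nonzero
global sections over `X`. These are constant columns over `ℓ`, of which there are too few for a
division algebra of dimension `n ^ 2` to act on them (`not_linEquiv_hyperplane`).
-/

open CategoryTheory AlgebraicGeometry TensorProduct Opposite
noncomputable section
namespace SeveriBrauer

/-! ### Morphisms of sheaves that are bijective on a basis -/

section LocallyBijective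
variable {X : Scheme.{u}}

/-- A morphism of presheaves of abelian groups that is bijective on a neighbourhood basis of every
point is inverted by sheafification. -/
lemma W_of_basis {P Q : TopCat.Presheaf Ab.{u} X} (φ : P ⟶ Q)
    (H : ∀ (U : X.Opens) (x : X), x ∈ U → ∃ (V : X.Opens), V ≤ U ∧ x ∈ V ∧
      Function.Bijective (φ.app (op V))) :
    (Opens.grothendieckTopology X).W φ := by
  rw [GrothendieckTopology.W_iff_isLocallyBijective]
  constructor
  · constructor
    intro U s t hst x hx
    obtain ⟨V, hV, hxV, hb⟩ := H U.unop x hx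
    refine ⟨V, homOfLE hV, ?_, hxV⟩
    apply hb.1
    refine (NatTrans.naturality_apply φ (homOfLE hV).op s).trans ?_
    refine Eq.trans ?_ (NatTrans.naturality_apply φ (homOfLE hV).op t).symm
    exact congrArg _ hst
  · constructor
    intro U s x hx
    obtain ⟨V, hV, hxV, hb⟩ := H U x hx
    obtain ⟨t, ht⟩ := hb.2 (Q.map (homOfLE hV).op s)
    exact ⟨V, homOfLE hV, ⟨t, ht⟩, hxV⟩

/-- A morphism of sheaves of modules that is bijective on a neighbourhood basis of every point is an
isomorphism. -/
lemma isIso_of_basis {M N : X.Modules} (φ : M ⟶ N)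
    (H : ∀ (U : X.Opens) (x : X), x ∈ U → ∃ (V : X.Opens), V ≤ U ∧ x ∈ V ∧
      Function.Bijective (φ.app V)) : IsIso φ := by
  have h := W_of_basis φ.mapPresheaf H
  have h2 : (Opens.grothendieckTopology X).W
      ((sheafToPresheaf _ _).map ((SheafOfModules.toSheaf X.ringCatSheaf).map φ)) := h
  rw [GrothendieckTopology.W_sheafToPresheaf_map_iff_isIso] at h2
  have h3 : IsIso ((Scheme.Modules.toPresheaf X).map φ) :=
    inferInstanceAs (IsIso ((sheafToPresheaf _ _).map
      ((SheafOfModules.toSheaf X.ringCatSheaf).map φ)))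
  exact isIso_of_reflects_iso φ (Scheme.Modules.toPresheaf X)

/-- A morphism from a presheaf of modules to a sheaf of modules that is bijective on a
neighbourhood basis of every point identifies the sheaf with the sheafification. -/
lemma exists_iso_of_basis (P : X.PresheafOfModules) (M : X.Modules) (φ : P ⟶ M.val)
    (H : ∀ (U : X.Opens) (x : X), x ∈ U → ∃ (V : X.Opens), V ≤ U ∧ x ∈ V ∧
      Function.Bijective (φ.app (op V))) :
    ∃ e : sheafify P ≅ M, ∀ (U : X.Opens) (s : P.obj (op U)),
      e.hom.app U (toSheafify P U s) = φ.app (op U) s := by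
  let f : sheafify P ⟶ M :=
    (PresheafOfModules.sheafificationHomEquiv (𝟙 X.ringCatSheaf.obj)).symm φ
  have hf := PresheafOfModules.toPresheaf_map_sheafificationHomEquiv_def
    (𝟙 X.ringCatSheaf.obj) f
  replace hf : (PresheafOfModules.toPresheaf _).map φ =
      CategoryTheory.toSheafify (Opens.grothendieckTopology X) P.presheaf ≫
        (PresheafOfModules.toPresheaf X.ringCatSheaf.obj).map f.val :=
    (congrArg _ (Equiv.apply_symm_apply _ φ).symm).trans hf
  have hW : (Opens.grothendieckTopology X).W ((PresheafOfModules.toPresheaf _).map φ) :=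
    W_of_basis _ H
  have hWf : (Opens.grothendieckTopology X).W
      ((sheafToPresheaf _ _).map ((SheafOfModules.toSheaf X.ringCatSheaf).map f)) := by
    refine MorphismProperty.of_precomp (W := (Opens.grothendieckTopology X).W)
      (W' := (Opens.grothendieckTopology X).W) _ _
      (GrothendieckTopology.W_toSheafify (Opens.grothendieckTopology X) P.presheaf) ?_
    exact hf ▸ hW
  rw [GrothendieckTopology.W_sheafToPresheaf_map_iff_isIso] at hWf
  have h3 : IsIso ((Scheme.Modules.toPresheaf X).map f) :=
    inferInstanceAs (IsIso ((sheafToPresheaf _ _).map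
      ((SheafOfModules.toSheaf X.ringCatSheaf).map f)))
  have : IsIso f := isIso_of_reflects_iso f (Scheme.Modules.toPresheaf X)
  refine ⟨asIso f, fun U s ↦ ?_⟩
  exact (ConcreteCategory.congr_hom (NatTrans.congr_app hf (op U)) s).symm

end LocallyBijective

/-! ### Regular functions inside the function field -/

section Integral
variable {X : Scheme.{u}}

lemma genericPoint_mem [IrreducibleSpace X] {U : X.Opens} {x : X} (hx : x ∈ U) :
    genericPoint X ∈ U :=
  ((genericPoint_spec X).specializes trivial).mem_open U.2 hx

variable [IsIntegral X]

/-- The germ of a section at the generic point. -/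
def gen (U : X.Opens) (hU : genericPoint X ∈ U) : Γ(X, U) →+* X.functionField :=
  (X.presheaf.germ U (genericPoint X) hU).hom

lemma gen_injective (U : X.Opens) (hU : genericPoint X ∈ U) : Function.Injective (gen U hU) :=
  germ_injective_of_isIntegral X (genericPoint X) hU

lemma gen_res {U V : X.Opens} (i : V ⟶ U) (hV : genericPoint X ∈ V) (r : Γ(X, U)) :
    gen V hV (X.presheaf.map i.op r) = gen U (i.le hV) r :=
  X.presheaf.germ_res_apply i _ hV r

lemma algebraMap_germ {U : X.Opens} (x : X) (hx : x ∈ U) (r : Γ(X, U)) :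
    algebraMap (X.presheaf.stalk x) X.functionField (X.presheaf.germ U x hx r) =
      gen U (genericPoint_mem hx) r :=
  X.presheaf.germ_stalkSpecializes_apply hx ((genericPoint_spec X).specializes trivial) r

lemma stalk_injective (x : X) :
    Function.Injective (algebraMap (X.presheaf.stalk x) X.functionField) :=
  IsFractionRing.injective _ _

/-- The local ring at `x`, as a subring of the function field. -/
def reg (x : X) : Subring X.functionField :=
  (algebraMap (X.presheaf.stalk x) X.functionField).range

lemma gen_mem_reg {U : X.Opens} {x : X} (hx : x ∈ U) (r : Γ(X, U)) :
    gen U (genericPoint_mem hx) r ∈ reg x := ⟨_, algebraMap_germ x hx r⟩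

lemma exists_gen_of_mem_reg {x : X} {f : X.functionField} (hf : f ∈ reg x) :
    ∃ (U : X.Opens) (hx : x ∈ U) (r : Γ(X, U)), gen U (genericPoint_mem hx) r = f := by
  obtain ⟨s, rfl⟩ := hf
  obtain ⟨U, hx, r, rfl⟩ := X.presheaf.exists_germ_eq s
  exact ⟨U, hx, r, (algebraMap_germ x hx r).symm⟩

lemma exists_mem_reg {x : X} {f : X.functionField} (hf : f ∈ reg x) :
    ∃ U : X.Opens, x ∈ U ∧ ∀ y ∈ U, f ∈ reg y := by
  obtain ⟨U, hx, r, rfl⟩ := exists_gen_of_mem_reg hf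
  exact ⟨U, hx, fun y hy ↦ gen_mem_reg hy r⟩

/-- The local ring at the generic point is the whole function field. -/
lemma mem_reg_genericPoint (f : X.functionField) : f ∈ reg (genericPoint X) := by
  obtain ⟨U, hx, r, rfl⟩ := X.presheaf.exists_germ_eq f
  exact gen_mem_reg hx r

/-- A rational function that is regular at all points of `U` is a section over `U`. -/
lemma exists_gen_of_forall_mem_reg {U : X.Opens} (hU : genericPoint X ∈ U)
    {f : X.functionField} (hf : ∀ x ∈ U, f ∈ reg x) : ∃ r : Γ(X, U), gen U hU r = f := by
  have key (x : U) : ∃ (V : X.Opens) (i : V ⟶ U) (hx : x.1 ∈ V) (r : Γ(X, V)),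
      gen V (genericPoint_mem hx) r = f := by
    obtain ⟨V, hx, r, hr⟩ := exists_gen_of_mem_reg (hf x.1 x.2)
    refine ⟨V ⊓ U, homOfLE inf_le_right, ⟨hx, x.2⟩, X.presheaf.map (homOfLE inf_le_left).op r, ?_⟩
    rw [gen_res]; exact hr
  choose V i hx r hr using key
  have hcov : U ≤ ⨆ x, V x := fun x hxU ↦
    TopologicalSpace.Opens.mem_iSup.2 ⟨⟨x, hxU⟩, hx ⟨x, hxU⟩⟩
  obtain ⟨s, hs, -⟩ := X.sheaf.existsUnique_gluing' V U i hcov r (by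
    intro x y
    have hm : genericPoint X ∈ V x ⊓ V y :=
      ⟨genericPoint_mem (hx x), genericPoint_mem (hx y)⟩
    refine gen_injective (V x ⊓ V y) hm ?_
    refine (gen_res _ hm _).trans (Eq.trans ?_ (gen_res _ hm _).symm)
    exact (hr x).trans (hr y).symm)
  refine ⟨s, ?_⟩
  have := hs ⟨genericPoint X, hU⟩
  rw [← hr ⟨genericPoint X, hU⟩]
  refine Eq.trans ?_ (congrArg _ this)
  exact (gen_res _ _ _).symm

/-- `f` and its inverse are regular at `x`. -/
def IsRegUnit (x : X) (f : X.functionField) : Prop := f ≠ 0 ∧ f ∈ reg x ∧ f⁻¹ ∈ reg x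

lemma IsRegUnit.mul {x : X} {f g : X.functionField} (hf : IsRegUnit x f) (hg : IsRegUnit x g) :
    IsRegUnit x (f * g) :=
  ⟨mul_ne_zero hf.1 hg.1, mul_mem hf.2.1 hg.2.1, by rw [mul_inv]; exact mul_mem hf.2.2 hg.2.2⟩

lemma IsRegUnit.inv {x : X} {f : X.functionField} (hf : IsRegUnit x f) : IsRegUnit x f⁻¹ :=
  ⟨inv_ne_zero hf.1, hf.2.2, by rw [inv_inv]; exact hf.2.1⟩

lemma IsRegUnit.one (x : X) : IsRegUnit x 1 :=
  ⟨one_ne_zero, one_mem _, by rw [inv_one]; exact one_mem _⟩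

lemma IsRegUnit.eventually {x : X} {f : X.functionField} (hf : IsRegUnit x f) :
    ∃ U : X.Opens, x ∈ U ∧ ∀ y ∈ U, IsRegUnit y f := by
  obtain ⟨U, hU, h⟩ := exists_mem_reg hf.2.1
  obtain ⟨V, hV, h'⟩ := exists_mem_reg hf.2.2
  exact ⟨U ⊓ V, ⟨hU, hV⟩, fun y hy ↦ ⟨hf.1, h y hy.1, h' y hy.2⟩⟩

lemma isRegUnit_algebraMap {x : X} {s : X.presheaf.stalk x} (hs : IsUnit s) :
    IsRegUnit x (algebraMap _ X.functionField s) := by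
  obtain ⟨s, rfl⟩ := hs
  have h : algebraMap _ X.functionField (s : X.presheaf.stalk x) ≠ 0 :=
    (s.isUnit.map (algebraMap _ X.functionField)).ne_zero
  refine ⟨h, ⟨_, rfl⟩, ⟨(s⁻¹ : _), eq_inv_of_mul_eq_one_left ?_⟩⟩
  rw [← map_mul, Units.inv_mul, map_one]

lemma IsRegUnit.mem_iff {x : X} {f g : X.functionField} (hf : IsRegUnit x f) :
    f * g ∈ reg x ↔ g ∈ reg x :=
  ⟨fun h ↦ by simpa [hf.1] using mul_mem hf.2.2 h, fun h ↦ mul_mem hf.2.1 h⟩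

end Integral

/-! ### Sheaves of lattices -/

section Lattice
variable (X : Scheme.{u}) [IsIntegral X] (V : Type u) [AddCommGroup V] [Module X.functionField V]

/-- Families `(v_x)` of vectors of `V`, indexed by the points of `U`. -/
abbrev FamSec (U : X.Opens) : Type u := ∀ _ : U, V

instance (U : X.Opens) : Module Γ(X, U) (FamSec X V U) where
  smul r s x := gen U (genericPoint_mem x.2) r • s x
  one_smul s := funext fun x ↦ by
    change gen U _ 1 • s x = s x
    rw [map_one, one_smul]
  mul_smul r r' s := funext fun x ↦ by
    change gen U _ (r * r') • s x = gen U _ r • gen U _ r' • s x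
    rw [map_mul, mul_smul]
  smul_zero r := funext fun x ↦ smul_zero _
  smul_add r s t := funext fun x ↦ smul_add _ _ _
  add_smul r r' s := funext fun x ↦ by
    change gen U _ (r + r') • s x = gen U _ r • s x + gen U _ r' • s x
    rw [map_add, add_smul]
  zero_smul s := funext fun x ↦ by
    change gen U _ 0 • s x = 0
    rw [map_zero, zero_smul]

/-- The presheaf of all families of vectors of `V`. -/
def famAb : TopCat.Presheaf Ab.{u} X where
  obj U := AddCommGrpCat.of (FamSec X V U.unop)
  map {U W} i := AddCommGrpCat.ofHom
    { toFun f x := f ⟨x.1, i.unop.le x.2⟩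
      map_zero' := rfl
      map_add' _ _ := rfl }

instance (U : X.Opensᵒᵖ) : Module (X.ringCatSheaf.obj.obj U) ((famAb X V).obj U) :=
  inferInstanceAs (Module Γ(X, U.unop) (FamSec X V U.unop))

/-- The presheaf of all families of vectors of `V`, as a presheaf of modules. -/
def famPresheaf : X.PresheafOfModules :=
  PresheafOfModules.ofPresheaf (famAb X V) (fun _U _W i r m ↦ funext fun x ↦
    congrArg (· • m _) (gen_res i.unop (genericPoint_mem x.2) r).symm)

omit [Module X.functionField V] in
lemma isSheaf_famAb : (famAb X V).IsSheaf := by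
  rw [TopCat.Presheaf.isSheaf_iff_isSheaf_comp (forget Ab)]
  exact TopCat.Presheaf.toTypes_isSheaf X.toTopCat (fun _ ↦ V)

/-- A family of additive subgroups `Λ_x ⊆ V` stable under the local rings `𝒪_x`. -/
structure Lattice where
  carrier : X → AddSubgroup V
  smul_mem : ∀ (x : X) (f : X.functionField) (v : V), f ∈ reg x → v ∈ carrier x → f • v ∈ carrier x

variable {X V}

/-- The family is constant, with value in all `Λ_x`, `x ∈ U`. -/
def IsLatSec (Λ : Lattice X V) (U : X.Opens) (f : FamSec X V U) : Prop :=
  ∀ x : U, f x ∈ Λ.carrier x.1 ∧ ∀ y : U, f x = f y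

/-- The constant families with value in all `Λ_x`, `x ∈ U`. -/
def latSubmodule (Λ : Lattice X V) : (famPresheaf X V).Submodule where
  obj U :=
    { carrier := {f : FamSec X V U.unop | IsLatSec Λ U.unop f}
      zero_mem' := fun _ ↦ ⟨AddSubgroup.zero_mem _, fun _ ↦ rfl⟩
      add_mem' := fun {a b} (ha : IsLatSec Λ _ a) (hb : IsLatSec Λ _ b) x ↦
        ⟨AddSubgroup.add_mem _ (ha x).1 (hb x).1, fun y ↦
          congrArg₂ (fun v w : V ↦ v + w) ((ha x).2 y) ((hb x).2 y)⟩
      smul_mem' := fun r a (ha : IsLatSec Λ _ a) x ↦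
        ⟨Λ.smul_mem x.1 _ _ (gen_mem_reg x.2 r) (ha x).1, fun y ↦
          congrArg (fun v : V ↦ gen U.unop (genericPoint_mem x.2) r • v) ((ha x).2 y)⟩ }
  map {U W} i f (hf : IsLatSec Λ _ f) x :=
    ⟨(hf ⟨x.1, i.unop.le x.2⟩).1, fun _ ↦ (hf ⟨x.1, i.unop.le x.2⟩).2 _⟩

lemma isLatSec_of_local (Λ : Lattice X V) (U : X.Opens) (f : FamSec X V U)
    (hf : ∀ x ∈ U, ∃ (W : X.Opens) (i : W ⟶ U), x ∈ W ∧
      IsLatSec Λ W (fun y ↦ f ⟨y.1, i.le y.2⟩)) : IsLatSec Λ U f := by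
  intro x
  obtain ⟨W, i, hx, h⟩ := hf x.1 x.2
  refine ⟨(h ⟨x.1, hx⟩).1, fun y ↦ ?_⟩
  obtain ⟨W', i', hy, h'⟩ := hf y.1 y.2
  exact ((h ⟨x.1, hx⟩).2 ⟨genericPoint X, genericPoint_mem hx⟩).trans
    ((h' ⟨y.1, hy⟩).2 ⟨genericPoint X, genericPoint_mem hy⟩).symm

/-- The subsheaf of the constant sheaf `V` whose sections over `U` are the vectors that lie in
`Λ_x` for all `x ∈ U`. -/
def lat (Λ : Lattice X V) : X.Modules where
  val := (latSubmodule Λ).toPresheafOfModules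
  isSheaf := isSheaf_submodule (famPresheaf X V) (isSheaf_famAb X V) _
    fun U f hf ↦ isLatSec_of_local Λ U f hf

/-- The value in `V` of a section over a nonempty open set. -/
def latVal (Λ : Lattice X V) (U : X.Opens) (hU : genericPoint X ∈ U) : Γ(lat Λ, U) →+ V where
  toFun s := s.1 ⟨genericPoint X, hU⟩
  map_zero' := rfl
  map_add' _ _ := rfl

variable {Λ : Lattice X V} {U W : X.Opens}

lemma latVal_injective (hU : genericPoint X ∈ U) : Function.Injective (latVal Λ U hU) :=
  fun s t h ↦ Subtype.ext (funext fun x ↦ ((show IsLatSec Λ U s.1 from s.2) x).2 _ |>.trans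
    (h.trans (((show IsLatSec Λ U t.1 from t.2) x).2 _).symm))

lemma latVal_mem (hU : genericPoint X ∈ U) (s : Γ(lat Λ, U)) {x : X} (hx : x ∈ U) :
    latVal Λ U hU s ∈ Λ.carrier x := by
  have h : IsLatSec Λ U s.1 := s.2
  have h1 := (h ⟨x, hx⟩).1
  rw [(h ⟨x, hx⟩).2 ⟨_, hU⟩] at h1
  exact h1

/-- The section with a given value. -/
def latMk (Λ : Lattice X V) (U : X.Opens) (v : V) (hv : ∀ x ∈ U, v ∈ Λ.carrier x) : Γ(lat Λ, U) :=
  ⟨fun _ ↦ v, (fun x ↦ ⟨hv x.1 x.2, fun _ ↦ rfl⟩ : IsLatSec Λ U fun _ ↦ v)⟩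

/-- Compatible semilinear maps from the sections of a presheaf of modules to `V`, defined over
nonempty open sets and with values in `Λ`. -/
structure LatHom (P : X.PresheafOfModules) (Λ : Lattice X V) where
  toFun (U : X.Opens) (hU : genericPoint X ∈ U) : P.obj (op U) →+ V
  map_smul (U : X.Opens) (hU : genericPoint X ∈ U) (r : Γ(X, U)) (s : P.obj (op U)) :
    toFun U hU ((show X.ringCatSheaf.obj.obj (op U) from r) • s) = gen U hU r • toFun U hU s
  map_res {U W : X.Opens} (i : W ⟶ U) (hW : genericPoint X ∈ W) (s : P.obj (op U)) :
    toFun W hW (P.map i.op s) = toFun U (i.le hW) s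
  mem (U : X.Opens) (x : X) (hx : x ∈ U) (s : P.obj (op U)) :
    toFun U (genericPoint_mem hx) s ∈ Λ.carrier x

/-- The morphism to `lat Λ` given by compatible maps to `V`. -/
def LatHom.hom {P : X.PresheafOfModules} (θ : LatHom P Λ) : P ⟶ (lat Λ).val :=
  PresheafOfModules.homMk
    { app := fun U ↦ AddCommGrpCat.ofHom
        { toFun := fun s ↦ (⟨fun x ↦ θ.toFun U.unop (genericPoint_mem x.2) s,
            (fun x ↦ ⟨θ.mem U.unop x.1 x.2 s, fun _ ↦ rfl⟩ : IsLatSec Λ U.unop _)⟩ :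
            Γ(lat Λ, U.unop))
          map_zero' := Subtype.ext (funext fun _ ↦ map_zero _)
          map_add' := fun _ _ ↦ Subtype.ext (funext fun _ ↦ map_add _ _ _) }
      naturality := fun U W i ↦ by
        ext s
        exact Subtype.ext (funext fun x ↦ θ.map_res i.unop (genericPoint_mem x.2) s) }
    (fun U r s ↦ Subtype.ext (funext fun _ ↦ θ.map_smul U.unop _ r s))

/-- The map to `V` is bijective onto the vectors that lie in `Λ_x` for all `x ∈ U`. -/
def LatHom.BijOn {P : X.PresheafOfModules} (θ : LatHom P Λ) (U : X.Opens) : Prop :=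
  ∀ hU : genericPoint X ∈ U, Function.Injective (θ.toFun U hU) ∧
    ∀ v, (∀ x ∈ U, v ∈ Λ.carrier x) → ∃ s, θ.toFun U hU s = v

lemma LatHom.BijOn.bijective {P : X.PresheafOfModules} {θ : LatHom P Λ} (h : θ.BijOn U)
    (hU : genericPoint X ∈ U) : Function.Bijective (θ.hom.app (op U)) := by
  refine ⟨fun s t hst ↦ (h hU).1 (congrArg (latVal Λ U hU) hst), fun t ↦ ?_⟩
  obtain ⟨s, hs⟩ := (h hU).2 (latVal Λ U hU t) fun x hx ↦ latVal_mem hU t hx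
  exact ⟨s, latVal_injective hU hs⟩

lemma LatHom.exists_iso {P : X.PresheafOfModules} (θ : LatHom P Λ)
    (H : ∀ (U : X.Opens) (x : X), x ∈ U → ∃ W : X.Opens, W ≤ U ∧ x ∈ W ∧ θ.BijOn W) :
    ∃ e : sheafify P ≅ lat Λ, ∀ (U : X.Opens) (hU : genericPoint X ∈ U) (s : P.obj (op U)),
      latVal Λ U hU (e.hom.app U (toSheafify P U s)) = θ.toFun U hU s := by
  obtain ⟨e, he⟩ := exists_iso_of_basis P (lat Λ) θ.hom fun U x hx ↦ by
    obtain ⟨W, hW, hxW, h⟩ := H U x hx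
    exact ⟨W, hW, hxW, h.bijective (genericPoint_mem hxW)⟩
  exact ⟨e, fun U hU s ↦ by rw [he]; rfl⟩

lemma LatHom.exists_iso' {M : X.Modules} (θ : LatHom M.val Λ)
    (H : ∀ (U : X.Opens) (x : X), x ∈ U → ∃ W : X.Opens, W ≤ U ∧ x ∈ W ∧ θ.BijOn W) :
    ∃ e : M ≅ lat Λ, ∀ (U : X.Opens) (hU : genericPoint X ∈ U) (s : Γ(M, U)),
      latVal Λ U hU (e.hom.app U s) = θ.toFun U hU s := by
  let f : M ⟶ lat Λ := ⟨θ.hom⟩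
  have : IsIso f := isIso_of_basis f fun U x hx ↦ by
    obtain ⟨W, hW, hxW, h⟩ := H U x hx
    exact ⟨W, hW, hxW, h.bijective (genericPoint_mem hxW)⟩
  exact ⟨asIso f, fun U hU s ↦ rfl⟩

end Lattice

/-! ### Generators of invertible modules -/

section Generator
variable {X : Scheme.{u}}

/-- The map `r ↦ r s` from functions to sections of `M`. -/
def mulSec (M : X.Modules) {U : X.Opens} (s : Γ(M, U)) : Γ(X, U) →+ Γ(M, U) :=
  (LinearMap.toSpanSingleton Γ(X, U) Γ(M, U) s).toAddMonoidHom

lemma mulSec_apply (M : X.Modules) {U : X.Opens} (s : Γ(M, U)) (r : Γ(X, U)) :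
    mulSec M s r = r • s := rfl

/-- The section `g` over `U` freely generates the module `M` over every open subset of `U`. -/
def IsGenerator (M : X.Modules) (U : X.Opens) (g : Γ(M, U)) : Prop :=
  ∀ (W : X.Opens) (i : W ⟶ U), Function.Bijective fun r : Γ(X, W) ↦ r • M.presheaf.map i.op g

/-- A module with a free generator over `U` is isomorphic over `U` to the structure sheaf. -/
lemma IsGenerator.exists_iso {M : X.Modules} {U : X.Opens} {g : Γ(M, U)} (hg : IsGenerator M U g) :
    Nonempty (M.restrict U.ι ≅ structureModule U) := by
  let j (W : U.toScheme.Opens) : U.ι ''ᵁ W ⟶ U :=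
    homOfLE (by rintro _ ⟨y, -, rfl⟩; exact y.2)
  have key (W : U.toScheme.Opens) (r m : Γ(X, U.ι ''ᵁ W)) :
      mulSec M (M.presheaf.map (j W).op g) (r * m) =
        mulSec M (mulSec M (M.presheaf.map (j W).op g) m) ((U.ι.appIso W).inv r) := by
    simp only [mulSec_apply, mul_smul]
    congr 1
    simp only [Scheme.Opens.ι_appIso, Iso.refl_inv]
    rfl
  have key2 {V W : X.Opens} (a : V ⟶ U) (b : W ⟶ U) (i : W ⟶ V) (r : Γ(X, V)) :
      mulSec M (M.presheaf.map b.op g) (X.presheaf.map i.op r) =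
        M.presheaf.map i.op (mulSec M (M.presheaf.map a.op g) r) := by
    simp only [mulSec_apply, Scheme.Modules.map_smul]
    congr 1
    rw [← ConcreteCategory.comp_apply, ← Functor.map_comp]; rfl
  let ψ : (structureModule U).val ⟶ (M.restrict U.ι).val :=
    PresheafOfModules.homMk
      { app := fun W ↦ AddCommGrpCat.ofHom
          (mulSec M (M.presheaf.map (j W.unop).op g))
        naturality := fun W W' i ↦ by
          ext (r : Γ(X, U.ι ''ᵁ W.unop))
          exact key2 (j W.unop) (j W'.unop) (U.ι.opensFunctor.map i.unop) r }
      (fun W r m ↦ by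
        exact key W.unop r m)
  let f : structureModule U ⟶ M.restrict U.ι := ⟨ψ⟩
  have : IsIso f := isIso_of_basis f fun V x hx ↦ ⟨V, le_rfl, hx, hg _ (j V)⟩
  exact ⟨(asIso f).symm⟩

/-- An invertible module has a free generator in a neighbourhood of every point: the section that
corresponds to `1` under a local isomorphism with the structure sheaf. -/
lemma exists_isGenerator {M : X.Modules} (hM : IsInvertible M) (x : X) :
    ∃ (U : X.Opens) (g : Γ(M, U)), x ∈ U ∧ IsGenerator M U g := by
  obtain ⟨U, hx, ⟨φ⟩⟩ := hM x
  let one : Γ(structureModule U, ⊤) := (1 : Γ(U, ⊤))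
  let g : Γ(M, U.ι ''ᵁ ⊤) := φ.inv.app ⊤ one
  refine ⟨U.ι ''ᵁ ⊤, g, by simpa using hx, fun W i ↦ ?_⟩
  obtain ⟨W, rfl⟩ : ∃ W' : U.toScheme.Opens, U.ι ''ᵁ W' = W := by
    refine ⟨U.ι ⁻¹ᵁ W, ?_⟩
    rw [Scheme.Hom.image_preimage_eq_opensRange_inf, inf_eq_right]
    refine i.le.trans ?_
    rintro _ ⟨y, -, rfl⟩
    exact ⟨y, rfl⟩
  have h1 : M.presheaf.map i.op g = φ.inv.app W (1 : Γ(U, W)) := by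
    have := NatTrans.naturality_apply φ.inv.mapPresheaf (homOfLE (le_top : W ≤ ⊤)).op one
    have h2 : (structureModule U).presheaf.map (homOfLE (le_top : W ≤ ⊤)).op one = (1 : Γ(U, W)) :=
      map_one (U.toScheme.presheaf.map (homOfLE (le_top : W ≤ ⊤)).op).hom
    rw [h2] at this
    exact this.symm
  have h3 (r : Γ(X, U.ι ''ᵁ W)) :
      mulSec M (M.presheaf.map i.op g) r = φ.inv.app W (r : Γ(U, W)) := by
    rw [h1]
    have := Scheme.Modules.Hom.app_smul φ.inv (U := W) (r : Γ(U, W)) (1 : Γ(U, W))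
    have e : (show Γ(U, W) from r) * 1 = r := mul_one _
    refine Eq.trans ?_ ((this.symm).trans (congrArg (φ.inv.app W) e))
    have e2 : (U.ι.appIso W).inv r = (r : Γ(X, U.ι ''ᵁ W)) := by
      simp only [Scheme.Opens.ι_appIso, Iso.refl_inv]
      rfl
    exact (congrArg (mulSec M (φ.inv.app W (1 : Γ(U, W)) : Γ(M, U.ι ''ᵁ W))) e2).symm
  have h4 : Function.Bijective (φ.inv.app W) := by
    have : IsIso (φ.inv.app W) := inferInstance
    exact ConcreteCategory.bijective_of_isIso _
  have h5 : (fun r : Γ(X, U.ι ''ᵁ W) ↦ r • M.presheaf.map i.op g) = φ.inv.app W := funext h3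
  exact h5 ▸ h4

end Generator

/-! ### Tensor products of sheaves of lattices -/

section SemiTensor
variable {R A B K V₁ V₂ V : Type*} [CommRing R] [AddCommGroup A] [Module R A] [AddCommGroup B]
  [Module R B] [Field K] [AddCommGroup V₁] [Module K V₁] [AddCommGroup V₂] [Module K V₂]
  [AddCommGroup V] [Module K V] (g : R →+* K) (a : A →+ V₁) (b : B →+ V₂)
  (ha : ∀ r x, a (r • x) = g r • a x) (hb : ∀ r x, b (r • x) = g r • b x)
  (β : V₁ →ₗ[K] V₂ →ₗ[K] V)

/-- The map `x ⊗ y ↦ β (a x) (b y)`, for semilinear maps `a` and `b`. -/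
def semiTensor : A ⊗[R] B →+ V :=
  TensorProduct.liftAddHom
    { toFun := fun x ↦ ((β (a x)).toAddMonoidHom.comp b)
      map_zero' := by ext t; simp
      map_add' := fun s s' ↦ by ext t; simp }
    (fun r s t ↦ by simp [ha, hb])

lemma semiTensor_smul (r : R) (z : A ⊗[R] B) :
    semiTensor g a b ha hb β (r • z) = g r • semiTensor g a b ha hb β z := by
  induction z using TensorProduct.induction_on with
  | zero => simp
  | tmul s t => simp [semiTensor, TensorProduct.smul_tmul', ha]
  | add x y hx hy => rw [smul_add, map_add, map_add, hx, hy, smul_add]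

end SemiTensor

section Frame
variable {X : Scheme.{u}} [IsIntegral X] {V : Type u} [AddCommGroup V] [Module X.functionField V]
  {Λ : Lattice X V} {ι : Type*}

/-- At every point `y ∈ U`, the basis `b` of `V` generates the `𝒪_y`-module `Λ_y`. -/
def Lattice.FreeOn (Λ : Lattice X V) (U : X.Opens) (b : Module.Basis ι X.functionField V) : Prop :=
  ∀ y ∈ U, ∀ v, v ∈ Λ.carrier y ↔ ∀ i, b.repr v i ∈ reg y

lemma Lattice.FreeOn.basis_mem {U : X.Opens} {b : Module.Basis ι X.functionField V}
    (h : Λ.FreeOn U b) (i : ι) (y : X) (hy : y ∈ U) : b i ∈ Λ.carrier y := by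
  classical
  rw [h y hy]
  intro j
  rw [Module.Basis.repr_self, Finsupp.single_apply]
  split_ifs
  · exact one_mem _
  · exact zero_mem _

variable [Fintype ι]

lemma LatHom.map_smul' {P : X.PresheafOfModules} (θ : LatHom P Λ) (U : X.Opens)
    (hU : genericPoint X ∈ U) (r : X.ringCatSheaf.obj.obj (op U)) (s : P.obj (op U)) :
    θ.toFun U hU (r • s) = gen U hU (show Γ(X, U) from r) • θ.toFun U hU s :=
  θ.map_smul U hU r s

/-- Sections over `U` that span the sections of `P` and have a basis of the lattice as their values
are linearly independent, so that the sections of `P` over `U` are those of the lattice. -/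
lemma LatHom.BijOn.of_span {P : X.PresheafOfModules} {θ : LatHom P Λ} {U : X.Opens}
    {b : Module.Basis ι X.functionField V} (hb : Λ.FreeOn U b) (m : ι → P.obj (op U))
    (hm : ∀ hU i, θ.toFun U hU (m i) = b i)
    (hs : ∀ s : P.obj (op U), ∃ c : ι → X.ringCatSheaf.obj.obj (op U), s = ∑ i, c i • m i) :
    θ.BijOn U := by
  intro hU
  have key (c : ι → X.ringCatSheaf.obj.obj (op U)) :
      θ.toFun U hU (∑ i, c i • m i) = ∑ i, gen U hU (show Γ(X, U) from c i) • b i := by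
    rw [map_sum]
    exact Finset.sum_congr rfl fun i _ ↦ by rw [θ.map_smul', hm]
  constructor
  · rw [injective_iff_map_eq_zero]
    intro s h
    obtain ⟨c, rfl⟩ := hs s
    rw [key] at h
    have h0 := Fintype.linearIndependent_iff.1 b.linearIndependent _ h
    refine Finset.sum_eq_zero fun i _ ↦ ?_
    have h1 : c i = 0 := gen_injective U hU ((h0 i).trans (map_zero _).symm)
    rw [h1, zero_smul]
  · intro v hv
    have h1 (i : ι) : ∃ r : Γ(X, U), gen U hU r = b.repr v i :=
      exists_gen_of_forall_mem_reg hU fun x hx ↦ (hb x hx v).1 (hv x hx) i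
    choose c hc using h1
    refine ⟨∑ i, (show X.ringCatSheaf.obj.obj (op U) from c i) • m i, ?_⟩
    rw [key]
    refine Eq.trans ?_ (b.sum_repr v)
    exact Finset.sum_congr rfl fun i _ ↦ congrArg (· • b i) (hc i)

/-- Sections with given values in a frame, together with the fact that they span. -/
lemma LatHom.BijOn.exists_span {P : X.PresheafOfModules} {θ : LatHom P Λ} {U : X.Opens}
    (hB : θ.BijOn U) {b : Module.Basis ι X.functionField V} (hb : Λ.FreeOn U b)
    (hU : genericPoint X ∈ U) :
    ∃ m : ι → P.obj (op U), (∀ i, θ.toFun U hU (m i) = b i) ∧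
      ∀ s : P.obj (op U), ∃ c : ι → X.ringCatSheaf.obj.obj (op U), s = ∑ i, c i • m i := by
  choose m hm using fun i ↦ (hB hU).2 (b i) (hb.basis_mem i)
  refine ⟨m, hm, fun s ↦ ?_⟩
  have h1 (i : ι) : ∃ r : Γ(X, U), gen U hU r = b.repr (θ.toFun U hU s) i :=
    exists_gen_of_forall_mem_reg hU fun x hx ↦ (hb x hx _).1 (θ.mem U x hx s) i
  choose c hc using h1
  refine ⟨c, (hB hU).1 ?_⟩
  rw [map_sum]
  refine (b.sum_repr _).symm.trans (Finset.sum_congr rfl fun i _ ↦ ?_)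
  refine Eq.trans ?_ (θ.map_smul' U hU (c i) (m i)).symm
  exact congrArg₂ (· • ·) (hc i).symm (hm i).symm

/-- The tautological maps on the sections of `lat Λ`. -/
def LatHom.id (Λ : Lattice X V) : LatHom (lat Λ).val Λ where
  toFun U hU := latVal Λ U hU
  map_smul _ _ _ _ := rfl
  map_res _ _ _ := rfl
  mem _ _ hx s := latVal_mem (genericPoint_mem hx) s hx

lemma LatHom.bijOn_id (Λ : Lattice X V) (U : X.Opens) : (LatHom.id Λ).BijOn U := fun hU ↦
  ⟨latVal_injective hU, fun v hv ↦ ⟨latMk Λ U v hv, rfl⟩⟩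

/-- Composition with a morphism of sheaves of modules. -/
def LatHom.precomp {M N : X.Modules} (f : M ⟶ N) (θ : LatHom N.val Λ) : LatHom M.val Λ where
  toFun U hU := (θ.toFun U hU).comp (f.app U).hom
  map_smul U hU r s := (congrArg (θ.toFun U hU) (f.app_smul r s)).trans (θ.map_smul U hU r _)
  map_res i hW s := (congrArg (θ.toFun _ hW)
    (NatTrans.naturality_apply f.mapPresheaf i.op s)).trans (θ.map_res i hW _)
  mem U x hx s := θ.mem U x hx _

lemma LatHom.BijOn.precomp {M N : X.Modules} (f : M ≅ N) {θ : LatHom N.val Λ} {U : X.Opens}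
    (h : θ.BijOn U) : (LatHom.precomp f.hom θ).BijOn U := fun hU ↦ by
  have h4 : Function.Bijective (f.hom.app U) := by
    have : IsIso (f.hom.app U) := inferInstance
    exact ConcreteCategory.bijective_of_isIso _
  refine ⟨(h hU).1.comp h4.1, fun v hv ↦ ?_⟩
  obtain ⟨t, ht⟩ := (h hU).2 v hv
  obtain ⟨s, rfl⟩ := h4.2 t
  exact ⟨s, ht⟩

variable {V₁ V₂ : Type u} [AddCommGroup V₁] [Module X.functionField V₁] [AddCommGroup V₂]
  [Module X.functionField V₂] {Λ₁ : Lattice X V₁} {Λ₂ : Lattice X V₂}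

/-- The product of the maps on the sections of `M` and `N`, with respect to a bilinear map. -/
def LatHom.tensor {M N : X.Modules} (θ₁ : LatHom M.val Λ₁) (θ₂ : LatHom N.val Λ₂)
    (β : V₁ →ₗ[X.functionField] V₂ →ₗ[X.functionField] V)
    (hβ : ∀ x, ∀ v ∈ Λ₁.carrier x, ∀ w ∈ Λ₂.carrier x, β v w ∈ Λ.carrier x) :
    LatHom (tensorPresheaf M N) Λ :=
  let T (U : X.Opens) (hU : genericPoint X ∈ U) : Γ(M, U) ⊗[Γ(X, U)] Γ(N, U) →+ V :=
    semiTensor (gen U hU) (show Γ(M, U) →+ V₁ from θ₁.toFun U hU)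
      (show Γ(N, U) →+ V₂ from θ₂.toFun U hU) (θ₁.map_smul U hU) (θ₂.map_smul U hU) β
  { toFun := T
    map_smul := fun U hU r s ↦ semiTensor_smul (gen U hU) (show Γ(M, U) →+ V₁ from θ₁.toFun U hU)
      (show Γ(N, U) →+ V₂ from θ₂.toFun U hU) (θ₁.map_smul U hU) (θ₂.map_smul U hU) β r s
    map_res := fun {U W} i hW s ↦ by
      induction s using TensorProduct.induction_on with
      | zero => exact (congrArg _ (map_zero _)).trans ((map_zero _).trans (map_zero (T U _)).symm)
      | tmul s t =>
        change β (θ₁.toFun W hW (M.val.map i.op s)) (θ₂.toFun W hW (N.val.map i.op t)) =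
          β (θ₁.toFun U _ s) (θ₂.toFun U _ t)
        rw [θ₁.map_res, θ₂.map_res]
      | add a b ha hb =>
        exact (congrArg _ (map_add _ _ _)).trans ((map_add _ _ _).trans
          ((congrArg₂ (· + ·) ha hb).trans (map_add (T U _) _ _).symm))
    mem := fun U x hx s ↦ by
      induction s using TensorProduct.induction_on with
      | zero => exact (map_zero (T U _)).symm ▸ AddSubgroup.zero_mem _
      | tmul s t => exact hβ x _ (θ₁.mem U x hx s) _ (θ₂.mem U x hx t)
      | add a b ha hb =>
        exact (map_add (T U _) a b).symm ▸ AddSubgroup.add_mem _ ha hb }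

lemma LatHom.tensor_tmul {M N : X.Modules} (θ₁ : LatHom M.val Λ₁) (θ₂ : LatHom N.val Λ₂)
    (β : V₁ →ₗ[X.functionField] V₂ →ₗ[X.functionField] V)
    (hβ : ∀ x, ∀ v ∈ Λ₁.carrier x, ∀ w ∈ Λ₂.carrier x, β v w ∈ Λ.carrier x)
    (U : X.Opens) (hU : genericPoint X ∈ U) (s : Γ(M, U)) (t : Γ(N, U)) :
    (LatHom.tensor θ₁ θ₂ β hβ).toFun U hU
      (s ⊗ₜ[Γ(X, U)] t : Γ(M, U) ⊗[Γ(X, U)] Γ(N, U)) = β (θ₁.toFun U hU s) (θ₂.toFun U hU t) :=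
  rfl

variable {ι₁ ι₂ : Type*} [Fintype ι₁] [Fintype ι₂]

/-- Over an open set on which both lattices are free, the tensor product of the modules of sections
already consists of the sections of the product lattice. Sheafification is therefore harmless. -/
lemma LatHom.bijOn_tensor {M N : X.Modules} {θ₁ : LatHom M.val Λ₁} {θ₂ : LatHom N.val Λ₂}
    {β : V₁ →ₗ[X.functionField] V₂ →ₗ[X.functionField] V}
    {hβ : ∀ x, ∀ v ∈ Λ₁.carrier x, ∀ w ∈ Λ₂.carrier x, β v w ∈ Λ.carrier x} {U : X.Opens}
    (hU : genericPoint X ∈ U)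
    (h₁ : θ₁.BijOn U) (h₂ : θ₂.BijOn U) {b₁ : Module.Basis ι₁ X.functionField V₁}
    {b₂ : Module.Basis ι₂ X.functionField V₂} {b : Module.Basis (ι₁ × ι₂) X.functionField V}
    (hb₁ : Λ₁.FreeOn U b₁) (hb₂ : Λ₂.FreeOn U b₂) (hb : Λ.FreeOn U b)
    (hbb : ∀ i j, β (b₁ i) (b₂ j) = b (i, j)) : (LatHom.tensor θ₁ θ₂ β hβ).BijOn U := by
  obtain ⟨m₁, hm₁, hs₁⟩ := h₁.exists_span hb₁ hU
  obtain ⟨m₂, hm₂, hs₂⟩ := h₂.exists_span hb₂ hU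
  refine LatHom.BijOn.of_span hb
    (fun ij ↦ (show Γ(M, U) ⊗[Γ(X, U)] Γ(N, U) from
      (show Γ(M, U) from m₁ ij.1) ⊗ₜ[Γ(X, U)] (show Γ(N, U) from m₂ ij.2))) (fun _ ij ↦ ?_) ?_
  · refine (LatHom.tensor_tmul θ₁ θ₂ β hβ U hU _ _).trans ?_
    exact (congrArg₂ (fun v w ↦ β v w) (hm₁ _) (hm₂ _)).trans (hbb _ _)
  · intro (s : Γ(M, U) ⊗[Γ(X, U)] Γ(N, U))
    change ∃ c : ι₁ × ι₂ → Γ(X, U), s = ∑ ij, c ij • ((show Γ(M, U) from m₁ ij.1) ⊗ₜ[Γ(X, U)]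
      (show Γ(N, U) from m₂ ij.2))
    induction s using TensorProduct.induction_on with
    | zero => exact ⟨0, by simp⟩
    | add a b ha hb =>
      obtain ⟨c, rfl⟩ := ha
      obtain ⟨d, rfl⟩ := hb
      exact ⟨c + d, by simp [add_smul, Finset.sum_add_distrib]⟩
    | tmul s t =>
      obtain ⟨c, hc⟩ := hs₁ s
      obtain ⟨d, hd⟩ := hs₂ t
      have hc' : s = ∑ i, (show Γ(X, U) from c i) • (show Γ(M, U) from m₁ i) := hc
      have hd' : t = ∑ i, (show Γ(X, U) from d i) • (show Γ(N, U) from m₂ i) := hd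
      refine ⟨fun ij ↦ (show Γ(X, U) from c ij.1) * (show Γ(X, U) from d ij.2), ?_⟩
      rw [hc', hd', TensorProduct.sum_tmul, Fintype.sum_prod_type]
      refine Finset.sum_congr rfl fun i _ ↦ ?_
      rw [TensorProduct.tmul_sum]
      exact Finset.sum_congr rfl fun j _ ↦ TensorProduct.smul_tmul_smul _ _ _ _

end Frame

/-! ### Cartier divisors and invertible modules -/

section Divisor
variable {X : Scheme.{u}} [IsIntegral X]

lemma IsRegUnit.mul_unit {x : X} {f g : X.functionFieldˣ} (hf : IsRegUnit x (f : X.functionField))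
    (hg : IsRegUnit x (g : X.functionField)) : IsRegUnit x ((f * g : X.functionFieldˣ) : _) := by
  rw [Units.val_mul]; exact hf.mul hg

variable (X) in
/-- The units of the local ring at `x`, as a subgroup of the units of the function field. -/
def regUnits (x : X) : Subgroup X.functionFieldˣ where
  carrier := {f | IsRegUnit x (f : X.functionField)}
  one_mem' := IsRegUnit.one x
  mul_mem' := IsRegUnit.mul_unit
  inv_mem' := fun {f} hf ↦ by
    change IsRegUnit x ((f⁻¹ : X.functionFieldˣ) : X.functionField)
    rw [Units.val_inv_eq_inv_val]; exact hf.inv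

lemma mem_regUnits {x : X} {f : X.functionFieldˣ} :
    f ∈ regUnits X x ↔ IsRegUnit x (f : X.functionField) := Iff.rfl

variable (X) in
/-- The group of Cartier divisors of `X`, given by a local equation `c_x ∈ K^×` at every point
`x`: near `x`, the functions `c_x` and `c_y` differ by a unit at `y`. -/
def divisors : Subgroup (X → X.functionFieldˣ) where
  carrier := {c | ∀ x, ∃ U : X.Opens, x ∈ U ∧ ∀ y ∈ U, c y / c x ∈ regUnits X y}
  one_mem' := fun x ↦ ⟨⊤, trivial, fun y _ ↦ by simp⟩
  mul_mem' := fun {c d} hc hd x ↦ by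
    obtain ⟨U, hU, h⟩ := hc x
    obtain ⟨V, hV, h'⟩ := hd x
    refine ⟨U ⊓ V, ⟨hU, hV⟩, fun y hy ↦ ?_⟩
    have := mul_mem (h y hy.1) (h' y hy.2)
    rwa [← mul_div_mul_comm] at this
  inv_mem' := fun {c} hc x ↦ by
    obtain ⟨U, hU, h⟩ := hc x
    refine ⟨U, hU, fun y hy ↦ ?_⟩
    have := inv_mem (h y hy)
    rwa [inv_div, ← inv_div_inv] at this

/-- Two Cartier divisors are linearly equivalent. -/
def LinEquiv (c d : divisors X) : Prop :=
  ∃ h : X.functionFieldˣ, ∀ y, h * c.1 y / d.1 y ∈ regUnits X y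

lemma LinEquiv.refl (c : divisors X) : LinEquiv c c :=
  ⟨1, fun y ↦ by simp⟩

lemma LinEquiv.symm {c d : divisors X} (h : LinEquiv c d) : LinEquiv d c := by
  obtain ⟨h, H⟩ := h
  refine ⟨h⁻¹, fun y ↦ ?_⟩
  convert inv_mem (H y) using 1
  rw [inv_div, mul_comm h, ← div_div, div_eq_mul_inv _ h, mul_comm h⁻¹, mul_div_right_comm]

lemma LinEquiv.mul {c d c' d' : divisors X} (h : LinEquiv c d) (h' : LinEquiv c' d') :
    LinEquiv (c * c') (d * d') := by
  obtain ⟨h, H⟩ := h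
  obtain ⟨h', H'⟩ := h'
  refine ⟨h * h', fun y ↦ ?_⟩
  convert mul_mem (H y) (H' y) using 1
  change h * h' * (c.1 y * c'.1 y) / (d.1 y * d'.1 y) = _
  rw [mul_mul_mul_comm, mul_div_mul_comm]

lemma LinEquiv.trans {c d e : divisors X} (h : LinEquiv c d) (h' : LinEquiv d e) :
    LinEquiv c e := by
  have := (h.mul h').mul (LinEquiv.refl d⁻¹)
  simpa [mul_comm d e, mul_assoc] using this

lemma LinEquiv.inv {c d : divisors X} (h : LinEquiv c d) : LinEquiv c⁻¹ d⁻¹ := by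
  have := h.symm.mul (LinEquiv.refl (c⁻¹ * d⁻¹))
  have e : d * (c⁻¹ * d⁻¹) = c⁻¹ := by rw [mul_comm c⁻¹, mul_inv_cancel_left]
  rwa [e, mul_inv_cancel_left] at this

lemma LinEquiv.zpow {c d : divisors X} (h : LinEquiv c d) (m : ℤ) : LinEquiv (c ^ m) (d ^ m) := by
  have hn (n : ℕ) : LinEquiv (c ^ n) (d ^ n) := by
    induction n with
    | zero => rw [pow_zero, pow_zero]; exact .refl _
    | succ n ih => rw [pow_succ, pow_succ]; exact ih.mul h
  cases m with
  | ofNat n => rw [Int.ofNat_eq_natCast, zpow_natCast, zpow_natCast]; exact hn n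
  | negSucc n => rw [zpow_negSucc, zpow_negSucc]; exact (hn _).inv

/-- The fractional ideals `c_x 𝒪_x`. -/
def divLattice (c : divisors X) : Lattice X X.functionField where
  carrier x :=
    { carrier := {f | ((c.1 x)⁻¹ : X.functionFieldˣ) * f ∈ reg x}
      zero_mem' := by simp
      add_mem' := fun ha hb ↦ by
        change _ * _ ∈ reg x
        rw [mul_add]; exact add_mem ha hb
      neg_mem' := fun ha ↦ by
        change _ * _ ∈ reg x
        rw [mul_neg]; exact neg_mem ha }
  smul_mem x f v hf hv := by
    change _ * (f * v) ∈ reg x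
    rw [mul_left_comm]; exact mul_mem hf hv

lemma mem_divLattice {c : divisors X} {x : X} {f : X.functionField} :
    f ∈ (divLattice c).carrier x ↔ ((c.1 x)⁻¹ : X.functionFieldˣ) * f ∈ reg x := Iff.rfl

/-- The invertible sheaf `𝒪(c)` whose stalk at `x` is `c_x 𝒪_x`. -/
def divSheaf (c : divisors X) : X.Modules := lat (divLattice c)

/-- The basis of the function field, as a vector space over itself, given by a unit. -/
def unitBasis (a : X.functionFieldˣ) : Module.Basis Unit X.functionField X.functionField :=
  (Module.Basis.singleton Unit X.functionField).unitsSMul fun _ ↦ a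

lemma unitBasis_apply (a : X.functionFieldˣ) (i : Unit) : unitBasis a i = a := by
  simp [unitBasis, Module.Basis.unitsSMul_apply, Units.smul_def]

lemma unitBasis_repr (a : X.functionFieldˣ) (v : X.functionField) (i : Unit) :
    (unitBasis a).repr v i = (a⁻¹ : X.functionFieldˣ) * v := by
  simp [unitBasis, Module.Basis.repr_unitsSMul, Units.smul_def]

lemma divLattice_freeOn (c : divisors X) (a : X.functionFieldˣ) {U : X.Opens}
    (h : ∀ y ∈ U, c.1 y / a ∈ regUnits X y) : (divLattice c).FreeOn U (unitBasis a) := by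
  intro y hy v
  simp only [unitBasis_repr, forall_const, mem_divLattice]
  rw [← (h y hy).mem_iff, ← mul_assoc, ← Units.val_mul]
  congr! 3
  rw [div_eq_mul_inv, mul_right_comm, mul_inv_cancel, one_mul]

lemma exists_freeOn (c : divisors X) (x : X) : ∃ U : X.Opens, x ∈ U ∧
    ∀ W ≤ U, (divLattice c).FreeOn W (unitBasis (c.1 x)) := by
  obtain ⟨U, hU, h⟩ := c.2 x
  exact ⟨U, hU, fun W hW ↦ divLattice_freeOn c (c.1 x) fun y hy ↦ h y (hW hy)⟩

lemma LatHom.exists_iso_of_forall_bijOn {V : Type u} [AddCommGroup V] [Module X.functionField V]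
    {Λ : Lattice X V} {P : X.PresheafOfModules} (θ : LatHom P Λ)
    (H : ∀ x : X, ∃ U : X.Opens, x ∈ U ∧ ∀ W ≤ U, θ.BijOn W) :
    ∃ e : sheafify P ≅ lat Λ, ∀ (U : X.Opens) (hU : genericPoint X ∈ U) (s : P.obj (op U)),
      latVal Λ U hU (e.hom.app U (toSheafify P U s)) = θ.toFun U hU s :=
  θ.exists_iso fun U x hx ↦ by
    obtain ⟨W, hxW, h⟩ := H x
    exact ⟨U ⊓ W, inf_le_left, ⟨hx, hxW⟩, h _ inf_le_right⟩

/-- The sheaf of a product of divisors is the tensor product of their sheaves. -/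
lemma tensor_divSheaf {M N : X.Modules} {c d : divisors X} (e : M ≅ divSheaf c)
    (f : N ≅ divSheaf d) : Nonempty (tensor M N ≅ divSheaf (c * d)) := by
  let θ := LatHom.tensor (Λ := divLattice (c * d)) (LatHom.precomp e.hom (LatHom.id (divLattice c)))
    (LatHom.precomp f.hom (LatHom.id (divLattice d)))
    (LinearMap.mul X.functionField X.functionField) (fun x v hv w hw ↦ by
      rw [mem_divLattice] at hv hw ⊢
      change (((c.1 x * d.1 x)⁻¹ : X.functionFieldˣ) : X.functionField) * (v * w) ∈ reg x
      convert mul_mem hv hw using 1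
      rw [mul_inv, Units.val_mul, mul_mul_mul_comm])
  obtain ⟨g, -⟩ := θ.exists_iso_of_forall_bijOn fun x ↦ by
    obtain ⟨U, hU, h⟩ := exists_freeOn c x
    obtain ⟨V, hV, h'⟩ := exists_freeOn d x
    obtain ⟨W, hW, h''⟩ := exists_freeOn (c * d) x
    refine ⟨U ⊓ V ⊓ W, ⟨⟨hU, hV⟩, hW⟩, fun T hT hη ↦ ?_⟩
    refine LatHom.bijOn_tensor hη ((LatHom.bijOn_id _ T).precomp e)
      ((LatHom.bijOn_id _ T).precomp f) (h T (hT.trans (inf_le_left.trans inf_le_left)))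
      (h' T (hT.trans (inf_le_left.trans inf_le_right)))
      (b := (unitBasis ((c * d).1 x)).reindex (Equiv.prodUnique Unit Unit).symm) ?_ ?_ hη
    · intro y hy v
      rw [h'' T (hT.trans inf_le_right) y hy v]
      simp
    · intro i j
      simp only [unitBasis_apply, Module.Basis.reindex_apply]
      rfl
  exact ⟨g⟩

/-- Linearly equivalent divisors have isomorphic sheaves; the isomorphism is the multiplication by the
rational function that realizes the equivalence. -/
lemma divSheaf_iso_of_linEquiv {c d : divisors X} (h : LinEquiv c d) :
    Nonempty (divSheaf c ≅ divSheaf d) := by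
  obtain ⟨h, H⟩ := h
  have key (x : X) (v : X.functionField) :
      h * v ∈ (divLattice d).carrier x ↔ v ∈ (divLattice c).carrier x := by
    rw [mem_divLattice, mem_divLattice, ← (H x).mem_iff (g := _ * v), ← mul_assoc, ← mul_assoc,
      ← Units.val_mul, ← Units.val_mul]
    congr! 3
    rw [div_eq_mul_inv, mul_right_comm h, mul_inv_cancel_right, mul_comm]
  let θ : LatHom (divSheaf c).val (divLattice d) :=
    { toFun := fun U hU ↦ (AddMonoidHom.mulLeft (h : X.functionField)).comp
        (latVal (divLattice c) U hU)
      map_smul := fun U hU r s ↦ mul_left_comm _ _ _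
      map_res := fun _ _ _ ↦ rfl
      mem := fun U x hx s ↦ (key x _).2 (latVal_mem _ s hx) }
  obtain ⟨e, -⟩ := θ.exists_iso' fun U x hx ↦ ⟨U, le_rfl, hx, fun hU ↦ by
    refine ⟨(mul_right_injective₀ h.ne_zero).comp (latVal_injective hU), fun v hv ↦ ?_⟩
    have e : (h : X.functionField) * ((h⁻¹ : X.functionFieldˣ) * v) = v := by
      rw [← mul_assoc, ← Units.val_mul, mul_inv_cancel, Units.val_one, one_mul]
    refine ⟨latMk (divLattice c) U ((h⁻¹ : X.functionFieldˣ) * v) fun x hx ↦ ?_, e⟩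
    rw [← key, e]
    exact hv x hx⟩
  exact ⟨e⟩

lemma divSheaf_one : Nonempty (structureModule X ≅ divSheaf (1 : divisors X)) := by
  have key (x : X) (v : X.functionField) :
      v ∈ (divLattice (1 : divisors X)).carrier x ↔ v ∈ reg x := by
    rw [mem_divLattice]
    change (((1 : X.functionFieldˣ)⁻¹ : X.functionFieldˣ) : X.functionField) * v ∈ reg x ↔ _
    rw [inv_one, Units.val_one, one_mul]
  let θ : LatHom (structureModule X).val (divLattice (1 : divisors X)) :=
    { toFun := fun U hU ↦ (gen U hU).toAddMonoidHom
      map_smul := fun U hU r s ↦ map_mul (gen U hU) _ _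
      map_res := fun i hW s ↦ gen_res i hW s
      mem := fun U x hx s ↦ (key x _).2 (gen_mem_reg hx s) }
  obtain ⟨e, -⟩ := θ.exists_iso' fun U x hx ↦ ⟨U, le_rfl, hx, fun hU ↦
    ⟨gen_injective U hU, fun v hv ↦
      exists_gen_of_forall_mem_reg hU fun x hx ↦ (key x v).1 (hv x hx)⟩⟩
  exact ⟨e⟩

lemma tensorPow_divSheaf {M : X.Modules} {c : divisors X} (e : M ≅ divSheaf c) (m : ℕ) :
    Nonempty (tensorPow M m ≅ divSheaf (c ^ m)) := by
  induction m with
  | zero => rw [pow_zero]; exact divSheaf_one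
  | succ m ih =>
    obtain ⟨f⟩ := ih
    rw [pow_succ]
    exact tensor_divSheaf f e

/-- The local equation at `x` is a local generator. -/
lemma exists_isGenerator_divSheaf (c : divisors X) (x : X) :
    ∃ (U : X.Opens) (g : Γ(divSheaf c, U)), x ∈ U ∧ IsGenerator (divSheaf c) U g := by
  obtain ⟨U, hx, h⟩ := exists_freeOn c x
  have hU := genericPoint_mem hx
  refine ⟨U, latMk _ U (c.1 x) fun y hy ↦ ?_, hx, fun W i ↦ ?_⟩
  · have := (h U le_rfl).basis_mem () y hy
    rwa [unitBasis_apply] at this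
  · by_cases hW : genericPoint X ∈ W
    · have e (r : Γ(X, W)) : latVal (divLattice c) W hW (r • (divSheaf c).presheaf.map i.op
          (latMk _ U (c.1 x) fun y hy ↦ by
            have := (h U le_rfl).basis_mem () y hy
            rwa [unitBasis_apply] at this)) = gen W hW r * c.1 x := rfl
      constructor
      · intro r s hrs
        have := congrArg (latVal (divLattice c) W hW) hrs
        simp only [e] at this
        exact gen_injective W hW (mul_right_cancel₀ (c.1 x).ne_zero this)
      · intro s
        have h1 : ∀ y ∈ W, ((c.1 x)⁻¹ : X.functionFieldˣ) * latVal (divLattice c) W hW s ∈ reg y :=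
          fun y hy ↦ by
            have := (h W i.le y hy _).1 (latVal_mem hW s hy) ()
            rwa [unitBasis_repr] at this
        obtain ⟨r, hr⟩ := exists_gen_of_forall_mem_reg hW h1
        refine ⟨r, latVal_injective hW ?_⟩
        refine (e r).trans ?_
        rw [hr, mul_right_comm, ← Units.val_mul, inv_mul_cancel, Units.val_one, one_mul]
    · have hW0 : W = ⊥ := by
        rw [eq_bot_iff]
        exact fun y hy ↦ (hW (genericPoint_mem hy)).elim
      subst hW0
      have : Subsingleton Γ(X, ⊥) := inferInstance
      have h2 : Subsingleton Γ(divSheaf c, (⊥ : X.Opens)) :=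
        ⟨fun s t ↦ Subtype.ext (funext fun x ↦ x.2.elim)⟩
      exact ⟨fun _ _ _ ↦ Subsingleton.elim _ _, fun s ↦ ⟨0, Subsingleton.elim _ _⟩⟩

lemma isInvertible_of_iso_divSheaf {M : X.Modules} {c : divisors X} (e : M ≅ divSheaf c) :
    IsInvertible M := fun x ↦ by
  obtain ⟨U, g, hx, hg⟩ := exists_isGenerator_divSheaf c x
  obtain ⟨f⟩ := hg.exists_iso
  exact ⟨U, hx, ⟨(Scheme.Modules.restrictFunctor U.ι).mapIso e ≪≫ f⟩⟩

end Divisor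

section Res
variable {X : Scheme.{u}}

/-- The restriction of a section to a smaller open subset. -/
abbrev res (M : X.Modules) {U W : X.Opens} (h : W ≤ U) (s : Γ(M, U)) : Γ(M, W) :=
  M.presheaf.map (homOfLE h).op s

lemma res_res (M : X.Modules) {U V W : X.Opens} (h : V ≤ U) (h' : W ≤ V) (s : Γ(M, U)) :
    res M h' (res M h s) = res M (h'.trans h) s := by
  rw [res, res, ← ConcreteCategory.comp_apply, ← Functor.map_comp]; rfl

lemma res_smul (M : X.Modules) {U W : X.Opens} (h : W ≤ U) (r : Γ(X, U)) (s : Γ(M, U)) :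
    res M h (r • s) = X.presheaf.map (homOfLE h).op r • res M h s :=
  Scheme.Modules.map_smul _ _ _ _

lemma res_add (M : X.Modules) {U W : X.Opens} (h : W ≤ U) (s t : Γ(M, U)) :
    res M h (s + t) = res M h s + res M h t :=
  map_add _ _ _

lemma IsGenerator.exists_coord {M : X.Modules} {U₀ : X.Opens} {g₀ : Γ(M, U₀)}
    (h₀ : IsGenerator M U₀ g₀) {U W : X.Opens} (s : Γ(M, U)) (h : W ≤ U) (h' : W ≤ U₀) :
    ∃ r : Γ(X, W), res M h s = r • res M h' g₀ := by
  obtain ⟨r, hr⟩ := (h₀ W (homOfLE h')).2 (res M h s)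
  exact ⟨r, hr.symm⟩

end Res

section ToDivisor
variable {X : Scheme.{u}} [IsIntegral X] {M : X.Modules} {U₀ : X.Opens} {g₀ : Γ(M, U₀)}
  (h₀ : IsGenerator M U₀ g₀) (hU₀ : genericPoint X ∈ U₀)

lemma genericPoint_mem_inf {U W : X.Opens} (hU : genericPoint X ∈ U) (hW : genericPoint X ∈ W) :
    genericPoint X ∈ U ⊓ W := ⟨hU, hW⟩

/-- The rational function `f` with `s = f g₀`, for a section `s` over a nonempty open set. -/
def coord (U : X.Opens) (hU : genericPoint X ∈ U) (s : Γ(M, U)) : X.functionField :=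
  gen (U ⊓ U₀) (genericPoint_mem_inf hU hU₀) (h₀.exists_coord s inf_le_left inf_le_right).choose

lemma coord_eq {U W : X.Opens} (hU : genericPoint X ∈ U) (s : Γ(M, U)) (h : W ≤ U) (h' : W ≤ U₀)
    (hW : genericPoint X ∈ W) (r : Γ(X, W)) (hr : res M h s = r • res M h' g₀) :
    coord h₀ hU₀ U hU s = gen W hW r := by
  have h1 := (h₀.exists_coord s inf_le_left inf_le_right).choose_spec
  rw [coord]
  set r' := (h₀.exists_coord s (inf_le_left : U ⊓ U₀ ≤ U) inf_le_right).choose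
  have h2 : X.presheaf.map (homOfLE (le_inf h h')).op r' = r := by
    refine (h₀ W (homOfLE h')).1 ?_
    change _ • res M h' g₀ = r • res M h' g₀
    rw [← hr, ← res_res M (inf_le_left : U ⊓ U₀ ≤ U) (le_inf h h'), h1, res_smul, res_res]
  rw [← h2, gen_res]

lemma coord_add (U : X.Opens) (hU : genericPoint X ∈ U) (s t : Γ(M, U)) :
    coord h₀ hU₀ U hU (s + t) = coord h₀ hU₀ U hU s + coord h₀ hU₀ U hU t := by
  obtain ⟨r, hr⟩ := h₀.exists_coord s (inf_le_left : U ⊓ U₀ ≤ U) inf_le_right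
  obtain ⟨r', hr'⟩ := h₀.exists_coord t (inf_le_left : U ⊓ U₀ ≤ U) inf_le_right
  rw [coord_eq h₀ hU₀ hU s inf_le_left inf_le_right (genericPoint_mem_inf hU hU₀) r hr,
    coord_eq h₀ hU₀ hU t inf_le_left inf_le_right (genericPoint_mem_inf hU hU₀) r' hr', ← map_add]
  refine coord_eq h₀ hU₀ hU _ inf_le_left inf_le_right (genericPoint_mem_inf hU hU₀) _ ?_
  rw [res_add, hr, hr', add_smul]

lemma coord_smul (U : X.Opens) (hU : genericPoint X ∈ U) (a : Γ(X, U)) (s : Γ(M, U)) :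
    coord h₀ hU₀ U hU (a • s) = gen U hU a * coord h₀ hU₀ U hU s := by
  obtain ⟨r, hr⟩ := h₀.exists_coord s (inf_le_left : U ⊓ U₀ ≤ U) inf_le_right
  rw [coord_eq h₀ hU₀ hU s inf_le_left inf_le_right (genericPoint_mem_inf hU hU₀) r hr,
    ← gen_res (homOfLE (inf_le_left : U ⊓ U₀ ≤ U)) (genericPoint_mem_inf hU hU₀) a, ← map_mul]
  refine coord_eq h₀ hU₀ hU _ inf_le_left inf_le_right (genericPoint_mem_inf hU hU₀) _ ?_
  rw [res_smul, hr, mul_smul]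

lemma coord_res {U W : X.Opens} (h : W ≤ U) (hW : genericPoint X ∈ W) (s : Γ(M, U)) :
    coord h₀ hU₀ W hW (res M h s) = coord h₀ hU₀ U (h hW) s := by
  obtain ⟨r, hr⟩ := h₀.exists_coord s (inf_le_left.trans h : W ⊓ U₀ ≤ U) inf_le_right
  rw [coord_eq h₀ hU₀ (h hW) s _ inf_le_right (genericPoint_mem_inf hW hU₀) r hr]
  refine coord_eq h₀ hU₀ hW _ inf_le_left inf_le_right (genericPoint_mem_inf hW hU₀) _ ?_
  rw [res_res, hr]

lemma coord_ne_zero {U : X.Opens} (hU : genericPoint X ∈ U) {g : Γ(M, U)}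
    (hg : IsGenerator M U g) : coord h₀ hU₀ U hU g ≠ 0 := by
  obtain ⟨r, hr⟩ := hg.exists_coord g₀ (inf_le_right : U ⊓ U₀ ≤ U₀) inf_le_left
  have h1 : coord h₀ hU₀ U₀ hU₀ g₀ = 1 := by
    rw [← map_one (gen U₀ hU₀)]
    exact coord_eq h₀ hU₀ hU₀ _ le_rfl le_rfl hU₀ _ (one_smul _ _).symm
  rw [← coord_res h₀ hU₀ (inf_le_right : U ⊓ U₀ ≤ U₀) (genericPoint_mem_inf hU hU₀), hr, coord_smul, coord_res] at h1
  exact right_ne_zero_of_mul_eq_one h1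

lemma coord_generator {U : X.Opens} (hU : genericPoint X ∈ U) {g : Γ(M, U)}
    (hg : IsGenerator M U g) {W : X.Opens} (hW : genericPoint X ∈ W) (s : Γ(M, W)) {x : X}
    (hx : x ∈ U) (hx' : x ∈ W) : (coord h₀ hU₀ U hU g)⁻¹ * coord h₀ hU₀ W hW s ∈ reg x := by
  obtain ⟨r, hr⟩ := hg.exists_coord s (inf_le_left : W ⊓ U ≤ W) inf_le_right
  rw [← coord_res h₀ hU₀ (inf_le_left : W ⊓ U ≤ W) (genericPoint_mem_inf hW hU), hr, coord_smul, coord_res,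
    mul_left_comm, inv_mul_cancel₀ (coord_ne_zero h₀ hU₀ hU hg), mul_one]
  exact gen_mem_reg (show x ∈ W ⊓ U from ⟨hx', hx⟩) r

/-- Every invertible module is isomorphic to `𝒪(c)` for a Cartier divisor `c`. -/
lemma exists_iso_divSheaf (hM : IsInvertible M) : ∃ c : divisors X, Nonempty (M ≅ divSheaf c) := by
  obtain ⟨U₀, g₀, hU₀, h₀⟩ := exists_isGenerator hM (genericPoint X)
  choose U g hx hg using exists_isGenerator hM
  have hη (x : X) := genericPoint_mem (hx x)
  -- The local equation at `x` is the coordinate of a local generator with respect to a generator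
  -- at the generic point.
  let c (x : X) : X.functionFieldˣ :=
    Units.mk0 (coord h₀ hU₀ (U x) (hη x) (g x)) (coord_ne_zero h₀ hU₀ (hη x) (hg x))
  have hc (x y : X) (hy : y ∈ U x) : c y / c x ∈ regUnits X y := by
    have h1 : ((c y)⁻¹ : X.functionFieldˣ) * (c x : X.functionField) ∈ reg y :=
      Units.val_inv_eq_inv_val (c y) ▸ coord_generator h₀ hU₀ (hη y) (hg y) (hη x) (g x) (hx y) hy
    have h2 : ((c x)⁻¹ : X.functionFieldˣ) * (c y : X.functionField) ∈ reg y :=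
      Units.val_inv_eq_inv_val (c x) ▸ coord_generator h₀ hU₀ (hη x) (hg x) (hη y) (g y) hy (hx y)
    refine ⟨Units.ne_zero _, ?_, ?_⟩
    · rwa [div_eq_inv_mul, Units.val_mul]
    · rwa [← Units.val_inv_eq_inv_val, inv_div, div_eq_inv_mul, Units.val_mul]
  let d : divisors X := ⟨c, fun x ↦ ⟨U x, hx x, fun y hy ↦ hc x y hy⟩⟩
  let θ : LatHom M.val (divLattice d) :=
    { toFun := fun W hW ↦ AddMonoidHom.mk' (fun s ↦ coord h₀ hU₀ W hW s) (coord_add h₀ hU₀ W hW)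
      map_smul := fun W hW r s ↦ coord_smul h₀ hU₀ W hW r s
      map_res := fun i hW s ↦ coord_res h₀ hU₀ i.le hW s
      mem := fun W x hxW s ↦ by
        rw [mem_divLattice, Units.val_inv_eq_inv_val]
        exact coord_generator h₀ hU₀ (hη x) (hg x) (genericPoint_mem hxW) s (hx x) hxW }
  refine ⟨d, ?_⟩
  obtain ⟨e, -⟩ := θ.exists_iso' fun W x hxW ↦ ⟨W ⊓ U x, inf_le_left, ⟨hxW, hx x⟩, fun hW ↦ by
    have key (r : Γ(X, W ⊓ U x)) : coord h₀ hU₀ (W ⊓ U x) hW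
        (r • res M (inf_le_right : W ⊓ U x ≤ U x) (g x)) = gen _ hW r * c x := by
      rw [coord_smul, coord_res]; rfl
    constructor
    · intro s t hst
      obtain ⟨r, rfl⟩ := (hg x _ (homOfLE (inf_le_right : W ⊓ U x ≤ U x))).2 s
      obtain ⟨r', rfl⟩ := (hg x _ (homOfLE (inf_le_right : W ⊓ U x ≤ U x))).2 t
      have h1 := (key r).symm.trans (Eq.trans hst (key r'))
      rw [gen_injective _ hW (mul_right_cancel₀ (c x).ne_zero h1)]
    · intro v hv
      have h1 : ∀ y ∈ W ⊓ U x, ((c x)⁻¹ : X.functionFieldˣ) * v ∈ reg y := fun y hy ↦ by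
        have h2 := hv y hy
        rw [mem_divLattice] at h2
        rw [← (hc x y hy.2).mem_iff] at h2
        convert h2 using 1
        change _ = ((c y / c x : X.functionFieldˣ) : X.functionField) *
          (((c y)⁻¹ : X.functionFieldˣ) * v)
        rw [← mul_assoc, ← Units.val_mul, div_eq_mul_inv, mul_right_comm, mul_inv_cancel, one_mul]
      obtain ⟨r, hr⟩ := exists_gen_of_forall_mem_reg hW h1
      refine ⟨r • res M inf_le_right (g x), (key r).trans ?_⟩
      rw [hr, mul_right_comm, ← Units.val_mul, inv_mul_cancel, Units.val_one, one_mul]⟩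
  exact ⟨e⟩

end ToDivisor

/-! ### Inverse images of divisors -/

section Pullback
variable {X Y : Scheme.{u}}

/-- Every open set is contained in the inverse image of the whole space. This makes the inverse
image of the structure sheaf the structure sheaf. -/
instance (f : Y ⟶ X) : (TopologicalSpace.Opens.map f.base).Final where
  out U := by
    let t : StructuredArrow U (TopologicalSpace.Opens.map f.base) :=
      StructuredArrow.mk (Y := ⊤) (homOfLE (by exact fun _ _ ↦ trivial))
    have : Nonempty (StructuredArrow U (TopologicalSpace.Opens.map f.base)) := ⟨t⟩
    refine zigzag_isConnected fun a b ↦ ?_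
    have h (a : StructuredArrow U (TopologicalSpace.Opens.map f.base)) : Zag a t :=
      Or.inl ⟨StructuredArrow.homMk (homOfLE le_top) rfl⟩
    exact (Zigzag.of_zag (h a)).trans (Zigzag.of_zag (h b).symm)

/-- Inverse images preserve the structure sheaf. -/
lemma pullback_structureModule (f : Y ⟶ X) :
    Nonempty ((Scheme.Modules.pullback f).obj (structureModule X) ≅ structureModule Y) :=
  have : (SheafOfModules.pushforward.{u} f.toRingCatSheafHom).IsRightAdjoint :=
    inferInstanceAs (Scheme.Modules.pushforward f).IsRightAdjoint
  have h := SheafOfModules.instIsIsoPullbackObjUnitToUnitOfFinal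
    (F := TopologicalSpace.Opens.map f.base) (S := X.ringCatSheaf) (R := Y.ringCatSheaf)
    f.toRingCatSheafHom
  ⟨@asIso _ _ _ _ _ h⟩

/-- Inverse images preserve invertible modules. -/
lemma IsInvertible.pullback (f : Y ⟶ X) {M : X.Modules} (hM : IsInvertible M) :
    IsInvertible ((Scheme.Modules.pullback f).obj M) := by
  intro y
  obtain ⟨U, hU, ⟨φ⟩⟩ := hM (f y)
  refine ⟨f ⁻¹ᵁ U, hU, ?_⟩
  obtain ⟨ψ⟩ := pullback_structureModule (f ∣_ U)
  have e : (f ⁻¹ᵁ U).ι ≫ f = f ∣_ U ≫ U.ι := (morphismRestrict_ι f U).symm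
  exact ⟨(Scheme.Modules.restrictFunctorIsoPullback (f ⁻¹ᵁ U).ι).app _ ≪≫
    (Scheme.Modules.pullbackComp (f ⁻¹ᵁ U).ι f).app M ≪≫
    (Scheme.Modules.pullbackCongr e).app M ≪≫
    ((Scheme.Modules.pullbackComp (f ∣_ U) U.ι).app M).symm ≪≫
    (Scheme.Modules.pullback (f ∣_ U)).mapIso
      ((Scheme.Modules.restrictFunctorIsoPullback U.ι).symm.app M ≪≫ φ) ≪≫ ψ⟩

variable [IsIntegral X] [IsIntegral Y] (f : Y ⟶ X) [IsDominant f]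

lemma map_genericPoint : f (genericPoint Y) = genericPoint X := by
  have h := (genericPoint_spec Y).image f.continuous
  rw [Set.image_univ, f.denseRange.closure_range] at h
  exact h.eq (genericPoint_spec X)

/-- The homomorphism of function fields induced by a dominant morphism. -/
def funMap : X.functionField →+* Y.functionField :=
  (X.presheaf.stalkSpecializes (specializes_of_eq (map_genericPoint f)) ≫
    f.stalkMap (genericPoint Y)).hom

lemma genericPoint_mem_preimage {U : X.Opens} (hU : genericPoint X ∈ U) :
    genericPoint Y ∈ f ⁻¹ᵁ U := by
  change f (genericPoint Y) ∈ U
  rwa [map_genericPoint f]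

lemma funMap_gen (U : X.Opens) (hU : genericPoint X ∈ U) (r : Γ(X, U)) :
    funMap f (gen U hU r) = gen (f ⁻¹ᵁ U) (genericPoint_mem_preimage f hU) (f.app U r) := by
  have h : X.presheaf.germ U _ hU ≫ X.presheaf.stalkSpecializes
      (specializes_of_eq (map_genericPoint f)) ≫ f.stalkMap (genericPoint Y) =
      f.app U ≫ Y.presheaf.germ (f ⁻¹ᵁ U) _ (genericPoint_mem_preimage f hU) := by
    rw [TopCat.Presheaf.germ_stalkSpecializes_assoc, Scheme.Hom.germ_stalkMap]
  exact ConcreteCategory.congr_hom h r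

lemma funMap_mem_reg {y : Y} {a : X.functionField} (ha : a ∈ reg (f y)) : funMap f a ∈ reg y := by
  obtain ⟨U, hU, r, rfl⟩ := exists_gen_of_mem_reg ha
  rw [funMap_gen]
  exact gen_mem_reg (show y ∈ f ⁻¹ᵁ U from hU) _

/-- If the image of a function that is regular at `f y` is a unit at `y`, then the function is a
unit at `f y`. -/
lemma isRegUnit_of_funMap {y : Y} {a : X.functionField} (ha : a ∈ reg (f y))
    (h : IsRegUnit y (funMap f a)) : IsRegUnit (f y) a := by
  obtain ⟨U, hU, r, rfl⟩ := exists_gen_of_mem_reg ha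
  have hy : y ∈ f ⁻¹ᵁ U := hU
  rw [funMap_gen, ← algebraMap_germ y hy] at h
  obtain ⟨h0, -, ⟨s, hs⟩⟩ := h
  have h1 : IsUnit (Y.presheaf.germ (f ⁻¹ᵁ U) y hy (f.app U r)) := by
    refine IsUnit.of_mul_eq_one s (stalk_injective y ?_)
    rw [map_mul, hs, mul_inv_cancel₀ h0, map_one]
  have h2 : f.stalkMap y (X.presheaf.germ U (f y) hU r) =
      Y.presheaf.germ (f ⁻¹ᵁ U) y hy (f.app U r) := Scheme.Hom.germ_stalkMap_apply f U y hU r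
  rw [← h2] at h1
  have h3 : IsUnit (X.presheaf.germ U (f y) hU r) := isUnit_of_map_unit (f.stalkMap y).hom _ h1
  rw [← algebraMap_germ (f y) hU]
  exact isRegUnit_algebraMap h3

/-- The homomorphism of function fields on units. -/
def funMapUnits : X.functionFieldˣ →* Y.functionFieldˣ := Units.map (funMap f).toMonoidHom

lemma funMapUnits_mem {y : Y} {a : X.functionFieldˣ} (ha : a ∈ regUnits X (f y)) :
    funMapUnits f a ∈ regUnits Y y := by
  obtain ⟨-, h1, h2⟩ := ha
  refine ⟨Units.ne_zero _, funMap_mem_reg f h1, ?_⟩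
  have := funMap_mem_reg f h2
  rwa [map_inv₀] at this

/-- The inverse image of Cartier divisors under a dominant morphism. -/
def pullDiv : divisors X →* divisors Y where
  toFun c := ⟨fun y ↦ funMapUnits f (c.1 (f y)), fun y ↦ by
    obtain ⟨U, hU, h⟩ := c.2 (f y)
    refine ⟨f ⁻¹ᵁ U, hU, fun z hz ↦ ?_⟩
    rw [← map_div]
    exact funMapUnits_mem f (h (f z) hz)⟩
  map_one' := Subtype.ext (funext fun _ ↦ map_one _)
  map_mul' c d := Subtype.ext (funext fun _ ↦ map_mul _ _ _)

lemma pullDiv_apply (c : divisors X) (y : Y) : (pullDiv f c).1 y = funMapUnits f (c.1 (f y)) := rfl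

lemma LinEquiv.pullDiv {c d : divisors X} (h : LinEquiv c d) :
    LinEquiv (pullDiv f c) (pullDiv f d) := by
  obtain ⟨h, H⟩ := h
  refine ⟨funMapUnits f h, fun y ↦ ?_⟩
  rw [pullDiv_apply, pullDiv_apply, ← map_mul, ← map_div]
  exact funMapUnits_mem f (H (f y))

/-- A morphism between sheaves of divisors is the multiplication by a rational function. -/
lemma exists_mul_of_hom {c d : divisors X} (ψ : divSheaf c ⟶ divSheaf d) :
    ∃ h : X.functionField, ∀ (U : X.Opens) (hU : genericPoint X ∈ U) (s : Γ(divSheaf c, U)),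
      latVal (divLattice d) U hU (ψ.app U s) = h * latVal (divLattice c) U hU s := by
  obtain ⟨U₀, g₀, hU₀, h₀⟩ := exists_isGenerator_divSheaf c (genericPoint X)
  have e1 {U : X.Opens} (hU : genericPoint X ∈ U) (s : Γ(divSheaf c, U)) :
      ∃ r : X.functionField, latVal (divLattice c) U hU s = r * latVal (divLattice c) U₀ hU₀ g₀ ∧
        latVal (divLattice d) U hU (ψ.app U s) = r * latVal (divLattice d) U₀ hU₀ (ψ.app U₀ g₀) := by
    obtain ⟨r, hr⟩ := h₀.exists_coord s (inf_le_left : U ⊓ U₀ ≤ U) inf_le_right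
    have hη := genericPoint_mem_inf hU hU₀
    refine ⟨gen _ hη r, congrArg (latVal (divLattice c) _ hη) hr, ?_⟩
    have h2 : res (divSheaf d) (inf_le_left : U ⊓ U₀ ≤ U) (ψ.app U s) =
        r • res (divSheaf d) (inf_le_right : U ⊓ U₀ ≤ U₀) (ψ.app U₀ g₀) := by
      refine (NatTrans.naturality_apply ψ.mapPresheaf _ s).symm.trans ?_
      refine (congrArg (ψ.app _) hr).trans ((ψ.app_smul r _).trans ?_)
      exact congrArg (r • ·) (NatTrans.naturality_apply ψ.mapPresheaf _ g₀)
    exact congrArg (latVal (divLattice d) _ hη) h2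
  by_cases h0 : latVal (divLattice c) U₀ hU₀ g₀ = 0
  · refine ⟨0, fun U hU s ↦ ?_⟩
    obtain ⟨r, h1, h2⟩ := e1 hU s
    have h3 : g₀ = 0 := latVal_injective hU₀ (h0.trans (map_zero _).symm)
    have h4 : latVal (divLattice d) U₀ hU₀ (ψ.app U₀ g₀) = 0 := by
      rw [h3]
      exact (congrArg _ (map_zero (ψ.app U₀).hom)).trans (map_zero _)
    rw [h2, h4, mul_zero, zero_mul]
  · refine ⟨latVal (divLattice d) U₀ hU₀ (ψ.app U₀ g₀) / latVal (divLattice c) U₀ hU₀ g₀,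
      fun U hU s ↦ ?_⟩
    obtain ⟨r, h1, h2⟩ := e1 hU s
    rw [h1, h2]
    field_simp

/-- The inverse image of `𝒪(c)` under a dominant morphism is given by the inverse image of the
divisor. -/
lemma pullback_divSheaf (c : divisors X) :
    Nonempty ((Scheme.Modules.pullback f).obj (divSheaf c) ≅ divSheaf (pullDiv f c)) := by
  -- The inverse image is the sheaf of some divisor `c'`.
  obtain ⟨c', ⟨e⟩⟩ := exists_iso_divSheaf
    ((isInvertible_of_iso_divSheaf (Iso.refl (divSheaf c))).pullback f)
  have hmem {y : Y} {v : X.functionField} (hv : v ∈ (divLattice c).carrier (f y)) :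
      funMap f v ∈ (divLattice (pullDiv f c)).carrier y := by
    rw [mem_divLattice] at hv ⊢
    have := funMap_mem_reg f hv
    rwa [map_mul] at this
  -- The morphism that applies the map of function fields to the values of sections.
  let u : divSheaf c ⟶ (Scheme.Modules.pushforward f).obj (divSheaf (pullDiv f c)) :=
    ⟨PresheafOfModules.homMk
      { app := fun U ↦ AddCommGrpCat.ofHom
          { toFun := fun (s : Γ(divSheaf c, U.unop)) ↦
              (⟨fun y ↦ funMap f (s.1 ⟨f y.1, y.2⟩), (fun y ↦
                ⟨hmem ((show IsLatSec _ _ s.1 from s.2) ⟨f y.1, y.2⟩).1, fun z ↦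
                  congrArg (funMap f) (((show IsLatSec _ _ s.1 from s.2) ⟨f y.1, y.2⟩).2 _)⟩ :
                IsLatSec (divLattice (pullDiv f c)) (f ⁻¹ᵁ U.unop) _)⟩ :
                Γ(divSheaf (pullDiv f c), f ⁻¹ᵁ U.unop))
            map_zero' := Subtype.ext (funext fun _ ↦ map_zero _)
            map_add' := fun _ _ ↦ Subtype.ext (funext fun _ ↦ map_add _ _ _) }
        naturality := fun U W i ↦ rfl }
      (fun U r s ↦ Subtype.ext (funext fun y ↦ by
        refine (map_mul (funMap f) _ _).trans ?_
        exact congrArg (· * funMap f (s.1 ⟨f y.1, y.2⟩))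
          (funMap_gen f U.unop (genericPoint_mem (show f y.1 ∈ U.unop from y.2)) r)))⟩
  have hu (U : X.Opens) (hU : genericPoint X ∈ U) (s : Γ(divSheaf c, U)) :
      latVal (divLattice (pullDiv f c)) (f ⁻¹ᵁ U) (genericPoint_mem_preimage f hU) (u.app U s) =
        funMap f (latVal (divLattice c) U hU s) := by
    have := ((show IsLatSec _ _ s.1 from s.2) ⟨f (genericPoint Y),
      genericPoint_mem_preimage f hU⟩).2 ⟨_, hU⟩
    exact congrArg (funMap f) this
  let φ := ((Scheme.Modules.pullbackPushforwardAdjunction f).homEquiv _ _).symm u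
  have hφ : (Scheme.Modules.pullbackPushforwardAdjunction f).unit.app _ ≫
      (Scheme.Modules.pushforward f).map φ = u := by
    have := (Scheme.Modules.pullbackPushforwardAdjunction f).homEquiv_unit
      (f := φ)
    rw [← this]
    exact Equiv.apply_symm_apply _ _
  -- Its adjoint is the multiplication by a function `h`. It maps into the lattice of `pullDiv f c`,
  -- and it hits the local equations there, so that it is an isomorphism.
  obtain ⟨h, hh⟩ := exists_mul_of_hom (e.inv ≫ φ)
  have key (y : Y) : ∃ v ∈ (divLattice c').carrier y, funMap f (c.1 (f y)) = h * v := by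
    obtain ⟨U, hx, H⟩ := exists_freeOn c (f y)
    have hU := genericPoint_mem hx
    let s : Γ(divSheaf c, U) := latMk _ U (c.1 (f y)) fun z hz ↦ by
      have := (H U le_rfl).basis_mem () z hz
      rwa [unitBasis_apply] at this
    let t : Γ((Scheme.Modules.pullback f).obj (divSheaf c), f ⁻¹ᵁ U) :=
      ((Scheme.Modules.pullbackPushforwardAdjunction f).unit.app (divSheaf c)).app U s
    have ht : φ.app (f ⁻¹ᵁ U) t = u.app U s :=
      congrArg (fun g : divSheaf c ⟶ _ ↦ g.app U s) hφ
    have hη := genericPoint_mem_preimage f hU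
    refine ⟨latVal (divLattice c') (f ⁻¹ᵁ U) hη (e.hom.app _ t),
      latVal_mem hη _ (show y ∈ f ⁻¹ᵁ U from hx), ?_⟩
    rw [← hh]
    have h3 : (e.inv ≫ φ).app (f ⁻¹ᵁ U) (e.hom.app _ t) = φ.app _ t :=
      congrArg (fun g : _ ⟶ divSheaf (pullDiv f c) ↦ g.app (f ⁻¹ᵁ U) t)
        (e.hom_inv_id_assoc φ)
    rw [h3, ht, hu U hU]
    rfl
  have h0 : h ≠ 0 := by
    rintro rfl
    obtain ⟨v, -, hv⟩ := key (genericPoint Y)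
    rw [zero_mul] at hv
    exact (funMapUnits f (c.1 (f (genericPoint Y)))).ne_zero hv
  obtain ⟨i⟩ := divSheaf_iso_of_linEquiv (c := c') (d := pullDiv f c)
    ⟨Units.mk0 h h0, fun y ↦ by
      obtain ⟨v, hv, hv'⟩ := key y
      refine ⟨Units.ne_zero _, ?_, ?_⟩
      · obtain ⟨U, hx, H⟩ := exists_freeOn c' y
        let s : Γ(divSheaf c', U) := latMk _ U (c'.1 y) fun z hz ↦ by
          have := (H U le_rfl).basis_mem () z hz
          rwa [unitBasis_apply] at this
        have h4 := latVal_mem (genericPoint_mem hx) ((e.inv ≫ φ).app U s) hx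
        rw [hh, mem_divLattice] at h4
        rw [div_eq_inv_mul, Units.val_mul, Units.val_mul]
        exact h4
      · rw [← Units.val_inv_eq_inv_val, inv_div, div_eq_mul_inv, mul_inv, Units.val_mul,
          Units.val_mul]
        change funMap f (c.1 (f y)) * _ ∈ reg y
        rw [hv', mem_divLattice] at *
        convert hv using 1
        have : (h * v) * (((Units.mk0 h h0)⁻¹ : Y.functionFieldˣ) *
            ((c'.1 y)⁻¹ : Y.functionFieldˣ) : Y.functionField) =
            (h * ((Units.mk0 h h0)⁻¹ : Y.functionFieldˣ)) *
              (((c'.1 y)⁻¹ : Y.functionFieldˣ) * v) := by ring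
        rw [this, Units.val_inv_eq_inv_val, Units.val_mk0, mul_inv_cancel₀ h0, one_mul]⟩
  exact ⟨e ≪≫ i⟩

end Pullback

/-! ### Representations of the algebra and splittings -/

section Split

/-- The hypotheses on `D` used throughout: it has dimension `n²` over `k` with `n > 0`, and it becomes
a matrix algebra over an algebraic closure of `k`. -/
structure IsCSA (k D : Type u) [Field k] [DivisionRing D] [Algebra k D] (n : ℕ) : Prop where
  pos : 0 < n
  finrank : Module.finrank k D = n ^ 2
  split : IsSplittingField k D n (AlgebraicClosure k)

variable {k D : Type u} [Field k] [DivisionRing D] [Algebra k D] {n : ℕ}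
  {R : Type*} [CommRing R] [Algebra k R] {S : Type*} [CommRing S] [Algebra k S]

/-- The `R`-linear extension `R ⊗ D → M_n(R)` of an `n`-dimensional representation of `D`. -/
def liftHom (ψ : D →ₐ[k] Matrix (Fin n) (Fin n) R) : R ⊗[k] D →ₐ[R] Matrix (Fin n) (Fin n) R :=
  Algebra.TensorProduct.lift (Algebra.ofId R _) ψ fun r d ↦ Algebra.commutes r (ψ d)

lemma liftHom_tmul (ψ : D →ₐ[k] Matrix (Fin n) (Fin n) R) (r : R) (d : D) :
    liftHom ψ (r ⊗ₜ d) = r • ψ d := by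
  rw [Algebra.smul_def]
  exact Algebra.TensorProduct.lift_tmul _ _ _ _ _

/-- Extension of scalars of a representation. -/
def mapRep (f : R →ₐ[k] S) (ψ : D →ₐ[k] Matrix (Fin n) (Fin n) R) :
    D →ₐ[k] Matrix (Fin n) (Fin n) S := f.mapMatrix.comp ψ

lemma mapRep_apply (f : R →ₐ[k] S) (ψ : D →ₐ[k] Matrix (Fin n) (Fin n) R) (d : D) (i j : Fin n) :
    mapRep f ψ d i j = f (ψ d i j) := rfl

/-- Extension of scalars `R ⊗ D → S ⊗ D`. -/
abbrev extD (D : Type u) [DivisionRing D] [Algebra k D] (f : R →ₐ[k] S) :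
    R ⊗[k] D →ₐ[k] S ⊗[k] D :=
  Algebra.TensorProduct.map f (AlgHom.id k D)

lemma liftHom_extD (f : R →ₐ[k] S) (ψ : D →ₐ[k] Matrix (Fin n) (Fin n) R) (z : R ⊗[k] D)
    (i j : Fin n) : liftHom (mapRep f ψ) (extD D f z) i j = f (liftHom ψ z i j) := by
  induction z using TensorProduct.induction_on with
  | zero => simp
  | tmul r d => simp [liftHom_tmul, mapRep_apply]
  | add x y hx hy => simp [hx, hy]

section Basis
variable (b : Module.Basis (Fin n × Fin n) k D)

/-- The matrix of a representation with respect to a basis of `D` and the matrix units. -/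
def coordMatrix (ψ : D →ₐ[k] Matrix (Fin n) (Fin n) R) : Matrix (Fin n × Fin n) (Fin n × Fin n) R :=
  Matrix.of fun p i ↦ ψ (b i) p.1 p.2

lemma toMatrix_liftHom (ψ : D →ₐ[k] Matrix (Fin n) (Fin n) R) :
    LinearMap.toMatrix (Algebra.TensorProduct.basis R b) (Matrix.stdBasis R (Fin n) (Fin n))
      (liftHom ψ).toLinearMap = coordMatrix b ψ := by
  ext p i
  rw [LinearMap.toMatrix_apply]
  have h (M : Matrix (Fin n) (Fin n) R) (p : Fin n × Fin n) :
      (Matrix.stdBasis R (Fin n) (Fin n)).repr M p = M p.1 p.2 := by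
    rw [Matrix.stdBasis]
    simp [Matrix.ofLinearEquiv]
  simp [h, liftHom_tmul, coordMatrix]

lemma bijective_liftHom_iff (ψ : D →ₐ[k] Matrix (Fin n) (Fin n) R) :
    Function.Bijective (liftHom ψ) ↔ IsUnit (coordMatrix b ψ).det := by
  rw [← toMatrix_liftHom]
  constructor
  · intro h
    exact (LinearEquiv.isUnit_det (LinearEquiv.ofBijective (liftHom ψ).toLinearMap h)
      (Algebra.TensorProduct.basis R b) (Matrix.stdBasis R (Fin n) (Fin n)))
  · intro h
    have := (LinearEquiv.ofIsUnitDet (f := (liftHom ψ).toLinearMap) h).bijective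
    exact this

lemma det_coordMatrix_mapRep (f : R →ₐ[k] S) (ψ : D →ₐ[k] Matrix (Fin n) (Fin n) R) :
    (coordMatrix b (mapRep f ψ)).det = f (coordMatrix b ψ).det := by
  rw [← AlgHom.coe_toRingHom, RingHom.map_det]
  rfl

end Basis

lemma IsCSA.exists_basis (hc : IsCSA k D n) : Nonempty (Module.Basis (Fin n × Fin n) k D) := by
  have : Module.Finite k D := Module.finite_of_finrank_pos (by rw [hc.finrank]; exact pow_pos hc.pos 2)
  have b := Module.finBasisOfFinrankEq k D hc.finrank
  exact ⟨b.reindex ((finCongr (sq n)).trans finProdFinEquiv.symm)⟩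

/-- Over a field a representation of rank `n` is a splitting: over an algebraically closed field the
extension of `D` is a matrix algebra, hence simple, of the same dimension as the target. -/
lemma bijective_liftHom_field (hc : IsCSA k D n) {K : Type*} [Field K] [Algebra k K]
    (ψ : D →ₐ[k] Matrix (Fin n) (Fin n) K) : Function.Bijective (liftHom ψ) := by
  obtain ⟨b⟩ := hc.exists_basis
  have : NeZero n := ⟨hc.pos.ne'⟩
  have : Module.Finite k D := Module.finite_of_finrank_pos (by rw [hc.finrank]; exact pow_pos hc.pos 2)
  let Ω := AlgebraicClosure K
  let f : K →ₐ[k] Ω := IsScalarTower.toAlgHom k K Ω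
  let j : AlgebraicClosure k →ₐ[k] Ω := IsAlgClosed.lift
  obtain ⟨φ⟩ := hc.split
  let ψ₀ : D →ₐ[k] Matrix (Fin n) (Fin n) (AlgebraicClosure k) :=
    (φ.toAlgHom.restrictScalars k).comp Algebra.TensorProduct.includeRight
  have h₀ : liftHom ψ₀ = φ.toAlgHom := by
    refine AlgHom.ext fun z ↦ ?_
    induction z using TensorProduct.induction_on with
    | zero => simp
    | tmul r d =>
      rw [liftHom_tmul]
      change r • φ (1 ⊗ₜ d) = φ (r ⊗ₜ d)
      rw [← map_smul, TensorProduct.smul_tmul', smul_eq_mul, mul_one]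
    | add x y hx hy => rw [map_add, map_add, hx, hy]
  have h₁ : IsUnit (coordMatrix b ψ₀).det := by
    rw [← bijective_liftHom_iff, h₀]
    exact φ.bijective
  have h₂ : Function.Bijective (liftHom (mapRep j ψ₀)) := by
    rw [bijective_liftHom_iff b, det_coordMatrix_mapRep]
    exact h₁.map j
  let e : (Ω ⊗[k] D) ≃ₐ[Ω] Matrix (Fin n) (Fin n) Ω := AlgEquiv.ofBijective _ h₂
  have h₃ : Function.Bijective (liftHom (mapRep f ψ)) := by
    have hi : Function.Injective ((liftHom (mapRep f ψ)).comp e.symm.toAlgHom) :=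
      RingHom.injective ((liftHom (mapRep f ψ)).comp e.symm.toAlgHom).toRingHom
    have hb := (LinearMap.injective_iff_surjective
      (f := ((liftHom (mapRep f ψ)).comp e.symm.toAlgHom).toLinearMap)).1 hi
    have := (show Function.Bijective ((liftHom (mapRep f ψ)).comp e.symm.toAlgHom) from
      ⟨hi, hb⟩).comp e.bijective
    convert this using 1
    ext1 z
    simp
  rw [bijective_liftHom_iff b, det_coordMatrix_mapRep] at h₃
  rw [bijective_liftHom_iff b]
  exact (isUnit_map_iff f _).1 h₃

/-- An `n`-dimensional representation of `D` over a commutative ring `R` splits `R ⊗ D`: the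
determinant of `R ⊗ D → M_n(R)` is a unit, since it is nonzero in the residue fields of `R` by the
simplicity of matrix algebras. -/
lemma bijective_liftHom (hc : IsCSA k D n) (ψ : D →ₐ[k] Matrix (Fin n) (Fin n) R) :
    Function.Bijective (liftHom ψ) := by
  obtain ⟨b⟩ := hc.exists_basis
  rw [bijective_liftHom_iff b]
  by_contra h
  obtain ⟨m, hm, hmem⟩ := exists_max_ideal_of_mem_nonunits h
  let _ := Ideal.Quotient.field m
  have h1 := (bijective_liftHom_iff b _).1
    (bijective_liftHom_field hc (mapRep (Ideal.Quotient.mkₐ k m) ψ))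
  rw [det_coordMatrix_mapRep] at h1
  refine h1.ne_zero ?_
  exact Ideal.Quotient.eq_zero_iff_mem.2 hmem

/-- The isomorphism `R ⊗ D ≅ M_n(R)` given by an `n`-dimensional representation of `D`. -/
def splitEquiv (hc : IsCSA k D n) (ψ : D →ₐ[k] Matrix (Fin n) (Fin n) R) :
    (R ⊗[k] D) ≃ₐ[R] Matrix (Fin n) (Fin n) R :=
  AlgEquiv.ofBijective _ (bijective_liftHom hc ψ)

lemma splitEquiv_apply (hc : IsCSA k D n) (ψ : D →ₐ[k] Matrix (Fin n) (Fin n) R) (z : R ⊗[k] D) :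
    splitEquiv hc ψ z = liftHom ψ z := rfl

lemma liftHom_splitEquiv_symm (hc : IsCSA k D n) (ψ : D →ₐ[k] Matrix (Fin n) (Fin n) R)
    (M : Matrix (Fin n) (Fin n) R) : liftHom ψ ((splitEquiv hc ψ).symm M) = M :=
  (splitEquiv hc ψ).apply_symm_apply M

end Split

/-! ### Left ideals of rank `n` -/

section Row
variable {n : ℕ} {R : Type*} [CommRing R]

/-- The matrices of the form `v w`, with `v` a column, for a fixed row `w`. -/
def rowIdeal (w : Fin n → R) : Submodule R (Matrix (Fin n) (Fin n) R) where
  carrier := {M | ∃ v, M = Matrix.vecMulVec v w}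
  zero_mem' := ⟨0, by ext; simp [Matrix.vecMulVec_apply]⟩
  add_mem' := by
    rintro _ _ ⟨v, rfl⟩ ⟨v', rfl⟩
    exact ⟨v + v', by ext; simp [Matrix.vecMulVec_apply, add_mul]⟩
  smul_mem' := by
    rintro r _ ⟨v, rfl⟩
    exact ⟨r • v, by ext; simp [Matrix.vecMulVec_apply, mul_assoc]⟩

lemma mul_mem_rowIdeal {w : Fin n → R} (A : Matrix (Fin n) (Fin n) R)
    {M : Matrix (Fin n) (Fin n) R} (hM : M ∈ rowIdeal w) : A * M ∈ rowIdeal w := by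
  obtain ⟨v, rfl⟩ := hM
  exact ⟨A.mulVec v, Matrix.mul_vecMulVec _ _ _⟩

/-- Subtracting multiples of column `j`: the kernel of this map consists of the `v w` if `w_j` is
the unit `u`. -/
def rowQuot (w : Fin n → R) (j : Fin n) (u : Rˣ) :
    Matrix (Fin n) (Fin n) R →ₗ[R] (Fin n × {c : Fin n // c ≠ j} → R) where
  toFun M p := M p.1 p.2 - M p.1 j * ↑u⁻¹ * w p.2
  map_add' M N := by ext p; simp; ring
  map_smul' r M := by ext p; simp; ring

lemma rowQuot_surjective (w : Fin n → R) (j : Fin n) (u : Rˣ) :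
    Function.Surjective (rowQuot w j u) := by
  intro f
  refine ⟨Matrix.of fun a c ↦ if h : c = j then 0 else f (a, ⟨c, h⟩), ?_⟩
  ext p
  simp [rowQuot, p.2.2]

/-- The ideal of the matrices `v w` is the kernel of an explicit map onto a free module, because the
`j`-th column of such a matrix determines it when `w j` is invertible. -/
lemma ker_rowQuot {w : Fin n → R} {j : Fin n} {u : Rˣ} (hu : (u : R) = w j) :
    LinearMap.ker (rowQuot w j u) = rowIdeal w := by
  ext M
  rw [LinearMap.mem_ker]
  constructor
  · intro h
    refine ⟨fun a ↦ M a j * ↑u⁻¹, ?_⟩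
    ext a c
    rw [Matrix.vecMulVec_apply]
    by_cases hcj : c = j
    · subst hcj
      rw [← hu, mul_assoc, Units.inv_mul, mul_one]
    · exact sub_eq_zero.1 (congrFun h (a, ⟨c, hcj⟩))
  · rintro ⟨v, rfl⟩
    ext p
    simp only [rowQuot, LinearMap.coe_mk, AddHom.coe_mk, Matrix.vecMulVec_apply, ← hu,
      Units.mul_inv_cancel_right, Pi.zero_apply, sub_self]

end Row

section Ideal
variable {k D : Type u} [Field k] [DivisionRing D] [Algebra k D] {n : ℕ}
  {R S : Type u} [CommRing R] [Algebra k R] [CommRing S] [Algebra k S]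

/-- The left ideal of `R ⊗ D` that corresponds to the matrices `v w` in `M_n(R)`. -/
def rowSubmodule (ψ : D →ₐ[k] Matrix (Fin n) (Fin n) R) (w : Fin n → R) :
    Submodule R (R ⊗[k] D) := (rowIdeal w).comap (liftHom ψ).toLinearMap

lemma mem_rowSubmodule {ψ : D →ₐ[k] Matrix (Fin n) (Fin n) R} {w : Fin n → R} {z : R ⊗[k] D} :
    z ∈ rowSubmodule ψ w ↔ ∃ v, liftHom ψ z = Matrix.vecMulVec v w := Iff.rfl

/-- The quotient by the ideal of the matrices `v w` is free if `w` has an invertible entry. -/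
def rowQuotEquiv (hc : IsCSA k D n) (ψ : D →ₐ[k] Matrix (Fin n) (Fin n) R) {w : Fin n → R}
    {j : Fin n} {u : Rˣ} (hu : (u : R) = w j) :
    ((R ⊗[k] D) ⧸ rowSubmodule ψ w) ≃ₗ[R] (Fin n × {c : Fin n // c ≠ j} → R) :=
  (Submodule.quotEquivOfEq _ _ (by
    rw [LinearMap.ker_comp, ker_rowQuot hu]; rfl)).trans
  (((rowQuot w j u).comp (liftHom ψ).toLinearMap).quotKerEquivOfSurjective
    ((rowQuot_surjective w j u).comp (bijective_liftHom hc ψ).2))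

lemma card_rowQuot (n : ℕ) (j : Fin n) :
    Fintype.card (Fin n × {c : Fin n // c ≠ j}) = n ^ 2 - n := by
  rw [Fintype.card_prod, Fintype.card_subtype_compl, Fintype.card_fin, Fintype.card_subtype_eq,
    Nat.mul_sub_one, sq]

/-- The ideal of the `v w`, as an element of the Grassmannian. -/
def rowLeftIdeal (hc : IsCSA k D n) (ψ : D →ₐ[k] Matrix (Fin n) (Fin n) R) (w : Fin n → R)
    (hw : ∃ j, IsUnit (w j)) : leftIdeals k D n R :=
  ⟨{ toSubmodule := rowSubmodule ψ w
     finite_quotient := by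
      obtain ⟨j, u, hu⟩ := hw
      exact Module.Finite.equiv (rowQuotEquiv hc ψ hu).symm
     projective_quotient := by
      obtain ⟨j, u, hu⟩ := hw
      exact Module.Projective.of_equiv (rowQuotEquiv hc ψ hu).symm
     rankAtStalk_eq := fun p ↦ by
      obtain ⟨j, u, hu⟩ := hw
      have : Nontrivial R := ⟨0, 1, fun h ↦ p.2.ne_top ((Ideal.eq_top_iff_one _).2 (h ▸ zero_mem _))⟩
      rw [Module.rankAtStalk_eq_of_equiv (rowQuotEquiv hc ψ hu),
        Module.rankAtStalk_eq_finrank_of_free]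
      simp only [Pi.natCast_apply, Module.finrank_fintype_fun_eq_card, card_rowQuot, Nat.cast_id] },
   fun a x hx ↦ by
    change liftHom ψ (a * x) ∈ rowIdeal w
    rw [map_mul]
    exact mul_mem_rowIdeal _ hx⟩

/-- A left ideal of rank `n` that contains one matrix `e_a w`, with `w` unimodular, consists of the
matrices `v w`. -/
lemma eq_rowSubmodule (hc : IsCSA k D n) (ψ : D →ₐ[k] Matrix (Fin n) (Fin n) R) {w : Fin n → R}
    (hw : ∃ j, IsUnit (w j)) (I : leftIdeals k D n R) {a : Fin n} {z : R ⊗[k] D}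
    (hz : z ∈ I.1.toSubmodule) (hza : liftHom ψ z = Matrix.vecMulVec (Pi.single a 1) w) :
    I.1.toSubmodule = rowSubmodule ψ w := by
  have hle : rowSubmodule ψ w ≤ I.1.toSubmodule := by
    rintro y ⟨v, hv⟩
    have : y = (splitEquiv hc ψ).symm (Matrix.vecMulVec v (Pi.single a 1)) * z := by
      apply (bijective_liftHom hc ψ).1
      rw [map_mul, liftHom_splitEquiv_symm, hza, Matrix.vecMulVec_mul_vecMulVec]
      simpa using hv
    rw [this]
    exact I.2 _ _ hz
  refine le_antisymm (fun y hy ↦ ?_) hle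
  let J := (rowLeftIdeal hc ψ w hw).1
  have hb := Module.bijective_of_surjective_of_rankAtStalk_eq (M := (R ⊗[k] D) ⧸ J.toSubmodule)
    (φ := Submodule.factor hle) (Submodule.factor_surjective hle)
    fun m _ ↦ (J.rankAtStalk_eq _).trans (I.1.rankAtStalk_eq _).symm
  refine (Submodule.Quotient.mk_eq_zero J.toSubmodule).1 (hb.1 ?_)
  rw [map_zero]
  exact (Submodule.Quotient.mk_eq_zero I.1.toSubmodule).2 hy

/-- Extension of scalars takes the elements of a left ideal into its base change. -/
lemma extD_mem_map (f : R →ₐ[k] S) {N : ℕ} (I : Module.Grassmannian R (R ⊗[k] D) N)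
    {z : R ⊗[k] D} (hz : z ∈ I.toSubmodule) :
    extD D f z ∈ (Module.Grassmannian.map f I).toSubmodule := by
  let _ : Algebra R S := f.toAlgebra
  have : IsScalarTower k R S := IsScalarTower.of_algebraMap_eq' <| IsScalarTower.algebraMap_eq k R S
  rw [Module.Grassmannian.map_toSubmodule, LinearMap.mem_ker, Module.Grassmannian.baseChangeMkQ]
  have h : (AlgebraTensorModule.cancelBaseChange k R S S D).symm (extD D f z) = 1 ⊗ₜ z := by
    rw [LinearEquiv.symm_apply_eq]
    clear hz
    induction z using TensorProduct.induction_on with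
    | zero => simp
    | tmul r d => simp [Algebra.smul_def]; rfl
    | add x y hx hy => simp [TensorProduct.tmul_add, hx, hy]
  rw [LinearMap.comp_apply, LinearEquiv.coe_coe, h, LinearMap.baseChange_tmul,
    Submodule.mkQ_apply, (Submodule.Quotient.mk_eq_zero _).2 hz, TensorProduct.tmul_zero]

/-- An ideal of rank `n` is not contained in `𝔭 (R ⊗ D)`, for a prime `𝔭`: the quotient would have
rank `n²` there. -/
lemma exists_entry_notMem (hc : IsCSA k D n) (ψ : D →ₐ[k] Matrix (Fin n) (Fin n) R)
    (I : leftIdeals k D n R) (p : Ideal R) [p.IsPrime] :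
    ∃ z ∈ I.1.toSubmodule, ∃ a j, liftHom ψ z a j ∉ p := by
  by_contra! h
  -- If all entries of the ideal were in `p`, its quotient would have the full fiber `M_n(κ)` at `p`,
  -- which contradicts its rank `n² - n`.
  let κ := p.ResidueField
  let q : (R ⊗[k] D) →ₗ[R] (Fin n × Fin n → κ) :=
    { toFun := fun z p ↦ algebraMap R κ (liftHom ψ z p.1 p.2)
      map_add' := fun x y ↦ by ext; simp
      map_smul' := fun r x ↦ by
        ext p
        rw [map_smul, Matrix.smul_apply, smul_eq_mul, map_mul, Pi.smul_apply, Algebra.smul_def]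
        rfl }
  let q' := I.1.toSubmodule.liftQ q (fun z hz ↦ by
    ext p
    exact (Ideal.algebraMap_residueField_eq_zero).2 (h z hz p.1 p.2))
  have hs : Function.Surjective (q'.liftBaseChange κ) := by
    intro f
    refine ⟨∑ p, f p ⊗ₜ Submodule.Quotient.mk
      ((splitEquiv hc ψ).symm (Matrix.single p.1 p.2 1)), ?_⟩
    rw [map_sum]
    ext p
    have hq' (z) : q' (Submodule.Quotient.mk z) = q z := rfl
    rw [Finset.sum_apply, Finset.sum_eq_single p]
    · rw [LinearMap.liftBaseChange_tmul, hq']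
      simp [q, liftHom_splitEquiv_symm]
    · intro p' _ hp
      rw [LinearMap.liftBaseChange_tmul, hq']
      have : Matrix.single p'.1 p'.2 (1 : R) p.1 p.2 = 0 := by
        rw [Matrix.single_apply_of_ne]
        rintro ⟨h1, h2⟩
        exact hp (Prod.ext h1 h2)
      simp [q, liftHom_splitEquiv_symm, this]
    · simp
  have h1 := LinearMap.finrank_le_finrank_of_surjective (f := q'.liftBaseChange κ) hs
  have h2 := (p.finrank_fiber_eq_rankAtStalk (M := (R ⊗[k] D) ⧸ I.1.toSubmodule)).trans
    (I.1.rankAtStalk_eq _)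
  have h3 : n ^ 2 ≤ n ^ 2 - n := by
    simpa [sq] using h1.trans h2.le
  have := hc.pos
  have : n ≤ n ^ 2 := by nlinarith
  omega

/-- An ideal of rank `n` contains an element with matrix `e_a w`, where `w` has an entry outside a
given prime. -/
lemma exists_row_notMem (hc : IsCSA k D n) (ψ : D →ₐ[k] Matrix (Fin n) (Fin n) R)
    (I : leftIdeals k D n R) (p : Ideal R) [p.IsPrime] :
    ∃ z ∈ I.1.toSubmodule, ∃ (a j : Fin n) (w : Fin n → R), w j ∉ p ∧
      liftHom ψ z = Matrix.vecMulVec (Pi.single a 1) w := by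
  obtain ⟨z, hz, a, j, h⟩ := exists_entry_notMem hc ψ I p
  refine ⟨(splitEquiv hc ψ).symm (Matrix.single a a 1) * z, I.2 _ _ hz, a, j, liftHom ψ z a, h, ?_⟩
  rw [map_mul, liftHom_splitEquiv_symm]
  ext c d
  rw [Matrix.vecMulVec_apply]
  by_cases hca : c = a
  · subst hca; simp
  · simp [hca]

/-- Over a local ring `R`, an ideal `I` of rank `n` is a free module, and left multiplication on `I`
represents `D` by matrices over `R`. -/
lemma exists_rep [IsLocalRing R] (hc : IsCSA k D n) (I : leftIdeals k D n R) :
    Nonempty (D →ₐ[k] Matrix (Fin n) (Fin n) R) := by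
  have : Module.Finite k D :=
    Module.finite_of_finrank_pos (by rw [hc.finrank]; exact pow_pos hc.pos 2)
  obtain ⟨q, hq⟩ := Module.projective_lifting_property I.1.toSubmodule.mkQ LinearMap.id
    (Submodule.mkQ_surjective _)
  -- A complement of the ideal exhibits it as a free module of rank `n`.
  let r : (R ⊗[k] D) →ₗ[R] I.1.toSubmodule :=
    (LinearMap.id - q.comp I.1.toSubmodule.mkQ).codRestrict _ fun z ↦ by
      rw [← Submodule.Quotient.mk_eq_zero]
      have := LinearMap.congr_fun hq (I.1.toSubmodule.mkQ z)
      simp only [LinearMap.comp_apply, LinearMap.id_apply, Submodule.mkQ_apply] at this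
      simp [this]
  have hr : r.comp I.1.toSubmodule.subtype = LinearMap.id := by
    ext z
    have : I.1.toSubmodule.mkQ (z : R ⊗[k] D) = 0 := (Submodule.Quotient.mk_eq_zero _).2 z.2
    change (z : R ⊗[k] D) - q (I.1.toSubmodule.mkQ z) = z
    rw [this, map_zero, sub_zero]
  have : Module.Projective R I.1.toSubmodule :=
    Module.Projective.of_split I.1.toSubmodule.subtype r hr
  have : Module.Finite R I.1.toSubmodule :=
    Module.Finite.of_surjective r fun z ↦ ⟨z, LinearMap.congr_fun hr z⟩
  have : Module.Free R I.1.toSubmodule := Module.free_of_flat_of_isLocalRing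
  have : Module.Free R ((R ⊗[k] D) ⧸ I.1.toSubmodule) := Module.free_of_flat_of_isLocalRing
  have h1 : Module.finrank R ((R ⊗[k] D) ⧸ I.1.toSubmodule) = n ^ 2 - n := by
    have := I.1.rankAtStalk_eq ⟨IsLocalRing.maximalIdeal R, inferInstance⟩
    rwa [Module.rankAtStalk_eq_finrank_of_free] at this
  have h2 : Module.finrank R I.1.toSubmodule = n := by
    have e : (R ⊗[k] D) ≃ₗ[R] I.1.toSubmodule × ((R ⊗[k] D) ⧸ I.1.toSubmodule) :=
      LinearEquiv.ofBijective (r.prod I.1.toSubmodule.mkQ) (by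
        constructor
        · rw [← LinearMap.ker_eq_bot, LinearMap.ker_eq_bot']
          intro z hz
          have h1 : r z = 0 := congrArg Prod.fst hz
          have h2 : I.1.toSubmodule.mkQ z = 0 := congrArg Prod.snd hz
          have h3 : z - q (I.1.toSubmodule.mkQ z) = 0 := congrArg Subtype.val h1
          rwa [h2, map_zero, sub_zero] at h3
        · rintro ⟨x, y⟩
          have h1 : I.1.toSubmodule.mkQ (q y) = y := LinearMap.congr_fun hq y
          have h2 : I.1.toSubmodule.mkQ (x : R ⊗[k] D) = 0 :=
            (Submodule.Quotient.mk_eq_zero _).2 x.2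
          refine ⟨x + q y, Prod.ext (Subtype.ext ?_) ?_⟩
          · change (x : R ⊗[k] D) + q y - q (I.1.toSubmodule.mkQ (x + q y)) = x
            rw [map_add, h1, h2, zero_add, add_sub_cancel_right]
          · change I.1.toSubmodule.mkQ (x + q y) = y
            rw [map_add, h1, h2, zero_add])
    have := e.finrank_eq
    rw [Module.finrank_prod, h1, Module.finrank_baseChange, hc.finrank] at this
    have := hc.pos
    have : n ≤ n ^ 2 := by nlinarith
    omega
  let c := Module.finBasisOfFinrankEq R I.1.toSubmodule h2
  -- The algebra `D` acts on it by left multiplication.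
  let m : D →ₐ[k] Module.End R I.1.toSubmodule :=
    { toFun := fun d ↦
        { toFun := fun z ↦ ⟨((1 : R) ⊗ₜ[k] d) * (z : R ⊗[k] D), I.2 _ _ z.2⟩
          map_add' := fun x y ↦ Subtype.ext (mul_add _ _ _)
          map_smul' := fun x y ↦ Subtype.ext (mul_smul_comm _ _ _) }
      map_one' := by ext z; exact one_mul _
      map_mul' := fun x y ↦ by
        ext z
        change ((1 : R) ⊗ₜ[k] (x * y)) * (z : R ⊗[k] D) =
          ((1 : R) ⊗ₜ[k] x) * (((1 : R) ⊗ₜ[k] y) * (z : R ⊗[k] D))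
        rw [← mul_assoc, Algebra.TensorProduct.tmul_mul_tmul, mul_one]
      map_zero' := by
        ext z
        change ((1 : R) ⊗ₜ[k] (0 : D)) * (z : R ⊗[k] D) = 0
        rw [TensorProduct.tmul_zero, zero_mul]
      map_add' := fun x y ↦ by
        ext z
        change ((1 : R) ⊗ₜ[k] (x + y)) * (z : R ⊗[k] D) =
          ((1 : R) ⊗ₜ[k] x) * (z : R ⊗[k] D) + ((1 : R) ⊗ₜ[k] y) * (z : R ⊗[k] D)
        rw [TensorProduct.tmul_add, add_mul]
      commutes' := fun r ↦ by
        ext z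
        change ((1 : R) ⊗ₜ[k] (algebraMap k D r)) * (z : R ⊗[k] D) = r • (z : R ⊗[k] D)
        rw [Algebra.algebraMap_eq_smul_one, TensorProduct.tmul_smul, smul_mul_assoc,
          ← Algebra.TensorProduct.one_def, one_mul] }
  exact ⟨((LinearMap.toMatrixAlgEquiv c).toAlgHom.restrictScalars k).comp m⟩

end Ideal

/-! ### The lattices of `𝒟` and of its ideals -/

section InterLattice
variable {k D : Type u} [Field k] [DivisionRing D] [Algebra k D] {X : Over (Spec (.of k))}
  [IsIntegral X.left]

/-- The inclusion of the local ring at `x` into the function field. -/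
def toF (x : X.left) : X.left.presheaf.stalk x →ₐ[k] FunField X where
  __ := algebraMap (X.left.presheaf.stalk x) X.left.functionField
  commutes' a := algebraMap_germ (X := X.left) (U := ⊤) x trivial
    ((X.hom.appTop) ((Scheme.ΓSpecIso (.of k)).inv a))

lemma toF_injective (x : X.left) : Function.Injective (toF x) := stalk_injective x

lemma toF_mem_reg {x : X.left} (s : X.left.presheaf.stalk x) : toF x s ∈ reg x := ⟨s, rfl⟩

lemma isRegUnit_toF {x : X.left} {s : X.left.presheaf.stalk x} (hs : IsUnit s) :
    IsRegUnit x (toF x s : X.left.functionField) := isRegUnit_algebraMap hs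

lemma toF_stalkPoint (x : X.left) :
    specOverMap (toF x) ≫ stalkPoint X x = stalkPoint X (genericPoint X.left) :=
  Over.OverMorphism.ext (Scheme.SpecMap_stalkSpecializes_fromSpecStalk
    ((genericPoint_spec X.left).specializes trivial))

variable (D X) in
/-- The elements of `F ⊗ D` that come from `𝒪_x ⊗ D`. -/
def azLat : Lattice X.left (FunField X ⊗[k] D) where
  carrier x := (extD D (toF x)).toRingHom.toAddMonoidHom.range
  smul_mem := by
    rintro x _ _ ⟨s, rfl⟩ ⟨z, rfl⟩
    refine ⟨s • z, ?_⟩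
    change extD D (toF x) (s • z) = toF x s • extD D (toF x) z
    induction z using TensorProduct.induction_on with
    | zero => simp
    | tmul r d => simp [TensorProduct.smul_tmul']
    | add x y hx hy => simp only [smul_add, map_add, hx, hy]

lemma mem_azLat {x : X.left} {z : FunField X ⊗[k] D} :
    z ∈ (azLat D X).carrier x ↔ ∃ z', extD D (toF x) z' = z := Iff.rfl

lemma repr_extD {R S ι : Type*} [CommRing R] [Algebra k R] [CommRing S] [Algebra k S]
    (b : Module.Basis ι k D) (f : R →ₐ[k] S) (z : R ⊗[k] D) (i : ι) :
    (Algebra.TensorProduct.basis S b).repr (extD D f z) i =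
      f ((Algebra.TensorProduct.basis R b).repr z i) := by
  induction z using TensorProduct.induction_on with
  | zero => simp
  | tmul r d => simp
  | add x y hx hy => simp only [map_add, Finsupp.add_apply, hx, hy]

lemma extD_injective {R S : Type*} [CommRing R] [Algebra k R] [CommRing S] [Algebra k S]
    {f : R →ₐ[k] S} (hf : Function.Injective f) : Function.Injective (extD D f) := by
  intro z z' h
  let b := Module.Basis.ofVectorSpace k D
  refine (Algebra.TensorProduct.basis R b).ext_elem fun i ↦ hf ?_
  rw [← repr_extD, ← repr_extD, h]

lemma exists_extD {R S ι : Type*} [CommRing R] [Algebra k R] [CommRing S] [Algebra k S] [Fintype ι]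
    (b : Module.Basis ι k D) (f : R →ₐ[k] S) (z : S ⊗[k] D)
    (h : ∀ i, ∃ r, f r = (Algebra.TensorProduct.basis S b).repr z i) : ∃ z', extD D f z' = z := by
  choose r hr using h
  refine ⟨∑ i, r i ⊗ₜ b i, ?_⟩
  rw [map_sum, ← (Algebra.TensorProduct.basis S b).sum_repr z]
  refine Finset.sum_congr rfl fun i _ ↦ ?_
  simp [hr, TensorProduct.smul_tmul']

lemma mem_azLat_iff_repr {ι : Type*} [Fintype ι] (b : Module.Basis ι k D) {x : X.left}
    {z : FunField X ⊗[k] D} : z ∈ (azLat D X).carrier x ↔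
      ∀ i, (Algebra.TensorProduct.basis (FunField X) b).repr z i ∈ reg x := by
  rw [mem_azLat]
  constructor
  · rintro ⟨z, rfl⟩ i
    rw [repr_extD]
    exact toF_mem_reg _
  · exact exists_extD b (toF x) z

/-- A representation over `F` with entries in `𝒪_x` is defined over `𝒪_x`. -/
lemma exists_mapRep {n : ℕ} {ψ : D →ₐ[k] Matrix (Fin n) (Fin n) (FunField X)} {x : X.left}
    (h : ∀ d i j, ψ d i j ∈ reg x) :
    ∃ ψ' : D →ₐ[k] Matrix (Fin n) (Fin n) (X.left.presheaf.stalk x), mapRep (toF x) ψ' = ψ := by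
  have hi : Function.Injective ((toF x).mapMatrix (m := Fin n)) := fun M N hMN ↦ by
    ext i j
    exact toF_injective x (congrFun (congrFun hMN i) j)
  have hr : ∀ d, ψ d ∈ ((toF x).mapMatrix (m := Fin n)).range := fun d ↦ by
    choose M hM using h d
    exact ⟨Matrix.of M, by ext i j; exact hM i j⟩
  let e := AlgEquiv.ofInjective _ hi
  refine ⟨e.symm.toAlgHom.comp (ψ.codRestrict _ hr), ?_⟩
  ext1 d
  exact congrArg Subtype.val (e.apply_symm_apply ⟨ψ d, hr d⟩)

/-- Membership in the lattice of `𝒟` can be tested on the matrix entries of a representation with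
regular entries, since such a representation is a splitting of `𝒟` at `x`. -/
lemma mem_azLat_iff {n : ℕ} (hc : IsCSA k D n)
    {ψ : D →ₐ[k] Matrix (Fin n) (Fin n) (FunField X)} {x : X.left}
    (h : ∀ d i j, ψ d i j ∈ reg x) {z : FunField X ⊗[k] D} :
    z ∈ (azLat D X).carrier x ↔ ∀ i j, liftHom ψ z i j ∈ reg x := by
  obtain ⟨ψ', rfl⟩ := exists_mapRep h
  rw [mem_azLat]
  constructor
  · rintro ⟨z, rfl⟩ i j
    rw [liftHom_extD]
    exact toF_mem_reg _
  · intro hz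
    choose M hM using hz
    refine ⟨(splitEquiv hc ψ').symm (Matrix.of M), (bijective_liftHom hc (mapRep (toF x) ψ')).1 ?_⟩
    ext i j
    rw [liftHom_extD, liftHom_splitEquiv_symm]
    exact hM i j

/-- The lattices `W ∩ (𝒪_x ⊗ D)`. -/
def interLat (W : Submodule (FunField X) (FunField X ⊗[k] D)) : Lattice X.left W where
  carrier x := ((azLat D X).carrier x).comap W.subtype.toAddMonoidHom
  smul_mem x f v hf hv := (azLat D X).smul_mem x f v hf hv

lemma mem_interLat {W : Submodule (FunField X) (FunField X ⊗[k] D)} {x : X.left} {v : W} :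
    v ∈ (interLat W).carrier x ↔ (v : FunField X ⊗[k] D) ∈ (azLat D X).carrier x := Iff.rfl

lemma germD_mem_azLat (U : X.left.Opens) (hU : genericPoint X.left ∈ U) (s : Sec D X U)
    {x : X.left} (hx : x ∈ U) : germD D X U _ hU s ∈ (azLat D X).carrier x := by
  refine ⟨germD D X U x hx s, ?_⟩
  change ((extD D (toF x)).comp (germD D X U x hx)) s = _
  congr 1
  ext a
  · simp only [germD, AlgHom.comp_apply, Algebra.TensorProduct.includeLeft_apply,
      Algebra.TensorProduct.map_tmul, map_one]
    congr 1
    exact algebraMap_germ x hx a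
  · simp [germD]

lemma germD_injective (U : X.left.Opens) (hU : genericPoint X.left ∈ U) :
    Function.Injective (germD D X U _ hU) := extD_injective (gen_injective U hU)

variable [FiniteDimensional k D]

lemma exists_germD {U : X.left.Opens} (hU : genericPoint X.left ∈ U) {z : FunField X ⊗[k] D}
    (hz : ∀ x ∈ U, z ∈ (azLat D X).carrier x) : ∃ s : Sec D X U, germD D X U _ hU s = z := by
  let b := Module.finBasis k D
  refine exists_extD b _ _ fun i ↦ ?_
  exact exists_gen_of_forall_mem_reg hU fun x hx ↦ (mem_azLat_iff_repr b).1 (hz x hx) i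

variable (D X) in
/-- The inclusions `𝒟(U) → F ⊗ D`. -/
def azHom : LatHom (azumaya D X).val (azLat D X) where
  toFun U hU := (germD D X U _ hU).toRingHom.toAddMonoidHom
  map_smul U hU r s := germD_smul D X U _ hU r s
  map_res i hW s := germD_resD D X i _ hW s
  mem U _ hx s := germD_mem_azLat U _ s hx

lemma bijOn_azHom (U : X.left.Opens) : (azHom D X).BijOn U := fun hU ↦
  ⟨germD_injective U hU, fun _ hv ↦ exists_germD hU hv⟩

/-- The inclusions `(W ∩ 𝒟)(U) → W`. -/
def interHom (W : Submodule (FunField X) (FunField X ⊗[k] D)) :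
    LatHom (interGen W).val (interLat W) where
  toFun U hU :=
    { toFun := interGerm W U hU
      map_zero' := Subtype.ext (map_zero (germD D X U _ hU))
      map_add' := fun s t ↦ Subtype.ext (map_add (germD D X U _ hU) s.1 t.1) }
  map_smul U hU r s := Subtype.ext (germD_smul D X U _ hU r s.1)
  map_res i hW s := Subtype.ext (germD_resD D X i _ hW s.1)
  mem U _ hx s := germD_mem_azLat U _ s.1 hx

lemma bijOn_interHom (W : Submodule (FunField X) (FunField X ⊗[k] D)) (U : X.left.Opens) :
    (interHom W).BijOn U := fun hU ↦ by
  refine ⟨fun s t h ↦ Subtype.ext (germD_injective U hU (congrArg Subtype.val h)), fun v hv ↦ ?_⟩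
  obtain ⟨s, hs⟩ := exists_germD hU hv
  exact ⟨⟨s, fun _ ↦ hs ▸ v.2⟩, Subtype.ext hs⟩

end InterLattice

/-! ### Local descriptions of `T` and `σ(T)` -/

section Involution
variable {k D : Type u} [Field k] [DivisionRing D] [Algebra k D] {n : ℕ}

/-- A `k`-linear involution of `D`, without a condition on its type. -/
structure IsInvolution (σ : D →ₗ[k] D) : Prop where
  map_mul (x y : D) : σ (x * y) = σ y * σ x
  involutive (x : D) : σ (σ x) = x

lemma IsInvolution.map_one {σ : D →ₗ[k] D} (hσ : IsInvolution σ) : σ 1 = 1 := by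
  have h := hσ.map_mul (σ 1) 1
  rwa [mul_one, hσ.involutive, mul_one, eq_comm] at h

variable {R : Type*} [CommRing R] [Algebra k R]

/-- The representation `d ↦ ψ(σ(d))ᵀ`. -/
def transposeRep {σ : D →ₗ[k] D} (hσ : IsInvolution σ) (ψ : D →ₐ[k] Matrix (Fin n) (Fin n) R) :
    D →ₐ[k] Matrix (Fin n) (Fin n) R where
  toFun d := (ψ (σ d)).transpose
  map_one' := by rw [hσ.map_one, map_one, Matrix.transpose_one]
  map_mul' x y := by rw [hσ.map_mul, map_mul, Matrix.transpose_mul]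
  map_zero' := by rw [map_zero, map_zero, Matrix.transpose_zero]
  map_add' x y := by rw [map_add, map_add, Matrix.transpose_add]
  commutes' r := by
    rw [Algebra.algebraMap_eq_smul_one, map_smul, hσ.map_one, map_smul, map_one,
      Matrix.transpose_smul, Matrix.transpose_one, Algebra.algebraMap_eq_smul_one]

lemma liftHom_transposeRep {σ : D →ₗ[k] D} (hσ : IsInvolution σ)
    (ψ : D →ₐ[k] Matrix (Fin n) (Fin n) R) (z : R ⊗[k] D) :
    liftHom (transposeRep hσ ψ) z = (liftHom ψ (σ.baseChange R z)).transpose := by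
  induction z using TensorProduct.induction_on with
  | zero => simp
  | tmul r d => rw [LinearMap.baseChange_tmul, liftHom_tmul, liftHom_tmul]; rfl
  | add x y hx hy => rw [map_add, map_add, map_add, hx, hy, Matrix.transpose_add]

lemma baseChange_involutive {σ : D →ₗ[k] D} (hσ : IsInvolution σ) (z : R ⊗[k] D) :
    σ.baseChange R (σ.baseChange R z) = z := by
  induction z using TensorProduct.induction_on with
  | zero => simp
  | tmul r d => simp [hσ.involutive]
  | add x y hx hy => rw [map_add, map_add, hx, hy]

end Involution

section Frame
variable {k D : Type u} [Field k] [DivisionRing D] [Algebra k D] {X : Over (Spec (.of k))}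
  [IsIntegral X.left] {n : ℕ}

/-- Near every point the generic ideal `T` is given by a row with an invertible entry: it is the
generic fiber of the ideal that corresponds to the local ring at this point. -/
lemma exists_T_eq (hc : IsCSA k D n) (P : SeveriBrauerVariety k D n X) (x : X.left)
    (ψ : D →ₐ[k] Matrix (Fin n) (Fin n) (X.left.presheaf.stalk x)) :
    ∃ w : Fin n → X.left.presheaf.stalk x, (∃ j, IsUnit (w j)) ∧
      P.T = rowSubmodule (mapRep (toF x) ψ) (fun i ↦ toF x (w i)) := by
  obtain ⟨z, hz, a, j, w, hj, h⟩ := exists_row_notMem hc ψ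
    (P.ideal _ (stalkPoint X x)) (IsLocalRing.maximalIdeal _)
  have hj' : IsUnit (w j) := by simpa using hj
  refine ⟨w, ⟨j, hj'⟩, eq_rowSubmodule hc (mapRep (toF x) ψ) ⟨j, hj'.map (toF x)⟩
    (P.ideal (FunField X) (stalkPoint X (genericPoint X.left))) (z := extD D (toF x) z) (a := a) ?_ ?_⟩
  · rw [← toF_stalkPoint x, P.ideal_comp]
    exact extD_mem_map _ _ hz
  · ext b c
    rw [liftHom_extD, h, Matrix.vecMulVec_apply, Matrix.vecMulVec_apply, map_mul]
    congr 1
    by_cases hb : b = a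
    · subst hb; simp
    · simp [hb]

variable (P : SeveriBrauerVariety k D n X) (σ : D →ₗ[k] D)

/-- A description of `T` and `σ(T)` over an open set `U`: the algebra `𝒟` is identified with
`M_n(𝒪)` over `U` such that `T` consists of the matrices `v w` and `σ(T)` of the matrices `u v`, for
a row `w` and a column `u` that have an invertible entry. -/
structure Frame (U : X.left.Opens) where
  ψ : D →ₐ[k] Matrix (Fin n) (Fin n) (FunField X)
  w : Fin n → FunField X
  u : Fin n → FunField X
  jw : Fin n
  ju : Fin n
  ψ_mem : ∀ y ∈ U, ∀ d i j, ψ d i j ∈ reg y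
  w_mem : ∀ y ∈ U, ∀ i, w i ∈ reg y
  u_mem : ∀ y ∈ U, ∀ i, u i ∈ reg y
  w_unit : ∀ y ∈ U, IsRegUnit y (w jw)
  u_unit : ∀ y ∈ U, IsRegUnit y (u ju)
  mem_T : ∀ z, z ∈ P.T ↔ ∃ v, liftHom ψ z = Matrix.vecMulVec v w
  mem_sigmaT : ∀ z, z ∈ P.sigmaT σ ↔ ∃ v, liftHom ψ z = Matrix.vecMulVec u v

/-- The restriction of a frame. -/
def Frame.res {P : SeveriBrauerVariety k D n X} {σ : D →ₗ[k] D} {U V : X.left.Opens} (h : V ≤ U)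
    (f : Frame P σ U) : Frame P σ V :=
  { f with
    ψ_mem := fun y hy ↦ f.ψ_mem y (h hy)
    w_mem := fun y hy ↦ f.w_mem y (h hy)
    u_mem := fun y hy ↦ f.u_mem y (h hy)
    w_unit := fun y hy ↦ f.w_unit y (h hy)
    u_unit := fun y hy ↦ f.u_unit y (h hy) }

/-- Finitely many regular functions at `x` are regular in a common neighbourhood. -/
lemma exists_forall_mem_reg {Y : Scheme.{u}} [IsIntegral Y] {ι : Type*} [Finite ι] {x : Y}
    {f : ι → Y.functionField} (hf : ∀ i, f i ∈ reg x) :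
    ∃ U : Y.Opens, x ∈ U ∧ ∀ y ∈ U, ∀ i, f i ∈ reg y := by
  have h : ∀ᶠ y in nhds x, ∀ i, f i ∈ reg y := Filter.eventually_all.2 fun i ↦ by
    obtain ⟨U, hU, h⟩ := exists_mem_reg (hf i)
    exact Filter.eventually_of_mem (U.isOpen.mem_nhds hU) h
  obtain ⟨U, h, hU, hx⟩ := mem_nhds_iff.1 h
  exact ⟨⟨U, hU⟩, hx, h⟩

variable {P σ} in
/-- The ideal that corresponds to the local ring at `x` splits `𝒟` at `x`, and gives the row `w`. The
ideal `σ(T)` becomes a left ideal under the transposed splitting, which gives the column `u`. All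
these data are regular in a neighbourhood of `x`. -/
lemma exists_frame (hc : IsCSA k D n) (hσ : IsInvolution σ) (x : X.left) :
    ∃ U : X.left.Opens, x ∈ U ∧ Nonempty (Frame P σ U) := by
  have : Module.Finite k D :=
    Module.finite_of_finrank_pos (by rw [hc.finrank]; exact pow_pos hc.pos 2)
  obtain ⟨ψ⟩ := exists_rep hc (P.ideal _ (stalkPoint X x))
  obtain ⟨w, ⟨jw, hw⟩, hT⟩ := exists_T_eq hc P x ψ
  obtain ⟨u, ⟨ju, hu⟩, hT'⟩ := exists_T_eq hc P x (transposeRep hσ ψ)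
  let b := Module.finBasis k D
  obtain ⟨U₁, h₁, H₁⟩ := exists_forall_mem_reg (x := x)
    (f := fun p : _ × Fin n × Fin n ↦ mapRep (toF x) ψ (b p.1) p.2.1 p.2.2) fun _ ↦ toF_mem_reg _
  obtain ⟨U₂, h₂, H₂⟩ := exists_forall_mem_reg (x := x) (f := fun i ↦ toF x (w i))
    fun _ ↦ toF_mem_reg _
  obtain ⟨U₃, h₃, H₃⟩ := exists_forall_mem_reg (x := x) (f := fun i ↦ toF x (u i))
    fun _ ↦ toF_mem_reg _
  obtain ⟨U₄, h₄, H₄⟩ := (isRegUnit_toF hw).eventually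
  obtain ⟨U₅, h₅, H₅⟩ := (isRegUnit_toF hu).eventually
  refine ⟨U₁ ⊓ U₂ ⊓ U₃ ⊓ U₄ ⊓ U₅, ⟨⟨⟨⟨h₁, h₂⟩, h₃⟩, h₄⟩, h₅⟩, ⟨⟨mapRep (toF x) ψ,
    fun i ↦ toF x (w i), fun i ↦ toF x (u i), jw, ju, fun y hy d i j ↦ ?_,
    fun y hy ↦ H₂ y hy.1.1.1.2, fun y hy ↦ H₃ y hy.1.1.2, fun y hy ↦ H₄ y hy.1.2,
    fun y hy ↦ H₅ y hy.2, fun z ↦ by rw [hT]; exact mem_rowSubmodule, fun z ↦ ?_⟩⟩⟩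
  · rw [← b.sum_repr d, map_sum, Matrix.sum_apply]
    refine sum_mem fun m _ ↦ ?_
    rw [map_smul, Matrix.smul_apply, Algebra.smul_def]
    refine mul_mem ?_ (H₁ y hy.1.1.1.1 (m, i, j))
    rw [← (toF y).commutes]
    exact toF_mem_reg _
  · have e : mapRep (toF x) (transposeRep hσ ψ) = transposeRep hσ (mapRep (toF x) ψ) := rfl
    have h1 : z ∈ P.sigmaT σ ↔ σ.baseChange _ z ∈ P.T := by
      constructor
      · rintro ⟨t, ht, rfl⟩
        rw [baseChange_involutive hσ]
        exact ht
      · exact fun h ↦ ⟨_, h, baseChange_involutive hσ z⟩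
    rw [h1, hT', mem_rowSubmodule, e]
    simp only [liftHom_transposeRep]
    refine exists_congr fun v ↦ ?_
    rw [baseChange_involutive hσ, ← Matrix.transpose_inj, Matrix.transpose_transpose, Matrix.transpose_vecMulVec]

end Frame

/-! ### Bases over the domain of a frame -/

section FrameBases
variable {k D : Type u} [Field k] [DivisionRing D] [Algebra k D] {X : Over (Spec (.of k))}
  [IsIntegral X.left] {n : ℕ} {P : SeveriBrauerVariety k D n X} {σ : D →ₗ[k] D} {U : X.left.Opens}
  (hc : IsCSA k D n) (f : Frame P σ U)

namespace Frame

lemma w_ne_zero (hU : genericPoint X.left ∈ U) : f.w f.jw ≠ 0 := (f.w_unit _ hU).1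
lemma u_ne_zero (hU : genericPoint X.left ∈ U) : f.u f.ju ≠ 0 := (f.u_unit _ hU).1

/-- The element of `F ⊗ D` with a given matrix. -/
abbrev el (M : Matrix (Fin n) (Fin n) (FunField X)) : FunField X ⊗[k] D := (splitEquiv hc f.ψ).symm M

lemma liftHom_el (M : Matrix (Fin n) (Fin n) (FunField X)) : liftHom f.ψ (f.el hc M) = M :=
  liftHom_splitEquiv_symm hc f.ψ M

lemma el_mul (M N : Matrix (Fin n) (Fin n) (FunField X)) :
    f.el hc (M * N) = f.el hc M * f.el hc N := map_mul _ _ _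

/-- The elements of `T` correspond to columns `v`. -/
def tEquiv (hU : genericPoint X.left ∈ U) : P.T ≃ₗ[FunField X] (Fin n → FunField X) where
  toFun t i := liftHom f.ψ t i f.jw / f.w f.jw
  map_add' s t := by ext i; simp [add_div]
  map_smul' r t := by ext i; simp [mul_div_assoc]
  invFun v := ⟨f.el hc (Matrix.vecMulVec v f.w), (f.mem_T _).2 ⟨v, f.liftHom_el hc _⟩⟩
  left_inv t := by
    obtain ⟨v, hv⟩ := (f.mem_T _).1 t.2
    refine Subtype.ext ((bijective_liftHom hc f.ψ).1 ?_)
    simp only [liftHom_el, hv]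
    congr 1
    ext i
    rw [Matrix.vecMulVec_apply, mul_div_cancel_right₀ _ (f.w_ne_zero hU)]
  right_inv v := by
    ext i
    simp only [liftHom_el]
    rw [Matrix.vecMulVec_apply, mul_div_cancel_right₀ _ (f.w_ne_zero hU)]

/-- The elements of `σ(T)` correspond to rows `v`. -/
def sEquiv (hU : genericPoint X.left ∈ U) : P.sigmaT σ ≃ₗ[FunField X] (Fin n → FunField X) where
  toFun t i := liftHom f.ψ t f.ju i / f.u f.ju
  map_add' s t := by ext i; simp [add_div]
  map_smul' r t := by ext i; simp [mul_div_assoc]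
  invFun v := ⟨f.el hc (Matrix.vecMulVec f.u v), (f.mem_sigmaT _).2 ⟨v, f.liftHom_el hc _⟩⟩
  left_inv t := by
    obtain ⟨v, hv⟩ := (f.mem_sigmaT _).1 t.2
    refine Subtype.ext ((bijective_liftHom hc f.ψ).1 ?_)
    simp only [liftHom_el, hv]
    congr 1
    ext i
    rw [Matrix.vecMulVec_apply, mul_div_cancel_left₀ _ (f.u_ne_zero hU)]
  right_inv v := by
    ext i
    simp only [liftHom_el]
    rw [Matrix.vecMulVec_apply, mul_div_cancel_left₀ _ (f.u_ne_zero hU)]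

/-- The elements `v w` of `T` that also have the form `u v'` are the multiples of `u w`. -/
lemma mem_L (hU : genericPoint X.left ∈ U) (z : FunField X ⊗[k] D) :
    z ∈ P.L σ ↔ ∃ a : FunField X, liftHom f.ψ z = a • Matrix.vecMulVec f.u f.w := by
  constructor
  · rintro ⟨h1, h2⟩
    obtain ⟨v, hv⟩ := (f.mem_T z).1 h1
    obtain ⟨v', hv'⟩ := (f.mem_sigmaT z).1 h2
    refine ⟨v f.ju / f.u f.ju, ?_⟩
    have h (i) : v i * f.w f.jw = f.u i * v' f.jw := by
      have := congrFun (congrFun (hv.symm.trans hv') i) f.jw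
      rwa [Matrix.vecMulVec_apply, Matrix.vecMulVec_apply] at this
    have hw := f.w_ne_zero hU
    have hu := f.u_ne_zero hU
    rw [hv]
    ext i j
    rw [Matrix.smul_apply, Matrix.vecMulVec_apply, Matrix.vecMulVec_apply, smul_eq_mul]
    have : v i = v f.ju / f.u f.ju * f.u i := by
      rw [div_mul_eq_mul_div, eq_div_iff hu]
      apply mul_right_cancel₀ hw
      linear_combination (f.u f.ju) * h i - f.u i * h f.ju
    rw [this]; ring
  · rintro ⟨a, h⟩
    refine ⟨(f.mem_T z).2 ⟨a • f.u, ?_⟩, (f.mem_sigmaT z).2 ⟨a • f.w, ?_⟩⟩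
    · rw [h, Matrix.smul_vecMulVec]
    · rw [h, Matrix.vecMulVec_smul]

/-- The elements of `L` are the multiples of `u w`. -/
def lEquiv (hU : genericPoint X.left ∈ U) : P.L σ ≃ₗ[FunField X] FunField X where
  toFun l := liftHom f.ψ l f.ju f.jw / (f.u f.ju * f.w f.jw)
  map_add' s t := by simp [add_div]
  map_smul' r t := by simp [mul_div_assoc]
  invFun a := ⟨f.el hc (a • Matrix.vecMulVec f.u f.w), (f.mem_L hU _).2 ⟨a, f.liftHom_el hc _⟩⟩
  left_inv t := by
    obtain ⟨v, hv⟩ := (f.mem_L hU _).1 t.2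
    refine Subtype.ext ((bijective_liftHom hc f.ψ).1 ?_)
    simp only [liftHom_el, hv]
    congr 1
    rw [Matrix.smul_apply, Matrix.vecMulVec_apply, smul_eq_mul, mul_div_cancel_right₀]
    exact mul_ne_zero (f.u_ne_zero hU) (f.w_ne_zero hU)
  right_inv v := by
    simp only [liftHom_el]
    rw [Matrix.smul_apply, Matrix.vecMulVec_apply, smul_eq_mul, mul_div_cancel_right₀]
    exact mul_ne_zero (f.u_ne_zero hU) (f.w_ne_zero hU)

/-- The basis of `T` given by a frame. -/
def tBasis (hU : genericPoint X.left ∈ U) : Module.Basis (Fin n) (FunField X) P.T :=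
  .ofEquivFun (f.tEquiv hc hU)

/-- The basis of `σ(T)` given by a frame. -/
def sBasis (hU : genericPoint X.left ∈ U) : Module.Basis (Fin n) (FunField X) (P.sigmaT σ) :=
  .ofEquivFun (f.sEquiv hc hU)

/-- The basis of `L` given by a frame. -/
def lBasis (hU : genericPoint X.left ∈ U) : Module.Basis Unit (FunField X) (P.L σ) :=
  (Module.Basis.singleton Unit (FunField X)).map (f.lEquiv hc hU).symm

/-- The basis of `F ⊗ D` given by a frame. -/
def azBasis : Module.Basis (Fin n × Fin n) (FunField X) (FunField X ⊗[k] D) :=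
  (Matrix.stdBasis _ _ _).map (splitEquiv hc f.ψ).symm.toLinearEquiv

lemma tBasis_apply (hU : genericPoint X.left ∈ U) (i : Fin n) :
    (f.tBasis hc hU i : FunField X ⊗[k] D) = f.el hc (Matrix.vecMulVec (Pi.single i 1) f.w) := by
  rw [tBasis, Module.Basis.coe_ofEquivFun]; rfl

lemma sBasis_apply (hU : genericPoint X.left ∈ U) (i : Fin n) :
    (f.sBasis hc hU i : FunField X ⊗[k] D) = f.el hc (Matrix.vecMulVec f.u (Pi.single i 1)) := by
  rw [sBasis, Module.Basis.coe_ofEquivFun]; rfl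

lemma lBasis_apply (hU : genericPoint X.left ∈ U) (i : Unit) :
    (f.lBasis hc hU i : FunField X ⊗[k] D) = f.el hc (Matrix.vecMulVec f.u f.w) := by
  rw [lBasis, Module.Basis.map_apply, Module.Basis.singleton_apply]
  change f.el hc ((1 : FunField X) • _) = _
  rw [one_smul]

lemma azBasis_apply (i : Fin n × Fin n) : f.azBasis hc i = f.el hc (Matrix.single i.1 i.2 1) := by
  rw [azBasis, Module.Basis.map_apply, Matrix.stdBasis_eq_single]; rfl

lemma azBasis_repr (z : FunField X ⊗[k] D) (i : Fin n × Fin n) :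
    (f.azBasis hc).repr z i = liftHom f.ψ z i.1 i.2 := by
  rw [azBasis, Module.Basis.map_repr, Matrix.stdBasis]
  simp [Matrix.ofLinearEquiv]
  rfl

lemma freeOn_az : (azLat D X).FreeOn U (f.azBasis hc) := fun y hy v ↦ by
  simp only [azBasis_repr]
  rw [mem_azLat_iff hc (f.ψ_mem y hy), Prod.forall]

lemma freeOn_T (hU : genericPoint X.left ∈ U) : (interLat P.T).FreeOn U (f.tBasis hc hU) :=
  fun y hy t ↦ by
  obtain ⟨v, rfl⟩ := (f.tEquiv hc hU).symm.surjective t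
  rw [mem_interLat, mem_azLat_iff hc (f.ψ_mem y hy)]
  have h : liftHom f.ψ ((f.tEquiv hc hU).symm v) = Matrix.vecMulVec v f.w := f.liftHom_el hc _
  simp only [h, Matrix.vecMulVec_apply, tBasis, Module.Basis.ofEquivFun_repr_apply,
    LinearEquiv.apply_symm_apply]
  refine ⟨fun H i ↦ ?_, fun H i j ↦ mul_mem (H i) (f.w_mem y hy j)⟩
  rw [← (f.w_unit y hy).mem_iff, mul_comm]
  exact H i f.jw

lemma freeOn_sigmaT (hU : genericPoint X.left ∈ U) :
    (interLat (P.sigmaT σ)).FreeOn U (f.sBasis hc hU) :=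
  fun y hy t ↦ by
  obtain ⟨v, rfl⟩ := (f.sEquiv hc hU).symm.surjective t
  rw [mem_interLat, mem_azLat_iff hc (f.ψ_mem y hy)]
  have h : liftHom f.ψ ((f.sEquiv hc hU).symm v) = Matrix.vecMulVec f.u v := f.liftHom_el hc _
  simp only [h, Matrix.vecMulVec_apply, sBasis, Module.Basis.ofEquivFun_repr_apply,
    LinearEquiv.apply_symm_apply]
  refine ⟨fun H i ↦ ?_, fun H i j ↦ mul_mem (f.u_mem y hy i) (H j)⟩
  rw [← (f.u_unit y hy).mem_iff]
  exact H f.ju i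

lemma freeOn_L (hU : genericPoint X.left ∈ U) :
    (interLat (P.L σ)).FreeOn U (f.lBasis hc hU) :=
  fun y hy t ↦ by
  obtain ⟨v, rfl⟩ := (f.lEquiv hc hU).symm.surjective t
  rw [mem_interLat, mem_azLat_iff hc (f.ψ_mem y hy)]
  have h : liftHom f.ψ ((f.lEquiv hc hU).symm v) = v • Matrix.vecMulVec f.u f.w := f.liftHom_el hc _
  simp only [h, Matrix.smul_apply, Matrix.vecMulVec_apply, lBasis, Module.Basis.map_repr,
    LinearEquiv.symm_symm, LinearEquiv.trans_apply, LinearEquiv.apply_symm_apply,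
    Module.Basis.singleton_repr, smul_eq_mul, forall_const]
  refine ⟨fun H ↦ ?_, fun H i j ↦ mul_mem H (mul_mem (f.u_mem y hy i) (f.w_mem y hy j))⟩
  rw [← ((f.u_unit y hy).mul (f.w_unit y hy)).mem_iff, mul_comm]
  exact H _ _

end Frame
end FrameBases

/-! ### Generic fibers -/

section Fiber
variable {X : Scheme.{u}}

lemma exists_modGerm (M : X.Modules) (y : X) (z : modStalk M y) :
    ∃ (U : X.Opens) (hy : y ∈ U) (s : Γ(M, U)), modGerm M U y hy s = z := by
  obtain ⟨U, hU, s, hs⟩ := TopCat.Presheaf.exists_germ_eq (C := Ab.{u}) M.presheaf z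
  exact ⟨U, hU, s, hs⟩

lemma modStalkMap_modGerm {M N : X.Modules} (f : M ⟶ N) (U : X.Opens) (y : X) (hy : y ∈ U)
    (s : Γ(M, U)) : modStalkMap f y (modGerm M U y hy s) = modGerm N U y hy (f.app U s) :=
  TopCat.Presheaf.stalkFunctor_map_germ_apply (C := Ab.{u}) U y hy f.mapPresheaf s

variable [IsIntegral X] {V : Type u} [AddCommGroup V] [Module X.functionField V]
  {Λ : Lattice X V}

/-- Every vector belongs to the lattices at all points of some nonempty open set. -/
def Lattice.IsFull (Λ : Lattice X V) : Prop :=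
  ∀ v, ∃ U : X.Opens, genericPoint X ∈ U ∧ ∀ x ∈ U, v ∈ Λ.carrier x

lemma Lattice.FreeOn.isFull {ι : Type*} [Finite ι] {U : X.Opens}
    {b : Module.Basis ι X.functionField V} (h : Λ.FreeOn U b) (hU : genericPoint X ∈ U) :
    Λ.IsFull := fun v ↦ by
  obtain ⟨W, hW, H⟩ := exists_forall_mem_reg (x := genericPoint X) (f := fun i ↦ b.repr v i)
    fun i ↦ mem_reg_genericPoint _
  exact ⟨U ⊓ W, ⟨hU, hW⟩, fun y hy ↦ (h y hy.1 v).2 (H y hy.2)⟩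

variable (Λ) in
/-- The map from the generic fiber of `lat Λ` to `V`. -/
def latStalk : modStalk (lat Λ) (genericPoint X) ⟶ AddCommGrpCat.of V :=
  Limits.colimit.desc ((TopologicalSpace.OpenNhds.inclusion (genericPoint X)).op ⋙
    (lat Λ).presheaf)
    { pt := AddCommGrpCat.of V
      ι := { app := fun U ↦ AddCommGrpCat.ofHom (latVal Λ U.unop.1 U.unop.2)
             naturality := fun _ _ _ ↦ rfl } }

lemma latStalk_germ (U : X.Opens) (hU : genericPoint X ∈ U) (s : Γ(lat Λ, U)) :
    latStalk Λ (modGerm (lat Λ) U _ hU s) = latVal Λ U hU s := by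
  have := Limits.colimit.ι_desc (F := (TopologicalSpace.OpenNhds.inclusion (genericPoint X)).op ⋙
    (lat Λ).presheaf)
    { pt := AddCommGrpCat.of V
      ι := { app := fun U ↦ AddCommGrpCat.ofHom (latVal Λ U.unop.1 U.unop.2)
             naturality := fun _ _ _ ↦ rfl } } (op ⟨U, hU⟩)
  exact ConcreteCategory.congr_hom this s

lemma latStalk_bijective (hΛ : Λ.IsFull) : Function.Bijective (latStalk Λ) := by
  constructor
  · rw [injective_iff_map_eq_zero]
    intro z hz
    obtain ⟨U, hU, s, rfl⟩ := exists_modGerm _ _ z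
    rw [latStalk_germ] at hz
    have : s = 0 := latVal_injective hU (hz.trans (map_zero _).symm)
    rw [this, map_zero]
  · intro v
    obtain ⟨U, hU, h⟩ := hΛ v
    exact ⟨modGerm _ U _ hU (latMk Λ U v h), latStalk_germ U hU _⟩

/-- The generic fiber of a sheaf isomorphic to `lat Λ` is `V`. -/
lemma exists_fiber_equiv {M : X.Modules} (e : M ≅ lat Λ) (hΛ : Λ.IsFull) :
    ∃ κ : modStalk M (genericPoint X) ≃+ V,
      ∀ (U : X.Opens) (hU : genericPoint X ∈ U) (s : Γ(M, U)),
        κ (modGerm M U _ hU s) = latVal Λ U hU (e.hom.app U s) := by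
  let g : modStalk M (genericPoint X) →+ V :=
    (latStalk Λ).hom.comp (modStalkMap e.hom (genericPoint X))
  have hg : Function.Bijective g := by
    have h1 : IsIso ((TopCat.Presheaf.stalkFunctor Ab.{u} (genericPoint X)).map
        e.hom.mapPresheaf) := by
      have : IsIso e.hom.mapPresheaf :=
        inferInstanceAs (IsIso ((Scheme.Modules.toPresheaf X).map e.hom))
      infer_instance
    exact (latStalk_bijective hΛ).comp (ConcreteCategory.bijective_of_isIso _)
  refine ⟨AddEquiv.ofBijective g hg, fun U hU s ↦ ?_⟩
  change latStalk Λ (modStalkMap e.hom _ (modGerm M U _ hU s)) = _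
  rw [modStalkMap_modGerm, latStalk_germ]

/-- The maps to `V` given by a morphism to `lat Λ`. -/
def LatHom.ofHom {P : X.PresheafOfModules} (f : P ⟶ (lat Λ).val) : LatHom P Λ where
  toFun U hU := (latVal Λ U hU).comp (f.app (op U)).hom.toAddMonoidHom
  map_smul U hU _ s := congrArg (latVal Λ U hU) ((f.app (op U)).hom.map_smul _ s)
  map_res {_ W} i hW s := congrArg (latVal Λ W hW) (PresheafOfModules.naturality_apply f i.op s)
  mem _ _ hx _ := latVal_mem _ _ hx

variable {V₁ V₂ : Type u} [AddCommGroup V₁] [Module X.functionField V₁] [AddCommGroup V₂]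
  [Module X.functionField V₂]

/-- The tensor product of two families of lattices. -/
def Lattice.tensor (Λ₁ : Lattice X V₁) (Λ₂ : Lattice X V₂) :
    Lattice X (V₁ ⊗[X.functionField] V₂) where
  carrier x := AddSubgroup.closure {z | ∃ v ∈ Λ₁.carrier x, ∃ w ∈ Λ₂.carrier x, z = v ⊗ₜ w}
  smul_mem x f v hf hv := by
    induction hv using AddSubgroup.closure_induction with
    | mem z hz =>
      obtain ⟨v, hv, w, hw, rfl⟩ := hz
      exact AddSubgroup.subset_closure ⟨f • v, Λ₁.smul_mem x f v hf hv, w, hw, rfl⟩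
    | zero => rw [smul_zero]; exact zero_mem _
    | add a b _ _ ha hb => rw [smul_add]; exact add_mem ha hb
    | neg a _ ha => rw [smul_neg]; exact neg_mem ha

lemma Lattice.tmul_mem {Λ₁ : Lattice X V₁} {Λ₂ : Lattice X V₂} (x : X) (v : V₁)
    (hv : v ∈ Λ₁.carrier x) (w : V₂) (hw : w ∈ Λ₂.carrier x) :
    v ⊗ₜ w ∈ (Λ₁.tensor Λ₂).carrier x :=
  AddSubgroup.subset_closure ⟨v, hv, w, hw, rfl⟩

/-- Products of local bases form a local basis of the product lattice. -/
lemma Lattice.FreeOn.tensor {ι₁ ι₂ : Type*} [Fintype ι₁] [Fintype ι₂] {Λ₁ : Lattice X V₁}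
    {Λ₂ : Lattice X V₂} {U : X.Opens} {b₁ : Module.Basis ι₁ X.functionField V₁}
    {b₂ : Module.Basis ι₂ X.functionField V₂} (h₁ : Λ₁.FreeOn U b₁) (h₂ : Λ₂.FreeOn U b₂) :
    (Λ₁.tensor Λ₂).FreeOn U (b₁.tensorProduct b₂) := fun y hy v ↦ by
  constructor
  · intro hv
    induction hv using AddSubgroup.closure_induction with
    | mem z hz =>
      obtain ⟨v, hv, w, hw, rfl⟩ := hz
      rintro ⟨i, j⟩
      rw [Module.Basis.tensorProduct_repr_tmul_apply, smul_eq_mul]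
      exact mul_mem ((h₂ y hy w).1 hw j) ((h₁ y hy v).1 hv i)
    | zero => intro i; rw [map_zero]; exact zero_mem _
    | add a b _ _ ha hb => intro i; rw [map_add]; exact add_mem (ha i) (hb i)
    | neg a _ ha => intro i; rw [map_neg]; exact neg_mem (ha i)
  · intro hv
    rw [← (b₁.tensorProduct b₂).sum_repr v]
    refine sum_mem fun i _ ↦ (Λ₁.tensor Λ₂).smul_mem y _ _ (hv i) ?_
    rw [Module.Basis.tensorProduct_apply']
    exact Lattice.tmul_mem y _ (h₁.basis_mem i.1 y hy) _ (h₂.basis_mem i.2 y hy)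

end Fiber

/-! ### The maps `mult` and `can` over the function field -/

section Balanced
variable {R A : Type*} [CommRing R] [Ring A] [Algebra R A]

/-- A quotient of `M ⊗ N` is generated by one element `x_o ⊗ y_o` if `M` and `N` are spanned by
elements `x_i` and `y_j` with `x_i ⊗ y_j = δ_{ij} x_o ⊗ y_o` in the quotient. -/
lemma exists_eq_smul {M N Q : Type*} [AddCommGroup M] [Module R M] [AddCommGroup N] [Module R N]
    [AddCommGroup Q] [Module R Q] (q : M ⊗[R] N →ₗ[R] Q) {ι : Type*} [Fintype ι] [DecidableEq ι]
    (x : ι → M) (y : ι → N) (o : ι)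
    (key : ∀ i j, q (x i ⊗ₜ y j) = (if i = j then (1 : R) else 0) • q (x o ⊗ₜ y o))
    (sx : ∀ s : M, ∃ c : ι → R, s = ∑ i, c i • x i) (sy : ∀ t : N, ∃ c : ι → R, t = ∑ i, c i • y i)
    (z : M ⊗[R] N) : ∃ r : R, q z = r • q (x o ⊗ₜ y o) := by
  induction z using TensorProduct.induction_on with
  | zero => exact ⟨0, by simp⟩
  | add a b ha hb =>
    obtain ⟨r, hr⟩ := ha
    obtain ⟨r', hr'⟩ := hb
    exact ⟨r + r', by rw [map_add, hr, hr', add_smul]⟩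
  | tmul s t =>
    obtain ⟨c, rfl⟩ := sx s
    obtain ⟨d, rfl⟩ := sy t
    refine ⟨∑ i, c i * d i, ?_⟩
    have h1 : (∑ i, c i • x i) ⊗ₜ[R] (∑ i, d i • y i) =
        ∑ i, ∑ j, (c i * d j) • (x i ⊗ₜ[R] y j) := by
      rw [TensorProduct.sum_tmul]
      refine Finset.sum_congr rfl fun i _ ↦ ?_
      rw [TensorProduct.tmul_sum]
      exact Finset.sum_congr rfl fun j _ ↦ TensorProduct.smul_tmul_smul _ _ _ _
    generalize q (x o ⊗ₜ y o) = e at key ⊢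
    rw [h1]
    simp_rw [map_sum, map_smul, key, smul_smul, mul_ite, mul_one, mul_zero, ← Finset.sum_smul,
      Finset.sum_ite_eq, Finset.mem_univ, if_true]

/-- The projection to a quotient of `M ⊗ N`. -/
def tensorQuot {M N : Type*} [AddCommGroup M] [AddCommGroup N] [Module R M] [Module R N]
    (K : Submodule R (M ⊗[R] N)) : M ⊗[R] N →ₗ[R] TensorQuotient K := K.mkQ

lemma tensorQuot_eq {M N : Type*} [AddCommGroup M] [AddCommGroup N] [Module R M] [Module R N]
    {K : Submodule R (M ⊗[R] N)} {z z' : M ⊗[R] N} (h : z - z' ∈ K) :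
    tensorQuot K z = tensorQuot K z' := (Submodule.Quotient.eq _).2 h

/-- The map induced on a quotient of `M ⊗ N`. -/
def tensorLift {M N Q : Type*} [AddCommGroup M] [AddCommGroup N] [Module R M] [Module R N]
    [AddCommGroup Q] [Module R Q] (K : Submodule R (M ⊗[R] N)) (B : M →ₗ[R] N →ₗ[R] Q)
    (h : ∀ z ∈ K, TensorProduct.lift B z = 0) : TensorQuotient K →ₗ[R] Q :=
  K.liftQ (TensorProduct.lift B) h

lemma tensorQuot_surjective {M N : Type*} [AddCommGroup M] [AddCommGroup N] [Module R M]
    [Module R N] (K : Submodule R (M ⊗[R] N)) : Function.Surjective (tensorQuot K) :=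
  K.mkQ_surjective

/-- The reduced trace in a split algebra does not depend on the isomorphism with a matrix algebra. -/
lemma trace_eq_trace {E A : Type*} [Field E] [Ring A] [Algebra E A] {n : ℕ}
    (φ ψ : A ≃ₐ[E] Matrix (Fin n) (Fin n) E) (a : A) : (φ a).trace = (ψ a).trace := by
  let c : Matrix (Fin n) (Fin n) E ≃ₐ[E] Module.End E (Fin n → E) := Matrix.toLinAlgEquiv'
  obtain ⟨T, hT⟩ := AlgEquiv.eq_linearEquivConjAlgEquiv ((c.symm.trans (ψ.symm.trans φ)).trans c)
  have h := AlgEquiv.congr_fun hT (c (ψ a))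
  simp only [AlgEquiv.trans_apply, AlgEquiv.symm_apply_apply] at h
  have h1 (M : Matrix (Fin n) (Fin n) E) : M.trace = LinearMap.trace E _ (c M) :=
    (Matrix.trace_toLin'_eq M).symm
  rw [h1, h1, h]
  exact LinearMap.trace_conj' _ _

end Balanced

section Generic
variable {k D : Type u} [Field k] [DivisionRing D] [Algebra k D] {X : Over (Spec (.of k))}
  [IsIntegral X.left] {n : ℕ} {P : SeveriBrauerVariety k D n X} {σ : D →ₗ[k] D} {U : X.left.Opens}
  (hc : IsCSA k D n) (f : Frame P σ U)

namespace Frame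

/-- All elements of the basis of `σ(T)` are right multiples of a single one by matrix units. -/
lemma s_mul_e (hU : genericPoint X.left ∈ U) (i : Fin n) :
    (f.sBasis hc hU i : FunField X ⊗[k] D) = f.sBasis hc hU f.jw * f.el hc (Matrix.single f.jw i 1) := by
  rw [sBasis_apply, sBasis_apply, ← el_mul, Matrix.vecMulVec_mul]
  congr 2
  ext j
  simp [Matrix.vecMul, Matrix.single_apply, Pi.single_apply, eq_comm]

/-- A matrix unit takes the basis of `T` to one of its members, or to zero. -/
lemma e_mul_t (hU : genericPoint X.left ∈ U) (i j : Fin n) :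
    ((if i = j then f.tBasis hc hU f.jw else 0 : P.T) : FunField X ⊗[k] D) =
      f.el hc (Matrix.single f.jw i 1) * f.tBasis hc hU j := by
  rw [tBasis_apply, ← el_mul, Matrix.mul_vecMulVec]
  split_ifs with h
  · subst h
    rw [tBasis_apply]
    congr 2
    ext a
    simp [Matrix.mulVec, Matrix.single_apply, Pi.single_apply, eq_comm]
  · have : (Matrix.single f.jw i (1 : FunField X)).mulVec (Pi.single j 1) = 0 := by
      ext a
      simp [h]
    rw [this, Matrix.zero_vecMulVec]
    exact (map_zero (splitEquiv hc f.ψ).symm).symm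

lemma s_mul_t (hU : genericPoint X.left ∈ U) :
    (f.sBasis hc hU f.jw : FunField X ⊗[k] D) * f.tBasis hc hU f.jw = f.lBasis hc hU () := by
  rw [tBasis_apply, sBasis_apply, lBasis_apply, ← el_mul, Matrix.vecMulVec_mul_vecMulVec]
  congr 2
  simp

end Frame

lemma sigmaT_mul_T (f : Frame P σ U) (hU : genericPoint X.left ∈ U)
    (s : P.sigmaT σ) (t : P.T) : (s * t : FunField X ⊗[k] D) ∈ P.L σ := by
  obtain ⟨a, ha⟩ := (f.mem_sigmaT _).1 s.2
  obtain ⟨v, hv⟩ := (f.mem_T _).1 t.2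
  refine (f.mem_L hU _).2 ⟨a ⬝ᵥ v, ?_⟩
  rw [map_mul, ha, hv, Matrix.vecMulVec_mul_vecMulVec, Matrix.vecMulVec_smul]

variable (P σ) in
/-- The map `σ(T) ⊗_{D_F} T → L`, `s ⊗ t ↦ s t`. -/
lemma exists_mult (hc : IsCSA k D n) (f : Frame P σ U) (hU : genericPoint X.left ∈ U) :
    ∃ mult : BalancedTensor (P.sigmaT σ) P.T ≃ₗ[FunField X] P.L σ,
      ∀ (s : P.sigmaT σ) (t : P.T), (mult (BalancedTensor.tmul s t) : FunField X ⊗[k] D) = s * t := by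
  let B : P.sigmaT σ →ₗ[FunField X] P.T →ₗ[FunField X] P.L σ :=
    LinearMap.mk₂ _ (fun s t ↦ ⟨s * t, sigmaT_mul_T f hU s t⟩)
      (fun _ _ _ ↦ Subtype.ext (add_mul _ _ _)) (fun _ _ _ ↦ Subtype.ext (smul_mul_assoc _ _ _))
      (fun _ _ _ ↦ Subtype.ext (mul_add _ _ _)) (fun _ _ _ ↦ Subtype.ext (mul_smul_comm _ _ _))
  let m : BalancedTensor (P.sigmaT σ) P.T →ₗ[FunField X] P.L σ :=
    tensorLift (balancedRel (P.sigmaT σ) P.T) B fun z hz ↦ by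
      induction hz using Submodule.span_induction with
      | mem z hz =>
        obtain ⟨x, x', y, y', a, h, h', rfl⟩ := hz
        rw [map_sub, TensorProduct.lift.tmul, TensorProduct.lift.tmul, sub_eq_zero]
        refine Subtype.ext ?_
        change (x' * y : FunField X ⊗[k] D) = x * y'
        rw [h, h', mul_assoc]
      | zero => rw [map_zero]
      | add a b _ _ ha hb => rw [map_add, ha, hb, add_zero]
      | smul r a _ ha => rw [map_smul, ha, smul_zero]
  have hm (s : P.sigmaT σ) (t : P.T) :
      (m (BalancedTensor.tmul s t) : FunField X ⊗[k] D) = s * t := rfl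
  have h0 : m (BalancedTensor.tmul (f.sBasis hc hU f.jw) (f.tBasis hc hU f.jw)) =
      f.lBasis hc hU () := Subtype.ext (f.s_mul_t hc hU)
  -- Matrix units move every tensor to a multiple of a single one, so that the source is at most
  -- one-dimensional.
  have hz (z : BalancedTensor (P.sigmaT σ) P.T) : ∃ r : FunField X,
      z = r • BalancedTensor.tmul (f.sBasis hc hU f.jw) (f.tBasis hc hU f.jw) := by
    obtain ⟨z, rfl⟩ := tensorQuot_surjective _ z
    refine exists_eq_smul (tensorQuot (balancedRel (P.sigmaT σ) P.T)) (f.sBasis hc hU)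
      (f.tBasis hc hU) f.jw (fun i j ↦ ?_) (fun s ↦ ⟨_, ((f.sBasis hc hU).sum_repr s).symm⟩)
      (fun s ↦ ⟨_, ((f.tBasis hc hU).sum_repr s).symm⟩) z
    rw [← map_smul]
    refine tensorQuot_eq (Submodule.subset_span
        ⟨f.sBasis hc hU f.jw, f.sBasis hc hU i, f.tBasis hc hU j, _,
        f.el hc (Matrix.single f.jw i 1), f.s_mul_e hc hU i, f.e_mul_t hc hU i j, ?_⟩)
    split_ifs <;> simp
  refine ⟨LinearEquiv.ofBijective m ⟨?_, fun l ↦ ?_⟩, hm⟩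
  · rw [← LinearMap.ker_eq_bot, LinearMap.ker_eq_bot']
    intro z h
    obtain ⟨r, rfl⟩ := hz z
    rw [map_smul, h0] at h
    rw [(smul_eq_zero.1 h).resolve_right ((f.lBasis hc hU).ne_zero ()), zero_smul]
  · refine ⟨(f.lBasis hc hU).repr l () •
      BalancedTensor.tmul (f.sBasis hc hU f.jw) (f.tBasis hc hU f.jw), ?_⟩
    rw [map_smul, h0]
    simpa using (f.lBasis hc hU).sum_repr l

lemma Frame.hasReducedTrace_iff (hc : IsCSA k D n) (f : Frame P σ U) (a : FunField X ⊗[k] D)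
    (e : FunField X) : HasReducedTrace n a e ↔ (liftHom f.ψ a).trace = e := by
  constructor
  · rintro ⟨φ, h⟩
    rw [← h]
    exact trace_eq_trace (splitEquiv hc f.ψ) φ a
  · exact fun h ↦ ⟨splitEquiv hc f.ψ, h⟩

/-- An element `m` with `Trd(l m) = 1`, where `l` is the generator of `L` given by the frame. -/
lemma Frame.exists_trace_eq_one (hU : genericPoint X.left ∈ U) : ∃ m : FunField X ⊗[k] D,
    HasReducedTrace n ((f.lBasis hc hU () : FunField X ⊗[k] D) * m) (1 : FunField X) := by
  refine ⟨f.el hc (Matrix.single f.jw f.ju (f.w f.jw * f.u f.ju)⁻¹), ?_⟩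
  rw [f.hasReducedTrace_iff hc, map_mul, lBasis_apply, liftHom_el, liftHom_el]
  have h := mul_ne_zero (f.w_ne_zero hU) (f.u_ne_zero hU)
  rw [Matrix.vecMulVec_mul, Matrix.trace_vecMulVec]
  simp only [dotProduct, Matrix.vecMul, Matrix.single_apply]
  rw [Finset.sum_eq_single f.ju]
  · rw [Finset.sum_eq_single f.jw]
    · simp only [and_self, if_true]
      rw [← mul_assoc, mul_comm (f.u f.ju), mul_inv_cancel₀ h]
    · intro b _ hb
      simp [hb.symm]
    · simp
  · intro b _ hb
    simp [hb.symm]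
  · simp

/-- For `Trd(l m) = 1`, the map `t ⊗ s ↦ l ⊗ t m s` sends the basis of `T ⊗ σ(T)` given by a frame to
the basis of `L ⊗ D_F` given by it. -/
lemma Frame.tmul_eq (hU : genericPoint X.left ∈ U) (l : P.L σ) (m : FunField X ⊗[k] D)
    (h : HasReducedTrace n ((l : FunField X ⊗[k] D) * m) (1 : FunField X)) (i j : Fin n) :
    l ⊗ₜ[FunField X] ((f.tBasis hc hU i : FunField X ⊗[k] D) * m * f.sBasis hc hU j) =
      f.lBasis hc hU () ⊗ₜ f.azBasis hc (i, j) := by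
  rw [f.hasReducedTrace_iff hc] at h
  have hl : l = (f.lBasis hc hU).repr l () • f.lBasis hc hU () := by
    simpa using ((f.lBasis hc hU).sum_repr l).symm
  generalize (f.lBasis hc hU).repr l () = c at hl
  subst hl
  rw [TensorProduct.smul_tmul]
  congr 1
  apply (bijective_liftHom hc f.ψ).1
  rw [map_smul, map_mul, map_mul, tBasis_apply, sBasis_apply, azBasis_apply, liftHom_el, liftHom_el,
    liftHom_el]
  rw [Submodule.coe_smul, smul_mul_assoc, map_smul, map_mul, lBasis_apply, liftHom_el,
    Matrix.trace_smul, Matrix.vecMulVec_mul, Matrix.trace_vecMulVec] at h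
  rw [Matrix.vecMulVec_mul, Matrix.vecMulVec_mul_vecMulVec, dotProduct_comm]
  ext a b
  rw [Matrix.smul_apply, Matrix.vecMulVec_apply, Matrix.single_apply]
  simp only [Pi.smul_apply, smul_eq_mul, Pi.single_apply] at h ⊢
  by_cases hi : i = a <;> by_cases hj : j = b <;> simp [hi, hj, eq_comm, h]

variable (P σ) in
/-- The map `T ⊗ σ(T) → L ⊗ D_F`, `t ⊗ s ↦ l ⊗ t m s`, where `Trd(l m) = 1`. -/
lemma exists_can (hc : IsCSA k D n) (f : Frame P σ U) (hU : genericPoint X.left ∈ U) :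
    ∃ can : (P.T ⊗[FunField X] P.sigmaT σ) ≃ₗ[FunField X]
        (P.L σ ⊗[FunField X] (FunField X ⊗[k] D)),
      ∀ (l : P.L σ) (m : FunField X ⊗[k] D),
        HasReducedTrace n ((l : FunField X ⊗[k] D) * m) (1 : FunField X) →
        ∀ (t : P.T) (s : P.sigmaT σ), can (t ⊗ₜ s) = l ⊗ₜ ((t : FunField X ⊗[k] D) * m * s) := by
  let can := ((f.tBasis hc hU).tensorProduct (f.sBasis hc hU)).equiv
    ((f.lBasis hc hU).tensorProduct (f.azBasis hc)) (Equiv.uniqueProd _ Unit).symm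
  refine ⟨can, fun l m h t s ↦ ?_⟩
  let B : P.T →ₗ[FunField X] P.sigmaT σ →ₗ[FunField X] (P.L σ ⊗[FunField X] (FunField X ⊗[k] D)) :=
    LinearMap.mk₂ _ (fun t s ↦ l ⊗ₜ ((t : FunField X ⊗[k] D) * m * s))
      (fun _ _ _ ↦ by simp only [Submodule.coe_add, add_mul, TensorProduct.tmul_add])
      (fun _ _ _ ↦ by simp only [Submodule.coe_smul, smul_mul_assoc, TensorProduct.tmul_smul])
      (fun _ _ _ ↦ by simp only [Submodule.coe_add, mul_add, TensorProduct.tmul_add])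
      (fun _ _ _ ↦ by simp only [Submodule.coe_smul, mul_smul_comm, TensorProduct.tmul_smul])
  have : (TensorProduct.mk _ _ _).compr₂ can.toLinearMap = B := by
    refine (f.tBasis hc hU).ext fun i ↦ (f.sBasis hc hU).ext fun j ↦ ?_
    refine Eq.trans ?_ (f.tmul_eq hc hU l m h i j).symm
    change can (f.tBasis hc hU i ⊗ₜ f.sBasis hc hU j) = _
    rw [← Module.Basis.tensorProduct_apply, Module.Basis.equiv_apply]
    exact Module.Basis.tensorProduct_apply _ _ _ _
  exact LinearMap.congr_fun (LinearMap.congr_fun this t) s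

end Generic

lemma Lattice.FreeOn.reindex {X : Scheme.{u}} [IsIntegral X] {V : Type u} [AddCommGroup V]
    [Module X.functionField V] {Λ : Lattice X V} {ι ι' : Type*} {U : X.Opens}
    {b : Module.Basis ι X.functionField V} (h : Λ.FreeOn U b) (e : ι ≃ ι') :
    Λ.FreeOn U (b.reindex e) := fun y hy v ↦ by
  rw [h y hy v]
  simp only [Module.Basis.repr_reindex_apply]
  exact (e.symm.forall_congr_right (q := fun i ↦ b.repr v i ∈ reg y)).symm

/-! ### The isomorphisms of sheaves -/

section SheafIso
variable {k D : Type u} [Field k] [DivisionRing D] [Algebra k D] [FiniteDimensional k D]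
  {X : Over (Spec (.of k))}
  [IsIntegral X.left] {n : ℕ} {P : SeveriBrauerVariety k D n X} {σ : D →ₗ[k] D} {U : X.left.Opens}

omit [FiniteDimensional k D] in
lemma mul_mem_azLat {x : X.left} {a b : FunField X ⊗[k] D} (ha : a ∈ (azLat D X).carrier x)
    (hb : b ∈ (azLat D X).carrier x) : a * b ∈ (azLat D X).carrier x := by
  obtain ⟨a, rfl⟩ := ha
  obtain ⟨b, rfl⟩ := hb
  exact ⟨a * b, map_mul (extD D (toF x)) a b⟩

/-- The multiplication `σ(T) × T → L`. -/
def mulBilin (f : Frame P σ U) (hU : genericPoint X.left ∈ U) :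
    P.sigmaT σ →ₗ[FunField X] P.T →ₗ[FunField X] P.L σ :=
  LinearMap.mk₂ _ (fun s t ↦ ⟨s * t, sigmaT_mul_T f hU s t⟩)
    (fun _ _ _ ↦ Subtype.ext (add_mul _ _ _)) (fun _ _ _ ↦ Subtype.ext (smul_mul_assoc _ _ _))
    (fun _ _ _ ↦ Subtype.ext (mul_add _ _ _)) (fun _ _ _ ↦ Subtype.ext (mul_smul_comm _ _ _))

/-- The multiplication of sections. -/
def mulLatHom (f : Frame P σ U) (hU : genericPoint X.left ∈ U) :
    LatHom (tensorPresheaf (P.sheafSigmaT σ) P.sheafT) (interLat (P.L σ)) :=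
  LatHom.tensor (interHom (P.sigmaT σ)) (interHom P.T) (mulBilin f hU)
    fun _ _ hv _ hw ↦ mul_mem_azLat hv hw

/-- The multiplication of sections kills the relations `x a ⊗ y - x ⊗ a y`. -/
lemma ι_mulLatHom (f : Frame P σ U) (hU : genericPoint X.left ∈ U) :
    (balancedSubmodule (P.sigmaT σ) P.T).ι ≫ (mulLatHom f hU).hom = 0 := by
  ext W s
  refine Subtype.ext (funext fun x ↦ ?_)
  have hW := genericPoint_mem x.2
  change (mulLatHom f hU).toFun W.unop hW s.1 = 0
  have hs : s.1 ∈ balancedRel (R := Γ(X.left, W.unop)) (A := Sec D X W.unop)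
    ((interSubmodule X (genericPoint X.left) (P.sigmaT σ)).obj W)
    ((interSubmodule X (genericPoint X.left) P.T).obj W) := s.2
  generalize s.1 = z at hs
  induction hs using Submodule.span_induction with
  | mem z hz =>
    obtain ⟨x, x', y, y', a, h, h', rfl⟩ := hz
    refine (map_sub ((mulLatHom f hU).toFun W.unop hW) _ _).trans (sub_eq_zero.2 (Subtype.ext ?_))
    change germD D X W.unop _ hW x'.1 * germD D X W.unop _ hW y.1 =
      germD D X W.unop _ hW x.1 * germD D X W.unop _ hW y'.1
    rw [← map_mul, ← map_mul, h, h', mul_assoc]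
  | zero => exact map_zero ((mulLatHom f hU).toFun W.unop hW)
  | add a b _ _ ha hb =>
    exact (map_add ((mulLatHom f hU).toFun W.unop hW) _ _).trans (by rw [ha, hb, add_zero])
  | smul r a _ ha =>
    exact ((mulLatHom f hU).map_smul W.unop hW r a).trans (by rw [ha, smul_zero])

/-- The multiplication of sections, on the quotient by the relations `x a ⊗ y = x ⊗ a y`. -/
def balLatHom (f : Frame P σ U) (hU : genericPoint X.left ∈ U) :
    LatHom (Limits.cokernel (balancedSubmodule (P.sigmaT σ) P.T).ι) (interLat (P.L σ)) :=
  LatHom.ofHom (Limits.cokernel.desc _ (mulLatHom f hU).hom (ι_mulLatHom f hU))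

lemma balLatHom_π (f : Frame P σ U) (hU : genericPoint X.left ∈ U) (W : X.left.Opens)
    (hW : genericPoint X.left ∈ W)
    (z : (tensorPresheaf (P.sheafSigmaT σ) P.sheafT).obj (op W)) :
    (balLatHom f hU).toFun W hW
      ((Limits.cokernel.π (balancedSubmodule (P.sigmaT σ) P.T).ι).app (op W) z) =
      (mulLatHom f hU).toFun W hW z := by
  have h := Limits.cokernel.π_desc (balancedSubmodule (P.sigmaT σ) P.T).ι (mulLatHom f hU).hom
    (ι_mulLatHom f hU)
  have h1 := congrArg (fun g : tensorPresheaf (P.sheafSigmaT σ) P.sheafT ⟶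
    (lat (interLat (P.L σ))).val ↦ latVal (interLat (P.L σ)) W hW (g.app (op W) z)) h
  exact h1

lemma π_eq {W : X.left.Opens} {z z' : (tensorPresheaf (P.sheafSigmaT σ) P.sheafT).obj (op W)}
    (h : z - z' ∈ (balancedSubmodule (P.sigmaT σ) P.T).obj (op W)) :
    (Limits.cokernel.π (balancedSubmodule (P.sigmaT σ) P.T).ι).app (op W) z =
      (Limits.cokernel.π (balancedSubmodule (P.sigmaT σ) P.T).ι).app (op W) z' := by
  rw [← sub_eq_zero, ← map_sub]
  have h1 := congrArg (fun g : (balancedSubmodule (P.sigmaT σ) P.T).toPresheafOfModules ⟶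
    Limits.cokernel (balancedSubmodule (P.sigmaT σ) P.T).ι ↦ g.app (op W) ⟨_, h⟩)
    (Limits.cokernel.condition (balancedSubmodule (P.sigmaT σ) P.T).ι)
  exact h1

/-- Over the domain of a frame with distinguished index `j`, the balanced relations with matrix units
reduce every tensor to a multiple of `s_j ⊗ t_j`, whose product is the generator `u w` of `ℒ`. -/
lemma bijOn_balLatHom (hc : IsCSA k D n) (g : Frame P σ U) (hη : genericPoint X.left ∈ U)
    {W : X.left.Opens} (f : Frame P σ W) : (balLatHom g hη).BijOn W := by
  by_cases hW : genericPoint X.left ∈ W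
  swap
  · exact fun h ↦ (hW h).elim
  obtain ⟨x, hx, sx⟩ := (bijOn_interHom (P.sigmaT σ) W).exists_span (f.freeOn_sigmaT hc hW) hW
  obtain ⟨y, hy, sy⟩ := (bijOn_interHom P.T W).exists_span (f.freeOn_T hc hW) hW
  have he (i : Fin n) : ∃ e : Sec D X W, germD D X W _ hW e =
      f.el hc (Matrix.single f.jw i 1) := exists_germD hW fun z hz ↦ by
    rw [← f.azBasis_apply hc (f.jw, i)]
    exact (f.freeOn_az hc).basis_mem _ z hz
  choose e he using he
  let p := (Limits.cokernel.π (balancedSubmodule (P.sigmaT σ) P.T).ι).app (op W)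
  let Q := (Limits.cokernel (balancedSubmodule (P.sigmaT σ) P.T).ι).obj (op W)
  let _ : Module Γ(X.left, W) Q := inferInstanceAs (Module (X.left.ringCatSheaf.obj.obj (op W)) Q)
  let q : Γ(P.sheafSigmaT σ, W) ⊗[Γ(X.left, W)] Γ(P.sheafT, W) →ₗ[Γ(X.left, W)] Q := p.hom
  let x' (i : Fin n) : Γ(P.sheafSigmaT σ, W) := x i
  let y' (i : Fin n) : Γ(P.sheafT, W) := y i
  have hx' (i) : germD D X W _ hW (x' i).1 = f.sBasis hc hW i := congrArg Subtype.val (hx i)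
  have hy' (i) : germD D X W _ hW (y' i).1 = f.tBasis hc hW i := congrArg Subtype.val (hy i)
  refine LatHom.BijOn.of_span (f.freeOn_L hc hW) (fun _ ↦ q (x' f.jw ⊗ₜ y' f.jw)) (fun _ _ ↦ ?_)
    fun s ↦ ?_
  · refine (balLatHom_π g hη W hW _).trans (Subtype.ext ?_)
    refine Eq.trans ?_ (f.s_mul_t hc hW)
    exact congrArg₂ (· * ·) (hx' _) (hy' _)
  · obtain ⟨z, rfl⟩ := PresheafOfModules.surjective_of_epi
      (Limits.cokernel.π (balancedSubmodule (P.sigmaT σ) P.T).ι) (op W) s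
    -- The relation that moves the matrix unit from the `i`-th element of `σ(𝒯)` to the `j`-th element
    -- of `𝒯`.
    have key (i j : Fin n) : q (x' i ⊗ₜ[Γ(X.left, W)] y' j) =
        (if i = j then (1 : Γ(X.left, W)) else 0) • q (x' f.jw ⊗ₜ[Γ(X.left, W)] y' f.jw) := by
      let y₀ : Γ(P.sheafT, W) := if i = j then y' f.jw else 0
      have h₀ : (if i = j then (1 : Γ(X.left, W)) else 0) • (x' f.jw ⊗ₜ[Γ(X.left, W)] y' f.jw) =
          x' f.jw ⊗ₜ y₀ := by
        dsimp only [y₀]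
        split_ifs
        · rw [one_smul]
        · rw [zero_smul, TensorProduct.tmul_zero]
      have h₁ : germD D X W _ hW y₀.1 =
          ((if i = j then f.tBasis hc hW f.jw else 0 : P.T) : FunField X ⊗[k] D) := by
        dsimp only [y₀]
        split_ifs
        · exact hy' _
        · exact map_zero (germD D X W _ hW)
      rw [← map_smul q, h₀]
      have hr : x' i ⊗ₜ[Γ(X.left, W)] y' j - x' f.jw ⊗ₜ[Γ(X.left, W)] y₀ ∈
          balancedRel (R := Γ(X.left, W)) (A := Sec D X W)
            ((interSubmodule X (genericPoint X.left) (P.sigmaT σ)).obj (op W))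
            ((interSubmodule X (genericPoint X.left) P.T).obj (op W)) := by
        refine Submodule.subset_span ⟨x' f.jw, x' i, y' j, y₀, e i, ?_, ?_, rfl⟩
        · apply germD_injective W hW
          rw [map_mul, hx', hx', he]
          exact f.s_mul_e hc hW i
        · apply germD_injective W hW
          rw [map_mul, hy', he, ← f.e_mul_t hc hW i j]
          exact h₁
      exact π_eq hr
    obtain ⟨r, hr⟩ := exists_eq_smul q x' y' f.jw key sx sy z
    refine ⟨fun _ ↦ r, ?_⟩
    rw [Fintype.sum_unique]
    exact hr

/-- The identification of `σ(𝒯) ⊗_𝒟 𝒯` with a sheaf of lattices in `L`. -/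
lemma exists_balanced_iso (hc : IsCSA k D n) (hσ : IsInvolution σ) (g : Frame P σ U)
    (hη : genericPoint X.left ∈ U) :
    ∃ e : balancedTensor (P.sigmaT σ) P.T ≅ lat (interLat (P.L σ)),
      ∀ (W : X.left.Opens) (hW : genericPoint X.left ∈ W) (s : Γ(P.sheafSigmaT σ, W))
        (t : Γ(P.sheafT, W)),
        (latVal (interLat (P.L σ)) W hW (e.hom.app W (balancedTmul (P.sigmaT σ) P.T W s t)) : FunField X ⊗[k] D) =
          interGerm _ W hW s * interGerm _ W hW t := by
  obtain ⟨e, he⟩ := (balLatHom g hη).exists_iso_of_forall_bijOn fun x ↦ by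
    obtain ⟨V, hV, ⟨f⟩⟩ := exists_frame hc hσ x
    exact ⟨V, hV, fun W hW ↦ bijOn_balLatHom hc g hη (f.res hW)⟩
  refine ⟨e, fun W hW s t ↦ ?_⟩
  let z : Γ(P.sheafSigmaT σ, W) ⊗[Γ(X.left, W)] Γ(P.sheafT, W) := s ⊗ₜ[Γ(X.left, W)] t
  exact congrArg Subtype.val ((he W hW _).trans (balLatHom_π g hη W hW z))

lemma exists_inter_iso (W : Submodule (FunField X) (FunField X ⊗[k] D)) :
    ∃ e : interGen W ≅ lat (interLat W),
      ∀ (V : X.left.Opens) (hV : genericPoint X.left ∈ V) (s : Γ(interGen W, V)),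
        latVal _ V hV (e.hom.app V s) = interGerm _ V hV s :=
  (interHom W).exists_iso' fun V _ hx ↦ ⟨V, le_rfl, hx, bijOn_interHom W V⟩

/-- The identification of `ℒ ⊗ 𝒟` with a sheaf of lattices. -/
lemma exists_tensor_az_iso (hc : IsCSA k D n) (hσ : IsInvolution σ) :
    ∃ e : tensor (P.sheafL σ) (azumaya D X) ≅ lat ((interLat (P.L σ)).tensor (azLat D X)),
      ∀ (W : X.left.Opens) (hW : genericPoint X.left ∈ W) (s : Γ(P.sheafL σ, W))
        (t : Γ(azumaya D X, W)),
        latVal _ W hW (e.hom.app W (tmul (P.sheafL σ) (azumaya D X) W s t)) =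
          interGerm _ W hW s ⊗ₜ azumayaGerm W hW t := by
  let θ := LatHom.tensor (Λ := (interLat (P.L σ)).tensor (azLat D X)) (interHom (P.L σ))
    (azHom D X) (TensorProduct.mk _ _ _) Lattice.tmul_mem
  obtain ⟨e, he⟩ := θ.exists_iso_of_forall_bijOn fun x ↦ by
    obtain ⟨V, hV, ⟨f⟩⟩ := exists_frame (P := P) hc hσ x
    refine ⟨V, hV, fun W hW hη ↦ ?_⟩
    have f' := f.res hW
    exact LatHom.bijOn_tensor hη (bijOn_interHom _ W) (bijOn_azHom W) (f'.freeOn_L hc hη)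
      (f'.freeOn_az hc) ((f'.freeOn_L hc hη).tensor (f'.freeOn_az hc))
      (fun i j ↦ (Module.Basis.tensorProduct_apply _ _ _ _).symm) hη
  exact ⟨e, fun W hW s t ↦ he W hW _⟩

/-- The identification of `𝒯 ⊗ σ(𝒯)` with a sheaf of lattices. -/
lemma exists_tensor_T_iso (hc : IsCSA k D n) (hσ : IsInvolution σ)
    (can : (P.T ⊗[FunField X] P.sigmaT σ) ≃ₗ[FunField X]
        (P.L σ ⊗[FunField X] (FunField X ⊗[k] D)))
    (hcan : ∀ (l : P.L σ) (m : FunField X ⊗[k] D),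
        HasReducedTrace n ((l : FunField X ⊗[k] D) * m) (1 : FunField X) →
        ∀ (t : P.T) (s : P.sigmaT σ), can (t ⊗ₜ s) = l ⊗ₜ ((t : FunField X ⊗[k] D) * m * s)) :
    ∃ e : tensor P.sheafT (P.sheafSigmaT σ) ≅ lat ((interLat (P.L σ)).tensor (azLat D X)),
      ∀ (W : X.left.Opens) (hW : genericPoint X.left ∈ W) (s : Γ(P.sheafT, W))
        (t : Γ(P.sheafSigmaT σ, W)),
        latVal _ W hW (e.hom.app W (tmul P.sheafT (P.sheafSigmaT σ) W s t)) =
          can (interGerm _ W hW s ⊗ₜ interGerm _ W hW t) := by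
  -- The map `can` takes products of local bases to products of local bases.
  have key {V : X.left.Opens} (f : Frame P σ V) (hV : genericPoint X.left ∈ V) (i j : Fin n) :
      can (f.tBasis hc hV i ⊗ₜ f.sBasis hc hV j) = f.lBasis hc hV () ⊗ₜ f.azBasis hc (i, j) := by
    obtain ⟨m, hm⟩ := f.exists_trace_eq_one hc hV
    rw [hcan _ m hm]
    exact f.tmul_eq hc hV _ m hm i j
  let b {V : X.left.Opens} (f : Frame P σ V) (hV : genericPoint X.left ∈ V) :
      Module.Basis (Fin n × Fin n) (FunField X) (P.L σ ⊗[FunField X] (FunField X ⊗[k] D)) :=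
    ((f.lBasis hc hV).tensorProduct (f.azBasis hc)).reindex (Equiv.uniqueProd _ Unit)
  have hb {V : X.left.Opens} (f : Frame P σ V) (hV : genericPoint X.left ∈ V) :
      ((interLat (P.L σ)).tensor (azLat D X)).FreeOn V (b f hV) := ((f.freeOn_L hc hV).tensor (f.freeOn_az hc)).reindex _
  have hb' {V : X.left.Opens} (f : Frame P σ V) (hV : genericPoint X.left ∈ V) (i j : Fin n) :
      can (f.tBasis hc hV i ⊗ₜ f.sBasis hc hV j) = b f hV (i, j) := by
    rw [key, Module.Basis.reindex_apply]
    exact (Module.Basis.tensorProduct_apply _ _ _ _).symm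
  let θ := LatHom.tensor (Λ := (interLat (P.L σ)).tensor (azLat D X)) (interHom P.T)
    (interHom (P.sigmaT σ)) ((TensorProduct.mk _ _ _).compr₂ can.toLinearMap) fun x v hv w hw ↦ by
      obtain ⟨V, hV, ⟨f⟩⟩ := exists_frame (P := P) hc hσ x
      have hη := genericPoint_mem hV
      change can (v ⊗ₜ w) ∈ _
      have hv' := (f.freeOn_T hc hη x hV v).1 hv
      have hw' := (f.freeOn_sigmaT hc hη x hV w).1 hw
      rw [← (f.tBasis hc hη).sum_repr v, ← (f.sBasis hc hη).sum_repr w, TensorProduct.sum_tmul,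
        map_sum]
      refine sum_mem fun i _ ↦ ?_
      rw [TensorProduct.tmul_sum, map_sum]
      refine sum_mem fun j _ ↦ ?_
      rw [TensorProduct.smul_tmul_smul, map_smul, hb']
      exact Lattice.smul_mem _ x _ _ (mul_mem (hv' i) (hw' j)) ((hb f hη).basis_mem _ x hV)
  obtain ⟨e, he⟩ := θ.exists_iso_of_forall_bijOn fun x ↦ by
    obtain ⟨V, hV, ⟨f⟩⟩ := exists_frame (P := P) hc hσ x
    refine ⟨V, hV, fun W hW hη ↦ ?_⟩
    have f' := f.res hW
    exact LatHom.bijOn_tensor hη (bijOn_interHom _ W) (bijOn_interHom _ W) (f'.freeOn_T hc hη)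
      (f'.freeOn_sigmaT hc hη) (hb f' hη) (hb' f' hη) hη
  exact ⟨e, fun W hW s t ↦ he W hW _⟩

end SheafIso

/-- Two isomorphisms to the same sheaf of lattices induce compatible identifications of the generic
fibers. -/
lemma fiber_equiv_comp {X : Scheme.{u}} [IsIntegral X] {V : Type u} [AddCommGroup V]
    [Module X.functionField V] {Λ : Lattice X V} {M N : X.Modules} (e : M ≅ lat Λ) (e' : N ≅ lat Λ)
    {κ : modStalk M (genericPoint X) ≃+ V} {κ' : modStalk N (genericPoint X) ≃+ V}
    (hκ : ∀ (U : X.Opens) (hU : genericPoint X ∈ U) (s : Γ(M, U)),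
      κ (modGerm M U _ hU s) = latVal Λ U hU (e.hom.app U s))
    (hκ' : ∀ (U : X.Opens) (hU : genericPoint X ∈ U) (s : Γ(N, U)),
      κ' (modGerm N U _ hU s) = latVal Λ U hU (e'.hom.app U s)) (z) :
    κ' (modStalkMap (e ≪≫ e'.symm).hom (genericPoint X) z) = κ z := by
  obtain ⟨U, hU, s, rfl⟩ := exists_modGerm _ _ z
  rw [modStalkMap_modGerm, hκ, hκ']
  have h := congrArg (fun g : lat Λ ⟶ lat Λ ↦ latVal Λ U hU (g.app U (e.hom.app U s)))
    e'.inv_hom_id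
  exact h

variable {k D : Type u} [Field k] [DivisionRing D] [Algebra k D] [FiniteDimensional k D]
  {X : Over (Spec (.of k))} [IsIntegral X.left] {n : ℕ}

set_option maxHeartbeats 2000000 in
/-- The isomorphisms `mult` and `can`, over the function field and over `X`. -/
lemma exists_mult_can (P : SeveriBrauerVariety k D n X) {σ : D →ₗ[k] D} (hc : IsCSA k D n)
    (hσ : IsInvolution σ) :
      ∃ (mult : BalancedTensor (P.sigmaT σ) P.T ≃ₗ[FunField X] P.L σ)
        (can : (P.T ⊗[FunField X] P.sigmaT σ) ≃ₗ[FunField X]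
          (P.L σ ⊗[FunField X] (FunField X ⊗[k] D))),
        (∀ (s : P.sigmaT σ) (t : P.T),
          (mult (BalancedTensor.tmul s t) : FunField X ⊗[k] D) = s * t) ∧
        (∃ (l : P.L σ) (m : FunField X ⊗[k] D),
          HasReducedTrace n ((l : FunField X ⊗[k] D) * m) (1 : FunField X)) ∧
        (∀ (l : P.L σ) (m : FunField X ⊗[k] D),
          HasReducedTrace n ((l : FunField X ⊗[k] D) * m) (1 : FunField X) →
          ∀ (t : P.T) (s : P.sigmaT σ),
            can (t ⊗ₜ s) = l ⊗ₜ ((t : FunField X ⊗[k] D) * m * s)) ∧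
        ∃ (multX : balancedTensor (P.sigmaT σ) P.T ≅ P.sheafL σ)
          (canX : tensor P.sheafT (P.sheafSigmaT σ) ≅ tensor (P.sheafL σ) (azumaya D X))
          (κ₁ : modStalk (balancedTensor (P.sigmaT σ) P.T) (genericPoint X.left) ≃+
            BalancedTensor (P.sigmaT σ) P.T)
          (κ₂ : modStalk (P.sheafL σ) (genericPoint X.left) ≃+ P.L σ)
          (κ₃ : modStalk (tensor P.sheafT (P.sheafSigmaT σ)) (genericPoint X.left) ≃+
            P.T ⊗[FunField X] P.sigmaT σ)
          (κ₄ : modStalk (tensor (P.sheafL σ) (azumaya D X)) (genericPoint X.left) ≃+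
            P.L σ ⊗[FunField X] (FunField X ⊗[k] D)),
          (∀ (U : X.left.Opens) (hU : genericPoint X.left ∈ U)
            (s : Γ(P.sheafSigmaT σ, U)) (t : Γ(P.sheafT, U)),
            κ₁ (modGerm _ U _ hU (balancedTmul (P.sigmaT σ) P.T U s t)) =
              BalancedTensor.tmul (interGerm _ U hU s) (interGerm _ U hU t)) ∧
          (∀ (U : X.left.Opens) (hU : genericPoint X.left ∈ U) (s : Γ(P.sheafL σ, U)),
            κ₂ (modGerm _ U _ hU s) = interGerm _ U hU s) ∧
          (∀ (U : X.left.Opens) (hU : genericPoint X.left ∈ U)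
            (t : Γ(P.sheafT, U)) (s : Γ(P.sheafSigmaT σ, U)),
            κ₃ (modGerm _ U _ hU (tmul P.sheafT (P.sheafSigmaT σ) U t s)) =
              interGerm _ U hU t ⊗ₜ interGerm _ U hU s) ∧
          (∀ (U : X.left.Opens) (hU : genericPoint X.left ∈ U)
            (l : Γ(P.sheafL σ, U)) (a : Γ(azumaya D X, U)),
            κ₄ (modGerm _ U _ hU (tmul (P.sheafL σ) (azumaya D X) U l a)) =
              interGerm _ U hU l ⊗ₜ azumayaGerm U hU a) ∧
          (∀ z, κ₂ (modStalkMap multX.hom (genericPoint X.left) z) = mult (κ₁ z)) ∧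
          (∀ z, κ₄ (modStalkMap canX.hom (genericPoint X.left) z) = can (κ₃ z)) := by
  obtain ⟨U, hη, ⟨f⟩⟩ := exists_frame (P := P) hc hσ (genericPoint X.left)
  obtain ⟨mult, hmult⟩ := exists_mult P σ hc f hη
  obtain ⟨can, hcan⟩ := exists_can P σ hc f hη
  -- The two sides of each isomorphism are the same sheaf of lattices, up to `mult` and `can`.
  obtain ⟨e₁, h₁⟩ := exists_balanced_iso hc hσ f hη
  obtain ⟨e₂, h₂⟩ := exists_inter_iso (P.L σ)
  obtain ⟨e₃, h₃⟩ := exists_tensor_T_iso hc hσ can hcan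
  obtain ⟨e₄, h₄⟩ := exists_tensor_az_iso (P := P) hc hσ
  have fL := (f.freeOn_L hc hη).isFull hη
  have fA := ((f.freeOn_L hc hη).tensor (f.freeOn_az hc)).isFull hη
  obtain ⟨κ₁, k₁⟩ := exists_fiber_equiv e₁ fL
  obtain ⟨κ₂, k₂⟩ := exists_fiber_equiv e₂ fL
  obtain ⟨κ₃, k₃⟩ := exists_fiber_equiv e₃ fA
  obtain ⟨κ₄, k₄⟩ := exists_fiber_equiv e₄ fA
  obtain ⟨m, hm⟩ := f.exists_trace_eq_one hc hη
  refine ⟨mult, can, hmult, ⟨_, m, hm⟩, hcan, e₁ ≪≫ e₂.symm, e₃ ≪≫ e₄.symm,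
    κ₁.trans mult.symm.toAddEquiv, κ₂, κ₃.trans can.symm.toAddEquiv, κ₄, fun W hW s t ↦ ?_,
    fun W hW s ↦ (k₂ W hW s).trans (h₂ W hW s), fun W hW s t ↦ ?_,
    fun W hW s t ↦ (k₄ W hW _).trans (h₄ W hW s t), fun z ↦ ?_, fun z ↦ ?_⟩
  · refine mult.symm_apply_eq.2 ((k₁ W hW _).trans (Subtype.ext ?_))
    exact (h₁ W hW s t).trans (hmult _ _).symm
  · exact can.symm_apply_eq.2 ((k₃ W hW _).trans (h₃ W hW s t))
  · exact (fiber_equiv_comp e₁ e₂ k₁ k₂ z).trans (mult.apply_symm_apply _).symm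
  · exact (fiber_equiv_comp e₃ e₄ k₃ k₄ z).trans (can.apply_symm_apply _).symm

/-! ### Fractions in a unique factorization domain -/

section LocalUnits
variable {A : Type u} [CommRing A] [IsDomain A]

local notation "Q" => FractionRing A

/-- An element of the fraction field that belongs to the localization at a prime ideal. -/
def IsLocFrac (p : Ideal A) (q : FractionRing A) : Prop :=
  ∃ a b : A, b ∉ p ∧ q * algebraMap A (FractionRing A) b = algebraMap A (FractionRing A) a

lemma frac_ne_zero {a : A} (h : a ≠ 0) : algebraMap A (FractionRing A) a ≠ 0 :=
  (map_ne_zero_iff _ (IsFractionRing.injective A (FractionRing A))).2 h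

/-- A nonzero element of `A`, as a unit of the fraction field. -/
def fracUnit (a : A) (h : a ≠ 0) : (FractionRing A)ˣ := Units.mk0 _ (frac_ne_zero h)

/-- The units of the localization at a prime ideal, inside the fraction field. -/
def locUnits (p : Ideal A) [p.IsPrime] : Subgroup (FractionRing A)ˣ where
  carrier := {q | ∃ a b : A, a ∉ p ∧ b ∉ p ∧
    (q : FractionRing A) * algebraMap A (FractionRing A) b = algebraMap A (FractionRing A) a}
  one_mem' := ⟨1, 1, p.one_notMem, p.one_notMem, by simp⟩
  mul_mem' := by
    rintro q q' ⟨a, b, ha, hb, h⟩ ⟨a', b', ha', hb', h'⟩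
    refine ⟨a * a', b * b', fun H ↦ (Ideal.IsPrime.mem_or_mem ‹_› H).elim ha ha',
      fun H ↦ (Ideal.IsPrime.mem_or_mem ‹_› H).elim hb hb', ?_⟩
    rw [map_mul, map_mul, ← h, ← h', Units.val_mul]
    ring
  inv_mem' := by
    rintro q ⟨a, b, ha, hb, h⟩
    refine ⟨b, a, hb, ha, ?_⟩
    rw [← h, ← mul_assoc, Units.inv_mul, one_mul]

lemma fracUnit_mem_locUnits {p : Ideal A} [p.IsPrime] {a : A} (ha : a ∉ p) :
    fracUnit a (fun h ↦ ha (h ▸ p.zero_mem)) ∈ locUnits p :=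
  ⟨a, 1, ha, p.one_notMem, by simp [fracUnit]⟩

lemma mem_locUnits_iff {p : Ideal A} [p.IsPrime] {q : (FractionRing A)ˣ} :
    q ∈ locUnits p ↔ IsLocFrac p q ∧ IsLocFrac p (q⁻¹ : (FractionRing A)ˣ) := by
  constructor
  · rintro ⟨a, b, ha, hb, h⟩
    exact ⟨⟨a, b, hb, h⟩, ⟨b, a, ha, by rw [← h, ← mul_assoc, Units.inv_mul, one_mul]⟩⟩
  · rintro ⟨⟨a, b, hb, h⟩, ⟨c, d, hd, h'⟩⟩
    refine ⟨a, b, fun ha ↦ ?_, hb, h⟩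
    have : b * d = a * c := by
      apply IsFractionRing.injective A (FractionRing A)
      rw [map_mul, map_mul, ← h, ← h']
      linear_combination -(algebraMap A Q b * algebraMap A Q d) * q.mul_inv
    exact (Ideal.IsPrime.mem_or_mem ‹_› (this ▸ p.mul_mem_right c ha : b * d ∈ p)).elim hb hd

/-- An element of the fraction field is a unit at a prime `(π)` up to a power of `π`. -/
lemma exists_zpow_mem_locUnits [WfDvdMonoid A] {π : A} (hπ : Prime π) {p : Ideal A} [p.IsPrime]
    (hp : p = Ideal.span {π}) (q : (FractionRing A)ˣ) :
    ∃ v : ℤ, q * fracUnit π hπ.ne_zero ^ v ∈ locUnits p := by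
  subst hp
  obtain ⟨a, b, hb, h⟩ := IsFractionRing.div_surjective (A := A) (q : FractionRing A)
  have hb0 : b ≠ 0 := nonZeroDivisors.ne_zero hb
  have ha0 : a ≠ 0 := by
    rintro rfl
    exact q.ne_zero (by rw [← h, map_zero, zero_div])
  obtain ⟨m, a', ha', rfl⟩ := WfDvdMonoid.max_power_factor ha0 hπ.irreducible
  obtain ⟨l, b', hb', rfl⟩ := WfDvdMonoid.max_power_factor hb0 hπ.irreducible
  have hp := frac_ne_zero hπ.ne_zero
  have hb'' : algebraMap A Q b' ≠ 0 := frac_ne_zero fun h ↦ hb0 (by rw [h, mul_zero])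
  refine ⟨(l : ℤ) - m, a', b', by rwa [Ideal.mem_span_singleton], by rwa [Ideal.mem_span_singleton],
    ?_⟩
  rw [Units.val_mul, ← h, Units.val_zpow_eq_zpow_val]
  change _ * algebraMap A Q π ^ _ * _ = _
  rw [zpow_sub₀ hp, map_mul, map_mul, map_pow, map_pow, zpow_natCast, zpow_natCast]
  field_simp

/-- In a unique factorization domain, a fraction is a unit at a prime ideal if it is a unit at all
the prime elements of the ideal. -/
lemma mem_locUnits_of_forall_prime [UniqueFactorizationMonoid A] {p : Ideal A} [p.IsPrime]
    {q : (FractionRing A)ˣ}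
    (H : ∀ π : A, Prime π → π ∈ p → ∃ a b, ¬ π ∣ a ∧ ¬ π ∣ b ∧
      (q : FractionRing A) * algebraMap A (FractionRing A) b = algebraMap A (FractionRing A) a) :
    q ∈ locUnits p := by
  obtain ⟨a, b, hr, h⟩ := IsFractionRing.exists_reduced_fraction (A := A) (q : FractionRing A)
  have hb0 : (b : A) ≠ 0 := nonZeroDivisors.ne_zero b.2
  have h1 : (q : Q) * algebraMap A Q b = algebraMap A Q a := by
    rw [← h, IsLocalization.mk'_spec]
  have ha0 : a ≠ 0 := by
    rintro rfl
    rw [map_zero] at h1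
    exact (mul_ne_zero q.ne_zero (frac_ne_zero hb0)) h1
  have key (c d : A) (h : (q : Q) * algebraMap A Q d = algebraMap A Q c) : c * b = d * a := by
    apply IsFractionRing.injective A Q
    rw [map_mul, map_mul, ← h, ← h1]
    ring
  have fac (c : A) (hc : c ∈ p) (hc0 : c ≠ 0) : ∃ π, Prime π ∧ π ∈ p ∧ π ∣ c := by
    obtain ⟨f, hf, e⟩ := UniqueFactorizationMonoid.exists_prime_factors c hc0
    obtain ⟨u, hu⟩ := e
    have h2 : f.prod ∈ p := by
      have := p.mul_mem_right (↑u⁻¹ : A) hc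
      rwa [← hu, mul_assoc, Units.mul_inv, mul_one] at this
    obtain ⟨π, hπ, hp⟩ := (Ideal.IsPrime.multiset_prod_mem_iff_exists_mem ‹_› f).1 h2
    exact ⟨π, hf π hπ, hp, hu ▸ (Multiset.dvd_prod hπ).mul_right _⟩
  refine ⟨a, b, fun hap ↦ ?_, fun hbp ↦ ?_, h1⟩
  · obtain ⟨π, hπ, hp, hd⟩ := fac a hap ha0
    obtain ⟨c, d, hc, hd', hq⟩ := H π hπ hp
    have h2 : π ∣ c * b := key c d hq ▸ hd.mul_left d
    exact hπ.not_isUnit (hr hd ((hπ.dvd_or_dvd h2).resolve_left hc))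
  · obtain ⟨π, hπ, hp, hd⟩ := fac b hbp hb0
    obtain ⟨c, d, hc, hd', hq⟩ := H π hπ hp
    have h2 : π ∣ d * a := key c d hq ▸ hd.mul_left c
    exact hπ.not_isUnit (hr ((hπ.dvd_or_dvd h2).resolve_left hd') hd)

end LocalUnits

/-! ### Homogeneous fractions -/

section Homogeneous
variable {σ : Type*} {K : Type u} [Field K]

local notation "S" => MvPolynomial σ K

/-- The homomorphism `f ↦ ∑ f_i t^i`, where `f_i` is the homogeneous component of degree `i`. -/
def gradeHom : MvPolynomial σ K →ₐ[K] Polynomial (MvPolynomial σ K) :=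
  MvPolynomial.aeval fun i ↦ Polynomial.C (MvPolynomial.X i) * Polynomial.X

/-- The map `gradeHom` records the degree as the exponent of a further variable. -/
lemma gradeHom_of_isHomogeneous {f : MvPolynomial σ K} {m : ℕ} (hf : f.IsHomogeneous m) :
    gradeHom f = Polynomial.C f * Polynomial.X ^ m := by
  classical
  have h (d : σ →₀ ℕ) (c : K) : gradeHom (MvPolynomial.monomial d c) =
      Polynomial.C (MvPolynomial.monomial d c) * Polynomial.X ^ d.degree := by
    rw [gradeHom, MvPolynomial.aeval_monomial]
    simp only [Finsupp.prod, mul_pow, Finset.prod_mul_distrib, Finset.prod_pow_eq_pow_sum]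
    rw [← mul_assoc, MvPolynomial.monomial_eq, Finsupp.prod]
    simp only [map_mul, map_prod, map_pow]
    rfl
  conv_lhs => rw [f.as_sum]
  conv_rhs => rw [f.as_sum]
  rw [map_sum, map_sum, Finset.sum_mul]
  refine Finset.sum_congr rfl fun d hd ↦ ?_
  rw [h, hf.degree_eq_sum_deg_support hd]
  rfl

lemma coeff_gradeHom (f : MvPolynomial σ K) (i : ℕ) :
    (gradeHom f).coeff i = MvPolynomial.homogeneousComponent i f := by
  conv_lhs => rw [← f.sum_homogeneousComponent, map_sum]
  simp only [gradeHom_of_isHomogeneous (MvPolynomial.homogeneousComponent_isHomogeneous _ f),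
    Polynomial.finsetSum_coeff, Polynomial.coeff_C_mul, Polynomial.coeff_X_pow]
  simp only [mul_ite, mul_one, mul_zero, Finset.sum_ite_eq, Finset.mem_range]
  split_ifs with h
  · rfl
  · exact (MvPolynomial.homogeneousComponent_eq_zero _ _ (by omega)).symm

/-- A factor of a nonzero homogeneous polynomial is homogeneous. -/
lemma exists_isHomogeneous_of_dvd {f g : MvPolynomial σ K} {m : ℕ} (hg : g.IsHomogeneous m)
    (hg0 : g ≠ 0) (h : f ∣ g) : ∃ i, f.IsHomogeneous i := by
  obtain ⟨f', rfl⟩ := h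
  have inj : Function.Injective (gradeHom (σ := σ) (K := K)) := fun a b h ↦ by
    rw [← a.sum_homogeneousComponent, ← b.sum_homogeneousComponent]
    have h' (i) : MvPolynomial.homogeneousComponent i a = MvPolynomial.homogeneousComponent i b := by
      rw [← coeff_gradeHom, ← coeff_gradeHom, h]
    rw [a.sum_homogeneousComponent, ← b.sum_homogeneousComponent]
    by_contra hne
    refine hne ?_
    ext d
    have := congrArg (MvPolynomial.coeff d) (h' d.degree)
    rw [MvPolynomial.coeff_homogeneousComponent, MvPolynomial.coeff_homogeneousComponent] at this
    simpa [b.sum_homogeneousComponent] using this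
  have hf0 : gradeHom f ≠ 0 := (map_ne_zero_iff _ inj).2 (left_ne_zero_of_mul hg0)
  have hf0' : gradeHom f' ≠ 0 := (map_ne_zero_iff _ inj).2 (right_ne_zero_of_mul hg0)
  have e := gradeHom_of_isHomogeneous hg
  rw [map_mul] at e
  have h1 := Polynomial.natDegree_mul hf0 hf0'
  have h2 := Polynomial.natTrailingDegree_mul hf0 hf0'
  rw [e, Polynomial.natDegree_C_mul_X_pow _ _ hg0] at h1
  rw [e, Polynomial.C_mul_X_pow_eq_monomial, Polynomial.natTrailingDegree_monomial hg0] at h2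
  have h3 := Polynomial.natTrailingDegree_le_natDegree (gradeHom f)
  have h4 := Polynomial.natTrailingDegree_le_natDegree (gradeHom f')
  refine ⟨(gradeHom f).natDegree, ?_⟩
  have h5 : f = MvPolynomial.homogeneousComponent (gradeHom f).natDegree f := by
    conv_lhs => rw [← f.sum_homogeneousComponent]
    have hz (i) (hi : i ≠ (gradeHom f).natDegree) : MvPolynomial.homogeneousComponent i f = 0 := by
      rw [← coeff_gradeHom]
      rcases lt_or_gt_of_ne hi with hi | hi
      · exact Polynomial.coeff_eq_zero_of_lt_natTrailingDegree (by omega)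
      · exact Polynomial.coeff_eq_zero_of_natDegree_lt hi
    rw [Finset.sum_eq_single (gradeHom f).natDegree (fun i _ hi ↦ hz i hi)]
    intro hi
    rw [Finset.mem_range] at hi
    exact MvPolynomial.homogeneousComponent_eq_zero _ _ (by omega)
  have h6 := MvPolynomial.homogeneousComponent_isHomogeneous (gradeHom f).natDegree f
  rwa [← h5] at h6

lemma homogeneousComponent_mul_of_isHomogeneous {a b : MvPolynomial σ K} {j : ℕ}
    (hb : b.IsHomogeneous j) (i : ℕ) : MvPolynomial.homogeneousComponent i (a * b) =
      if j ≤ i then MvPolynomial.homogeneousComponent (i - j) a * b else 0 := by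
  rw [← coeff_gradeHom, ← coeff_gradeHom, map_mul, gradeHom_of_isHomogeneous hb, ← mul_assoc,
    Polynomial.coeff_mul_X_pow', Polynomial.coeff_mul_C]

/-- An element of the fraction field that is a quotient of homogeneous polynomials, with degree
`m`. -/
def HasDegree (q : FractionRing (MvPolynomial σ K)) (m : ℤ) : Prop :=
  ∃ (i j : ℕ) (a b : MvPolynomial σ K), (i : ℤ) = j + m ∧ a.IsHomogeneous i ∧ b.IsHomogeneous j ∧
    b ≠ 0 ∧ q * algebraMap _ (FractionRing (MvPolynomial σ K)) b = algebraMap _ _ a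

lemma HasDegree.mul {q q' : FractionRing (MvPolynomial σ K)} {m m' : ℤ} (h : HasDegree q m)
    (h' : HasDegree q' m') : HasDegree (q * q') (m + m') := by
  obtain ⟨i, j, a, b, e, ha, hb, hb0, hq⟩ := h
  obtain ⟨i', j', a', b', e', ha', hb', hb0', hq'⟩ := h'
  refine ⟨i + i', j + j', a * a', b * b', by push_cast; omega, ha.mul ha', hb.mul hb',
    mul_ne_zero hb0 hb0', ?_⟩
  rw [map_mul, map_mul, ← hq, ← hq']
  ring

lemma HasDegree.inv {q : FractionRing (MvPolynomial σ K)} {m : ℤ} (h : HasDegree q m)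
    (h0 : q ≠ 0) : HasDegree q⁻¹ (-m) := by
  obtain ⟨i, j, a, b, e, ha, hb, hb0, hq⟩ := h
  have ha0 : a ≠ 0 := by
    rintro rfl
    exact mul_ne_zero h0 (frac_ne_zero hb0) (hq.trans (map_zero _))
  exact ⟨j, i, b, a, by omega, hb, ha, ha0, by rw [← hq, ← mul_assoc, inv_mul_cancel₀ h0, one_mul]⟩

lemma HasDegree.of_isHomogeneous {a : MvPolynomial σ K} {i : ℕ} (h : a.IsHomogeneous i) :
    HasDegree (algebraMap _ (FractionRing (MvPolynomial σ K)) a) i :=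
  ⟨i, 0, a, 1, by simp, h, MvPolynomial.isHomogeneous_one σ K, one_ne_zero, by simp⟩

lemma HasDegree.pow {q : FractionRing (MvPolynomial σ K)} {m : ℤ} (h : HasDegree q m) (v : ℕ) :
    HasDegree (q ^ v) (v * m) := by
  induction v with
  | zero => simpa using HasDegree.of_isHomogeneous (MvPolynomial.isHomogeneous_one σ K)
  | succ v ih => simpa [pow_succ, add_mul] using ih.mul h

lemma HasDegree.zpow {q : FractionRing (MvPolynomial σ K)} {m : ℤ} (h : HasDegree q m)
    (h0 : q ≠ 0) (v : ℤ) : HasDegree (q ^ v) (v * m) := by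
  obtain ⟨v, rfl | rfl⟩ := v.eq_nat_or_neg
  · simpa using h.pow v
  · simpa using (h.pow v).inv (pow_ne_zero v h0)

lemma HasDegree.prod {ι : Type*} (s : Finset ι) (q : ι → FractionRing (MvPolynomial σ K))
    (m : ι → ℤ) (h : ∀ i ∈ s, HasDegree (q i) (m i)) : HasDegree (∏ i ∈ s, q i) (∑ i ∈ s, m i) := by
  classical
  induction s using Finset.induction_on with
  | empty => simpa using HasDegree.of_isHomogeneous (MvPolynomial.isHomogeneous_one σ K)
  | insert i s hi ih =>
    rw [Finset.prod_insert hi, Finset.sum_insert hi]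
    exact (h i (Finset.mem_insert_self i s)).mul (ih fun j hj ↦ h j (Finset.mem_insert_of_mem hj))

/-- A quotient of homogeneous polynomials that belongs to the localization at a prime ideal has a
homogeneous denominator outside the ideal. -/
lemma HasDegree.exists_of_isLocFrac {q : FractionRing (MvPolynomial σ K)} {m : ℤ}
    (h : HasDegree q m) (h0 : q ≠ 0) {p : Ideal (MvPolynomial σ K)} (hp : IsLocFrac p q) :
    ∃ (i j : ℕ) (a b : MvPolynomial σ K), (i : ℤ) = j + m ∧ a.IsHomogeneous i ∧ b.IsHomogeneous j ∧
      b ∉ p ∧ q * algebraMap _ (FractionRing (MvPolynomial σ K)) b = algebraMap _ _ a := by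
  obtain ⟨i, j, a, b, e, ha, hb, hb0, hq⟩ := h
  obtain ⟨c, d, hd, hq'⟩ := hp
  have hcd : c * b = d * a := by
    apply IsFractionRing.injective (MvPolynomial σ K) (FractionRing (MvPolynomial σ K))
    rw [map_mul, map_mul, ← hq, ← hq']
    ring
  obtain ⟨l, hl⟩ : ∃ l, MvPolynomial.homogeneousComponent l d ∉ p := by
    by_contra! H
    exact hd (d.sum_homogeneousComponent ▸ p.sum_mem fun l _ ↦ H l)
  have ha0 : a ≠ 0 := by
    rintro rfl
    exact mul_ne_zero h0 (frac_ne_zero hb0) (hq.trans (map_zero _))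
  have h1 := homogeneousComponent_mul_of_isHomogeneous (a := d) ha (l + i)
  have hl0 : MvPolynomial.homogeneousComponent l d ≠ 0 := fun h ↦ hl (h ▸ p.zero_mem)
  rw [if_pos (by omega), Nat.add_sub_cancel, ← hcd,
    homogeneousComponent_mul_of_isHomogeneous hb] at h1
  split_ifs at h1 with hj
  swap
  · exact (mul_ne_zero hl0 ha0 h1.symm).elim
  refine ⟨l + i - j, l, MvPolynomial.homogeneousComponent (l + i - j) c, _, by omega,
    MvPolynomial.homogeneousComponent_isHomogeneous _ _,
    MvPolynomial.homogeneousComponent_isHomogeneous _ _, hl, ?_⟩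
  apply mul_right_cancel₀ (frac_ne_zero hb0)
  rw [← map_mul, h1, map_mul, ← hq]
  ring

end Homogeneous

/-! ### The function field of Proj -/

section ProjIntegral
variable {A : Type u} [CommRing A] [IsDomain A] {S : Type*} [SetLike S A] [AddSubgroupClass S A]
  (𝒜 : ℕ → S) [GradedRing 𝒜]

/-- The zero ideal, as a point of `Proj`. -/
def zeroPoint (h : ∃ d, 0 < d ∧ ∃ b ∈ 𝒜 d, b ≠ 0) : ProjectiveSpectrum 𝒜 where
  asHomogeneousIdeal := ⊥
  isPrime := Ideal.isPrime_bot
  not_irrelevant_le H := by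
    obtain ⟨d, hd, b, hb, hb0⟩ := h
    refine hb0 (H (?_ : b ∈ HomogeneousIdeal.irrelevant 𝒜))
    rw [HomogeneousIdeal.mem_irrelevant_iff]
    exact (DirectSum.decompose_of_mem_ne 𝒜 hb hd.ne')

lemma zeroPoint_mem (h : ∃ d, 0 < d ∧ ∃ b ∈ 𝒜 d, b ≠ 0) {U : (Proj 𝒜).Opens} {x : Proj 𝒜}
    (hx : x ∈ U) : (zeroPoint 𝒜 h : Proj 𝒜) ∈ U := by
  obtain ⟨_, ⟨f, rfl⟩, hxf, hf⟩ :=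
    (ProjectiveSpectrum.isTopologicalBasis_basic_opens 𝒜).exists_subset_of_mem_open hx U.2
  refine hf ?_
  change f ∉ (⊥ : Ideal A)
  rintro (rfl : f = 0)
  exact hxf (zero_mem _)

/-- Proj of a graded domain is integral: its local rings embed into localizations of the domain, and
the zero ideal is a generic point. -/
lemma isIntegral_proj (h : ∃ d, 0 < d ∧ ∃ b ∈ 𝒜 d, b ≠ 0) : IsIntegral (Proj 𝒜) := by
  have : ∀ x : Proj 𝒜, _root_.IsReduced ((Proj 𝒜).presheaf.stalk x) := fun x' ↦ by
    let x : ProjectiveSpectrum 𝒜 := x'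
    have h1 : Function.Injective
        (algebraMap (HomogeneousLocalization.AtPrime 𝒜 x.asHomogeneousIdeal.toIdeal)
          (Localization.AtPrime x.asHomogeneousIdeal.toIdeal)) :=
      HomogeneousLocalization.val_injective _
    have h2 : IsDomain (Localization.AtPrime x.asHomogeneousIdeal.toIdeal) :=
      IsLocalization.isDomain_localization
        (Ideal.primeCompl_le_nonZeroDivisors x.asHomogeneousIdeal.toIdeal)
    have h3 : _root_.IsReduced (HomogeneousLocalization.AtPrime 𝒜 x.asHomogeneousIdeal.toIdeal) :=
      isReduced_of_injective _ h1
    exact isReduced_of_injective (Proj.stalkIso' 𝒜 x) (Proj.stalkIso' 𝒜 x).injective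
  have := isReduced_of_isReduced_stalk (Proj 𝒜)
  have : IrreducibleSpace (Proj 𝒜) :=
    { toNonempty := ⟨zeroPoint 𝒜 h⟩
      isPreirreducible_univ := by
        rintro U V hU hV ⟨x, -, hx⟩ ⟨y, -, hy⟩
        exact ⟨zeroPoint 𝒜 h, trivial, zeroPoint_mem 𝒜 h (U := ⟨U, hU⟩) hx,
          zeroPoint_mem 𝒜 h (U := ⟨V, hV⟩) hy⟩ }
  exact isIntegral_of_irreducibleSpace_of_isReduced _

variable {𝒜}

lemma le_of_primeCompl (x : ProjectiveSpectrum 𝒜) :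
    ∀ y : x.asHomogeneousIdeal.toIdeal.primeCompl, IsUnit (algebraMap A (FractionRing A) y) :=
  fun y ↦ (frac_ne_zero (ne_of_mem_of_not_mem (zero_mem _) y.2).symm).isUnit

/-- The inclusion of the localization at a point of `Proj` in the fraction field. -/
def fracStalkHom (x : ProjectiveSpectrum 𝒜) : fracStalk 𝒜 x →+* FractionRing A :=
  IsLocalization.lift (M := x.asHomogeneousIdeal.toIdeal.primeCompl)
    (g := algebraMap A (FractionRing A)) (le_of_primeCompl x)

lemma fracStalkHom_algebraMap (x : ProjectiveSpectrum 𝒜) (a : A) :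
    fracStalkHom x (algebraMap A (fracStalk 𝒜 x) a) = algebraMap A (FractionRing A) a :=
  IsLocalization.lift_eq _ _

lemma fracStalkHom_injective (x : ProjectiveSpectrum 𝒜) : Function.Injective (fracStalkHom x) := by
  refine (IsLocalization.lift_injective_iff _).2 fun a b ↦ ?_
  rw [(IsLocalization.injective _
    (Ideal.primeCompl_le_nonZeroDivisors x.asHomogeneousIdeal.toIdeal)).eq_iff,
    (IsFractionRing.injective A (FractionRing A)).eq_iff]

lemma isLocFrac_fracStalkHom (x : ProjectiveSpectrum 𝒜) (z : fracStalk 𝒜 x) :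
    IsLocFrac x.asHomogeneousIdeal.toIdeal (fracStalkHom x z) := by
  obtain ⟨⟨a, b⟩, h⟩ := IsLocalization.surj (M := x.asHomogeneousIdeal.toIdeal.primeCompl) z
  refine ⟨a, b, b.2, ?_⟩
  rw [← fracStalkHom_algebraMap x, ← map_mul, h, fracStalkHom_algebraMap]

/-- A section of the structure sheaf near a point is a quotient of homogeneous elements of the same
degree. -/
lemma exists_frac_of_section {U : (Proj 𝒜).Opens} (r : Γ(Proj 𝒜, U)) (x : ProjectiveSpectrum 𝒜) (hx : x ∈ U) :
    ∃ (V : (Proj 𝒜).Opens) (_ : V ≤ U) (i : ℕ) (a b : A), x ∈ V ∧ a ∈ 𝒜 i ∧ b ∈ 𝒜 i ∧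
      ∀ y : V, b ∉ ProjectiveSpectrum.asHomogeneousIdeal (𝒜 := 𝒜) y.1 ∧
      ∀ hy : y.1 ∈ U, fracStalkHom y.1 (secVal 𝒜 r ⟨y.1, hy⟩) * algebraMap A (FractionRing A) b =
        algebraMap A (FractionRing A) a := by
  obtain ⟨V, hxV, i, j, ⟨a, ha⟩, ⟨b, hb⟩, hn, hr⟩ := r.2 ⟨x, hx⟩
  refine ⟨V, i.le, j, a, b, hxV, ha, hb, fun y ↦ ⟨hn y, fun hy ↦ ?_⟩⟩
  have e := congrArg HomogeneousLocalization.val (hr y)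
  rw [HomogeneousLocalization.val_mk] at e
  have e2 : secVal 𝒜 r ⟨y.1, hy⟩ * algebraMap A (fracStalk 𝒜 y.1) b =
      algebraMap A (fracStalk 𝒜 y.1) a :=
    (congrArg (· * algebraMap A (fracStalk 𝒜 y.1) b) e).trans (mk_mul_algebraMap y.1 a ⟨b, hn y⟩)
  have h := congrArg (fracStalkHom y.1) e2
  rw [map_mul] at h
  rw [fracStalkHom_algebraMap (𝒜 := 𝒜) y.1 a] at h
  rw [← h]
  exact congrArg _ (fracStalkHom_algebraMap (𝒜 := 𝒜) y.1 b).symm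

section
variable [IsIntegral (Proj 𝒜)]

variable (𝒜) in
/-- The generic point, as a prime ideal. -/
def genericIdeal : ProjectiveSpectrum 𝒜 := genericPoint (Proj 𝒜)

/-- The function field of `Proj`, inside the fraction field. -/
def funFrac : (Proj 𝒜).functionField →+* FractionRing A :=
  ((fracStalkHom (genericIdeal 𝒜)).comp
    (algebraMap (HomogeneousLocalization.AtPrime 𝒜 (genericIdeal 𝒜).asHomogeneousIdeal.toIdeal)
      _)).comp (Proj.stalkIso' 𝒜 (genericIdeal 𝒜)).toRingHom

lemma funFrac_injective : Function.Injective (funFrac (𝒜 := 𝒜)) :=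
  (funFrac (𝒜 := 𝒜)).injective

lemma funFrac_gen {U : (Proj 𝒜).Opens} (hU : genericPoint (Proj 𝒜) ∈ U) (r : Γ(Proj 𝒜, U)) :
    funFrac (gen U hU r) = fracStalkHom (genericIdeal 𝒜) (secVal 𝒜 r ⟨_, hU⟩) :=
  congrArg (fun z ↦ fracStalkHom (genericIdeal 𝒜) (HomogeneousLocalization.val z))
    (Proj.stalkIso'_germ 𝒜 U _ hU r)

lemma exists_frac_of_mem_reg {x : ProjectiveSpectrum 𝒜} {f : (Proj 𝒜).functionField} (hf : f ∈ reg (X := Proj 𝒜) x) :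
    ∃ (i : ℕ) (a b : A), a ∈ 𝒜 i ∧ b ∈ 𝒜 i ∧ b ∉ x.asHomogeneousIdeal ∧
      funFrac f * algebraMap A (FractionRing A) b = algebraMap A (FractionRing A) a := by
  obtain ⟨U, hx, r, rfl⟩ := exists_gen_of_mem_reg hf
  obtain ⟨V, hV, i, a, b, hxV, ha, hb, H⟩ := exists_frac_of_section r x hx
  refine ⟨i, a, b, ha, hb, (H ⟨x, hxV⟩).1, ?_⟩
  rw [funFrac_gen]
  exact (H ⟨_, genericPoint_mem hxV⟩).2 _

/-- A quotient of homogeneous elements of the same degree belongs to the function field, and it is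
regular where the denominator does not vanish. -/
lemma exists_funFrac_eq {x : ProjectiveSpectrum 𝒜} {i : ℕ} {a b : A} (ha : a ∈ 𝒜 i) (hb : b ∈ 𝒜 i)
    (hx : b ∉ x.asHomogeneousIdeal) {q : FractionRing A}
    (hq : q * algebraMap A (FractionRing A) b = algebraMap A (FractionRing A) a) :
    ∃ f ∈ reg (X := Proj 𝒜) x, funFrac (𝒜 := 𝒜) f = q := by
  let s : HomogeneousLocalization.NumDenSameDeg 𝒜 x.asHomogeneousIdeal.toIdeal.primeCompl :=
    ⟨i, ⟨a, ha⟩, ⟨b, hb⟩, hx⟩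
  let r : Γ(Proj 𝒜, Proj.basicOpen 𝒜 b) := sectionInBasicOpen 𝒜 x s
  have hη := genericPoint_mem (X := Proj 𝒜) (U := Proj.basicOpen 𝒜 b) hx
  refine ⟨gen _ hη r, gen_mem_reg (X := Proj 𝒜) hx r, ?_⟩
  let z : fracStalk 𝒜 (genericIdeal 𝒜) := secVal 𝒜 r ⟨_, hη⟩
  have h1 : z * algebraMap A (fracStalk 𝒜 (genericIdeal 𝒜)) b =
      algebraMap A _ a := mk_mul_algebraMap (𝒜 := 𝒜) (genericIdeal 𝒜) a ⟨b, hη⟩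
  have h2 := congrArg (fracStalkHom (genericIdeal 𝒜)) h1
  rw [map_mul, fracStalkHom_algebraMap, fracStalkHom_algebraMap, ← hq] at h2
  refine (funFrac_gen hη r).trans ?_
  exact mul_right_cancel₀ (frac_ne_zero (ne_of_mem_of_not_mem (zero_mem _) hx).symm) h2

lemma mem_reg_proj_iff {x : ProjectiveSpectrum 𝒜} {f : (Proj 𝒜).functionField} :
    f ∈ reg (X := Proj 𝒜) x ↔ ∃ (i : ℕ) (a b : A), a ∈ 𝒜 i ∧ b ∈ 𝒜 i ∧ b ∉ x.asHomogeneousIdeal ∧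
      funFrac f * algebraMap A (FractionRing A) b = algebraMap A (FractionRing A) a := by
  refine ⟨exists_frac_of_mem_reg, fun ⟨i, a, b, ha, hb, hx, h⟩ ↦ ?_⟩
  obtain ⟨g, hg, e⟩ := exists_funFrac_eq ha hb hx h
  exact funFrac_injective e ▸ hg

end
end ProjIntegral

/-! ### Projective space -/

section ProjSpace
attribute [local instance] MvPolynomial.gradedAlgebra

variable (ℓ : Type u) [Field ℓ] (n : ℕ)

/-- The graded pieces of the coordinate ring of `ℙ^{n-1}`. -/
abbrev coordGrading : ℕ → Submodule ℓ (MvPolynomial (Fin n) ℓ) :=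
  MvPolynomial.homogeneousSubmodule (Fin n) ℓ

variable {ℓ n}

/-- The homogeneous prime ideal of a point of `ℙ^{n-1}`. -/
def primeAt (y : projSpace ℓ n) : Ideal (MvPolynomial (Fin n) ℓ) :=
  (ProjectiveSpectrum.asHomogeneousIdeal (𝒜 := coordGrading ℓ n) y).toIdeal

instance (y : projSpace ℓ n) : (primeAt y).IsPrime :=
  ProjectiveSpectrum.isPrime (𝒜 := coordGrading ℓ n) y

/-- The coordinates do not vanish simultaneously. -/
lemma exists_X_notMem (y : projSpace ℓ n) : ∃ j, MvPolynomial.X j ∉ primeAt y := by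
  by_contra! H
  obtain ⟨d, b, hd, hb, hy⟩ := exists_homogeneous_notMem (coordGrading ℓ n) y
  refine hy (?_ : b ∈ primeAt y)
  rw [b.as_sum]
  refine (primeAt y).sum_mem fun m hm ↦ ?_
  have hm0 : m ≠ 0 := by
    rintro rfl
    have := MvPolynomial.IsHomogeneous.degree_eq_sum_deg_support hb hm
    simp at this
    omega
  obtain ⟨j, hj⟩ := Finsupp.ne_iff.1 hm0
  have : MvPolynomial.X j ∣ MvPolynomial.monomial m (MvPolynomial.coeff m b) :=
    MvPolynomial.X_dvd_monomial.2 (Or.inr hj)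
  exact (primeAt y).mem_of_dvd this (H j)

lemma mem_of_primeAt_le {y z : projSpace ℓ n} (h : primeAt y ≤ primeAt z)
    {U : (projSpace ℓ n).Opens} (hz : z ∈ U) : y ∈ U := by
  obtain ⟨_, ⟨f, rfl⟩, hxf, hf⟩ := (ProjectiveSpectrum.isTopologicalBasis_basic_opens
    (coordGrading ℓ n)).exists_subset_of_mem_open hz U.2
  exact hf (fun hy ↦ hxf (h hy))

/-- An irreducible homogeneous polynomial defines a point of `ℙ^{n-1}`, if `n ≥ 2`. -/
lemma exists_primeAt_eq_span (hn : 2 ≤ n) {π : MvPolynomial (Fin n) ℓ} (hπ : Prime π) {i : ℕ}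
    (hi : π.IsHomogeneous i) : ∃ y : projSpace ℓ n, primeAt y = Ideal.span {π} := by
  have hI : (Ideal.span {π}).IsHomogeneous (coordGrading ℓ n) :=
    Ideal.homogeneous_span _ _ (by rintro _ rfl; exact ⟨i, hi⟩)
  let y : ProjectiveSpectrum (coordGrading ℓ n) :=
    { asHomogeneousIdeal := ⟨Ideal.span {π}, hI⟩
      isPrime := (Ideal.span_singleton_prime hπ.ne_zero).2 hπ
      not_irrelevant_le := fun H ↦ by
        have key (j : Fin n) : π ∣ MvPolynomial.X j := by
          have : (MvPolynomial.X j : MvPolynomial (Fin n) ℓ) ∈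
              HomogeneousIdeal.irrelevant (coordGrading ℓ n) := by
            rw [HomogeneousIdeal.mem_irrelevant_iff]
            exact DirectSum.decompose_of_mem_ne (coordGrading ℓ n)
              (MvPolynomial.isHomogeneous_X ℓ j) one_ne_zero
          exact Ideal.mem_span_singleton.1 (H this)
        have h0 := key ⟨0, by omega⟩
        have h1 := key ⟨1, by omega⟩
        have h2 := hπ.irreducible.associated_of_dvd
          MvPolynomial.X_prime.irreducible h0
        have h3 := h2.symm.dvd.trans h1
        rw [MvPolynomial.X_dvd_X] at h3
        · simp at h3 }
  exact ⟨y, rfl⟩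

variable [NeZero n]

variable (ℓ n) in
lemma isIntegral_projSpace : IsIntegral (projSpace ℓ n) :=
  isIntegral_proj _ ⟨1, one_pos, MvPolynomial.X 0, MvPolynomial.isHomogeneous_X ℓ 0,
    MvPolynomial.X_ne_zero 0⟩

instance : IsIntegral (projSpace ℓ n) := isIntegral_projSpace ℓ n

/-- The function field of `ℙ^{n-1}`, inside the field of rational functions of the coordinates. -/
def ratFun : (projSpace ℓ n).functionField →+* FractionRing (MvPolynomial (Fin n) ℓ) :=
  haveI : IsIntegral (Proj (coordGrading ℓ n)) := isIntegral_projSpace ℓ n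
  funFrac (𝒜 := coordGrading ℓ n)

lemma ratFun_injective : Function.Injective (ratFun (ℓ := ℓ) (n := n)) := RingHom.injective _

lemma hasDegree_ratFun (f : (projSpace ℓ n).functionField) : HasDegree (ratFun f) 0 := by
  have : IsIntegral (Proj (coordGrading ℓ n)) := isIntegral_projSpace ℓ n
  obtain ⟨i, a, b, ha, hb, hη, h⟩ := exists_frac_of_mem_reg (𝒜 := coordGrading ℓ n)
    (x := genericIdeal _) (mem_reg_genericPoint f)
  exact ⟨i, i, a, b, by simp, ha, hb, (ne_of_mem_of_not_mem (zero_mem _) hη).symm, h⟩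

lemma mem_reg_projSpace_iff {y : projSpace ℓ n} {f : (projSpace ℓ n).functionField} :
    f ∈ reg y ↔ IsLocFrac (primeAt y) (ratFun f) := by
  have : IsIntegral (Proj (coordGrading ℓ n)) := isIntegral_projSpace ℓ n
  refine (mem_reg_proj_iff (𝒜 := coordGrading ℓ n)).trans ⟨fun h ↦ ?_, fun h ↦ ?_⟩
  · obtain ⟨i, a, b, ha, hb, hx, h⟩ := h
    exact ⟨a, b, hx, h⟩
  · by_cases h0 : ratFun f = 0
    · refine ⟨0, 0, 1, zero_mem _, MvPolynomial.isHomogeneous_one _ _,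
        (primeAt y).one_notMem, ?_⟩
      exact (congrArg (· * _) h0).trans (by rw [zero_mul, map_zero])
    · obtain ⟨i, j, a, b, e, ha, hb, hx, h⟩ := (hasDegree_ratFun f).exists_of_isLocFrac h0 h
      obtain rfl : i = j := by omega
      exact ⟨i, a, b, ha, hb, hx, h⟩

lemma exists_ratFun_eq {q : FractionRing (MvPolynomial (Fin n) ℓ)} (hq : HasDegree q 0) :
    ∃ f : (projSpace ℓ n).functionField, ratFun f = q := by
  have : IsIntegral (Proj (coordGrading ℓ n)) := isIntegral_projSpace ℓ n
  obtain ⟨i, j, a, b, e, ha, hb, hb0, h⟩ := hq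
  obtain rfl : i = j := by omega
  let x := zeroPoint (coordGrading ℓ n) ⟨1, one_pos, MvPolynomial.X 0,
    MvPolynomial.isHomogeneous_X ℓ 0, MvPolynomial.X_ne_zero 0⟩
  obtain ⟨f, -, hf⟩ := exists_funFrac_eq (𝒜 := coordGrading ℓ n) (x := x) ha hb hb0 h
  exact ⟨f, hf⟩

lemma exists_unit_ratFun_eq {q : (FractionRing (MvPolynomial (Fin n) ℓ))ˣ}
    (hq : HasDegree (q : FractionRing (MvPolynomial (Fin n) ℓ)) 0) :
    ∃ f : (projSpace ℓ n).functionFieldˣ, Units.map ratFun.toMonoidHom f = q := by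
  obtain ⟨f, hf⟩ := exists_ratFun_eq hq
  have h0 : f ≠ 0 := by
    rintro rfl
    exact q.ne_zero (hf.symm.trans (map_zero _))
  exact ⟨Units.mk0 f h0, Units.ext hf⟩

lemma mem_regUnits_projSpace_iff {y : projSpace ℓ n} {f : (projSpace ℓ n).functionFieldˣ} :
    f ∈ regUnits _ y ↔ Units.map ratFun.toMonoidHom f ∈ locUnits (primeAt y) := by
  rw [mem_locUnits_iff, mem_regUnits, ← map_inv]
  refine ⟨fun h ↦ ⟨mem_reg_projSpace_iff.1 h.2.1, ?_⟩, fun h ↦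
    ⟨f.ne_zero, mem_reg_projSpace_iff.2 h.1, ?_⟩⟩
  · have := h.2.2
    rw [← Units.val_inv_eq_inv_val] at this
    exact mem_reg_projSpace_iff.1 this
  · rw [← Units.val_inv_eq_inv_val]
    exact mem_reg_projSpace_iff.2 h.2

/-- A coordinate, as a unit of the field of rational functions. -/
def coordUnit (j : Fin n) : (FractionRing (MvPolynomial (Fin n) ℓ))ˣ :=
  fracUnit (MvPolynomial.X j) (MvPolynomial.X_ne_zero j)

lemma hasDegree_coordUnit (j : Fin n) :
    HasDegree (coordUnit (ℓ := ℓ) j : FractionRing (MvPolynomial (Fin n) ℓ)) 1 :=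
  HasDegree.of_isHomogeneous (MvPolynomial.isHomogeneous_X ℓ j)

lemma exists_coordFun (j : Fin n) : ∃ f : (projSpace ℓ n).functionFieldˣ,
    Units.map ratFun.toMonoidHom f = coordUnit j / coordUnit 0 := by
  refine exists_unit_ratFun_eq ?_
  rw [div_eq_mul_inv, Units.val_mul, Units.val_inv_eq_inv_val]
  exact (hasDegree_coordUnit j).mul ((hasDegree_coordUnit 0).inv (Units.ne_zero _))

variable (ℓ) in
/-- The rational function `x_j / x_0` on `ℙ^{n-1}`. -/
def coordFun (j : Fin n) : (projSpace ℓ n).functionFieldˣ := (exists_coordFun j).choose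

lemma ratFun_coordFun (j : Fin n) :
    Units.map ratFun.toMonoidHom (coordFun ℓ j) = coordUnit j / coordUnit 0 :=
  (exists_coordFun j).choose_spec

/-- A coordinate that does not vanish at the point. -/
def coordAt (y : projSpace ℓ n) : Fin n := (exists_X_notMem y).choose

lemma coordAt_notMem (y : projSpace ℓ n) : MvPolynomial.X (coordAt y) ∉ primeAt y :=
  (exists_X_notMem y).choose_spec

lemma coordFun_div_mem {y : projSpace ℓ n} {i j : Fin n} (hi : MvPolynomial.X i ∉ primeAt y)
    (hj : MvPolynomial.X j ∉ primeAt y) : coordFun ℓ i / coordFun ℓ j ∈ regUnits _ y := by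
  rw [mem_regUnits_projSpace_iff, map_div, ratFun_coordFun, ratFun_coordFun,
    div_div_div_cancel_right]
  exact div_mem (fracUnit_mem_locUnits hi) (fracUnit_mem_locUnits hj)

variable (ℓ n) in
/-- The divisor with local equation `x_j / x_0` at the points where `x_j ≠ 0`, whose sheaf is
`𝒪(1)`. -/
def hyperplane : divisors (projSpace ℓ n) where
  val y := coordFun ℓ (coordAt y)
  property x := by
    refine ⟨Proj.basicOpen _ (MvPolynomial.X (coordAt x)), coordAt_notMem x, fun y hy ↦ ?_⟩
    exact coordFun_div_mem (coordAt_notMem y) hy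

end ProjSpace

/-! ### The Picard group of projective space -/

section PicProjSpace
attribute [local instance] MvPolynomial.gradedAlgebra

variable {ℓ : Type u} [Field ℓ] {n : ℕ} [NeZero n]

local notation "Q" => FractionRing (MvPolynomial (Fin n) ℓ)

/-- The group homomorphism given by `ratFun`. -/
abbrev ratUnit : (projSpace ℓ n).functionFieldˣ →* (FractionRing (MvPolynomial (Fin n) ℓ))ˣ :=
  Units.map ratFun.toMonoidHom

lemma hasDegree_ratUnit (f : (projSpace ℓ n).functionFieldˣ) :
    HasDegree (ratUnit f : FractionRing (MvPolynomial (Fin n) ℓ)) 0 := hasDegree_ratFun f.1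

omit [NeZero n] in
/-- A prime element that divides the numerator or the denominator of a homogeneous fraction is
homogeneous. -/
lemma HasDegree.exists_not_dvd {q : (FractionRing (MvPolynomial (Fin n) ℓ))ˣ} {m : ℤ}
    (hq : HasDegree (q : FractionRing (MvPolynomial (Fin n) ℓ)) m) {π : MvPolynomial (Fin n) ℓ}
    (hπ : ¬ ∃ i, π.IsHomogeneous i) : ∃ a b, ¬ π ∣ a ∧ ¬ π ∣ b ∧
      (q : FractionRing (MvPolynomial (Fin n) ℓ)) * algebraMap _ _ b = algebraMap _ _ a := by
  obtain ⟨i, j, a, b, e, ha, hb, hb0, h⟩ := hq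
  have ha0 : a ≠ 0 := by
    rintro rfl
    exact mul_ne_zero q.ne_zero (frac_ne_zero hb0) (h.trans (map_zero _))
  exact ⟨a, b, fun hd ↦ hπ (exists_isHomogeneous_of_dvd ha ha0 hd),
    fun hd ↦ hπ (exists_isHomogeneous_of_dvd hb hb0 hd), h⟩

lemma mul_zpow_neg_div {G : Type*} [CommGroup G] (h c p q : G) (m : ℤ) :
    h * p ^ (-m) * c / (q / p) ^ m = c * h * q ^ (-m) := by
  rw [div_zpow, zpow_neg, zpow_neg, div_div_eq_mul_div, mul_right_comm h, inv_mul_cancel_right,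
    div_eq_mul_inv, mul_comm h c]

set_option maxHeartbeats 400000 in
/-- Every divisor on `ℙ^{n-1}` is a multiple of a hyperplane. The function that relates them is the
product of powers of the equations of the finitely many hypersurfaces where the divisor is not given
by its equation at the generic point. -/
lemma exists_linEquiv_zpow (hn : 2 ≤ n) (c : divisors (projSpace ℓ n)) :
    ∃ m : ℤ, LinEquiv c (hyperplane ℓ n ^ m) := by
  classical
  obtain ⟨U, hU, hcU⟩ := c.2 (genericPoint (projSpace ℓ n))
  obtain ⟨_, ⟨s, rfl⟩, hs, hsU⟩ := (ProjectiveSpectrum.isTopologicalBasis_basic_opens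
    (coordGrading ℓ n)).exists_subset_of_mem_open hU U.2
  have hs0 : s ≠ 0 := (ne_of_mem_of_not_mem (zero_mem _) hs).symm
  obtain ⟨i₀, j₀, a, b, -, -, -, hb0, hab⟩ := hasDegree_ratUnit (c.1 (genericPoint _))
  have ha0 : a ≠ 0 := by
    rintro rfl
    exact mul_ne_zero (Units.ne_zero _) (frac_ne_zero hb0) (hab.trans (map_zero _))
  have ht0 : s * a * b ≠ 0 := mul_ne_zero (mul_ne_zero hs0 ha0) hb0
  -- the hypersurfaces where `s a b` vanishes
  let 𝒮 : Set (Ideal (MvPolynomial (Fin n) ℓ)) :=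
    {I | ∃ π i, Prime π ∧ π.IsHomogeneous i ∧ π ∣ s * a * b ∧ I = Ideal.span {π}}
  have hfin : 𝒮.Finite := by
    obtain ⟨f, hf, hu⟩ := UniqueFactorizationMonoid.exists_prime_factors _ ht0
    refine (f.toFinset.image fun π ↦ Ideal.span {π}).finite_toSet.subset ?_
    rintro _ ⟨π, i, hπ, -, hd, rfl⟩
    obtain ⟨π', hπ', hd'⟩ := hπ.exists_mem_multiset_dvd (hd.trans hu.symm.dvd)
    refine Finset.mem_coe.2 (Finset.mem_image.2 ⟨π', Multiset.mem_toFinset.2 hπ', ?_⟩)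
    exact Ideal.span_singleton_eq_span_singleton.2
      (hπ.irreducible.associated_of_dvd (hf π' hπ').irreducible hd').symm
  have data (I : hfin.toFinset) : ∃ (π : MvPolynomial (Fin n) ℓ) (i : ℕ) (hπ : Prime π)
      (y : projSpace ℓ n) (v : ℤ), π.IsHomogeneous i ∧ I.1 = Ideal.span {π} ∧
      primeAt y = Ideal.span {π} ∧ π ∣ s * a * b ∧
      ratUnit (c.1 y) * fracUnit π hπ.ne_zero ^ v ∈ locUnits (primeAt y) := by
    obtain ⟨π, i, hπ, hi, hd, h⟩ := hfin.mem_toFinset.1 I.2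
    obtain ⟨y, hy⟩ := exists_primeAt_eq_span hn hπ hi
    obtain ⟨v, hv⟩ := exists_zpow_mem_locUnits hπ hy (ratUnit (c.1 y))
    exact ⟨π, i, hπ, y, v, hi, h, hy, hd, hv⟩
  choose π i hπ y v hi hI hy hd hv using data
  let h : Qˣ := ∏ I, fracUnit (π I) (hπ I).ne_zero ^ v I
  let m : ℤ := ∑ I, v I * i I
  have hdeg : HasDegree (h : Q) m := by
    have : (h : Q) = ∏ I, algebraMap _ Q (π I) ^ v I := by
      simp only [h, Units.coe_prod, Units.val_zpow_eq_zpow_val]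
      rfl
    rw [this]
    exact HasDegree.prod _ _ _ fun I _ ↦
      (HasDegree.of_isHomogeneous (hi I)).zpow (frac_ne_zero (hπ I).ne_zero) _
  have hcoord (j : Fin n) (m : ℤ) : HasDegree ((coordUnit j ^ m : Qˣ) : Q) m := by
    rw [Units.val_zpow_eq_zpow_val]
    simpa using (hasDegree_coordUnit (ℓ := ℓ) j).zpow (Units.ne_zero _) m
  have key (z : projSpace ℓ n) :
      ratUnit (c.1 z) * h * coordUnit (coordAt z) ^ (-m) ∈ locUnits (primeAt z) := by
    refine mem_locUnits_of_forall_prime fun π' hπ' hz ↦ ?_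
    by_cases hi' : ∃ i, π'.IsHomogeneous i
    swap
    · refine HasDegree.exists_not_dvd (m := 0) ?_ hi'
      have := ((hasDegree_ratUnit (c.1 z)).mul hdeg).mul (hcoord (coordAt z) (-m))
      rwa [zero_add, add_neg_cancel] at this
    obtain ⟨i', hi'⟩ := hi'
    obtain ⟨y', hy', hc⟩ : ∃ y', primeAt y' = Ideal.span {π'} ∧
        ratUnit (c.1 y') * h ∈ locUnits (primeAt y') := by
      by_cases hd' : π' ∣ s * a * b
      · have hm : Ideal.span {π'} ∈ hfin.toFinset :=
          hfin.mem_toFinset.2 ⟨π', i', hπ', hi', hd', rfl⟩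
        let I : hfin.toFinset := ⟨_, hm⟩
        refine ⟨y I, (hy I).trans (hI I).symm, ?_⟩
        have e : h = fracUnit (π I) (hπ I).ne_zero ^ v I *
            ∏ J ∈ Finset.univ.erase I, fracUnit (π J) (hπ J).ne_zero ^ v J :=
          (Finset.mul_prod_erase _ _ (Finset.mem_univ I)).symm
        rw [e, ← mul_assoc]
        refine mul_mem (hv I) (prod_mem fun J hJ ↦ zpow_mem (fracUnit_mem_locUnits fun hJI ↦ ?_) _)
        rw [hy I, Ideal.mem_span_singleton] at hJI
        refine Finset.ne_of_mem_erase hJ (Subtype.ext ?_)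
        rw [hI I, hI J]
        exact Ideal.span_singleton_eq_span_singleton.2
          ((hπ I).irreducible.associated_of_dvd (hπ J).irreducible hJI).symm
      · obtain ⟨y', hy'⟩ := exists_primeAt_eq_span hn hπ' hi'
        have hnot {x : MvPolynomial (Fin n) ℓ} (hx : x ∣ s * a * b) : x ∉ primeAt y' := fun H ↦ by
          rw [hy', Ideal.mem_span_singleton] at H
          exact hd' (H.trans hx)
        refine ⟨y', hy', mul_mem ?_ (prod_mem fun J _ ↦ zpow_mem (fracUnit_mem_locUnits
          (hnot (hd J))) _)⟩
        have h1 := mem_regUnits_projSpace_iff.1 (hcU y' (hsU (hnot (Dvd.intro _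
          (mul_assoc s a b).symm))))
        rw [map_div] at h1
        rw [← div_mul_cancel (ratUnit (c.1 y')) (ratUnit (c.1 (genericPoint _)))]
        exact mul_mem h1 ⟨a, b, hnot (Dvd.intro_left s rfl |>.mul_right b),
          hnot (Dvd.intro_left _ rfl), hab⟩
    have hle : primeAt y' ≤ primeAt z := by
      rw [hy', Ideal.span_singleton_le_iff_mem]; exact hz
    obtain ⟨W, hW, hcW⟩ := c.2 z
    have h1 := inv_mem (mem_regUnits_projSpace_iff.1 (hcW y' (mem_of_primeAt_le hle hW)))
    rw [← map_inv, inv_div, map_div] at h1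
    have h2 : coordUnit (coordAt z) ^ (-m) ∈ locUnits (primeAt y') :=
      zpow_mem (fracUnit_mem_locUnits fun h ↦ coordAt_notMem z (hle h)) _
    obtain ⟨a', b', ha', hb', e⟩ := mul_mem (mul_mem h1 hc) h2
    rw [hy', Ideal.mem_span_singleton] at ha' hb'
    refine ⟨a', b', ha', hb', ?_⟩
    rw [← e, ← mul_assoc, div_mul_cancel]
  obtain ⟨H, hH⟩ := exists_unit_ratFun_eq (ℓ := ℓ) (n := n) (q := h * coordUnit 0 ^ (-m)) (by
    have := hdeg.mul (hcoord 0 (-m))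
    rwa [add_neg_cancel] at this)
  refine ⟨m, H, fun z ↦ mem_regUnits_projSpace_iff.2 ?_⟩
  have e : (hyperplane ℓ n ^ m).1 z = coordFun ℓ (coordAt z) ^ m := rfl
  rw [e, map_div, map_mul, hH, map_zpow, ratFun_coordFun]
  convert key z using 1
  exact mul_zpow_neg_div _ _ _ _ _

omit [NeZero n] in
/-- A homogeneous fraction that is regular at all points of `ℙ^{n-1}` is a polynomial. -/
lemma HasDegree.exists_eq_algebraMap (hn : 2 ≤ n) {q : FractionRing (MvPolynomial (Fin n) ℓ)} {m : ℤ}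
    (hq : HasDegree q m) (h0 : q ≠ 0) (H : ∀ y : projSpace ℓ n, IsLocFrac (primeAt y) q) :
    ∃ (i : ℕ) (a : MvPolynomial (Fin n) ℓ), (i : ℤ) = m ∧ a.IsHomogeneous i ∧
      algebraMap _ _ a = q := by
  obtain ⟨a, b, hr, h⟩ := IsFractionRing.exists_reduced_fraction
    (A := MvPolynomial (Fin n) ℓ) q
  obtain ⟨i, j, a', b', e, ha', hb', hb0', h'⟩ := hq
  have hb0 : (b : MvPolynomial (Fin n) ℓ) ≠ 0 := nonZeroDivisors.ne_zero b.2
  have h1 : q * algebraMap _ Q (b : MvPolynomial (Fin n) ℓ) = algebraMap _ Q a := by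
    rw [← h, IsLocalization.mk'_spec]
  have key (c d : MvPolynomial (Fin n) ℓ) (h : q * algebraMap _ Q d = algebraMap _ Q c) :
      c * b = d * a := by
    apply IsFractionRing.injective (MvPolynomial (Fin n) ℓ) Q
    rw [map_mul, map_mul, ← h, ← h1]
    ring
  have hbu : IsUnit (b : MvPolynomial (Fin n) ℓ) := by
    by_contra hu
    obtain ⟨π, hπ, hd⟩ := WfDvdMonoid.exists_irreducible_factor hu hb0
    have hp := hπ.prime
    have hdb : π ∣ b' := by
      have : π ∣ b' * a := key _ _ h' ▸ hd.mul_left a'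
      exact (hp.dvd_or_dvd this).resolve_right fun hda ↦ hπ.not_isUnit (hr hda hd)
    obtain ⟨l, hl⟩ := exists_isHomogeneous_of_dvd hb' hb0' hdb
    obtain ⟨y, hy⟩ := exists_primeAt_eq_span hn hp hl
    obtain ⟨c, d, hd', hcd⟩ := H y
    rw [hy, Ideal.mem_span_singleton] at hd'
    have : π ∣ d * a := key _ _ hcd ▸ hd.mul_left c
    exact hπ.not_isUnit (hr ((hp.dvd_or_dvd this).resolve_left hd') hd)
  obtain ⟨β, hβ⟩ := hbu.exists_right_inv
  have h2 : algebraMap _ Q (a * β) = q := by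
    rw [map_mul, ← h1, mul_assoc, ← map_mul, hβ, map_one, mul_one]
  have h3 : a * β * b' = a' := by
    apply IsFractionRing.injective (MvPolynomial (Fin n) ℓ) Q
    rw [map_mul, h2, h']
  have h4 : a * β ≠ 0 := fun h ↦ h0 (by rw [← h2, h, map_zero])
  have ha0' : a' ≠ 0 := h3 ▸ mul_ne_zero h4 hb0'
  obtain ⟨l, hl⟩ := exists_isHomogeneous_of_dvd ha' ha0' (Dvd.intro _ h3)
  have h5 := (hl.mul hb').inj_right (h3 ▸ ha') (h3 ▸ ha0')
  exact ⟨l, a * β, by omega, hl, h2⟩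

/-- A nonzero section of `𝒪(m)`, as a rational function, comes from a homogeneous polynomial of
degree `m`. -/
lemma exists_isHomogeneous_of_section (hn : 2 ≤ n) {f : (projSpace ℓ n).functionFieldˣ} {m : ℤ}
    (H : ∀ y, (f / (hyperplane ℓ n ^ m).1 y).1 ∈ reg y) :
    ∃ (i : ℕ) (a : MvPolynomial (Fin n) ℓ), (i : ℤ) = m ∧ a.IsHomogeneous i ∧
      algebraMap _ _ a = ((ratUnit f * coordUnit 0 ^ m :
        (FractionRing (MvPolynomial (Fin n) ℓ))ˣ) : FractionRing (MvPolynomial (Fin n) ℓ)) := by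
  refine HasDegree.exists_eq_algebraMap hn ?_ (Units.ne_zero _) fun y ↦ ?_
  · have := (hasDegree_ratUnit f).mul ((hasDegree_coordUnit (ℓ := ℓ) (0 : Fin n)).zpow
      (Units.ne_zero _) m)
    rwa [zero_add, mul_one, ← Units.val_zpow_eq_zpow_val, ← Units.val_mul] at this
  · obtain ⟨a, b, hb, h⟩ := mem_reg_projSpace_iff.1 (H y)
    have h1 : coordUnit (coordAt y) ^ m ∈ locUnits (primeAt y) :=
      zpow_mem (fracUnit_mem_locUnits (coordAt_notMem y)) m
    obtain ⟨a', b', -, hb', h'⟩ := h1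
    refine ⟨a * a', b * b', fun h ↦ ((inferInstance : (primeAt y).IsPrime).mem_or_mem h).elim hb hb',
      ?_⟩
    rw [map_mul, map_mul, ← h, ← h']
    have e : (hyperplane ℓ n ^ m).1 y = coordFun ℓ (coordAt y) ^ m := rfl
    have e1 : ratUnit (f / (hyperplane ℓ n ^ m).1 y) * coordUnit (coordAt y) ^ m =
        ratUnit f * coordUnit 0 ^ m := by
      rw [e, map_div, map_zpow, ratFun_coordFun, div_zpow, div_div_eq_mul_div, div_mul_cancel]
    have e2 : ratFun (f / (hyperplane ℓ n ^ m).1 y).1 *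
        ((coordUnit (coordAt y) ^ m : Qˣ) : Q) = _ := congrArg Units.val e1
    rw [← e2]
    ring

end PicProjSpace

/-! ### Automorphisms of projective space -/

section Functoriality
variable {X Y Z : Scheme.{u}} [IsIntegral X] [IsIntegral Y] [IsIntegral Z]

lemma funMap_comp (f : X ⟶ Y) (g : Y ⟶ Z) [IsDominant f] [IsDominant g] [IsDominant (f ≫ g)]
    (a : Z.functionField) : funMap (f ≫ g) a = funMap f (funMap g a) := by
  obtain ⟨U, hU, r, rfl⟩ := exists_gen_of_mem_reg (mem_reg_genericPoint a)
  rw [funMap_gen, funMap_gen, funMap_gen]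
  rfl

lemma funMap_id (a : X.functionField) : funMap (𝟙 X) a = a := by
  obtain ⟨U, hU, r, rfl⟩ := exists_gen_of_mem_reg (mem_reg_genericPoint a)
  rw [funMap_gen]
  rfl

lemma pullDiv_comp (f : X ⟶ Y) (g : Y ⟶ Z) [IsDominant f] [IsDominant g] [IsDominant (f ≫ g)]
    (c : divisors Z) : pullDiv (f ≫ g) c = pullDiv f (pullDiv g c) :=
  Subtype.ext (funext fun _ ↦ Units.ext (funMap_comp f g _))

lemma pullDiv_id (c : divisors X) : pullDiv (𝟙 X) c = c :=
  Subtype.ext (funext fun _ ↦ Units.ext (funMap_id _))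

lemma pullDiv_congr {f g : X ⟶ Y} [IsDominant f] [IsDominant g] (h : f = g) (c : divisors Y) :
    pullDiv f c = pullDiv g c := by
  subst h
  rfl

/-- The sheaf of the divisor has a nonzero global section. -/
def HasSection (c : divisors X) : Prop :=
  ∃ f : X.functionFieldˣ, ∀ y, (f / c.1 y).1 ∈ reg y

lemma HasSection.of_linEquiv {c d : divisors X} (h : HasSection c) (h' : LinEquiv c d) :
    HasSection d := by
  obtain ⟨f, hf⟩ := h
  obtain ⟨h, H⟩ := h'
  refine ⟨h * f, fun y ↦ ?_⟩
  have e : h * f / d.1 y = (h * c.1 y / d.1 y) * (f / c.1 y) := by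
    rw [div_mul_div_comm, mul_assoc h, mul_comm (c.1 y), ← mul_assoc, mul_div_mul_right_eq_div]
  rw [e, Units.val_mul]
  exact mul_mem (H y).2.1 (hf y)

lemma HasSection.pullDiv (f : X ⟶ Y) [IsDominant f] {c : divisors Y} (h : HasSection c) :
    HasSection (pullDiv f c) := by
  obtain ⟨a, ha⟩ := h
  refine ⟨funMapUnits f a, fun y ↦ ?_⟩
  rw [pullDiv_apply, ← map_div]
  exact funMap_mem_reg f (ha (f y))

end Functoriality

section PicProjSpace
attribute [local instance] MvPolynomial.gradedAlgebra

variable {ℓ : Type u} [Field ℓ] {n : ℕ} [NeZero n]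

lemma hasSection_hyperplane : HasSection (hyperplane ℓ n) := by
  refine ⟨1, fun y ↦ mem_reg_projSpace_iff.2 ⟨MvPolynomial.X 0, MvPolynomial.X (coordAt y),
    coordAt_notMem y, ?_⟩⟩
  have e : ratUnit (1 / (hyperplane ℓ n).1 y) * coordUnit (coordAt y) = coordUnit 0 := by
    have : (hyperplane ℓ n).1 y = coordFun ℓ (coordAt y) := rfl
    rw [this, map_div, map_one, ratFun_coordFun, one_div_div, div_mul_cancel]
  exact congrArg Units.val e

lemma nonneg_of_hasSection (hn : 2 ≤ n) {m : ℤ} (h : HasSection (hyperplane ℓ n ^ m)) : 0 ≤ m := by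
  obtain ⟨f, hf⟩ := h
  obtain ⟨i, -, hi, -⟩ := exists_isHomogeneous_of_section hn hf
  omega

lemma hasSection_one {X : Scheme.{u}} [IsIntegral X] : HasSection (1 : divisors X) :=
  ⟨1, fun y ↦ by
    have : (1 : X.functionFieldˣ) / (1 : divisors X).1 y = 1 := div_one _
    rw [this]
    exact one_mem _⟩

lemma eq_of_linEquiv_zpow (hn : 2 ≤ n) {i j : ℤ}
    (h : LinEquiv (hyperplane ℓ n ^ i) (hyperplane ℓ n ^ j)) : i = j := by
  have key {i j : ℤ} (h : LinEquiv (hyperplane ℓ n ^ i) (hyperplane ℓ n ^ j)) : 0 ≤ j - i := by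
    have h' := h.mul (LinEquiv.refl (hyperplane ℓ n ^ (-i)))
    rw [← zpow_add, ← zpow_add, add_neg_cancel, zpow_zero, ← sub_eq_add_neg] at h'
    exact nonneg_of_hasSection hn (hasSection_one.of_linEquiv h')
  have h1 := key h
  have h2 := key h.symm
  omega

/-- Automorphisms of projective space preserve the class of a hyperplane: the inverse image of
`𝒪(1)` has nonzero sections, and its class is a generator of the Picard group. -/
lemma pullDiv_hyperplane (hn : 2 ≤ n) (α : projSpace ℓ n ⟶ projSpace ℓ n) [IsIso α] :
    LinEquiv (pullDiv α (hyperplane ℓ n)) (hyperplane ℓ n) := by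
  obtain ⟨i, hi⟩ := exists_linEquiv_zpow hn (pullDiv α (hyperplane ℓ n))
  obtain ⟨j, hj⟩ := exists_linEquiv_zpow hn (pullDiv (inv α) (hyperplane ℓ n))
  have hi0 := nonneg_of_hasSection hn ((hasSection_hyperplane.pullDiv α).of_linEquiv hi)
  have hj0 := nonneg_of_hasSection hn ((hasSection_hyperplane.pullDiv (inv α)).of_linEquiv hj)
  have h1 := hi.pullDiv (inv α)
  rw [← pullDiv_comp, pullDiv_congr (IsIso.inv_hom_id α), pullDiv_id, map_zpow] at h1
  have h2 := h1.trans (hj.zpow i)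
  rw [← zpow_mul] at h2
  nth_rw 1 [← zpow_one (hyperplane ℓ n)] at h2
  have h3 := eq_of_linEquiv_zpow hn h2
  have h4 : i = 1 := Int.eq_one_of_mul_eq_one_left hi0 h3.symm
  rwa [h4, zpow_one] at hi

end PicProjSpace

/-! ### Constants and charts of projective space -/

section Constants
variable {A : Type u} [CommRing A] {S : Type*} [SetLike S A] [AddSubgroupClass S A]
  (𝒜 : ℕ → S) [GradedRing 𝒜]

/-- The chart `Spec A_(f) → Proj` on the local ring of a point of `D₊(f)`. -/
lemma SpecMap_awayToSection_germ {f : A} {m : ℕ} (hf : f ∈ 𝒜 m) (hm : 0 < m) (x : Proj 𝒜)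
    (hx : x ∈ Proj.basicOpen 𝒜 f) :
    Spec.map (Proj.awayToSection 𝒜 f ≫ (Proj 𝒜).presheaf.germ _ x hx) ≫ Proj.awayι 𝒜 f hf hm =
      (Proj 𝒜).fromSpecStalk x := by
  rw [Spec.map_comp, Category.assoc, Proj.awayι,
    ← (Proj.isAffineOpen_basicOpen 𝒜 f hf hm).fromSpecStalk_eq_fromSpecStalk hx,
    IsAffineOpen.fromSpecStalk]
  congr 1
  have h1 : (Proj.isAffineOpen_basicOpen 𝒜 f hf hm).fromSpec =
    (Proj.isAffineOpen_basicOpen 𝒜 f hf hm).isoSpec.inv ≫ (Proj.basicOpen 𝒜 f).ι := rfl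
  rw [h1, ← Category.assoc]
  congr 1
  rw [← cancel_mono (Proj.basicOpenIsoSpec 𝒜 f hf hm).hom, Category.assoc, Iso.inv_hom_id,
    Category.comp_id, Iso.eq_inv_comp, Proj.basicOpenIsoSpec_hom]
  rfl

variable [IsDomain A] [IsIntegral (Proj 𝒜)]

/-- A degree-zero fraction, regarded as a rational function on Proj, is the same fraction. -/
lemma funFrac_awayToSection {f : A} (hη : genericPoint (Proj 𝒜) ∈ Proj.basicOpen 𝒜 f)
    (s : HomogeneousLocalization.NumDenSameDeg 𝒜 (Submonoid.powers f)) :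
    funFrac (gen (Proj.basicOpen 𝒜 f) hη (Proj.awayToSection 𝒜 f (HomogeneousLocalization.mk s))) *
      algebraMap A (FractionRing A) s.den = algebraMap A (FractionRing A) s.num := by
  have hs : (s.den : A) ∉ (genericIdeal 𝒜).asHomogeneousIdeal := by
    obtain ⟨i, hi⟩ := s.den_mem
    intro h
    refine hη ((genericIdeal 𝒜).isPrime.mem_of_pow_mem i ?_)
    rw [show f ^ i = s.den from hi]
    exact h
  let z : fracStalk 𝒜 (genericIdeal 𝒜) :=
    secVal 𝒜 (Proj.awayToSection 𝒜 f (HomogeneousLocalization.mk s)) ⟨_, hη⟩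
  have h1 : z * algebraMap A (fracStalk 𝒜 (genericIdeal 𝒜)) s.den =
      algebraMap A _ s.num := mk_mul_algebraMap (𝒜 := 𝒜) (genericIdeal 𝒜) s.num ⟨s.den, hs⟩
  have h2 := congrArg (fracStalkHom (genericIdeal 𝒜)) h1
  rw [map_mul, fracStalkHom_algebraMap, fracStalkHom_algebraMap] at h2
  rw [← h2]
  exact congrArg (· * _) (funFrac_gen hη _)

end Constants

section Charts
attribute [local instance] MvPolynomial.gradedAlgebra

variable (ℓ : Type u) [Field ℓ] (n : ℕ)

/-- The coordinate ring of the affine chart `x_j ≠ 0` of `ℙ^{n-1}`. -/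
abbrev chartRing (j : Fin n) : Type u :=
  HomogeneousLocalization.Away (coordGrading ℓ n) (MvPolynomial.X j)

/-- The affine chart `x_j ≠ 0` of `ℙ^{n-1}`. -/
def chart (j : Fin n) : Spec (.of (chartRing ℓ n j)) ⟶ projSpace ℓ n :=
  Proj.awayι (coordGrading ℓ n) (MvPolynomial.X j) (MvPolynomial.isHomogeneous_X ℓ j) one_pos

instance (j : Fin n) : IsOpenImmersion (chart ℓ n j) :=
  IsOpenImmersion.comp (Proj.basicOpenIsoSpec (coordGrading ℓ n) (MvPolynomial.X j)
    (MvPolynomial.isHomogeneous_X ℓ j) one_pos).inv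
    (Proj.basicOpen (coordGrading ℓ n) (MvPolynomial.X j)).ι

/-- The open set `x_j ≠ 0` of `ℙ^{n-1}`. -/
def chartOpen (j : Fin n) : (projSpace ℓ n).Opens :=
  Proj.basicOpen (coordGrading ℓ n) (MvPolynomial.X j)

lemma opensRange_chart (j : Fin n) : (chart ℓ n j).opensRange = chartOpen ℓ n j :=
  Proj.opensRange_awayι (coordGrading ℓ n) _ _ _

/-- The constants in the coordinate ring of a chart. -/
def chartConst (j : Fin n) : ℓ →+* chartRing ℓ n j :=
  (HomogeneousLocalization.fromZeroRingHom (coordGrading ℓ n) _).comp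
    (algebraMap ℓ (coordGrading ℓ n 0))

/-- The function `x_i / x_j` on the chart `x_j ≠ 0`. -/
def chartCoord (j i : Fin n) : chartRing ℓ n j :=
  HomogeneousLocalization.mk ⟨1, ⟨MvPolynomial.X i, MvPolynomial.isHomogeneous_X ℓ i⟩,
    ⟨MvPolynomial.X j, MvPolynomial.isHomogeneous_X ℓ j⟩, ⟨1, pow_one _⟩⟩

lemma chart_projSpaceHom (j : Fin n) : chart ℓ n j ≫ projSpaceHom ℓ n =
    Spec.map (CommRingCat.ofHom (chartConst ℓ n j)) := by
  have h : Proj.awayι (coordGrading ℓ n) (MvPolynomial.X j) (MvPolynomial.isHomogeneous_X ℓ j)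
      one_pos ≫ Proj.toSpecZero (coordGrading ℓ n) = _ :=
    Proj.awayι_toSpecZero (coordGrading ℓ n) (MvPolynomial.X j) (MvPolynomial.isHomogeneous_X ℓ j)
      one_pos
  rw [chart, projSpaceHom]
  refine (Category.assoc _ _ _).symm.trans ?_
  refine (congrArg (· ≫ _) h).trans ?_
  rw [← Spec.map_comp]
  rfl

variable {n}

/-- The homomorphism from the coordinate ring of a chart to the local ring of a point of it. -/
def chartGerm (j : Fin n) (y : projSpace ℓ n) (hy : y ∈ chartOpen ℓ n j) :
    chartRing ℓ n j →+* (projSpace ℓ n).presheaf.stalk y :=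
  (Proj.awayToSection (coordGrading ℓ n) (MvPolynomial.X j) ≫
    (Proj (coordGrading ℓ n)).presheaf.germ _ y hy).hom

lemma SpecMap_chartGerm (j : Fin n) (y : projSpace ℓ n) (hy : y ∈ chartOpen ℓ n j) :
    Spec.map (CommRingCat.ofHom (chartGerm ℓ j y hy)) ≫ chart ℓ n j =
      (projSpace ℓ n).fromSpecStalk y :=
  SpecMap_awayToSection_germ (coordGrading ℓ n) _ _ y hy

variable [NeZero n]

lemma genericPoint_mem_chartOpen (j : Fin n) :
    genericPoint (projSpace ℓ n) ∈ chartOpen ℓ n j := by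
  let y : projSpace ℓ n := zeroPoint (coordGrading ℓ n) ⟨1, one_pos, MvPolynomial.X 0,
    MvPolynomial.isHomogeneous_X ℓ 0, MvPolynomial.X_ne_zero 0⟩
  have hy : y ∈ chartOpen ℓ n j := fun h ↦ MvPolynomial.X_ne_zero (R := ℓ) j h
  exact genericPoint_mem hy

/-- The functions on a chart, as rational functions. -/
def chartFun (j : Fin n) : chartRing ℓ n j →+* (projSpace ℓ n).functionField :=
  chartGerm ℓ j _ (genericPoint_mem_chartOpen ℓ j)

lemma algebraMap_chartGerm (j : Fin n) (y : projSpace ℓ n) (hy : y ∈ chartOpen ℓ n j)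
    (a : chartRing ℓ n j) : algebraMap _ (projSpace ℓ n).functionField (chartGerm ℓ j y hy a) =
      chartFun ℓ j a :=
  algebraMap_germ (X := projSpace ℓ n) y hy
    (Proj.awayToSection (coordGrading ℓ n) (MvPolynomial.X j) a)

lemma ratFun_chartFun (j : Fin n) (s : HomogeneousLocalization.NumDenSameDeg (coordGrading ℓ n)
      (Submonoid.powers (MvPolynomial.X j))) :
    ratFun (chartFun ℓ j (HomogeneousLocalization.mk s)) * algebraMap _ _ s.den.1 =
      algebraMap _ _ s.num.1 := by
  have : IsIntegral (Proj (coordGrading ℓ n)) := isIntegral_projSpace ℓ n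
  exact funFrac_awayToSection (coordGrading ℓ n) (genericPoint_mem_chartOpen ℓ j) s

lemma chartFun_chartCoord (j i : Fin n) :
    chartFun ℓ j (chartCoord ℓ n j i) = (coordFun ℓ i / coordFun ℓ j : (projSpace ℓ n).functionFieldˣ) := by
  apply ratFun_injective
  apply mul_right_cancel₀ (frac_ne_zero (MvPolynomial.X_ne_zero (R := ℓ) j))
  refine (ratFun_chartFun ℓ j _).trans ?_
  have e : ratUnit (coordFun ℓ i / coordFun ℓ j) * coordUnit j = coordUnit i := by
    rw [map_div, ratFun_coordFun, ratFun_coordFun, div_div_div_cancel_right, div_mul_cancel]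
  exact (congrArg Units.val e).symm

lemma ratFun_chartConst (j : Fin n) (a : ℓ) :
    ratFun (chartFun ℓ j (chartConst ℓ n j a)) =
      algebraMap (MvPolynomial (Fin n) ℓ) (FractionRing (MvPolynomial (Fin n) ℓ))
        (MvPolynomial.C a) := by
  have := ratFun_chartFun ℓ j ⟨0, algebraMap ℓ (coordGrading ℓ n 0) a, 1, one_mem _⟩
  have h1 : algebraMap (MvPolynomial (Fin n) ℓ) (FractionRing (MvPolynomial (Fin n) ℓ))
    ((1 : coordGrading ℓ n 0) : MvPolynomial (Fin n) ℓ) = 1 := map_one _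
  rw [h1, mul_one] at this
  exact this

variable (n) in
/-- The constant functions on `ℙ^{n-1}`. -/
def constFun : ℓ →+* (projSpace ℓ n).functionField := (chartFun ℓ 0).comp (chartConst ℓ n 0)

lemma chartFun_chartConst (j : Fin n) (a : ℓ) :
    chartFun ℓ j (chartConst ℓ n j a) = constFun ℓ n a := by
  apply ratFun_injective
  rw [ratFun_chartConst]
  exact (ratFun_chartConst ℓ 0 a).symm

lemma constFun_mem_reg (a : ℓ) (y : projSpace ℓ n) : constFun ℓ n a ∈ reg y := by
  rw [← chartFun_chartConst ℓ (coordAt y), ← algebraMap_chartGerm ℓ _ y (coordAt_notMem y)]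
  exact ⟨_, rfl⟩

lemma fromSpecStalk_projSpaceHom : (projSpace ℓ n).fromSpecStalk (genericPoint _) ≫
    projSpaceHom ℓ n = Spec.map (CommRingCat.ofHom (constFun ℓ n)) := by
  rw [← SpecMap_chartGerm ℓ 0 _ (genericPoint_mem_chartOpen ℓ 0), Category.assoc,
    chart_projSpaceHom, ← Spec.map_comp]
  rfl

/-- A function that is regular everywhere on `ℙ^{n-1}` is constant. -/
lemma exists_constFun_eq (hn : 2 ≤ n) {f : (projSpace ℓ n).functionField} (hf : ∀ y, f ∈ reg y) :
    ∃ a : ℓ, constFun ℓ n a = f := by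
  by_cases h0 : f = 0
  · exact ⟨0, by rw [h0, map_zero]⟩
  obtain ⟨i, a, hi, ha, h⟩ := (hasDegree_ratFun f).exists_eq_algebraMap hn
    ((map_ne_zero_iff _ ratFun_injective).2 h0) fun y ↦ mem_reg_projSpace_iff.1 (hf y)
  obtain rfl : i = 0 := by omega
  refine ⟨MvPolynomial.coeff 0 a, ratFun_injective ?_⟩
  refine (ratFun_chartConst ℓ 0 _).trans ?_
  rw [← h]
  congr 1
  rw [← MvPolynomial.totalDegree_zero_iff_isHomogeneous] at ha
  exact (MvPolynomial.totalDegree_eq_zero_iff_eq_C.1 ha).symm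

end Charts

/-! ### Serre twists -/

section Twist
attribute [local instance] MvPolynomial.gradedAlgebra

variable {ℓ : Type u} [Field ℓ] {n : ℕ} [NeZero n]

local notation "Q" => FractionRing (MvPolynomial (Fin n) ℓ)

/-- The value of a section of `𝒪(m)` at the generic point, a homogeneous fraction. -/
def twistVal (m : ℤ) (U : (projSpace ℓ n).Opens) (hU : genericPoint (projSpace ℓ n) ∈ U) :
    Γ(serreTwist ℓ n m, U) →+ FractionRing (MvPolynomial (Fin n) ℓ) where
  toFun s := fracStalkHom (𝒜 := coordGrading ℓ n) (genericPoint (projSpace ℓ n))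
    (s.1 ⟨_, hU⟩)
  map_zero' := map_zero _
  map_add' _ _ := map_add _ _ _

/-- Near each point a section of `𝒪(m)` is a quotient of two homogeneous polynomials. -/
lemma exists_frac_of_twist {m : ℤ} {U : (projSpace ℓ n).Opens}
    (hU : genericPoint (projSpace ℓ n) ∈ U) (s : Γ(serreTwist ℓ n m, U)) (x : projSpace ℓ n)
    (hx : x ∈ U) : fracStalkHom (𝒜 := coordGrading ℓ n) x (s.1 ⟨x, hx⟩) = twistVal m U hU s ∧
      HasDegree (twistVal m U hU s) m := by
  obtain ⟨V, hV, hxV, i, j, a, b, e, ha, hb, H⟩ := s.2 x hx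
  have hη := genericPoint_mem (X := projSpace ℓ n) (U := V) hxV
  have key (y : projSpace ℓ n) (hy : y ∈ V) :
      fracStalkHom (𝒜 := coordGrading ℓ n) y (s.1 ⟨y, hV hy⟩) * algebraMap _ Q b =
        algebraMap _ Q a := by
    have h := congrArg (fracStalkHom (𝒜 := coordGrading ℓ n) y) (H ⟨y, hy⟩).2
    rw [map_mul] at h
    rw [← fracStalkHom_algebraMap (𝒜 := coordGrading ℓ n) y a, ← h]
    exact congrArg _ (fracStalkHom_algebraMap (𝒜 := coordGrading ℓ n) y b).symm
  have hb0 : b ≠ 0 := by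
    rintro rfl
    exact (H ⟨x, hxV⟩).1 (zero_mem _)
  exact ⟨mul_right_cancel₀ (frac_ne_zero hb0) ((key x hxV).trans (key _ hη).symm),
    i, j, a, b, e, ha, hb, hb0, key _ hη⟩

lemma exists_ratFun_twist {m : ℤ} {q : FractionRing (MvPolynomial (Fin n) ℓ)} (hq : HasDegree q m) :
    ∃ f : (projSpace ℓ n).functionField,
      ratFun f = q * (coordUnit 0 ^ (-m) : (FractionRing (MvPolynomial (Fin n) ℓ))ˣ) := by
  refine exists_ratFun_eq ?_
  have h := hq.mul ((hasDegree_coordUnit (ℓ := ℓ) (0 : Fin n)).zpow (Units.ne_zero _) (-m))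
  rwa [mul_one, add_neg_cancel, ← Units.val_zpow_eq_zpow_val] at h

/-- The sections of `𝒪(m)`, divided by `x_0^m`, as rational functions. -/
def twistFun (m : ℤ) (U : (projSpace ℓ n).Opens) (hU : genericPoint (projSpace ℓ n) ∈ U)
    (s : Γ(serreTwist ℓ n m, U)) : (projSpace ℓ n).functionField :=
  (exists_ratFun_twist (exists_frac_of_twist hU s _ hU).2).choose

lemma ratFun_twistFun (m : ℤ) (U : (projSpace ℓ n).Opens) (hU : genericPoint (projSpace ℓ n) ∈ U)
    (s : Γ(serreTwist ℓ n m, U)) : ratFun (twistFun m U hU s) = twistVal m U hU s *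
      (coordUnit 0 ^ (-m) : (FractionRing (MvPolynomial (Fin n) ℓ))ˣ) :=
  (exists_ratFun_twist (exists_frac_of_twist hU s _ hU).2).choose_spec

/-- The sections of `𝒪(m)` at `x` are the rational functions that become fractions with denominator
prime to `x` after the multiplication by `x_0^m`. -/
lemma mem_divLattice_hyperplane {m : ℤ} {x : projSpace ℓ n} {f : (projSpace ℓ n).functionField} :
    f ∈ (divLattice (hyperplane ℓ n ^ m)).carrier x ↔ IsLocFrac (primeAt x)
      (ratFun f * (coordUnit 0 ^ m : (FractionRing (MvPolynomial (Fin n) ℓ))ˣ)) := by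
  have e : (hyperplane ℓ n ^ m).1 x = coordFun ℓ (coordAt x) ^ m := rfl
  rw [mem_divLattice, e, mem_reg_projSpace_iff, map_mul]
  have h1 : ratUnit ((coordFun ℓ (coordAt x) ^ m)⁻¹) =
      (coordUnit (coordAt x) ^ m)⁻¹ * coordUnit 0 ^ m := by
    rw [map_inv, map_zpow, ratFun_coordFun, div_zpow, inv_div, div_eq_mul_inv, mul_comm]
  have h2 : ratFun (((coordFun ℓ (coordAt x) ^ m)⁻¹ : (projSpace ℓ n).functionFieldˣ) : _) =
      (((coordUnit (coordAt x) ^ m)⁻¹ * coordUnit 0 ^ m : Qˣ) : Q) := congrArg Units.val h1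
  have h3 : coordUnit (coordAt x) ^ m ∈ locUnits (primeAt x) :=
    zpow_mem (fracUnit_mem_locUnits (coordAt_notMem x)) m
  rw [h2]
  obtain ⟨a, b, ha, hb, h⟩ := h3
  have hp : (primeAt x).IsPrime := inferInstance
  constructor
  · rintro ⟨c, d, hd, h'⟩
    refine ⟨a * c, b * d, fun H ↦ (hp.mem_or_mem H).elim hb hd, ?_⟩
    rw [map_mul, map_mul, ← h, ← h', Units.val_mul]
    linear_combination -(ratFun f * (coordUnit 0 ^ m : Qˣ).1 * algebraMap _ Q b *
      algebraMap _ Q d) * (coordUnit (coordAt x) ^ m : Qˣ).mul_inv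
  · rintro ⟨c, d, hd, h'⟩
    refine ⟨b * c, a * d, fun H ↦ (hp.mem_or_mem H).elim ha hd, ?_⟩
    rw [map_mul, map_mul, ← h, ← h', Units.val_mul]
    linear_combination (ratFun f * (coordUnit 0 ^ m : Qˣ).1 * algebraMap _ Q b *
      algebraMap _ Q d) * (coordUnit (coordAt x) ^ m : Qˣ).mul_inv

end Twist

lemma exists_fracStalkHom_eq {A : Type u} [CommRing A] [IsDomain A] {S : Type*} [SetLike S A]
    [AddSubgroupClass S A] {𝒜 : ℕ → S} [GradedRing 𝒜] (x : ProjectiveSpectrum 𝒜)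
    {q : FractionRing A} (h : IsLocFrac x.asHomogeneousIdeal.toIdeal q) :
    ∃ z : fracStalk 𝒜 x, fracStalkHom x z = q := by
  obtain ⟨a, b, hb, h⟩ := h
  refine ⟨Localization.mk a ⟨b, hb⟩, ?_⟩
  have h1 := congrArg (fracStalkHom x) (mk_mul_algebraMap x a ⟨b, hb⟩)
  rw [map_mul, fracStalkHom_algebraMap, fracStalkHom_algebraMap, ← h] at h1
  exact mul_right_cancel₀ (frac_ne_zero (ne_of_mem_of_not_mem (zero_mem _) hb).symm) h1

section Twist
attribute [local instance] MvPolynomial.gradedAlgebra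

variable {ℓ : Type u} [Field ℓ] {n : ℕ} [NeZero n]

local notation "Q" => FractionRing (MvPolynomial (Fin n) ℓ)

lemma twistFun_eq {m : ℤ} {U : (projSpace ℓ n).Opens} {hU : genericPoint (projSpace ℓ n) ∈ U}
    {s : Γ(serreTwist ℓ n m, U)} {f : (projSpace ℓ n).functionField}
    (h : ratFun f = twistVal m U hU s *
      (coordUnit 0 ^ (-m) : (FractionRing (MvPolynomial (Fin n) ℓ))ˣ)) : twistFun m U hU s = f :=
  ratFun_injective ((ratFun_twistFun m U hU s).trans h.symm)

lemma twistVal_smul (m : ℤ) (U : (projSpace ℓ n).Opens) (hU : genericPoint (projSpace ℓ n) ∈ U)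
    (r : Γ(projSpace ℓ n, U)) (s : Γ(serreTwist ℓ n m, U)) :
    twistVal m U hU (r • s) = ratFun (gen U hU r) * twistVal m U hU s := by
  have : IsIntegral (Proj (coordGrading ℓ n)) := isIntegral_projSpace ℓ n
  have h : ratFun (gen U hU r) = _ := funFrac_gen (𝒜 := coordGrading ℓ n) hU r
  rw [h]
  exact map_mul (fracStalkHom (𝒜 := coordGrading ℓ n) (genericPoint (projSpace ℓ n))) _ _

lemma ratFun_twistFun_mul (m : ℤ) (U : (projSpace ℓ n).Opens)
    (hU : genericPoint (projSpace ℓ n) ∈ U) (s : Γ(serreTwist ℓ n m, U)) :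
    ratFun (twistFun m U hU s) * (coordUnit 0 ^ m : (FractionRing (MvPolynomial (Fin n) ℓ))ˣ) =
      twistVal m U hU s := by
  rw [ratFun_twistFun, mul_assoc, ← Units.val_mul, ← zpow_add, neg_add_cancel, zpow_zero,
    Units.val_one, mul_one]

lemma twistFun_add (m : ℤ) (U : (projSpace ℓ n).Opens) (hU : genericPoint (projSpace ℓ n) ∈ U)
    (s t : Γ(serreTwist ℓ n m, U)) :
    twistFun m U hU (s + t) = twistFun m U hU s + twistFun m U hU t :=
  twistFun_eq (by rw [map_add, ratFun_twistFun, ratFun_twistFun, map_add, add_mul])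

/-- The embedding of `𝒪(m)` in the function field. -/
def twistHom (m : ℤ) : LatHom (serreTwist ℓ n m).val (divLattice (hyperplane ℓ n ^ m)) where
  toFun U hU :=
    { toFun s := twistFun m U hU s
      map_zero' := twistFun_eq (by
        rw [map_zero]
        exact (zero_mul _).symm.trans (congrArg (· * _) (map_zero (twistVal m U hU)).symm))
      map_add' s t := twistFun_add m U hU s t }
  map_smul U hU r s := twistFun_eq (by
    rw [smul_eq_mul, map_mul]
    refine (congrArg _ (ratFun_twistFun m U hU s)).trans ?_
    rw [← mul_assoc]
    exact congrArg (· * _) (twistVal_smul m U hU r s).symm)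
  map_res i hW s := twistFun_eq (ratFun_twistFun m _ (i.le hW) s)
  mem U x hx s := by
    refine mem_divLattice_hyperplane.2 ?_
    refine (ratFun_twistFun_mul m U (genericPoint_mem hx) s).symm ▸ ?_
    rw [← (exists_frac_of_twist (genericPoint_mem hx) s x hx).1]
    exact isLocFrac_fracStalkHom (𝒜 := coordGrading ℓ n) x _

/-- The quotients by `x_0^m` of the sections of `𝒪(m)` are the sections of the sheaf of the divisor
`m H`. -/
lemma bijOn_twistHom (m : ℤ) (U : (projSpace ℓ n).Opens) : (twistHom (ℓ := ℓ) (n := n) m).BijOn U := by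
  intro hU
  have hc : ((coordUnit 0 ^ (-m) : Qˣ) : Q) ≠ 0 := Units.ne_zero _
  constructor
  · rw [injective_iff_map_eq_zero]
    intro s hs
    have h0 : twistVal m U hU s = 0 := by
      have := ratFun_twistFun m U hU s
      rw [show twistFun m U hU s = 0 from hs, map_zero] at this
      exact (mul_eq_zero.1 this.symm).resolve_right hc
    refine Subtype.ext (funext fun x ↦ ?_)
    apply fracStalkHom_injective (𝒜 := coordGrading ℓ n) x.1
    refine (exists_frac_of_twist hU s x.1 x.2).1.trans (h0.trans ?_)
    exact (map_zero (fracStalkHom (𝒜 := coordGrading ℓ n) x.1)).symm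
  · intro v hv
    let q : Q := ratFun v * (coordUnit 0 ^ m : Qˣ)
    have hq : HasDegree q m := by
      have h := (hasDegree_ratFun v).mul ((hasDegree_coordUnit (ℓ := ℓ) (0 : Fin n)).zpow
        (Units.ne_zero _) m)
      rwa [mul_one, zero_add, ← Units.val_zpow_eq_zpow_val] at h
    have hq' (x : projSpace ℓ n) (hx : x ∈ U) : IsLocFrac (primeAt x) q :=
      mem_divLattice_hyperplane.1 (hv x hx)
    have key (x : U) : ∃ z : fracStalk (coordGrading ℓ n) x.1,
        fracStalkHom (𝒜 := coordGrading ℓ n) x.1 z = q :=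
      exists_fracStalkHom_eq (𝒜 := coordGrading ℓ n) x.1 (hq' x.1 x.2)
    choose z hz using key
    have hs : IsLocallyFracOfDegree (coordGrading ℓ n) m (U := U) z := by
      intro x hx
      by_cases h0 : q = 0
      · have : z = 0 := funext fun x ↦ by
          apply fracStalkHom_injective (𝒜 := coordGrading ℓ n) x.1
          rw [hz, h0]
          exact (map_zero (fracStalkHom (𝒜 := coordGrading ℓ n) x.1)).symm
        rw [this]
        exact isLocallyFrac_zero x hx
      · obtain ⟨i, j, a, b, e, ha, hb, hbx, h⟩ := hq.exists_of_isLocFrac h0 (hq' x hx)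
        refine ⟨U ⊓ Proj.basicOpen (coordGrading ℓ n) b, inf_le_left, ⟨hx, hbx⟩, i, j, a, b, e, ha,
          hb, fun y ↦ ⟨y.2.2, ?_⟩⟩
        apply fracStalkHom_injective (𝒜 := coordGrading ℓ n) y.1
        rw [map_mul]
        refine Eq.trans (congrArg₂ (· * ·) (hz ⟨y.1, y.2.1⟩)
          (fracStalkHom_algebraMap (𝒜 := coordGrading ℓ n) y.1 b)) (h.trans ?_)
        exact (fracStalkHom_algebraMap (𝒜 := coordGrading ℓ n) y.1 a).symm
    refine ⟨⟨z, hs⟩, twistFun_eq ?_⟩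
    have e : twistVal (ℓ := ℓ) (n := n) m U hU ⟨z, hs⟩ = q := hz ⟨_, hU⟩
    rw [e]
    change _ = ratFun v * (coordUnit 0 ^ m : Qˣ).1 * _
    rw [mul_assoc, ← Units.val_mul, ← zpow_add, add_neg_cancel, zpow_zero, Units.val_one, mul_one]

/-- The twist `𝒪(m)` is the sheaf of `m` times a hyperplane. -/
lemma serreTwist_iso (m : ℤ) : Nonempty (serreTwist ℓ n m ≅ divSheaf (hyperplane ℓ n ^ m)) := by
  obtain ⟨e, -⟩ := (twistHom (ℓ := ℓ) (n := n) m).exists_iso' fun U x hx ↦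
    ⟨U, le_rfl, hx, bijOn_twistHom m U⟩
  exact ⟨e⟩

end Twist

/-! ### Points of projective space -/

section ChartHoms
attribute [local instance] MvPolynomial.gradedAlgebra

variable {ℓ : Type u} [Field ℓ] {n : ℕ}

local notation "A" => MvPolynomial (Fin n) ℓ

lemma val_chartConst (j : Fin n) (a : ℓ) : (chartConst ℓ n j a).val =
    algebraMap A (Localization.Away (MvPolynomial.X j : A))
      (MvPolynomial.C a) := by
  have h1 : chartConst ℓ n j a =
    HomogeneousLocalization.mk ⟨0, algebraMap ℓ (coordGrading ℓ n 0) a, 1, one_mem _⟩ := rfl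
  rw [h1, HomogeneousLocalization.val_mk]
  exact Localization.mk_one_eq_algebraMap _

lemma val_chartCoord_mul (j i : Fin n) : (chartCoord ℓ n j i).val *
    algebraMap A (Localization.Away (MvPolynomial.X j : A))
      (MvPolynomial.X j) = algebraMap A _ (MvPolynomial.X i) := by
  rw [chartCoord, HomogeneousLocalization.val_mk, Localization.mk_eq_mk']
  exact IsLocalization.mk'_spec (M := Submonoid.powers (MvPolynomial.X j : A)) _
    (MvPolynomial.X i : A) ⟨MvPolynomial.X j, 1, pow_one _⟩

lemma chartCoord_self (j : Fin n) : chartCoord ℓ n j j = 1 := by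
  apply HomogeneousLocalization.val_injective
  rw [HomogeneousLocalization.val_one, chartCoord, HomogeneousLocalization.val_mk]
  exact Localization.mk_self (⟨_, _⟩ : Submonoid.powers (MvPolynomial.X j : A))

/-- A homogeneous polynomial `a` of degree `d`, evaluated at the functions `x_i / x_j`, is the
function `a / x_j ^ d`. -/
lemma val_eval₂_chartCoord (j : Fin n) {d : ℕ} {a : MvPolynomial (Fin n) ℓ}
    (ha : a.IsHomogeneous d) :
    (a.eval₂ (chartConst ℓ n j) (chartCoord ℓ n j)).val *
      algebraMap A (Localization.Away (MvPolynomial.X j : A))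
        (MvPolynomial.X j) ^ d = algebraMap A _ a := by
  let L := Localization.Away (MvPolynomial.X j : A)
  let v : chartRing ℓ n j →+* L := algebraMap _ _
  change v _ * _ = _
  rw [MvPolynomial.eval₂_eq', map_sum, Finset.sum_mul]
  conv_rhs => rw [a.as_sum, map_sum]
  refine Finset.sum_congr rfl fun m hm ↦ ?_
  have hd : d = ∑ i, m i := by
    have := ha (MvPolynomial.mem_support_iff.1 hm)
    rw [← this, Finsupp.weight_apply, Finsupp.sum_fintype _ _ (by simp)]
    simp
  rw [map_mul, map_prod, MvPolynomial.monomial_eq, Finsupp.prod_fintype _ _ (by simp), map_mul,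
    map_prod, hd, ← Finset.prod_pow_eq_pow_sum, mul_assoc, ← Finset.prod_mul_distrib]
  refine congrArg₂ _ (val_chartConst j _) (Finset.prod_congr rfl fun i _ ↦ ?_)
  rw [map_pow, map_pow, ← mul_pow]
  exact congrArg (· ^ m i) (val_chartCoord_mul j i)

/-- The ring of a chart is generated over the constants by the coordinates `x_i / x_j`. -/
lemma exists_eval₂_chartCoord (j : Fin n) (z : chartRing ℓ n j) :
    ∃ a : MvPolynomial (Fin n) ℓ, a.eval₂ (chartConst ℓ n j) (chartCoord ℓ n j) = z := by
  obtain ⟨d, a, ha, rfl⟩ := HomogeneousLocalization.Away.mk_surjective (coordGrading ℓ n)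
    (MvPolynomial.isHomogeneous_X ℓ j) z
  have ha' : a.IsHomogeneous d := by
    have := (MvPolynomial.mem_homogeneousSubmodule _ _).1 ha
    simpa using this
  refine ⟨a, HomogeneousLocalization.val_injective _ ?_⟩
  have hu : IsUnit (algebraMap A (Localization.Away (MvPolynomial.X j : A))
      (MvPolynomial.X j) ^ d) := (IsLocalization.Away.algebraMap_isUnit _).pow d
  refine hu.mul_left_injective ?_
  refine (val_eval₂_chartCoord j ha').trans ?_
  refine Eq.trans ?_ (congrArg (· * _) (HomogeneousLocalization.Away.val_mk ..)).symm
  rw [Localization.mk_eq_mk', ← map_pow]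
  exact (IsLocalization.mk'_spec (M := Submonoid.powers (MvPolynomial.X j : A)) _ a
    ⟨MvPolynomial.X j ^ d, d, rfl⟩).symm

/-- A homomorphism on the coordinate ring of a chart is determined by its values at the constants
and at the functions `x_i / x_j`. -/
lemma chartRing_hom_ext {R : Type*} [CommRing R] {j : Fin n} {α β : chartRing ℓ n j →+* R}
    (hc : ∀ a, α (chartConst ℓ n j a) = β (chartConst ℓ n j a))
    (hx : ∀ i, α (chartCoord ℓ n j i) = β (chartCoord ℓ n j i)) : α = β := by
  ext z
  obtain ⟨a, rfl⟩ := exists_eval₂_chartCoord j z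
  rw [MvPolynomial.hom_eval₂, MvPolynomial.hom_eval₂]
  congr 1
  · exact RingHom.ext hc
  · exact funext hx

/-- A row `w` over an `ℓ`-algebra with `w_j` a unit is a point of the chart `x_j ≠ 0`, with
coordinates `x_i / x_j ↦ w_i / w_j`. -/
lemma exists_chartRing_hom {R : Type*} [CommRing R] (φ : ℓ →+* R) {w : Fin n → R} {j : Fin n}
    (hj : IsUnit (w j)) : ∃ α : chartRing ℓ n j →+* R, α.comp (chartConst ℓ n j) = φ ∧
      ∀ i, α (chartCoord ℓ n j i) * w j = w i := by
  have hj' : IsUnit (MvPolynomial.eval₂Hom φ w (MvPolynomial.X j)) := by simpa using hj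
  let g : Localization.Away (MvPolynomial.X j : A) →+* R :=
    IsLocalization.Away.lift _ hj'
  have hg (a) : g (algebraMap A _ a) = MvPolynomial.eval₂Hom φ w a :=
    IsLocalization.Away.lift_eq _ hj' a
  refine ⟨g.comp (algebraMap _ _), ?_, fun i ↦ ?_⟩
  · ext a
    have : g (chartConst ℓ n j a).val = φ a := by
      rw [val_chartConst, hg]; simp
    exact this
  · have := congrArg g (val_chartCoord_mul (ℓ := ℓ) j i)
    rw [map_mul, hg, hg] at this
    simpa using this

section Overlap
variable {R : Type u} [CommRing R]

/-- The coordinates of a point in two charts are proportional. -/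
lemma chartCoord_mul_of_eq {i j : Fin n} {α : chartRing ℓ n i →+* R} {β : chartRing ℓ n j →+* R}
    (h : Spec.map (CommRingCat.ofHom α) ≫ chart ℓ n i =
      Spec.map (CommRingCat.ofHom β) ≫ chart ℓ n j) (p : Fin n) :
    β (chartCoord ℓ n j p) * α (chartCoord ℓ n i j) = α (chartCoord ℓ n i p) := by
  -- Both maps factor through the coordinate ring of the overlap of the charts, where the identity
  -- holds for the coordinates themselves.
  let Z := HomogeneousLocalization.Away (coordGrading ℓ n)
    (MvPolynomial.X i * MvPolynomial.X j : A)
  let e := Proj.pullbackAwayιIso (coordGrading ℓ n) (MvPolynomial.isHomogeneous_X ℓ i) one_pos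
    (MvPolynomial.isHomogeneous_X ℓ j) one_pos rfl
  let m : Spec (.of R) ⟶ Spec (.of Z) := Limits.pullback.lift _ _ h ≫ e.hom
  obtain ⟨δ, hδ⟩ := Spec.map_surjective m
  let μ := HomogeneousLocalization.awayMap (coordGrading ℓ n) (f := (MvPolynomial.X i : A))
    (MvPolynomial.isHomogeneous_X ℓ j) rfl
  let ν := HomogeneousLocalization.awayMap (coordGrading ℓ n) (f := (MvPolynomial.X j : A))
    (x := MvPolynomial.X i * MvPolynomial.X j)
    (MvPolynomial.isHomogeneous_X ℓ i) (mul_comm _ _)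
  have hα : α = δ.hom.comp μ := by
    have : Spec.map (CommRingCat.ofHom α) = Spec.map (CommRingCat.ofHom (δ.hom.comp μ)) := by
      rw [CommRingCat.ofHom_comp, Spec.map_comp]
      refine Eq.trans ?_ (congrArg (· ≫ Spec.map (CommRingCat.ofHom μ)) hδ.symm)
      refine Eq.trans ?_ (Category.assoc _ _ _).symm
      refine Eq.trans ?_ (congrArg (Limits.pullback.lift _ _ h ≫ ·)
        (Proj.pullbackAwayιIso_hom_SpecMap_awayMap_left _ _ _ _ _ _).symm)
      exact (Limits.pullback.lift_fst _ _ _).symm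
    exact congrArg CommRingCat.Hom.hom (Spec.map_injective this)
  have hβ : β = δ.hom.comp ν := by
    have : Spec.map (CommRingCat.ofHom β) = Spec.map (CommRingCat.ofHom (δ.hom.comp ν)) := by
      rw [CommRingCat.ofHom_comp, Spec.map_comp]
      refine Eq.trans ?_ (congrArg (· ≫ Spec.map (CommRingCat.ofHom ν)) hδ.symm)
      refine Eq.trans ?_ (Category.assoc _ _ _).symm
      refine Eq.trans ?_ (congrArg (Limits.pullback.lift _ _ h ≫ ·)
        (Proj.pullbackAwayιIso_hom_SpecMap_awayMap_right _ _ _ _ _ _).symm)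
      exact (Limits.pullback.lift_snd _ _ _).symm
    exact congrArg CommRingCat.Hom.hom (Spec.map_injective this)
  rw [hα, hβ]
  simp only [RingHom.comp_apply]
  rw [← map_mul]
  refine congrArg δ.hom (HomogeneousLocalization.val_injective _ ?_)
  have hμ (q : Fin n) : (μ (chartCoord ℓ n i q)).val = Localization.mk (MvPolynomial.X q * MvPolynomial.X j)
      (⟨MvPolynomial.X i * MvPolynomial.X j, ⟨1, pow_one _⟩⟩ :
        Submonoid.powers (MvPolynomial.X i * MvPolynomial.X j : A)) := by
    have := HomogeneousLocalization.val_awayMap_mk (coordGrading ℓ n) (f := (MvPolynomial.X i : A))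
      (MvPolynomial.isHomogeneous_X ℓ j) rfl 1 ⟨MvPolynomial.X q, MvPolynomial.isHomogeneous_X ℓ q⟩ 1 (by
        rw [pow_one]; exact MvPolynomial.isHomogeneous_X ℓ i)
    simp only [pow_one] at this
    exact this
  have hν (q : Fin n) : (ν (chartCoord ℓ n j q)).val = Localization.mk (MvPolynomial.X q * MvPolynomial.X i)
      (⟨MvPolynomial.X i * MvPolynomial.X j, ⟨1, pow_one _⟩⟩ :
        Submonoid.powers (MvPolynomial.X i * MvPolynomial.X j : A)) := by
    have := HomogeneousLocalization.val_awayMap_mk (coordGrading ℓ n) (f := (MvPolynomial.X j : A))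
      (x := MvPolynomial.X i * MvPolynomial.X j)
      (MvPolynomial.isHomogeneous_X ℓ i) (mul_comm _ _) 1 ⟨MvPolynomial.X q, MvPolynomial.isHomogeneous_X ℓ q⟩ 1 (by
        rw [pow_one]; exact MvPolynomial.isHomogeneous_X ℓ j)
    simp only [pow_one] at this
    exact this
  rw [HomogeneousLocalization.val_mul, hμ, hμ, hν, Localization.mk_mul, Localization.mk_eq_mk_iff,
    Localization.r_iff_exists]
  exact ⟨1, by simp only [OneMemClass.coe_one, Submonoid.coe_mul]; ring⟩

/-- Two descriptions of a point in charts agree on the constants. -/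
lemma chartConst_comp_of_eq {i j : Fin n} {α : chartRing ℓ n i →+* R} {β : chartRing ℓ n j →+* R}
    (h : Spec.map (CommRingCat.ofHom α) ≫ chart ℓ n i =
      Spec.map (CommRingCat.ofHom β) ≫ chart ℓ n j) :
    α.comp (chartConst ℓ n i) = β.comp (chartConst ℓ n j) := by
  have := congrArg (· ≫ projSpaceHom ℓ n) h
  simp only [Category.assoc, chart_projSpaceHom, ← Spec.map_comp, ← CommRingCat.ofHom_comp] at this
  exact congrArg CommRingCat.Hom.hom (Spec.map_injective this)

/-- A point of the `i`-th chart at which the `j`-th coordinate is invertible lies in the `j`-th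
chart. -/
lemma exists_chart_eq {i j : Fin n} {α : chartRing ℓ n i →+* R}
    (h : IsUnit (α (chartCoord ℓ n i j))) : ∃ β : chartRing ℓ n j →+* R,
      Spec.map (CommRingCat.ofHom α) ≫ chart ℓ n i =
        Spec.map (CommRingCat.ofHom β) ≫ chart ℓ n j := by
  have hr : Set.range (Spec.map (CommRingCat.ofHom α) ≫ chart ℓ n i) ⊆ Set.range (chart ℓ n j) := by
    rintro _ ⟨q, rfl⟩
    have h1 : (Spec.map (CommRingCat.ofHom α) q) ∈ (chart ℓ n i) ⁻¹ᵁ (chartOpen ℓ n j) := by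
      have := Proj.awayι_preimage_basicOpen (coordGrading ℓ n) (MvPolynomial.isHomogeneous_X ℓ i)
        one_pos (MvPolynomial.isHomogeneous_X ℓ j) one_pos
      refine this.ge ?_
      have he : HomogeneousLocalization.Away.isLocalizationElem (𝒜 := coordGrading ℓ n)
        (MvPolynomial.isHomogeneous_X ℓ i) (MvPolynomial.isHomogeneous_X ℓ j) =
          chartCoord ℓ n i j := by
        apply HomogeneousLocalization.val_injective
        refine (HomogeneousLocalization.Away.val_mk ..).trans ?_
        rw [chartCoord, HomogeneousLocalization.val_mk]
        simp only [pow_one]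
      rw [he]
      intro hq
      exact q.2.ne_top (Ideal.eq_top_of_isUnit_mem _ hq h)
    rw [← opensRange_chart] at h1
    exact h1
  obtain ⟨β, hβ⟩ := Spec.map_surjective (IsOpenImmersion.lift (chart ℓ n j) _ hr)
  exact ⟨β.hom, by
    have := IsOpenImmersion.lift_fac (chart ℓ n j) _ hr
    rw [← hβ] at this
    exact this.symm⟩

/-- Points of two charts with proportional coordinates agree. -/
lemma chart_eq_of_mul {i j : Fin n} {α : chartRing ℓ n i →+* R} {β : chartRing ℓ n j →+* R}
    (hc : α.comp (chartConst ℓ n i) = β.comp (chartConst ℓ n j))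
    (h : ∀ p q, α (chartCoord ℓ n i p) * β (chartCoord ℓ n j q) =
      α (chartCoord ℓ n i q) * β (chartCoord ℓ n j p)) :
    Spec.map (CommRingCat.ofHom α) ≫ chart ℓ n i =
      Spec.map (CommRingCat.ofHom β) ≫ chart ℓ n j := by
  have hu : IsUnit (α (chartCoord ℓ n i j)) := by
    refine .of_mul_eq_one (β (chartCoord ℓ n j i)) ?_
    rw [h, chartCoord_self, chartCoord_self, map_one, map_one, one_mul]
  obtain ⟨γ, hγ⟩ := exists_chart_eq hu
  rw [hγ]
  suffices γ = β by rw [this]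
  refine chartRing_hom_ext (fun a ↦ ?_) fun p ↦ ?_
  · rw [chartConst_comp_of_eq hγ] at hc
    exact RingHom.congr_fun hc a
  · refine hu.mul_left_injective ?_
    change γ _ * _ = β _ * _
    rw [chartCoord_mul_of_eq hγ p, mul_comm, h, chartCoord_self, map_one, mul_one]

end Overlap
end ChartHoms

/-! ### Points of `X` over a splitting field -/

section RowPoint
variable {k D ℓ : Type u} [Field k] [DivisionRing D] [Algebra k D] [Field ℓ] [Algebra k ℓ] {n : ℕ}
  {X : Over (Spec (.of k))} (P : SeveriBrauerVariety k D n X) (hc : IsCSA k D n)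
  (ψ : D →ₐ[k] Matrix (Fin n) (Fin n) ℓ)

section Over
variable {R S : Type u} [CommRing R] [Algebra k R] [CommRing S] [Algebra k S]

/-- The `R`-valued point of `X` given by a row `w` over an `ℓ`-algebra `R`: the left ideal of the
matrices `v w`. -/
def rowPointOver (c : ℓ →ₐ[k] R) (w : Fin n → R) (hw : ∃ j, IsUnit (w j)) : specOver k R ⟶ X :=
  (P.ideal R).symm (rowLeftIdeal hc (mapRep c ψ) w hw)

/-- If the ideal of a point contains the matrix `e_a w`, then over every algebra in which an entry of
`w` becomes a unit the point is given by the row `w`. -/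
lemma comp_eq_rowPointOver (c : ℓ →ₐ[k] R) (w : Fin n → R) (x : specOver k R ⟶ X)
    {z : R ⊗[k] D} (hz : z ∈ (P.ideal R x).1.toSubmodule) {a : Fin n}
    (h : liftHom (mapRep c ψ) z = Matrix.vecMulVec (Pi.single a 1) w)
    (f : R →ₐ[k] S) (hw : ∃ j, IsUnit (f (w j))) :
    specOverMap f ≫ x = rowPointOver P hc ψ (f.comp c) (fun i ↦ f (w i)) hw := by
  apply (P.ideal S).injective
  rw [rowPointOver, Equiv.apply_symm_apply]
  apply Subtype.ext
  apply Module.Grassmannian.ext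
  refine eq_rowSubmodule hc (mapRep (f.comp c) ψ) hw _ (a := a) (z := extD D f z) ?_ ?_
  · rw [P.ideal_comp]
    exact extD_mem_map f _ hz
  · ext i j
    refine (liftHom_extD f (mapRep c ψ) z i j).trans ?_
    rw [h, Matrix.vecMulVec_apply, Matrix.vecMulVec_apply, map_mul]
    congr 1
    by_cases hi : i = a
    · subst hi; simp
    · simp [hi]

lemma exists_mem_ideal_rowPointOver (c : ℓ →ₐ[k] R) (w : Fin n → R) (hw : ∃ j, IsUnit (w j))
    (v : Fin n → R) : ∃ z ∈ (P.ideal R (rowPointOver P hc ψ c w hw)).1.toSubmodule,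
      liftHom (mapRep c ψ) z = Matrix.vecMulVec v w := by
  rw [rowPointOver, Equiv.apply_symm_apply]
  exact ⟨(splitEquiv hc (mapRep c ψ)).symm (Matrix.vecMulVec v w),
    ⟨v, liftHom_splitEquiv_symm ..⟩, liftHom_splitEquiv_symm ..⟩

lemma specOverMap_rowPointOver (c : ℓ →ₐ[k] R) (w : Fin n → R) (hw : ∃ j, IsUnit (w j))
    (f : R →ₐ[k] S) : specOverMap f ≫ rowPointOver P hc ψ c w hw =
      rowPointOver P hc ψ (f.comp c) (fun i ↦ f (w i)) (hw.imp fun _ h ↦ h.map f) := by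
  obtain ⟨z, hz, h⟩ := exists_mem_ideal_rowPointOver P hc ψ c w hw (Pi.single ⟨0, hc.pos⟩ 1)
  exact comp_eq_rowPointOver P hc ψ c w _ hz h f _

/-- Two rows give the same point if and only if they are proportional. -/
lemma rowPointOver_eq_iff (c : ℓ →ₐ[k] R) (w w' : Fin n → R) (hw : ∃ j, IsUnit (w j))
    (hw' : ∃ j, IsUnit (w' j)) : rowPointOver P hc ψ c w hw = rowPointOver P hc ψ c w' hw' ↔
      ∀ i j, w i * w' j = w j * w' i := by
  constructor
  · intro h i j
    obtain ⟨z, hz, e⟩ := exists_mem_ideal_rowPointOver P hc ψ c w hw (Pi.single ⟨0, hc.pos⟩ 1)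
    rw [h, rowPointOver, Equiv.apply_symm_apply] at hz
    obtain ⟨v, hv⟩ := hz
    have key (i) : w i = v ⟨0, hc.pos⟩ * w' i := by
      have := congrFun (congrFun (e.symm.trans hv) ⟨0, hc.pos⟩) i
      simpa [Matrix.vecMulVec_apply] using this
    rw [key i, key j]
    ring
  · intro h
    apply (P.ideal R).injective
    rw [rowPointOver, rowPointOver, Equiv.apply_symm_apply, Equiv.apply_symm_apply]
    apply Subtype.ext
    apply Module.Grassmannian.ext
    obtain ⟨j, u, hu⟩ := hw
    refine eq_rowSubmodule hc (mapRep c ψ) hw' _ (a := ⟨0, hc.pos⟩)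
      (z := (splitEquiv hc (mapRep c ψ)).symm (Matrix.vecMulVec (Pi.single ⟨0, hc.pos⟩ 1) w')) ?_
      (liftHom_splitEquiv_symm ..)
    refine ⟨Pi.single ⟨0, hc.pos⟩ (w' j * ↑u⁻¹), ?_⟩
    refine (liftHom_splitEquiv_symm ..).trans ?_
    ext a b
    rw [Matrix.vecMulVec_apply, Matrix.vecMulVec_apply]
    by_cases ha : a = ⟨0, hc.pos⟩
    · subst ha
      have := h b j
      rw [Pi.single_eq_same, Pi.single_eq_same, one_mul]
      have h2 : w' b = (w j * w' b) * ↑u⁻¹ := by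
        rw [← hu, mul_comm (u : R), mul_assoc, Units.mul_inv, mul_one]
      rw [h2, ← this]
      ring
    · simp [ha]

end Over

section Scheme
variable {R S : Type u} [CommRing R] [CommRing S]

/-- The morphism `Spec R → X` given by a row `w` over an `ℓ`-algebra `R`. -/
def rowPoint (φ : ℓ →+* R) (w : Fin n → R) (hw : ∃ j, IsUnit (w j)) : Spec (.of R) ⟶ X.left :=
  let _ : Algebra k R := (φ.comp (algebraMap k ℓ)).toAlgebra
  (rowPointOver P hc ψ ⟨φ, fun _ ↦ rfl⟩ w hw).left

lemma rowPoint_hom (φ : ℓ →+* R) (w : Fin n → R) (hw : ∃ j, IsUnit (w j)) :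
    rowPoint P hc ψ φ w hw ≫ X.hom = Spec.map (CommRingCat.ofHom (φ.comp (algebraMap k ℓ))) := by
  let _ : Algebra k R := (φ.comp (algebraMap k ℓ)).toAlgebra
  exact Over.w (rowPointOver P hc ψ ⟨φ, fun _ ↦ rfl⟩ w hw)

lemma rowPoint_eq_iff (φ : ℓ →+* R) (w w' : Fin n → R) (hw : ∃ j, IsUnit (w j))
    (hw' : ∃ j, IsUnit (w' j)) : rowPoint P hc ψ φ w hw = rowPoint P hc ψ φ w' hw' ↔
      ∀ i j, w i * w' j = w j * w' i := by
  let _ : Algebra k R := (φ.comp (algebraMap k ℓ)).toAlgebra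
  rw [← rowPointOver_eq_iff P hc ψ ⟨φ, fun _ ↦ rfl⟩ w w' hw hw']
  exact ⟨fun h ↦ Over.OverMorphism.ext h, fun h ↦ congrArg (·.left) h⟩

lemma SpecMap_rowPoint (φ : ℓ →+* R) (w : Fin n → R) (hw : ∃ j, IsUnit (w j)) (f : R →+* S) :
    Spec.map (CommRingCat.ofHom f) ≫ rowPoint P hc ψ φ w hw =
      rowPoint P hc ψ (f.comp φ) (fun i ↦ f (w i)) (hw.imp fun _ h ↦ h.map f) := by
  let _ : Algebra k R := (φ.comp (algebraMap k ℓ)).toAlgebra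
  let _ : Algebra k S := ((f.comp φ).comp (algebraMap k ℓ)).toAlgebra
  let f' : R →ₐ[k] S := ⟨f, fun _ ↦ rfl⟩
  exact congrArg (·.left) (specOverMap_rowPointOver P hc ψ ⟨φ, fun _ ↦ rfl⟩ w hw f')

/-- Locally, every point of `X` over an `ℓ`-algebra is given by a row. -/
lemma exists_comp_eq_rowPoint (φ : ℓ →+* R) (x : Spec (.of R) ⟶ X.left)
    (hx : x ≫ X.hom = Spec.map (CommRingCat.ofHom (φ.comp (algebraMap k ℓ))))
    (p : Ideal R) [hp : p.IsPrime] :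
    ∃ (w : Fin n → R) (j : Fin n), w j ∉ p ∧ ∀ (S : Type u) [CommRing S] (f : R →+* S)
      (hj : IsUnit (f (w j))), Spec.map (CommRingCat.ofHom f) ≫ x =
        rowPoint P hc ψ (f.comp φ) (fun i ↦ f (w i)) ⟨j, hj⟩ := by
  let _ : Algebra k R := (φ.comp (algebraMap k ℓ)).toAlgebra
  let x' : specOver k R ⟶ X := Over.homMk x hx
  let c : ℓ →ₐ[k] R := ⟨φ, fun _ ↦ rfl⟩
  obtain ⟨z, hz, a, j, w, hw, h⟩ := exists_row_notMem hc (mapRep c ψ) (P.ideal R x') p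
  refine ⟨w, j, hw, fun S _ f hj ↦ ?_⟩
  let _ : Algebra k S := ((f.comp φ).comp (algebraMap k ℓ)).toAlgebra
  let f' : R →ₐ[k] S := ⟨f, fun _ ↦ rfl⟩
  exact congrArg (·.left) (comp_eq_rowPointOver P hc ψ c w x' hz h f' ⟨j, hj⟩)

end Scheme
end RowPoint

/-! ### The isomorphism of `X_ℓ` with projective space -/

section SplitIso
attribute [local instance] MvPolynomial.gradedAlgebra

variable (ℓ : Type u) [Field ℓ] (n : ℕ)

lemma exists_mem_chartOpen (y : projSpace ℓ n) : ∃ j, y ∈ chartOpen ℓ n j :=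
  exists_X_notMem y

/-- The charts `x_j ≠ 0` cover `ℙ^{n-1}`. -/
def chartCover : (projSpace ℓ n).OpenCover :=
  Scheme.Cover.mkOfCovers (Fin n) (fun j ↦ Spec (.of (chartRing ℓ n j))) (chart ℓ n)
    (fun y ↦ by
      obtain ⟨j, hj⟩ := exists_mem_chartOpen ℓ n y
      rw [← opensRange_chart] at hj
      obtain ⟨z, hz⟩ := hj
      exact ⟨j, z, hz⟩)

variable {ℓ n}

/-- Locally, a morphism to `ℙ^{n-1}` is a morphism of an affine scheme to a chart. -/
lemma exists_chart_factor {R : Type u} [CommRing R] (h : Spec (.of R) ⟶ projSpace ℓ n)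
    (j : Fin n) (hj : ∀ q, h q ∈ chartOpen ℓ n j) :
    ∃ α : chartRing ℓ n j →+* R, h = Spec.map (CommRingCat.ofHom α) ≫ chart ℓ n j := by
  have hr : Set.range h ⊆ Set.range (chart ℓ n j) := by
    rintro _ ⟨q, rfl⟩
    have := hj q
    rw [← opensRange_chart] at this
    exact this
  obtain ⟨β, hβ⟩ := Spec.map_surjective (IsOpenImmersion.lift (chart ℓ n j) _ hr)
  exact ⟨β.hom, by
    have := IsOpenImmersion.lift_fac (chart ℓ n j) _ hr
    rw [← hβ] at this
    exact this.symm⟩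

lemma hom_ext_of_affine {Y Z : Scheme.{u}} {f g : Y ⟶ Z}
    (h : ∀ y : Y, ∃ (R : Type u) (_ : CommRing R) (i : Spec (.of R) ⟶ Y), IsOpenImmersion i ∧
      y ∈ Set.range i ∧ i ≫ f = i ≫ g) : f = g := by
  choose R hR i hi hy hfg using h
  let 𝒰 : Y.OpenCover := Scheme.Cover.mkOfCovers Y (fun y ↦ Spec (.of (R y))) i
    (fun y ↦ ⟨y, hy y⟩) (fun y ↦ hi y)
  exact 𝒰.hom_ext _ _ hfg

lemma exists_affine_nhd {Y : Scheme.{u}} (U : Y.Opens) (y : Y) (hy : y ∈ U) :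
    ∃ (R : Type u) (_ : CommRing R) (i : Spec (.of R) ⟶ Y), IsOpenImmersion i ∧
      y ∈ Set.range i ∧ ∀ q, i q ∈ U := by
  obtain ⟨_, ⟨V, hV, rfl⟩, hyV, hVU⟩ := Y.isBasis_affineOpens.exists_subset_of_mem_open hy U.2
  replace hV : IsAffineOpen V := hV
  refine ⟨Γ(Y, V), inferInstance, IsAffineOpen.fromSpec hV, inferInstance, ?_, fun q ↦ hVU ?_⟩
  · rw [IsAffineOpen.range_fromSpec]; exact hyV
  · rw [← IsAffineOpen.range_fromSpec hV]; exact ⟨q, rfl⟩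

variable {k D : Type u} [Field k] [DivisionRing D] [Algebra k D] [Algebra k ℓ]
  {X : Over (Spec (.of k))} (P : SeveriBrauerVariety k D n X) (hc : IsCSA k D n)
  (ψ : D →ₐ[k] Matrix (Fin n) (Fin n) ℓ)

/-- The morphism `ℙ^{n-1} → X` on a chart. -/
def chartRow (j : Fin n) : Spec (.of (chartRing ℓ n j)) ⟶ X.left :=
  rowPoint P hc ψ (chartConst ℓ n j) (chartCoord ℓ n j) ⟨j, by rw [chartCoord_self]; exact isUnit_one⟩

lemma isUnit_map_chartCoord {R : Type u} [CommRing R] {j : Fin n} (α : chartRing ℓ n j →+* R) :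
    ∃ i, IsUnit (α (chartCoord ℓ n j i)) := ⟨j, by rw [chartCoord_self, map_one]; exact isUnit_one⟩

lemma SpecMap_chartRow {R : Type u} [CommRing R] {j : Fin n} (α : chartRing ℓ n j →+* R) :
    Spec.map (CommRingCat.ofHom α) ≫ chartRow P hc ψ j =
      rowPoint P hc ψ (α.comp (chartConst ℓ n j)) (fun i ↦ α (chartCoord ℓ n j i))
        (isUnit_map_chartCoord α) :=
  SpecMap_rowPoint ..

lemma rowPoint_congr {R : Type u} [CommRing R] {φ φ' : ℓ →+* R} (h : φ = φ') (w : Fin n → R)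
    (hw : ∃ j, IsUnit (w j)) : rowPoint P hc ψ φ w hw = rowPoint P hc ψ φ' w hw := by rw [h]

/-- The morphism `ℙ^{n-1} → X` that sends a row `w` to the left ideal of the matrices `v w`. -/
def rowMap : projSpace ℓ n ⟶ X.left :=
  (chartCover ℓ n).glueMorphisms (chartRow P hc ψ) fun i j ↦ by
    refine hom_ext_of_affine fun y ↦ ?_
    obtain ⟨R, _, m, hm, hy, -⟩ := exists_affine_nhd ⊤ y trivial
    refine ⟨R, inferInstance, m, hm, hy, ?_⟩
    obtain ⟨α, hα⟩ := Spec.map_surjective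
      (m ≫ Limits.pullback.fst (chart ℓ n i) (chart ℓ n j))
    obtain ⟨β, hβ⟩ := Spec.map_surjective
      (m ≫ Limits.pullback.snd (chart ℓ n i) (chart ℓ n j))
    have h : Spec.map (CommRingCat.ofHom α.hom) ≫ chart ℓ n i =
        Spec.map (CommRingCat.ofHom β.hom) ≫ chart ℓ n j := by
      refine (congrArg (· ≫ chart ℓ n i) hα).trans
        (Eq.trans ?_ (congrArg (· ≫ chart ℓ n j) hβ).symm)
      exact (Category.assoc _ _ _).trans ((congrArg (m ≫ ·) Limits.pullback.condition).trans
        (Category.assoc _ _ _).symm)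
    refine (Category.assoc _ _ _).symm.trans (Eq.trans ?_ (Category.assoc _ _ _))
    refine (congrArg (· ≫ chartRow P hc ψ i) hα).symm.trans
      (Eq.trans ?_ (congrArg (· ≫ chartRow P hc ψ j) hβ))
    refine (SpecMap_chartRow P hc ψ α.hom).trans (Eq.trans ?_ (SpecMap_chartRow P hc ψ β.hom).symm)
    refine (rowPoint_congr P hc ψ (chartConst_comp_of_eq h) _ _).trans ?_
    refine (rowPoint_eq_iff P hc ψ _ _ _ _ _).2 fun p q ↦ ?_
    have h1 := chartCoord_mul_of_eq h p
    have h2 := chartCoord_mul_of_eq h q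
    simp only [← h1, ← h2]
    ring

lemma chart_rowMap (j : Fin n) : chart ℓ n j ≫ rowMap P hc ψ = chartRow P hc ψ j :=
  (chartCover ℓ n).ι_glueMorphisms (chartRow P hc ψ) _ j

lemma rowMap_hom : rowMap P hc ψ ≫ X.hom =
    projSpaceHom ℓ n ≫ Spec.map (CommRingCat.ofHom (algebraMap k ℓ)) := by
  refine (chartCover ℓ n).hom_ext _ _ fun (j : Fin n) ↦ ?_
  change chart ℓ n j ≫ _ = chart ℓ n j ≫ _
  rw [← Category.assoc, chart_rowMap, ← Category.assoc, chart_projSpaceHom, ← Spec.map_comp]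
  exact rowPoint_hom ..

/-- The morphism `ℙ^{n-1}_ℓ → X_ℓ` that sends a row `w` to the left ideal of the matrices `v w`. -/
def splitMap : projSpace ℓ n ⟶ baseChange X ℓ :=
  Limits.pullback.lift (rowMap P hc ψ) (projSpaceHom ℓ n) (rowMap_hom P hc ψ)

lemma splitMap_fst : splitMap P hc ψ ≫ Limits.pullback.fst _ _ = rowMap P hc ψ :=
  Limits.pullback.lift_fst _ _ _

lemma splitMap_snd : splitMap P hc ψ ≫ Limits.pullback.snd _ _ = projSpaceHom ℓ n :=
  Limits.pullback.lift_snd _ _ _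

/-- Rows that give the same point of `X` are proportional, hence the same point of `ℙ^{n-1}`. -/
instance mono_splitMap : Mono (splitMap P hc ψ) := by
  refine ⟨fun {Y} f g hfg ↦ hom_ext_of_affine fun y ↦ ?_⟩
  obtain ⟨i, hi⟩ := exists_mem_chartOpen ℓ n (f y)
  obtain ⟨j, hj⟩ := exists_mem_chartOpen ℓ n (g y)
  obtain ⟨R, _, m, hm, hy, hR⟩ := exists_affine_nhd (f ⁻¹ᵁ chartOpen ℓ n i ⊓ g ⁻¹ᵁ chartOpen ℓ n j)
    y ⟨hi, hj⟩
  refine ⟨R, inferInstance, m, hm, hy, ?_⟩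
  obtain ⟨α, hα⟩ := exists_chart_factor (m ≫ f) i fun q ↦ by
    rw [Scheme.Hom.comp_apply]; exact (hR q).1
  obtain ⟨β, hβ⟩ := exists_chart_factor (m ≫ g) j fun q ↦ by
    rw [Scheme.Hom.comp_apply]; exact (hR q).2
  have h0 : (m ≫ f) ≫ splitMap P hc ψ = (m ≫ g) ≫ splitMap P hc ψ := by
    rw [Category.assoc, Category.assoc, hfg]
  have h1 := congrArg (· ≫ Limits.pullback.fst _ _) h0
  have h2 := congrArg (· ≫ Limits.pullback.snd _ _) h0
  simp only [Category.assoc, splitMap_fst, splitMap_snd] at h1 h2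
  rw [← Category.assoc, ← Category.assoc, hα, hβ, Category.assoc, Category.assoc] at h1 h2
  rw [chart_projSpaceHom, chart_projSpaceHom, ← Spec.map_comp, ← Spec.map_comp] at h2
  have h2' : α.comp (chartConst ℓ n i) = β.comp (chartConst ℓ n j) :=
    congrArg CommRingCat.Hom.hom (Spec.map_injective h2)
  rw [chart_rowMap, chart_rowMap, SpecMap_chartRow, SpecMap_chartRow,
    rowPoint_congr P hc ψ h2', rowPoint_eq_iff] at h1
  rw [hα, hβ]
  exact chart_eq_of_mul h2' h1

/-- Over a splitting field every point of `X` is locally given by a row, so that the map from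
`ℙ^{n-1}` has local sections. -/
lemma exists_splitMap_section (y : baseChange X ℓ) :
    ∃ (S : Type u) (_ : CommRing S) (i : Spec (.of S) ⟶ baseChange X ℓ)
      (h : Spec (.of S) ⟶ projSpace ℓ n), IsOpenImmersion i ∧ y ∈ Set.range i ∧
        h ≫ splitMap P hc ψ = i := by
  obtain ⟨R, _, m, hm, ⟨p, rfl⟩, -⟩ := exists_affine_nhd ⊤ y trivial
  obtain ⟨φ, hφ⟩ := Spec.map_surjective (m ≫ Limits.pullback.snd _ _)
  have hx : (m ≫ Limits.pullback.fst _ _) ≫ X.hom =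
      Spec.map (CommRingCat.ofHom (φ.hom.comp (algebraMap k ℓ))) := by
    rw [Category.assoc, Limits.pullback.condition, ← Category.assoc, ← hφ]
    exact (Spec.map_comp _ _).symm
  obtain ⟨w, j, hj, hw⟩ := exists_comp_eq_rowPoint P hc ψ φ.hom _ hx p.asIdeal (hp := p.isPrime)
  let S := Localization.Away (w j)
  let f : R →+* S := algebraMap R S
  have hu : IsUnit (f (w j)) := IsLocalization.Away.algebraMap_isUnit (w j)
  obtain ⟨α, hα, hα'⟩ := exists_chartRing_hom (f.comp φ.hom) (w := fun i ↦ f (w i)) hu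
  have hopen : IsOpenImmersion (Spec.map (CommRingCat.ofHom f)) :=
    AlgebraicGeometry.IsOpenImmersion.of_isLocalization (w j)
  refine ⟨S, inferInstance, Spec.map (CommRingCat.ofHom f) ≫ m,
    Spec.map (CommRingCat.ofHom α) ≫ chart ℓ n j, inferInstance, ?_, ?_⟩
  · have : p ∈ Set.range (Spec.map (CommRingCat.ofHom f)) := by
      have h := PrimeSpectrum.localization_away_comap_range S (w j)
      exact h.ge hj
    obtain ⟨q, hq⟩ := this
    exact ⟨q, by rw [Scheme.Hom.comp_apply, hq]⟩
  · apply Limits.pullback.hom_ext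
    · rw [Category.assoc, splitMap_fst, Category.assoc, chart_rowMap, SpecMap_chartRow,
        Category.assoc, hw S f hu, rowPoint_congr P hc ψ hα, rowPoint_eq_iff]
      intro a b
      rw [← hα' a, ← hα' b]
      ring
    · rw [Category.assoc, splitMap_snd, Category.assoc, chart_projSpaceHom, ← Spec.map_comp,
        Category.assoc, ← hφ, ← CommRingCat.ofHom_comp, hα]
      exact Spec.map_comp _ _

/-- A monomorphism with local sections is an isomorphism. -/
instance isIso_splitMap : IsIso (splitMap P hc ψ) := by
  choose S hS i h hi hy hh using exists_splitMap_section P hc ψ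
  let 𝒰 : (baseChange X ℓ).OpenCover := Scheme.Cover.mkOfCovers (baseChange X ℓ)
    (fun y : baseChange X ℓ ↦ Spec (@CommRingCat.of (S y) (hS y))) i (fun y ↦ ⟨y, hy y⟩) (fun y ↦ hi y)
  change MorphismProperty.isomorphisms Scheme.{u} (splitMap P hc ψ)
  rw [IsZariskiLocalAtTarget.iff_of_openCover (P := .isomorphisms _) 𝒰]
  intro (y : baseChange X ℓ)
  let s : Spec (.of (S y)) ⟶ Limits.pullback (splitMap P hc ψ) (i y) :=
    Limits.pullback.lift (h y) (𝟙 _) ((hh y).trans (Category.id_comp _).symm)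
  have hs : s ≫ Limits.pullback.snd (splitMap P hc ψ) (i y) = 𝟙 _ := Limits.pullback.lift_snd _ _ _
  have : IsSplitEpi (Limits.pullback.snd (splitMap P hc ψ) (i y)) := ⟨⟨⟨s, hs⟩⟩⟩
  exact isIso_of_mono_of_isSplitEpi (Limits.pullback.snd (splitMap P hc ψ) (i y))

end SplitIso

/-! ### Integrality of `X` -/

section Integral
attribute [local instance] MvPolynomial.gradedAlgebra

lemma stalkMap_injective_of_flat {Y Z : Scheme.{u}} (f : Y ⟶ Z) [Flat f] (y : Y) :
    Function.Injective (f.stalkMap y).hom := by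
  algebraize [(f.stalkMap y).hom]
  have : Module.FaithfullyFlat (Z.presheaf.stalk (f y)) (Y.presheaf.stalk y) :=
    @Module.FaithfullyFlat.of_flat_of_isLocalHom _ _ _ _ _ _ _
      (Flat.stalkMap f y) (f.toLRSHom.prop y)
  exact FaithfulSMul.algebraMap_injective (Z.presheaf.stalk (f y)) (Y.presheaf.stalk y)

/-- Integrality descends along flat surjective morphisms. -/
lemma isIntegral_of_flat_of_surjective {Y Z : Scheme.{u}} (f : Y ⟶ Z) [Flat f] [Surjective f]
    [IsIntegral Y] : IsIntegral Z := by
  have : IrreducibleSpace Z := f.surjective.irreducibleSpace f.continuous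
  have (z : Z) : _root_.IsReduced (Z.presheaf.stalk z) := by
    obtain ⟨y, rfl⟩ := f.surjective z
    exact isReduced_of_injective (f.stalkMap y).hom (stalkMap_injective_of_flat f y)
  have := isReduced_of_isReduced_stalk Z
  exact isIntegral_of_irreducibleSpace_of_isReduced Z

variable {k D ℓ : Type u} [Field k] [DivisionRing D] [Algebra k D] [Field ℓ] [Algebra k ℓ] {n : ℕ}
  {X : Over (Spec (.of k))} (P : SeveriBrauerVariety k D n X) (hc : IsCSA k D n)
  (ψ : D →ₐ[k] Matrix (Fin n) (Fin n) ℓ)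

lemma rowMap_eq : rowMap P hc ψ = splitMap P hc ψ ≫ Limits.pullback.fst _ _ :=
  (splitMap_fst P hc ψ).symm

lemma flat_surjective_specMap (k ℓ : Type u) [Field k] [Field ℓ] [Algebra k ℓ] :
    Flat (Spec.map (CommRingCat.ofHom (algebraMap k ℓ))) ∧
      Surjective (Spec.map (CommRingCat.ofHom (algebraMap k ℓ))) := by
  rw [flat_and_surjective_SpecMap_iff]
  exact RingHom.faithfullyFlat_algebraMap_iff.2 inferInstance

instance flat_rowMap : Flat (rowMap P hc ψ) := by
  have := (flat_surjective_specMap k ℓ).1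
  rw [rowMap_eq]
  infer_instance

instance surjective_rowMap : Surjective (rowMap P hc ψ) := by
  have := (flat_surjective_specMap k ℓ).2
  rw [rowMap_eq]
  infer_instance

instance isDominant_rowMap : IsDominant (rowMap P hc ψ) := ⟨(rowMap P hc ψ).surjective.denseRange⟩

/-- The representation of `D` on `ℓ^n` over a splitting field. -/
def splitRep {A : Type*} [Ring A] [Algebra ℓ A] (φ : (ℓ ⊗[k] D) ≃ₐ[ℓ] A) [Algebra k A] [IsScalarTower k ℓ A] :
    D →ₐ[k] A :=
  (φ.toAlgHom.restrictScalars k).comp Algebra.TensorProduct.includeRight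

lemma isIntegral_severiBrauer (P : SeveriBrauerVariety k D n X) (hc : IsCSA k D n) :
    IsIntegral X.left := by
  have : NeZero n := ⟨hc.pos.ne'⟩
  obtain ⟨φ⟩ := hc.split
  exact isIntegral_of_flat_of_surjective (rowMap P hc (splitRep φ))

end Integral

/-! ### The generic point of projective space -/

section Generic
attribute [local instance] MvPolynomial.gradedAlgebra

/-- The function field of `ℙ^{n-1}_ℓ` as an algebra over a subfield `k` of `ℓ`. -/
abbrev constAlgebra (k ℓ : Type u) [Field k] [Field ℓ] [Algebra k ℓ] (n : ℕ) [NeZero n] :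
    Algebra k (projSpace ℓ n).functionField :=
  ((constFun ℓ n).comp (algebraMap k ℓ)).toAlgebra

attribute [local instance] constAlgebra

variable {k D ℓ : Type u} [Field k] [DivisionRing D] [Algebra k D] [Field ℓ] [Algebra k ℓ] {n : ℕ}
  [NeZero n] {X : Over (Spec (.of k))} [IsIntegral X.left] (P : SeveriBrauerVariety k D n X)
  (hc : IsCSA k D n) (ψ : D →ₐ[k] Matrix (Fin n) (Fin n) ℓ)

variable (k ℓ n) in
/-- The constants in the function field of `ℙ^{n-1}`. -/
def constHom : ℓ →ₐ[k] (projSpace ℓ n).functionField := ⟨constFun ℓ n, fun _ ↦ rfl⟩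

lemma SpecMap_funMap_fromSpecStalk {Y Z : Scheme.{u}} [IsIntegral Y] [IsIntegral Z] (f : Y ⟶ Z)
    [IsDominant f] : Spec.map (CommRingCat.ofHom (funMap f)) ≫ Z.fromSpecStalk (genericPoint Z) =
      Y.fromSpecStalk (genericPoint Y) ≫ f := by
  rw [← Scheme.SpecMap_stalkMap_fromSpecStalk,
    ← Scheme.SpecMap_stalkSpecializes_fromSpecStalk (specializes_of_eq (map_genericPoint f)),
    ← Category.assoc, ← Spec.map_comp]
  rfl

lemma algebraMap_hom_eq : X.left.fromSpecStalk (genericPoint X.left) ≫ X.hom =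
    Spec.map (CommRingCat.ofHom (algebraMap k (FunField X))) :=
  Over.w (stalkPoint X (genericPoint X.left))

/-- The inclusion of the function field of `X` into that of `ℙ^{n-1}_ℓ`. -/
def rowFun : FunField X →ₐ[k] (projSpace ℓ n).functionField where
  __ := funMap (rowMap P hc ψ)
  commutes' a := by
    have h : Spec.map (CommRingCat.ofHom ((funMap (rowMap P hc ψ)).comp
        (algebraMap k (FunField X)))) =
      Spec.map (CommRingCat.ofHom ((constFun ℓ n).comp (algebraMap k ℓ))) := by
      refine (Spec.map_comp (CommRingCat.ofHom (algebraMap k (FunField X)))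
        (CommRingCat.ofHom (funMap (rowMap P hc ψ)))).trans ?_
      refine Eq.trans ?_ (Spec.map_comp (CommRingCat.ofHom (algebraMap k ℓ))
        (CommRingCat.ofHom (constFun ℓ n))).symm
      rw [← fromSpecStalk_projSpaceHom, Category.assoc, ← rowMap_hom P hc ψ, ← Category.assoc,
        ← SpecMap_funMap_fromSpecStalk, Category.assoc, algebraMap_hom_eq]
    exact RingHom.congr_fun (congrArg CommRingCat.Hom.hom (Spec.map_injective h)) a

variable (ℓ n) in
/-- The row of homogeneous coordinates at the generic point of `ℙ^{n-1}`, normalized by the first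
one. -/
def genericRow (i : Fin n) : (projSpace ℓ n).functionField :=
  (coordFun ℓ i : (projSpace ℓ n).functionFieldˣ)

lemma isUnit_genericRow : ∃ j, IsUnit (genericRow ℓ n j) := ⟨0, Units.isUnit _⟩

/-- The generic point of `X`, extended to the function field of `ℙ^{n-1}`, is the point of the generic
row. -/
lemma specOverMap_rowFun : specOverMap (rowFun P hc ψ) ≫ stalkPoint X (genericPoint X.left) =
    rowPointOver P hc ψ (constHom k ℓ n) (genericRow ℓ n) isUnit_genericRow := by
  apply Over.OverMorphism.ext
  have h0 : (fun a ↦ chartFun ℓ 0 (chartConst ℓ n 0 a)) = constFun ℓ n := rfl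
  have h1 : Spec.map (CommRingCat.ofHom (funMap (rowMap P hc ψ))) ≫
      X.left.fromSpecStalk (genericPoint X.left) =
      rowPoint P hc ψ (constFun ℓ n) (fun i ↦ chartFun ℓ 0 (chartCoord ℓ n 0 i))
        (isUnit_map_chartCoord _) := by
    rw [SpecMap_funMap_fromSpecStalk, ← SpecMap_chartGerm ℓ 0 _ (genericPoint_mem_chartOpen ℓ 0),
      Category.assoc, chart_rowMap]
    exact SpecMap_chartRow P hc ψ (chartFun ℓ 0)
  have h2 : rowPoint P hc ψ (constFun ℓ n) (fun i ↦ chartFun ℓ 0 (chartCoord ℓ n 0 i))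
        (isUnit_map_chartCoord _) =
      rowPoint P hc ψ (constFun ℓ n) (genericRow ℓ n) isUnit_genericRow := by
    rw [rowPoint_eq_iff]
    intro i j
    rw [chartFun_chartCoord, chartFun_chartCoord, genericRow, genericRow, ← Units.val_mul,
      ← Units.val_mul, div_mul_eq_mul_div, div_mul_eq_mul_div, mul_comm]
  exact h1.trans h2

/-- Over `ℓ` the ideal `T` consists of the matrices `v x`, where `x` is the row of homogeneous
coordinates. -/
lemma liftHom_rowFun {z : FunField X ⊗[k] D} (hz : z ∈ P.T) :
    ∃ v, liftHom (mapRep (constHom k ℓ n) ψ) (extD D (rowFun P hc ψ) z) =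
      Matrix.vecMulVec v (genericRow ℓ n) := by
  have h := extD_mem_map (rowFun P hc ψ) _ hz
  rw [← P.ideal_comp, specOverMap_rowFun, rowPointOver, Equiv.apply_symm_apply] at h
  exact h

end Generic

/-! ### The divisor of `ℒ` -/

section Transport
variable {X : Scheme.{u}} [IsIntegral X] {V V' : Type u} [AddCommGroup V]
  [Module X.functionField V] [AddCommGroup V'] [Module X.functionField V']
  {Λ : Lattice X V} {Λ' : Lattice X V'} {P : X.PresheafOfModules}

/-- Transport of lattices along a linear isomorphism. -/
def LatHom.congr (θ : LatHom P Λ) (e : V ≃ₗ[X.functionField] V')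
    (h : ∀ x v, v ∈ Λ.carrier x ↔ e v ∈ Λ'.carrier x) : LatHom P Λ' where
  toFun U hU := e.toLinearMap.toAddMonoidHom.comp (θ.toFun U hU)
  map_smul U hU r s := (congrArg e (θ.map_smul U hU r s)).trans (e.map_smul _ _)
  map_res i hW s := congrArg e (θ.map_res i hW s)
  mem U x hx s := (h x _).1 (θ.mem U x hx s)

lemma LatHom.BijOn.congr {θ : LatHom P Λ} {U : X.Opens} (hθ : θ.BijOn U)
    (e : V ≃ₗ[X.functionField] V')
    (h : ∀ x v, v ∈ Λ.carrier x ↔ e v ∈ Λ'.carrier x) : (θ.congr e h).BijOn U := by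
  intro hU
  refine ⟨fun s t hst ↦ (hθ hU).1 (e.injective hst), fun v hv ↦ ?_⟩
  obtain ⟨s, hs⟩ := (hθ hU).2 (e.symm v) fun x hx ↦ by
    rw [h, e.apply_symm_apply]; exact hv x hx
  exact ⟨s, (congrArg e hs).trans (e.apply_symm_apply v)⟩

end Transport

section DivisorOfL
variable {k D : Type u} [Field k] [DivisionRing D] [Algebra k D] [FiniteDimensional k D]
  {X : Over (Spec (.of k))} [IsIntegral X.left] {n : ℕ} {P : SeveriBrauerVariety k D n X}
  {σ : D →ₗ[k] D}

/-- The sheaf `ℒ` is given by a Cartier divisor: for a nonzero `l ∈ L`, the vector `c_x l` generates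
the stalk at `x`. -/
lemma exists_sheafL_iso (hc : IsCSA k D n) (hσ : IsInvolution σ) :
    ∃ (c : divisors X.left) (l : P.L σ), Nonempty (P.sheafL σ ≅ divSheaf c) ∧
      ∀ x, ∃ (U : X.left.Opens) (f : Frame P σ U), x ∈ U ∧
        (c.1 x : FunField X) • (l : FunField X ⊗[k] D) = f.el hc (Matrix.vecMulVec f.u f.w) := by
  choose U hU hf using exists_frame (P := P) hc hσ
  let f (x) := (hf x).some
  let b (x) := (f x).lBasis hc (genericPoint_mem (hU x))
  have hb (x) : (interLat (P.L σ)).FreeOn (U x) (b x) := (f x).freeOn_L hc (genericPoint_mem (hU x))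
  let l := b (genericPoint X.left) ()
  have hbv (x) (v : P.L σ) : (b x).repr v () • b x () = v := by
    have := (b x).sum_repr v
    simpa using this
  have hbs (x) (a : FunField X) (v : P.L σ) : (b x).repr (a • v) () = a * (b x).repr v () :=
    congrFun (congrArg DFunLike.coe ((b x).repr.map_smul a v)) ()
  have hl : l ≠ 0 := (b (genericPoint X.left)).ne_zero ()
  have hr (x) : (b x).repr l () ≠ 0 := fun h ↦ hl (by rw [← hbv x l, h, zero_smul])
  -- The local equation at `x` takes the fixed element `l` to the generator of a frame near `x`.
  let c (x : X.left) : X.left.functionFieldˣ := (Units.mk0 _ (hr x))⁻¹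
  have hcl (x) : (c x : FunField X) • l = b x () := by
    conv_lhs => rw [← hbv x l]
    rw [smul_smul]
    change ((c x : FunField X) * (((Units.mk0 _ (hr x) : (FunField X)ˣ)) : FunField X)) • _ = _
    rw [← Units.val_mul, inv_mul_cancel, Units.val_one, one_smul]
  have hcc (x y) : b y () = ((c y / c x : X.left.functionFieldˣ) : FunField X) • b x () := by
    rw [← hcl x, smul_smul, ← Units.val_mul, div_mul_cancel, hcl]
  have hreg {x y z : X.left} (hz : z ∈ U x) (hz' : z ∈ U y) :
      ((c y / c x : X.left.functionFieldˣ) : X.left.functionField) ∈ reg z := by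
    have h1 := (hb y).basis_mem () z hz'
    rw [hb x z hz] at h1
    have h2 : (b x).repr (b y ()) () = ((c y / c x : X.left.functionFieldˣ) : FunField X) := by
      rw [hcc x y, hbs, Module.Basis.repr_self, Finsupp.single_eq_same, mul_one]
    rw [← h2]
    exact h1 ()
  have hcd : c ∈ divisors X.left := fun x ↦ ⟨U x, hU x, fun y hy ↦ ⟨Units.ne_zero _,
    hreg hy (hU y), by
      rw [← Units.val_inv_eq_inv_val, inv_div]
      exact hreg (hU y) hy⟩⟩
  let e : P.L σ ≃ₗ[FunField X] FunField X :=
    ((b (genericPoint X.left)).repr).trans (Finsupp.uniqueLinearEquiv _ _ ())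
  have he (v) : v = e v • l := by
    rw [← hbv (genericPoint X.left) v]
    congr 1
    rw [hbv]
    rfl
  have hmem (x) (v : P.L σ) : v ∈ (interLat (P.L σ)).carrier x ↔
      e v ∈ (divLattice ⟨c, hcd⟩).carrier x := by
    rw [hb x x (hU x), mem_divLattice]
    have h1 : (b x).repr v () = ((c x)⁻¹ : X.left.functionFieldˣ) * e v := by
      conv_lhs => rw [he v, hbs, mul_comm]
      congr 1
    rw [← h1]
    exact ⟨fun h ↦ h (), fun h _ ↦ h⟩
  refine ⟨⟨c, hcd⟩, l, ?_, fun x ↦ ⟨U x, f x, hU x, ?_⟩⟩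
  · obtain ⟨i, -⟩ := ((interHom (P.L σ)).congr (Λ' := divLattice ⟨c, hcd⟩) e hmem).exists_iso'
      fun V _ hx ↦ ⟨V, le_rfl, hx, (bijOn_interHom (P.L σ) V).congr e hmem⟩
    exact ⟨i⟩
  · rw [← (f x).lBasis_apply hc (genericPoint_mem (hU x)) ()]
    exact congrArg Subtype.val (hcl x)

end DivisorOfL

/-! ### The inverse image of `ℒ` on projective space -/

section Primitive
variable {X : Scheme.{u}} [IsIntegral X] {x : X}

/-- In a local ring, one of the summands of a unit is a unit. -/
lemma exists_isRegUnit_of_sum {ι : Type*} [Fintype ι] {a r : ι → X.functionField}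
    (ha : ∀ i, a i ∈ reg x) (hr : ∀ i, r i ∈ reg x) (h : IsRegUnit x (∑ i, a i * r i)) :
    ∃ i, IsRegUnit x (r i) := by
  choose a' ha' using fun i ↦ (show ∃ s, algebraMap (X.presheaf.stalk x) X.functionField s = a i from ha i)
  choose r' hr' using fun i ↦ (show ∃ s, algebraMap (X.presheaf.stalk x) X.functionField s = r i from hr i)
  by_contra! hn
  have h1 : ∑ i, a' i * r' i ∈ IsLocalRing.maximalIdeal (X.presheaf.stalk x) :=
    Ideal.sum_mem _ fun i _ ↦ Ideal.mul_mem_left _ _ <| by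
      rw [IsLocalRing.mem_maximalIdeal]
      intro hu
      exact hn i (hr' i ▸ isRegUnit_algebraMap hu)
  obtain ⟨h0, -, t, ht⟩ := h
  have h2 : algebraMap (X.presheaf.stalk x) X.functionField (∑ i, a' i * r' i) =
      ∑ i, a i * r i := by
    rw [map_sum]
    exact Finset.sum_congr rfl fun i _ ↦ by rw [map_mul, ha', hr']
  refine (IsLocalRing.mem_maximalIdeal _).1 h1 (.of_mul_eq_one t (stalk_injective x ?_))
  rw [map_mul, h2, map_one]
  exact (congrArg _ ht).trans (mul_inv_cancel₀ h0)

end Primitive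

section Intertwiner
variable {k D : Type u} [Field k] [DivisionRing D] [Algebra k D] {n : ℕ}

lemma liftHom_eq_sum {R ι : Type*} [CommRing R] [Algebra k R] [Fintype ι]
    (b : Module.Basis ι k D) (ψ : D →ₐ[k] Matrix (Fin n) (Fin n) R) (z : R ⊗[k] D) :
    liftHom ψ z = ∑ i, (Algebra.TensorProduct.basis R b).repr z i • ψ (b i) := by
  conv_lhs => rw [← (Algebra.TensorProduct.basis R b).sum_repr z]
  rw [map_sum]
  refine Finset.sum_congr rfl fun i _ ↦ ?_
  rw [map_smul, Algebra.TensorProduct.basis_apply, liftHom_tmul, one_smul]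

/-- Two `n`-dimensional representations of `D` over a field are isomorphic, since the automorphisms
of a matrix algebra are inner. -/
lemma exists_intertwiner {ℓ : Type*} [Field ℓ] [Algebra k ℓ] (hc : IsCSA k D n)
    (ψ ψ' : D →ₐ[k] Matrix (Fin n) (Fin n) ℓ) :
    ∃ C C' : Matrix (Fin n) (Fin n) ℓ, C * C' = 1 ∧ C' * C = 1 ∧ ∀ d, ψ' d * C = C * ψ d := by
  let e := (splitEquiv hc ψ).symm.trans (splitEquiv hc ψ')
  let t : Matrix (Fin n) (Fin n) ℓ ≃ₐ[ℓ] Module.End ℓ (Fin n → ℓ) := Matrix.toLinAlgEquiv'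
  obtain ⟨T, hT⟩ := (t.symm.trans (e.trans t)).eq_linearEquivConjAlgEquiv
  refine ⟨t.symm T.toLinearMap, t.symm T.symm.toLinearMap, ?_, ?_, fun d ↦ ?_⟩
  · rw [← map_mul, ← map_one t.symm]
    congr 1
    refine LinearMap.ext fun v ↦ ?_
    simp
  · rw [← map_mul, ← map_one t.symm]
    congr 1
    refine LinearMap.ext fun v ↦ ?_
    simp
  · apply t.injective
    rw [map_mul, map_mul, t.apply_symm_apply]
    have h1 : e (ψ d) = ψ' d := by
      have h2 (φ : D →ₐ[k] Matrix (Fin n) (Fin n) ℓ) : splitEquiv hc φ (1 ⊗ₜ d) = φ d := by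
        rw [splitEquiv_apply, liftHom_tmul, one_smul]
      rw [← h2 ψ, AlgEquiv.trans_apply, AlgEquiv.symm_apply_apply, h2]
    have h3 := DFunLike.congr_fun hT (t (ψ d))
    simp only [AlgEquiv.trans_apply, AlgEquiv.symm_apply_apply, h1] at h3
    rw [h3]
    refine LinearMap.ext fun v ↦ ?_
    simp [LinearEquiv.conjAlgEquiv_apply]

end Intertwiner

section Transposed
variable {k D ℓ K : Type u} [Field k] [DivisionRing D] [Algebra k D] {n : ℕ} [Field ℓ] [Algebra k ℓ]
  [Field K] [Algebra k K] {F : Type*} [CommRing F] [Algebra k F] {σ : D →ₗ[k] D}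

lemma baseChange_extD (σ : D →ₗ[k] D) (f : F →ₐ[k] K) (z : F ⊗[k] D) :
    σ.baseChange K (extD D f z) = extD D f (σ.baseChange F z) := by
  induction z using TensorProduct.induction_on with
  | zero => simp
  | tmul r d => simp
  | add x y hx hy => simp only [map_add, hx, hy]

/-- In coordinates over a splitting field `ℓ`: if `z` and the image of `z'` under the involution
agree, where `z` and `z'` are of the form `v w`, then `z` is a multiple of `(wC) w` for a fixed
invertible matrix `C` over `ℓ`. -/
lemma exists_smul_vecMulVec (hσ : IsInvolution σ) (ψ : D →ₐ[k] Matrix (Fin n) (Fin n) ℓ)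
    (c : ℓ →ₐ[k] K) {C C' : Matrix (Fin n) (Fin n) ℓ} (hC : C * C' = 1)
    (h : ∀ d, transposeRep hσ ψ d * C = C * ψ d) {w : Fin n → K} {j : Fin n} (hj : w j ≠ 0)
    {z' : K ⊗[k] D} {v v' : Fin n → K}
    (hz : liftHom (mapRep c ψ) (σ.baseChange K z') = Matrix.vecMulVec v w)
    (hz' : liftHom (mapRep c ψ) z' = Matrix.vecMulVec v' w) :
    ∃ a : K, liftHom (mapRep c ψ) (σ.baseChange K z') =
      a • Matrix.vecMulVec (Matrix.vecMul w (C'.map c)) w := by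
  -- In terms of matrices the involution is `M ↦ (C M C')ᵀ`.
  have h1 (z : K ⊗[k] D) : (liftHom (mapRep c ψ) (σ.baseChange K z)).transpose * C.map c =
      C.map c * liftHom (mapRep c ψ) z := by
    rw [← liftHom_transposeRep hσ]
    induction z using TensorProduct.induction_on with
    | zero => simp
    | tmul r d =>
      rw [liftHom_tmul, liftHom_tmul, Matrix.smul_mul, Matrix.mul_smul]
      congr 1
      have := congrArg (fun M ↦ c.mapMatrix M) (h d)
      simp only [map_mul] at this
      exact this
    | add x y hx hy => rw [map_add, map_add, add_mul, mul_add, hx, hy]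
  have hC' : C.map c * C'.map c = 1 := by
    have := congrArg (fun M ↦ c.mapMatrix M) hC
    simp only [map_mul, map_one] at this
    exact this
  have h2 : liftHom (mapRep c ψ) (σ.baseChange K z') =
      Matrix.vecMulVec (Matrix.vecMul w (C'.map c)) ((C.map c).mulVec v') := by
    have := congrArg (fun M ↦ (M * C'.map c).transpose) (h1 z')
    simp only [Matrix.mul_assoc, hC', mul_one, Matrix.transpose_transpose] at this
    rw [this, hz', Matrix.vecMulVec_mul, Matrix.mul_vecMulVec, Matrix.transpose_vecMulVec]
  set u := Matrix.vecMul w (C'.map c)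
  set x := (C.map c).mulVec v'
  refine ⟨x j / w j, ?_⟩
  rw [hz]
  have h3 (i) : v i * w j = u i * x j := by
    have := congrFun (congrFun (hz.symm.trans h2) i) j
    rwa [Matrix.vecMulVec_apply, Matrix.vecMulVec_apply] at this
  ext i p
  rw [Matrix.smul_apply, Matrix.vecMulVec_apply, Matrix.vecMulVec_apply, smul_eq_mul]
  have : v i = x j / w j * u i := by
    rw [div_mul_eq_mul_div, eq_div_iff hj, h3, mul_comm]
  rw [this, mul_assoc]

end Transposed

section Coordinates
variable {k D : Type u} [Field k] [DivisionRing D] [Algebra k D]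
  {X : Over (Spec (.of k))} [IsIntegral X.left] {n : ℕ} {P : SeveriBrauerVariety k D n X}
  {σ : D →ₗ[k] D} {U : X.left.Opens}

/-- The generator `u w` of `ℒ` has regular coordinates with respect to a basis of `D`, one of which
is a unit. -/
lemma repr_el_mem (hc : IsCSA k D n) {ι : Type*} [Fintype ι] (b : Module.Basis ι k D)
    (f : Frame P σ U) {x : X.left} (hx : x ∈ U) :
    (∀ i, (Algebra.TensorProduct.basis (FunField X) b).repr
      (f.el hc (Matrix.vecMulVec f.u f.w)) i ∈ reg x) ∧
    ∃ i, IsRegUnit x ((Algebra.TensorProduct.basis (FunField X) b).repr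
      (f.el hc (Matrix.vecMulVec f.u f.w)) i : X.left.functionField) := by
  have h1 : ∀ i, (Algebra.TensorProduct.basis (FunField X) b).repr
      (f.el hc (Matrix.vecMulVec f.u f.w)) i ∈ reg x := by
    rw [← mem_azLat_iff_repr b, mem_azLat_iff hc (f.ψ_mem x hx)]
    intro i j
    rw [f.liftHom_el, Matrix.vecMulVec_apply]
    exact mul_mem (f.u_mem x hx i) (f.w_mem x hx j)
  refine ⟨h1, exists_isRegUnit_of_sum (a := fun i ↦ f.ψ (b i) f.ju f.jw)
    (fun i ↦ f.ψ_mem x hx _ _ _) h1 ?_⟩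
  have h2 := congrFun (congrFun (liftHom_eq_sum b f.ψ (f.el hc (Matrix.vecMulVec f.u f.w))) f.ju) f.jw
  rw [f.liftHom_el, Matrix.vecMulVec_apply, Matrix.sum_apply] at h2
  have h3 := (f.u_unit x hx).mul (f.w_unit x hx)
  rw [h2] at h3
  convert h3 using 2
  rw [Matrix.smul_apply, smul_eq_mul, mul_comm]

end Coordinates

section PullbackOfL
attribute [local instance] MvPolynomial.gradedAlgebra
attribute [local instance] constAlgebra

section Rows
variable {ℓ : Type u} [Field ℓ] {n : ℕ} [NeZero n]

lemma genericRow_div_mem (y : projSpace ℓ n) (i : Fin n) :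
    genericRow ℓ n i / genericRow ℓ n (coordAt y) ∈ reg y := by
  have := chartFun_chartCoord ℓ (coordAt y) i
  rw [Units.val_div_eq_div_val] at this
  rw [genericRow, genericRow, ← this, ← algebraMap_chartGerm ℓ _ y (coordAt_notMem y)]
  exact ⟨_, rfl⟩

lemma genericRow_ne_zero (i : Fin n) : genericRow ℓ n i ≠ 0 := Units.ne_zero _

/-- If a multiple `s (wA) w` of the matrix of products of the homogeneous coordinates `w` with their
images under an invertible matrix `A` is primitive at `y`, then `s e²` is a unit at `y`, where
`e` is a homogeneous coordinate that does not vanish at `y`. -/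
lemma isRegUnit_of_primitive {A A' : Matrix (Fin n) (Fin n) ℓ} (hA : A * A' = 1)
    (y : projSpace ℓ n) {s : (projSpace ℓ n).functionField}
    (hmem : ∀ i j, s * (Matrix.vecMul (genericRow ℓ n) (A.map (constFun ℓ n)) i *
      genericRow ℓ n j) ∈ reg y)
    (hunit : ∃ i j, IsRegUnit y (s * (Matrix.vecMul (genericRow ℓ n) (A.map (constFun ℓ n)) i *
      genericRow ℓ n j))) :
    IsRegUnit y (s * genericRow ℓ n (coordAt y) ^ 2) := by
  set w := genericRow ℓ n
  set e := w (coordAt y)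
  have he : e ≠ 0 := genericRow_ne_zero _
  set u := Matrix.vecMul w (A.map (constFun ℓ n)) with hu
  have hw : ∀ i, w i / e ∈ reg y := genericRow_div_mem y
  have hu' : ∀ i, u i / e ∈ reg y := fun i ↦ by
    have : u i / e = ∑ j, w j / e * constFun ℓ n (A j i) := by
      rw [hu]
      simp only [Matrix.vecMul, dotProduct, Matrix.map_apply, Finset.sum_div]
      exact Finset.sum_congr rfl fun j _ ↦ mul_div_right_comm _ _ _
    rw [this]
    exact sum_mem fun j _ ↦ mul_mem (hw j) (constFun_mem_reg ℓ _ y)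
  have hmul : Matrix.vecMul u (A'.map (constFun ℓ n)) = w := by
    rw [hu, Matrix.vecMul_vecMul]
    have := congrArg (fun M ↦ (constFun ℓ n).mapMatrix M) hA
    simp only [map_mul, map_one] at this
    have h2 : A.map (constFun ℓ n) * A'.map (constFun ℓ n) = 1 := this
    rw [h2, Matrix.vecMul_one]
  -- The entries of the row `w` are combinations of those of `w A` with constant coefficients, so
  -- that `w A` is also unimodular after the division by `e`.
  obtain ⟨p, hp⟩ : ∃ p, IsRegUnit y (u p / e) := by
    refine exists_isRegUnit_of_sum (a := fun p ↦ constFun ℓ n (A' p (coordAt y)))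
      (fun p ↦ constFun_mem_reg ℓ _ y) hu' ?_
    have h1 : ∑ p, constFun ℓ n (A' p (coordAt y)) * (u p / e) = 1 := by
      have h2 := congrFun hmul (coordAt y)
      simp only [Matrix.vecMul, dotProduct, Matrix.map_apply] at h2
      calc ∑ p, constFun ℓ n (A' p (coordAt y)) * (u p / e)
          = (∑ p, u p * constFun ℓ n (A' p (coordAt y))) / e := by
            rw [Finset.sum_div]
            exact Finset.sum_congr rfl fun p _ ↦ by rw [mul_div_assoc', mul_comm]
        _ = 1 := by rw [h2]; exact div_self he
    rw [h1]
    exact IsRegUnit.one y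
  have hse : s * e ^ 2 ∈ reg y := by
    rw [← hp.mem_iff]
    convert hmem p (coordAt y) using 1
    change _ = s * (u p * e)
    field_simp
  obtain ⟨i, j, hij⟩ := hunit
  have h3 : s * (u i * w j) = ((u i / e) * (w j / e)) * (s * e ^ 2) := by field_simp
  have h4 : IsRegUnit y (∑ _ : Unit, ((u i / e) * (w j / e)) * (s * e ^ 2)) := by
    rw [Fintype.sum_unique, ← h3]
    exact hij
  exact (exists_isRegUnit_of_sum (fun _ ↦ mul_mem (hu' i) (hw j)) (fun _ ↦ hse) h4).elim fun _ h ↦ h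

end Rows

variable {k D ℓ : Type u} [Field k] [DivisionRing D] [Algebra k D] [Field ℓ] [Algebra k ℓ]
  {n : ℕ} [NeZero n] {X : Over (Spec (.of k))} [IsIntegral X.left]
  {P : SeveriBrauerVariety k D n X} {σ : D →ₗ[k] D} (hc : IsCSA k D n)
  (ψ : D →ₐ[k] Matrix (Fin n) (Fin n) ℓ)

/-- An element with coordinates that are regular, one of them a unit, at the image of `y` has a
matrix over `ℙ^{n-1}` with the same property at `y`. -/
lemma liftHom_primitive {ι : Type*} [Fintype ι] (b : Module.Basis ι k D) (y : projSpace ℓ n)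
    {z : FunField X ⊗[k] D}
    (hz : ∀ i, (Algebra.TensorProduct.basis (FunField X) b).repr z i ∈ reg (rowMap P hc ψ y))
    (hz' : ∃ i, IsRegUnit (rowMap P hc ψ y)
      ((Algebra.TensorProduct.basis (FunField X) b).repr z i : X.left.functionField)) :
    (∀ i j, liftHom (mapRep (constHom k ℓ n) ψ) (extD D (rowFun P hc ψ) z) i j ∈ reg y) ∧
      ∃ i j, IsRegUnit y
        (liftHom (mapRep (constHom k ℓ n) ψ) (extD D (rowFun P hc ψ) z) i j) := by
  set z' := extD D (rowFun P hc ψ) z with hz'_def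
  set K := (projSpace ℓ n).functionField
  have hr (i) : (Algebra.TensorProduct.basis K b).repr z' i =
      funMap (rowMap P hc ψ) ((Algebra.TensorProduct.basis (FunField X) b).repr z i) :=
    repr_extD b _ z i
  have h1 : ∀ i j, liftHom (mapRep (constHom k ℓ n) ψ) z' i j ∈ reg y := fun i j ↦ by
    rw [liftHom_eq_sum b, Matrix.sum_apply]
    refine sum_mem fun a _ ↦ ?_
    rw [Matrix.smul_apply, smul_eq_mul, hr]
    exact mul_mem (funMap_mem_reg _ (hz a)) (constFun_mem_reg ℓ _ y)
  refine ⟨h1, ?_⟩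
  obtain ⟨a, ha⟩ := hz'
  have ha' : IsRegUnit y ((Algebra.TensorProduct.basis K b).repr z' a) := by
    rw [hr]
    have := funMapUnits_mem (rowMap P hc ψ) (y := y) (a := Units.mk0 _ ha.1) ha
    exact this
  let N := liftHom (mapRep (constHom k ℓ n) ψ) z'
  -- The inverse of the splitting has constant coefficients. Hence the coordinates of `z'` are
  -- combinations of its matrix entries, one of which must be a unit.
  let s (p : Fin n × Fin n) : ℓ ⊗[k] D := (splitEquiv hc ψ).symm (Matrix.single p.1 p.2 1)
  have hs : z' = ∑ p : Fin n × Fin n, N p.1 p.2 • extD D (constHom k ℓ n) (s p) := by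
    apply (bijective_liftHom hc (mapRep (constHom k ℓ n) ψ)).1
    rw [map_sum]
    change N = _
    ext i j
    rw [Matrix.sum_apply, Finset.sum_eq_single (i, j)]
    · rw [map_smul, Matrix.smul_apply, liftHom_extD, liftHom_splitEquiv_symm]
      simp
    · intro p _ hp
      rw [map_smul, Matrix.smul_apply, liftHom_extD, liftHom_splitEquiv_symm,
        Matrix.single_apply_of_ne, map_zero, smul_zero]
      rintro ⟨h1, h2⟩
      exact hp (Prod.ext h1 h2)
    · simp
  have h2 : (Algebra.TensorProduct.basis K b).repr z' a = ∑ p : Fin n × Fin n,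
      constFun ℓ n ((Algebra.TensorProduct.basis ℓ b).repr (s p) a) * N p.1 p.2 := by
    conv_lhs => rw [hs]
    rw [map_sum, Finsupp.finsetSum_apply]
    refine Finset.sum_congr rfl fun p _ ↦ ?_
    rw [map_smul, Finsupp.smul_apply, repr_extD, smul_eq_mul, mul_comm]
    rfl
  rw [h2] at ha'
  obtain ⟨p, hp⟩ := exists_isRegUnit_of_sum (fun _ ↦ constFun_mem_reg ℓ _ y)
    (fun (p : Fin n × Fin n) ↦ h1 p.1 p.2) ha'
  exact ⟨p.1, p.2, hp⟩

/-- Over a splitting field, `ℒ` becomes the sheaf `𝒪(-2)`: in terms of the homogeneous coordinates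
`w`, the ideal `L` is spanned by a matrix of the form `(wC) w`, with entries of degree `2`. -/
lemma linEquiv_pullDiv_sheafL (hσ : IsInvolution σ) (c : divisors X.left) (l : P.L σ)
    (hl : ∀ x, ∃ (U : X.left.Opens) (f : Frame P σ U), x ∈ U ∧
      (c.1 x : FunField X) • (l : FunField X ⊗[k] D) = f.el hc (Matrix.vecMulVec f.u f.w)) :
    LinEquiv (pullDiv (rowMap P hc ψ) c) (hyperplane ℓ n ^ (-2 : ℤ)) := by
  obtain ⟨b⟩ := hc.exists_basis
  set K := (projSpace ℓ n).functionField
  obtain ⟨C, C', hC, hC', hCψ⟩ := exists_intertwiner hc ψ (transposeRep hσ ψ)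
  obtain ⟨v, hv⟩ := liftHom_rowFun P hc ψ l.2.1
  obtain ⟨t, ht, hlt⟩ := l.2.2
  obtain ⟨v', hv'⟩ := liftHom_rowFun P hc ψ ht
  rw [← hlt, ← baseChange_extD] at hv
  -- On `ℙ^{n-1}` the element `l` is a multiple `a (w C') w` of a quadratic expression in the row `w`.
  obtain ⟨a, ha⟩ := exists_smul_vecMulVec hσ ψ (constHom k ℓ n) hC hCψ
    (genericRow_ne_zero (ℓ := ℓ) (n := n) 0) hv hv'
  rw [baseChange_extD, hlt] at ha
  -- The local equation makes it primitive, which determines its order at `y`.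
  have key (y : projSpace ℓ n) : IsRegUnit y
      (funMap (rowMap P hc ψ) (c.1 (rowMap P hc ψ y)) * a * genericRow ℓ n (coordAt y) ^ 2) := by
    obtain ⟨U, f, hU, hf⟩ := hl (rowMap P hc ψ y)
    obtain ⟨h1, h2⟩ := repr_el_mem hc b f hU
    rw [← hf] at h1 h2
    obtain ⟨h3, h4⟩ := liftHom_primitive hc ψ b y h1 h2
    have h5 (i j) : liftHom (mapRep (constHom k ℓ n) ψ) (extD D (rowFun P hc ψ)
        ((c.1 (rowMap P hc ψ y) : FunField X) • (l : FunField X ⊗[k] D))) i j =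
        funMap (rowMap P hc ψ) (c.1 (rowMap P hc ψ y)) * a *
          (Matrix.vecMul (genericRow ℓ n) (C'.map (constFun ℓ n)) i * genericRow ℓ n j) := by
      have : extD D (rowFun P hc ψ)
        ((c.1 (rowMap P hc ψ y) : FunField X) • (l : FunField X ⊗[k] D)) =
        (funMap (rowMap P hc ψ) (c.1 (rowMap P hc ψ y)) : K) • extD D (rowFun P hc ψ) l := by
        rw [Algebra.smul_def, map_mul, Algebra.smul_def]
        congr 1
      rw [this, map_smul, ha, smul_smul, Matrix.smul_apply, Matrix.vecMulVec_apply]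
      rfl
    simp only [h5] at h3 h4
    exact isRegUnit_of_primitive hC' y h3 h4
  have ha0 : a ≠ 0 := fun h ↦ by
    have := (key (genericPoint _)).1
    rw [h] at this
    simp at this
  refine ⟨Units.mk0 a ha0, fun y ↦ ?_⟩
  rw [mem_regUnits]
  convert key y using 1
  have e1 : ((hyperplane ℓ n ^ (-2 : ℤ)).1 y : Kˣ) = (coordFun ℓ (coordAt y)) ^ (-2 : ℤ) := rfl
  rw [e1, zpow_neg, div_inv_eq_mul, Units.val_mul, Units.val_mul, mul_comm (Units.val _)]
  rfl

end PullbackOfL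

/-! ### The comparison over a splitting field -/

section Twist
attribute [local instance] MvPolynomial.gradedAlgebra

variable {k D ℓ : Type u} [Field k] [DivisionRing D] [Algebra k D] [Field ℓ] [Algebra k ℓ]
  {n : ℕ} [NeZero n] {X : Over (Spec (.of k))} [IsIntegral X.left]

lemma nonempty_pullback_iso {Y Z : Scheme.{u}} [IsIntegral Y] [IsIntegral Z] (f : Y ⟶ Z)
    [IsDominant f] {M : Z.Modules} {c : divisors Z} (e : M ≅ divSheaf c) :
    Nonempty ((Scheme.Modules.pullback f).obj M ≅ divSheaf (pullDiv f c)) := by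
  obtain ⟨i⟩ := pullback_divSheaf f c
  exact ⟨(Scheme.Modules.pullback f).mapIso e ≪≫ i⟩

/-- A sheaf whose class becomes `m` times the class of a hyperplane under `ℙ^{n-1}_ℓ → X` becomes
`𝒪(m)` under every isomorphism `X_ℓ ≅ ℙ^{n-1}_ℓ`, since automorphisms of projective space preserve
the class of a hyperplane. -/
lemma isTwistAfter_of_linEquiv (P : SeveriBrauerVariety k D n X) (hc : IsCSA k D n) (hn : 2 ≤ n)
    (ψ : D →ₐ[k] Matrix (Fin n) (Fin n) ℓ) {M : X.left.Modules} {c : divisors X.left}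
    (i : M ≅ divSheaf c) {m : ℤ}
    (h : LinEquiv (pullDiv (rowMap P hc ψ) c) (hyperplane ℓ n ^ m)) : IsTwistAfter M n ℓ m := by
  refine ⟨⟨(asIso (splitMap P hc ψ)).symm, ?_⟩, fun e _ ↦ ?_⟩
  · change inv (splitMap P hc ψ) ≫ projSpaceHom ℓ n = _
    rw [IsIso.inv_comp_eq, splitMap_snd]
  have hi : IsIntegral (baseChange X ℓ) := by
    have : Nonempty (baseChange X ℓ) := ⟨splitMap P hc ψ (genericPoint _)⟩
    exact isIntegral_of_isOpenImmersion e.hom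
  let p : baseChange X ℓ ⟶ X.left := Limits.pullback.fst _ _
  let α : projSpace ℓ n ⟶ projSpace ℓ n := e.inv ≫ inv (splitMap P hc ψ)
  have hp : p = e.hom ≫ α ≫ rowMap P hc ψ := by
    simp only [α, rowMap_eq, Category.assoc, Iso.hom_inv_id_assoc, IsIso.inv_hom_id_assoc]
    rfl
  have hα : IsDominant (α ≫ rowMap P hc ψ) := inferInstance
  have hd : IsDominant (e.hom ≫ α ≫ rowMap P hc ψ) := inferInstance
  have hpd : IsDominant p := hp ▸ hd
  have key : LinEquiv (pullDiv p c) (pullDiv e.hom (hyperplane ℓ n ^ m)) := by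
    rw [pullDiv_congr hp, pullDiv_comp, pullDiv_comp]
    refine ((h.pullDiv α).trans ?_).pullDiv e.hom
    rw [map_zpow]
    exact (pullDiv_hyperplane hn α).zpow m
  obtain ⟨i₁⟩ := nonempty_pullback_iso p i
  obtain ⟨t⟩ := serreTwist_iso (ℓ := ℓ) (n := n) m
  obtain ⟨i₂⟩ := nonempty_pullback_iso e.hom t
  obtain ⟨i₃⟩ := divSheaf_iso_of_linEquiv key
  exact ⟨i₁ ≪≫ i₃ ≪≫ i₂.symm⟩

end Twist

/-! ### Descent of functions and sections -/

section Expansion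
attribute [local instance] MvPolynomial.gradedAlgebra

/-- In a pushout `B = A ⊗_k ℓ` of rings, a `k`-basis of `ℓ` becomes an `A`-basis of `B`. -/
lemma bijective_sum_of_isPushout {k ℓ : Type u} [Field k] [Field ℓ] [Algebra k ℓ] {ι : Type*}
    (b : Module.Basis ι k ℓ) {A B : CommRingCat.{u}} {i : CommRingCat.of k ⟶ A} {α : A ⟶ B}
    {β : CommRingCat.of ℓ ⟶ B}
    (h : IsPushout i (CommRingCat.ofHom (algebraMap k ℓ)) α β) :
    Function.Bijective fun a : ι →₀ A ↦ a.sum fun j x ↦ α.hom x * β.hom (b j) := by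
  let _ : Algebra k A := i.hom.toAlgebra
  let e := IsPushout.isoIsPushout _ _ h (CommRingCat.isPushout_tensorProduct k A ℓ)
  have h1 (x : A) : e.hom.hom (α.hom x) = x ⊗ₜ 1 :=
    congrArg (fun f : A ⟶ CommRingCat.of (A ⊗[k] ℓ) ↦ f.hom x)
      (IsPushout.inl_isoIsPushout_hom _ _ h (CommRingCat.isPushout_tensorProduct k A ℓ))
  have h2 (x : ℓ) : e.hom.hom (β.hom x) = 1 ⊗ₜ x :=
    congrArg (fun f : CommRingCat.of ℓ ⟶ CommRingCat.of (A ⊗[k] ℓ) ↦ f.hom x)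
      (IsPushout.inr_isoIsPushout_hom _ _ h (CommRingCat.isPushout_tensorProduct k A ℓ))
  have h3 : Function.Bijective e.hom.hom := e.commRingCatIsoToRingEquiv.bijective
  have h4 : (fun a : ι →₀ A ↦ e.hom.hom (a.sum fun j x ↦ α.hom x * β.hom (b j))) =
      (Algebra.TensorProduct.basis A b).repr.symm := by
    funext a
    simp only [Finsupp.sum, map_sum, map_mul, h1, h2, Algebra.TensorProduct.tmul_mul_tmul, mul_one,
      one_mul]
    rw [Module.Basis.repr_symm_apply, Finsupp.linearCombination_apply, Finsupp.sum]
    refine Finset.sum_congr rfl fun j _ ↦ ?_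
    rw [Algebra.TensorProduct.basis_apply, TensorProduct.smul_tmul', smul_eq_mul, mul_one]
  have h5 : Function.Bijective
      (e.hom.hom ∘ fun a : ι →₀ A ↦ a.sum fun j x ↦ α.hom x * β.hom (b j)) := by
    change Function.Bijective
      (fun a : ι →₀ A ↦ e.hom.hom (a.sum fun j x ↦ α.hom x * β.hom (b j)))
    rw [h4]
    exact LinearEquiv.bijective _
  exact (Function.Bijective.of_comp_iff' h3 _).1 h5

lemma gen_structureRingHom {ℓ : Type u} [Field ℓ] {Y : Over (Spec (.of ℓ))} [IsIntegral Y.left]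
    {φ : ℓ →+* Y.left.functionField}
    (h : Y.left.fromSpecStalk (genericPoint Y.left) ≫ Y.hom = Spec.map (CommRingCat.ofHom φ))
    (V : Y.left.Opens) (hV : genericPoint Y.left ∈ V) (c : ℓ) :
    gen V hV (structureRingHom Y V c) = φ c := by
  have h1 : CommRingCat.ofHom (algebraMap ℓ (FunField Y)) = CommRingCat.ofHom φ :=
    Spec.map_injective (algebraMap_hom_eq.symm.trans h)
  exact ((germHom Y V _ hV).commutes c).trans
    (RingHom.congr_fun (congrArg CommRingCat.Hom.hom h1) c)

/-- Over the inverse image of an affine open set `U`, the functions on the base change of `X` are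
`Γ(X, U) ⊗ ℓ`. -/
lemma isPushout_sections {k ℓ : Type u} [Field k] [Field ℓ] [Algebra k ℓ]
    {X : Over (Spec (.of k))} {Y : Over (Spec (.of ℓ))} {g : Y.left ⟶ X.left}
    (H : IsPullback g Y.hom X.hom (Spec.map (CommRingCat.ofHom (algebraMap k ℓ))))
    {U : X.left.Opens} (hU : IsAffineOpen U) :
    IsPushout (CommRingCat.ofHom (structureRingHom X U)) (CommRingCat.ofHom (algebraMap k ℓ))
      (g.app U) (CommRingCat.ofHom (structureRingHom Y (g ⁻¹ᵁ U))) := by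
  have e : g ⁻¹ᵁ U = g ⁻¹ᵁ U ⊓ Y.hom ⁻¹ᵁ ⊤ := by simp
  have h := (isIso_pushoutSection_iff H (US := ⊤) (UT := ⊤) (UX := U) le_top le_top e).1
    (isIso_pushoutSection_of_isAffineOpen H le_top le_top e (isAffineOpen_top _)
      (isAffineOpen_top _) hU)
  refine IsPushout.of_iso h (Scheme.ΓSpecIso (.of k)) (Iso.refl _) (Scheme.ΓSpecIso (.of ℓ))
    (Iso.refl _) ?_ ?_ ?_ ?_
  · change _ = _ ≫ ((Scheme.ΓSpecIso (.of k)).inv ≫ _)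
    rw [Iso.hom_inv_id_assoc]
    rfl
  · refine Eq.trans ?_ (Scheme.ΓSpecIso_naturality _)
    congr 1
  · simp [Scheme.Hom.appLE]
  · change _ = _ ≫ ((Scheme.ΓSpecIso (.of ℓ)).inv ≫ _)
    rw [Iso.hom_inv_id_assoc]
    rfl

variable {k D ℓ : Type u} [Field k] [DivisionRing D] [Algebra k D] [Field ℓ] [Algebra k ℓ]
  {n : ℕ} {X : Over (Spec (.of k))} (P : SeveriBrauerVariety k D n X)
  (hc : IsCSA k D n) (ψ : D →ₐ[k] Matrix (Fin n) (Fin n) ℓ)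

lemma isPullback_rowMap : IsPullback (rowMap P hc ψ) (projSpaceHom ℓ n) X.hom
    (Spec.map (CommRingCat.ofHom (algebraMap k ℓ))) :=
  IsPullback.of_iso_pullback ⟨rowMap_hom P hc ψ⟩ (asIso (splitMap P hc ψ)) (splitMap_fst P hc ψ)
    (splitMap_snd P hc ψ)

variable (ℓ n) in
/-- The constant sections of the structure sheaf of projective space. -/
def constSec (V : (projSpace ℓ n).Opens) : ℓ →+* Γ(projSpace ℓ n, V) :=
  structureRingHom (Over.mk (projSpaceHom ℓ n)) V

lemma bijective_sum_sections {ι : Type*} (b : Module.Basis ι k ℓ) {U : X.left.Opens}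
    (hU : IsAffineOpen U) : Function.Bijective fun a : ι →₀ Γ(X.left, U) ↦
      a.sum fun j x ↦ ((rowMap P hc ψ).app U).hom x * constSec ℓ n (rowMap P hc ψ ⁻¹ᵁ U) (b j) :=
  bijective_sum_of_isPushout b
    (isPushout_sections (Y := Over.mk (projSpaceHom ℓ n)) (isPullback_rowMap P hc ψ) hU)

variable [NeZero n] [IsIntegral X.left] {ι : Type*} (b : Module.Basis ι k ℓ)

/-- The function `∑ a_j b_j` on `ℙ^{n-1}_ℓ` with coefficients `a_j` in the function field of `X`,
where the `b_j` form a basis of `ℓ` over `k`. -/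
def expand : (ι →₀ FunField X) →+ (projSpace ℓ n).functionField :=
  Finsupp.liftAddHom fun j ↦
    (AddMonoidHom.mulRight (constFun ℓ n (b j))).comp (rowFun P hc ψ : _ →+ _)

lemma expand_apply (a : ι →₀ FunField X) :
    expand P hc ψ b a = a.sum fun j x ↦ rowFun P hc ψ x * constFun ℓ n (b j) := rfl

lemma expand_smul (f : FunField X) (a : ι →₀ FunField X) :
    expand P hc ψ b (f • a) = rowFun P hc ψ f * expand P hc ψ b a := by
  rw [expand_apply, expand_apply, Finsupp.sum_smul_index (by simp), Finsupp.mul_sum]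
  simp only [map_mul, mul_assoc]

lemma gen_sum (U : X.left.Opens) (hU : genericPoint X.left ∈ U) (a : ι →₀ Γ(X.left, U)) :
    gen (rowMap P hc ψ ⁻¹ᵁ U) (genericPoint_mem_preimage (rowMap P hc ψ) hU)
      (a.sum fun j x ↦ ((rowMap P hc ψ).app U).hom x *
        constSec ℓ n (rowMap P hc ψ ⁻¹ᵁ U) (b j)) =
      expand P hc ψ b (a.mapRange (gen U hU) (map_zero _)) := by
  rw [expand_apply, Finsupp.sum_mapRange_index (by simp), Finsupp.sum, map_sum, Finsupp.sum]
  refine Finset.sum_congr rfl fun j _ ↦ ?_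
  rw [map_mul]
  congr 1
  · exact (funMap_gen (rowMap P hc ψ) U hU (a j)).symm
  · have : IsIntegral (Over.mk (projSpaceHom ℓ n)).left := inferInstanceAs (IsIntegral (projSpace ℓ n))
    exact gen_structureRingHom (Y := Over.mk (projSpaceHom ℓ n)) (fromSpecStalk_projSpaceHom ℓ) _ _ _

/-- A function that is regular over an affine open subset `U` of `X` is a combination of the `b_j`
with coefficients regular on `U`. -/
lemma exists_expand_eq {U : X.left.Opens} (hU : IsAffineOpen U) (hη : genericPoint X.left ∈ U)
    {f : (projSpace ℓ n).functionField} (hf : ∀ y, rowMap P hc ψ y ∈ U → f ∈ reg y) :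
    ∃ a : ι →₀ FunField X, expand P hc ψ b a = f ∧ ∀ x ∈ U, ∀ j, a j ∈ reg x := by
  obtain ⟨r, hr⟩ := exists_gen_of_forall_mem_reg
    (genericPoint_mem_preimage (rowMap P hc ψ) hη) (f := f) hf
  obtain ⟨a, ha⟩ := (bijective_sum_sections P hc ψ b hU).2 r
  refine ⟨a.mapRange (gen U hη) (map_zero _), ?_, fun x hx j ↦ ?_⟩
  · rw [← hr, ← ha]
    exact (gen_sum P hc ψ b U hη a).symm
  · rw [Finsupp.mapRange_apply]
    exact gen_mem_reg hx _

/-- Functions on `X` remain independent over a `k`-basis of `ℓ`, because `Γ(X, U) ⊗ ℓ` has this basis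
over `Γ(X, U)` for an affine neighbourhood `U` of the generic point. -/
lemma expand_injective : Function.Injective (expand P hc ψ b) := by
  rw [injective_iff_map_eq_zero]
  intro a ha
  obtain ⟨V, hV, hreg⟩ := exists_forall_mem_reg (x := genericPoint X.left)
    (f := fun j : a.support ↦ a j) (fun _ ↦ mem_reg_genericPoint _)
  obtain ⟨U, hU, hη, hUV⟩ := exists_isAffineOpen_mem_and_subset hV
  choose r hr using fun j : ι ↦ exists_gen_of_forall_mem_reg hη (f := a j) (fun x hx ↦ by
    by_cases hj : j ∈ a.support
    · exact hreg x (hUV hx) ⟨j, hj⟩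
    · rw [Finsupp.notMem_support_iff.1 hj]
      exact zero_mem _)
  have h0 (j) : r j ≠ 0 → j ∈ a.support := fun h ↦ by
    rw [Finsupp.mem_support_iff, ← hr j]
    exact fun h' ↦ h (gen_injective U hη (h'.trans (map_zero _).symm))
  let a' : ι →₀ Γ(X.left, U) := Finsupp.onFinset a.support r h0
  have h1 : a'.mapRange (gen U hη) (map_zero _) = a := Finsupp.ext fun j ↦ hr j
  have h2 := gen_sum P hc ψ b U hη a'
  rw [h1, ha] at h2
  have h3 := (bijective_sum_sections P hc ψ b hU).1
    (a₁ := a') (a₂ := 0) (gen_injective _ _ (h2.trans (map_zero _).symm))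
  rw [← h1, h3, Finsupp.mapRange_zero]

/-- Let `c` be a divisor on `X`. A section over `ℙ^{n-1}_ℓ` of the pullback of the associated
sheaf is a combination of the `b_j` whose coefficients are sections over `X`. -/
lemma exists_expand_eq_of_divisor (c : divisors X.left) {f : (projSpace ℓ n).functionField}
    (hf : ∀ y, rowFun P hc ψ (c.1 (rowMap P hc ψ y) : X.left.functionField) * f ∈ reg y) :
    ∃ a : ι →₀ FunField X, expand P hc ψ b a = f ∧
      ∀ x j, (c.1 x : X.left.functionField) * a j ∈ reg x := by
  have key (x : X.left) : ∃ a : ι →₀ FunField X, expand P hc ψ b a = f ∧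
      ∀ j, (c.1 x : X.left.functionField) * a j ∈ reg x := by
    obtain ⟨V, hV, hcV⟩ := c.2 x
    obtain ⟨U, hU, hxU, hUV⟩ := exists_isAffineOpen_mem_and_subset hV
    have hη : genericPoint X.left ∈ U := genericPoint_mem hxU
    obtain ⟨a, ha, hreg⟩ := exists_expand_eq P hc ψ b hU hη
      (f := rowFun P hc ψ (c.1 x : X.left.functionField) * f) (fun y hy ↦ by
        have h1 := funMap_mem_reg (rowMap P hc ψ) (y := y)
          ((regUnits X.left _).inv_mem (hcV _ (hUV hy))).2.1
        have h2 := mul_mem h1 (hf y)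
        refine (congrArg (· ∈ reg y) ?_).mp h2
        change funMap (rowMap P hc ψ) _ * (funMap (rowMap P hc ψ) _ * f) =
          funMap (rowMap P hc ψ) _ * f
        rw [← mul_assoc, ← map_mul, ← Units.val_mul]
        simp)
    refine ⟨((c.1 x)⁻¹ : X.left.functionFieldˣ).1 • a, ?_, fun j ↦ ?_⟩
    · have := expand_smul P hc ψ b ((c.1 x)⁻¹ : X.left.functionFieldˣ).1 a
      refine this.trans ?_
      rw [ha, ← mul_assoc, ← map_mul, Units.inv_mul, map_one, one_mul]
    · have := hreg x hxU j
      refine (congrArg (· ∈ reg x) ?_).mp this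
      exact (Units.mul_inv_cancel_left _ _).symm
  obtain ⟨a, ha, -⟩ := key (genericPoint X.left)
  refine ⟨a, ha, fun x ↦ ?_⟩
  obtain ⟨a', ha', h⟩ := key x
  rwa [expand_injective P hc ψ b (ha.trans ha'.symm)]

end Expansion

/-! ### The Picard group of `X` -/

section PicardDescent
attribute [local instance] MvPolynomial.gradedAlgebra

variable {k D ℓ : Type u} [Field k] [DivisionRing D] [Algebra k D] [Field ℓ] [Algebra k ℓ]
  {n : ℕ} [NeZero n] {X : Over (Spec (.of k))} [IsIntegral X.left]
  (P : SeveriBrauerVariety k D n X) (hc : IsCSA k D n) (ψ : D →ₐ[k] Matrix (Fin n) (Fin n) ℓ)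

lemma isRegUnit_constFun {a : ℓ} (ha : a ≠ 0) (y : projSpace ℓ n) :
    IsRegUnit y (constFun ℓ n a) := by
  refine ⟨(map_ne_zero _).2 ha, constFun_mem_reg ℓ a y, ?_⟩
  rw [← map_inv₀]
  exact constFun_mem_reg ℓ _ y

/-- The Picard group of `X` embeds into that of `ℙ^{n-1}_ℓ`: a generating section over `ℙ^{n-1}_ℓ`
is a combination of sections over `X`, and each of these that is not zero is a generator, since
the global functions on `ℙ^{n-1}_ℓ` are constant. -/
lemma linEquiv_one_of_pullDiv (hn : 2 ≤ n) {c : divisors X.left}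
    (h : LinEquiv (pullDiv (rowMap P hc ψ) c) 1) : LinEquiv c 1 := by
  obtain ⟨f, hf⟩ := h
  have hf' (y) : IsRegUnit y (rowFun P hc ψ (c.1 (rowMap P hc ψ y) : X.left.functionField) *
      (f : (projSpace ℓ n).functionField)) := by
    have h1 : IsRegUnit y _ := hf y
    have e : f * (pullDiv (rowMap P hc ψ) c).1 y / (1 : divisors (projSpace ℓ n)).1 y =
      (pullDiv (rowMap P hc ψ) c).1 y * f := by
      rw [mul_comm]; exact div_one _
    rw [e] at h1
    exact h1
  let b := Module.Basis.ofVectorSpace k ℓ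
  obtain ⟨a, ha, hreg⟩ := exists_expand_eq_of_divisor P hc ψ b c fun y ↦ (hf' y).2.1
  obtain ⟨j, hj⟩ : ∃ j, a j ≠ 0 := by
    by_contra! h0
    have : a = 0 := Finsupp.ext h0
    rw [this, map_zero] at ha
    exact f.ne_zero ha.symm
  -- The quotient of the two sections is regular everywhere, hence constant.
  obtain ⟨s, hs⟩ := exists_constFun_eq ℓ hn
    (f := rowFun P hc ψ (a j) / (f : (projSpace ℓ n).functionField)) fun y ↦ by
      have h1 := funMap_mem_reg (rowMap P hc ψ) (hreg (rowMap P hc ψ y) j)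
      rw [map_mul] at h1
      have h2 := mul_mem h1 (hf' y).2.2
      refine (congrArg (· ∈ reg y) ?_).mp h2
      change rowFun P hc ψ (c.1 (rowMap P hc ψ y) : X.left.functionField) * rowFun P hc ψ (a j) *
        (_ * _)⁻¹ = _
      have h3 := (hf' y).1
      rw [mul_inv, mul_mul_mul_comm, mul_inv_cancel₀ (left_ne_zero_of_mul h3), one_mul,
        div_eq_mul_inv]
  have hs0 : s ≠ 0 := by
    rintro rfl
    rw [map_zero, eq_comm, div_eq_zero_iff, or_iff_left f.ne_zero] at hs
    exact hj ((map_eq_zero _).1 hs)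
  refine ⟨Units.mk0 (a j : X.left.functionField) hj, fun x ↦ ?_⟩
  obtain ⟨y, rfl⟩ := (rowMap P hc ψ).surjective x
  rw [mem_regUnits]
  have e : (Units.mk0 (a j : X.left.functionField) hj * c.1 (rowMap P hc ψ y) /
      (1 : divisors X.left).1 (rowMap P hc ψ y) : X.left.functionFieldˣ) =
      c.1 (rowMap P hc ψ y) * Units.mk0 (a j : X.left.functionField) hj := by
    rw [mul_comm]; exact div_one _
  rw [e]
  refine isRegUnit_of_funMap (rowMap P hc ψ) (hreg _ j) ?_
  have h1 := (isRegUnit_constFun hs0 y).mul (hf' y)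
  refine (congrArg (IsRegUnit y) ?_).mp h1
  rw [hs, Units.val_mul, map_mul]
  change _ = rowFun P hc ψ _ * rowFun P hc ψ (a j)
  rw [mul_left_comm, div_mul_cancel₀ _ f.ne_zero]

omit [NeZero n] in
/-- The left ideal `T` is generated by an idempotent. -/
lemma Frame.exists_idempotent {P : SeveriBrauerVariety k D n X} {σ : D →ₗ[k] D}
    (hc : IsCSA k D n) {U : X.left.Opens} (f : Frame P σ U) (hU : genericPoint X.left ∈ U) :
    ∃ ε ∈ P.T, ε ≠ 0 ∧ ∀ z, z ∈ P.T ↔ z * ε = z := by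
  let e : Fin n → FunField X := Pi.single f.jw (f.w f.jw)⁻¹
  have hwe : f.w ⬝ᵥ e = 1 := by
    rw [dotProduct_single]
    exact mul_inv_cancel₀ (f.w_ne_zero hU)
  have hmul (v : Fin n → FunField X) : Matrix.vecMulVec v f.w * Matrix.vecMulVec e f.w =
      Matrix.vecMulVec v f.w := by
    rw [Matrix.vecMulVec_mul_vecMulVec, hwe, one_smul]
  refine ⟨f.el hc (Matrix.vecMulVec e f.w), (f.mem_T _).2 ⟨e, f.liftHom_el hc _⟩, fun h ↦ ?_,
    fun z ↦ ⟨fun hz ↦ ?_, fun hz ↦ (f.mem_T z).2 ?_⟩⟩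
  · have h1 := congrArg (liftHom f.ψ) h
    rw [liftHom_el, map_zero] at h1
    have h2 := congrFun (congrFun h1 f.jw) f.jw
    simp [Matrix.vecMulVec_apply, e, f.w_ne_zero hU] at h2
  · obtain ⟨v, hv⟩ := (f.mem_T z).1 hz
    apply (bijective_liftHom hc f.ψ).1
    rw [map_mul, liftHom_el, hv, hmul]
  · rw [← hz, map_mul, liftHom_el, Matrix.mul_vecMulVec]
    exact ⟨_, rfl⟩

attribute [local instance] constAlgebra

variable {ι : Type*} (b : Module.Basis ι k ℓ)

/-- The element `∑ b_j t_j` of `D` over the function field of `ℙ^{n-1}_ℓ`, for elements `t_j` of `D`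
over the function field of `X`. -/
def expandD : (ι →₀ FunField X ⊗[k] D) →+ (projSpace ℓ n).functionField ⊗[k] D :=
  Finsupp.liftAddHom fun j ↦ (DistribSMul.toAddMonoidHom _ (constFun ℓ n (b j))).comp
    (extD D (rowFun P hc ψ) : _ →+ _)

lemma expandD_apply (t : ι →₀ FunField X ⊗[k] D) : expandD P hc ψ b t =
    t.sum fun j z ↦ constFun ℓ n (b j) • extD D (rowFun P hc ψ) z := rfl

lemma repr_expandD {κ : Type*} (bD : Module.Basis κ k D) (t : ι →₀ FunField X ⊗[k] D) (d : κ) :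
    (Algebra.TensorProduct.basis (projSpace ℓ n).functionField bD).repr (expandD P hc ψ b t) d =
      expand P hc ψ b (t.mapRange
        (fun z ↦ (Algebra.TensorProduct.basis (FunField X) bD).repr z d) (by simp)) := by
  rw [expandD_apply, expand_apply, Finsupp.sum_mapRange_index (by simp), Finsupp.sum, map_sum,
    Finsupp.finsetSum_apply]
  refine Finset.sum_congr rfl fun j _ ↦ ?_
  rw [map_smul, Finsupp.smul_apply, repr_extD, smul_eq_mul, mul_comm]

lemma expandD_injective : Function.Injective (expandD P hc ψ b) := by
  obtain ⟨bD⟩ := hc.exists_basis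
  rw [injective_iff_map_eq_zero]
  intro t ht
  refine Finsupp.ext fun j ↦ (Algebra.TensorProduct.basis (FunField X) bD).repr.injective
    (Finsupp.ext fun d ↦ ?_)
  have h := repr_expandD P hc ψ b bD t d
  rw [ht, map_zero, Finsupp.zero_apply] at h
  have h1 := expand_injective P hc ψ b (h.symm.trans (map_zero _).symm)
  have h2 := DFunLike.congr_fun h1 j
  rw [Finsupp.mapRange_apply] at h2
  rw [h2]
  simp

lemma expandD_mul (t : ι →₀ FunField X ⊗[k] D) (e : FunField X ⊗[k] D) :
    expandD P hc ψ b (t.mapRange (· * e) (zero_mul e)) =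
      expandD P hc ψ b t * extD D (rowFun P hc ψ) e := by
  rw [expandD_apply, expandD_apply, Finsupp.sum_mapRange_index (by simp), Finsupp.sum_mul]
  simp only [map_mul, smul_mul_assoc]

lemma exists_dotProduct_eq_zero {K : Type*} [Field K] (hn : 2 ≤ n) (s : Fin n → K) :
    ∃ r : Fin n → K, r ≠ 0 ∧ r ⬝ᵥ s = 0 := by
  by_cases h : s 0 = 0
  · exact ⟨Pi.single 0 1, by simp, by simp [h]⟩
  · let i : Fin n := ⟨1, hn⟩
    have hi : i ≠ 0 := by simp [i, Fin.ext_iff]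
    refine ⟨Pi.single 0 (s i) - Pi.single i (s 0), fun h0 ↦ h ?_, ?_⟩
    · have := congrFun h0 i
      simpa [hi] using this
    · simp [sub_dotProduct, mul_comm]

/-- An element of `T` other than zero is not annihilated by the algebra `D_ℓ` of matrices acting on
constant columns: it does not have the form `a s w` for a constant column `s`. -/
lemma eq_zero_of_liftHom_eq (hn : 2 ≤ n) {t : FunField X ⊗[k] D} (s : Fin n → ℓ)
    (a : (projSpace ℓ n).functionField) (w : Fin n → (projSpace ℓ n).functionField)
    (h : liftHom (mapRep (constHom k ℓ n) ψ) (extD D (rowFun P hc ψ) t) =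
      Matrix.vecMulVec (fun i ↦ a * constFun ℓ n (s i)) w) : t = 0 := by
  classical
  by_contra ht
  obtain ⟨r, hr, hrs⟩ := exists_dotProduct_eq_zero hn s
  -- The matrix with the row `r` annihilates the column `s`.
  let m : ℓ ⊗[k] D := (splitEquiv hc ψ).symm (Matrix.vecMulVec (Pi.single 0 1) r)
  have hm : m ≠ 0 := fun h0 ↦ hr <| by
    have h1 : Matrix.vecMulVec (Pi.single (0 : Fin n) 1) r = 0 := (splitEquiv hc ψ).symm.injective
      (h0.trans (map_zero _).symm)
    funext j
    have := congrFun (congrFun h1 0) j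
    simpa [Matrix.vecMulVec_apply] using this
  -- The coefficients of `m` over a basis of `ℓ` are elements of `D` that annihilate `t`. They vanish
  -- since `D` is a division algebra.
  let b := Module.Basis.ofVectorSpace k ℓ
  let δ := TensorProduct.equivFinsuppOfBasisLeft b m
  have hmδ : m = δ.sum fun j d ↦ b j ⊗ₜ d := by
    rw [← TensorProduct.equivFinsuppOfBasisLeft_symm_apply, LinearEquiv.symm_apply_apply]
  let t' : Module.Basis.ofVectorSpaceIndex k ℓ →₀ FunField X ⊗[k] D :=
    δ.mapRange (fun d ↦ (1 ⊗ₜ d) * t) (by simp)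
  have h1 : expandD P hc ψ b t' = extD D (constHom k ℓ n) m * extD D (rowFun P hc ψ) t := by
    rw [expandD_apply, Finsupp.sum_mapRange_index (by simp), hmδ, Finsupp.sum, Finsupp.sum, map_sum,
      Finset.sum_mul]
    refine Finset.sum_congr rfl fun j _ ↦ ?_
    rw [map_mul, ← smul_mul_assoc]
    congr 1
    simp [extD, TensorProduct.smul_tmul']
    rfl
  have h2 : extD D (constHom k ℓ n) m * extD D (rowFun P hc ψ) t = 0 := by
    apply (bijective_liftHom hc (mapRep (constHom k ℓ n) ψ)).1
    have hM : liftHom (mapRep (constHom k ℓ n) ψ) (extD D (constHom k ℓ n) m) =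
        (Matrix.vecMulVec (Pi.single (0 : Fin n) 1) r).map (constFun ℓ n) := by
      ext p q
      rw [liftHom_extD, liftHom_splitEquiv_symm]
      rfl
    rw [map_mul, map_zero, h, hM, Matrix.mul_vecMulVec]
    have h4 := congrArg (constFun ℓ n) hrs
    rw [map_zero, dotProduct, map_sum] at h4
    ext p q
    rw [Matrix.vecMulVec_apply]
    simp only [Matrix.mulVec, dotProduct, Matrix.map_apply, Matrix.vecMulVec_apply, map_mul]
    have h5 : ∑ j, constFun ℓ n ((Pi.single (0 : Fin n) 1 : Fin n → ℓ) p) * constFun ℓ n (r j) *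
        (a * constFun ℓ n (s j)) = constFun ℓ n ((Pi.single (0 : Fin n) 1 : Fin n → ℓ) p) * a *
          ∑ j, constFun ℓ n (r j * s j) := by
      rw [Finset.mul_sum]
      refine Finset.sum_congr rfl fun j _ ↦ ?_
      rw [map_mul]
      ring
    rw [h5, h4, mul_zero, zero_mul]
    rfl
  have h3 : t' = 0 := expandD_injective P hc ψ b ((h1.trans h2).trans (map_zero _).symm)
  have h4 : δ = 0 := Finsupp.ext fun j ↦ by
    by_contra hj
    have h5 : (1 ⊗ₜ δ j : FunField X ⊗[k] D) * t = 0 := DFunLike.congr_fun h3 j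
    have h6 : (1 ⊗ₜ (δ j)⁻¹ : FunField X ⊗[k] D) * (1 ⊗ₜ δ j * t) = t := by
      rw [← mul_assoc, Algebra.TensorProduct.tmul_mul_tmul, inv_mul_cancel₀ hj, one_mul,
        ← Algebra.TensorProduct.one_def, one_mul]
    rw [h5, mul_zero] at h6
    exact ht h6.symm
  exact hm (by rw [hmδ, h4, Finsupp.sum_zero_index])

variable {P} in
/-- There is no invertible sheaf on `X` that becomes `𝒪(1)` over a splitting field: after twisting
with it, the sheaf `𝒯` would have a nonzero global section, which corresponds to a constant column,
so that `D` would act on a space of dimension `n`. -/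
lemma not_linEquiv_hyperplane {σ : D →ₗ[k] D} (hσ : IsInvolution σ) (hn : 2 ≤ n)
    (c : divisors X.left) : ¬ LinEquiv (pullDiv (rowMap P hc ψ) c) (hyperplane ℓ n) := by
  rintro ⟨h, H⟩
  set K := (projSpace ℓ n).functionField
  set w := genericRow ℓ n
  let g := rowMap P hc ψ
  let Φ := liftHom (mapRep (constHom k ℓ n) ψ)
  let C (y : projSpace ℓ n) : K := funMap g (c.1 (g y) : X.left.functionField)
  let C' (y : projSpace ℓ n) : K := funMap g ((c⁻¹).1 (g y) : X.left.functionField)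
  have hC (y) : C y * C' y = 1 := by
    refine (map_mul (funMap g) _ _).symm.trans ((congrArg (funMap g) ?_).trans (map_one _))
    exact Units.mul_inv (c.1 (g y))
  have hreg (y) : IsRegUnit y (h * C y / w (coordAt y)) := by
    have h1 : IsRegUnit y _ := H y
    rw [Units.val_div_eq_div_val, Units.val_mul] at h1
    exact h1
  have hregi (y) : w (coordAt y) * C' y / (h : K) ∈ reg y := by
    refine (congrArg (· ∈ reg y) ?_).mp (hreg y).2.2
    have h1 := hC y
    have h2 := left_ne_zero_of_mul_eq_one h1
    have h3 := eq_inv_of_mul_eq_one_right h1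
    rw [h3, inv_div, ← div_div, div_right_comm, div_eq_mul_inv _ (C y)]
  obtain ⟨bD⟩ := hc.exists_basis
  let b := Module.Basis.ofVectorSpace k ℓ
  -- the element `z` with matrix `h⁻¹ e₀ w`
  let S (j : Fin n) : ℓ ⊗[k] D := (splitEquiv hc ψ).symm (Matrix.single 0 j 1)
  let z : K ⊗[k] D := ∑ j, (w j / h) • extD D (constHom k ℓ n) (S j)
  have hΦz : Φ z = Matrix.vecMulVec (Pi.single (0 : Fin n) (h : K)⁻¹) w := by
    ext p q
    simp only [z, map_sum, map_smul, Matrix.sum_apply, Matrix.smul_apply, Φ, liftHom_extD, S,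
      liftHom_splitEquiv_symm, Matrix.vecMulVec_apply]
    by_cases hp : p = 0
    · subst hp
      rw [Finset.sum_eq_single q (fun j _ hj ↦ by simp [hj]) (by simp)]
      simp [div_eq_mul_inv, mul_comm]
    · rw [Finset.sum_eq_zero fun j _ ↦ by simp [Ne.symm hp]]
      simp [hp]
  choose a ha hareg using fun d ↦ exists_expand_eq_of_divisor P hc ψ b c⁻¹
    (f := (Algebra.TensorProduct.basis K bD).repr z d) (fun y ↦ by
      have h1 : (Algebra.TensorProduct.basis K bD).repr z d = ∑ j, (w j / h) *
          constFun ℓ n ((Algebra.TensorProduct.basis ℓ bD).repr (S j) d) := by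
        simp only [z, map_sum, Finsupp.finsetSum_apply, map_smul, Finsupp.smul_apply, repr_extD,
          smul_eq_mul]
        rfl
      rw [h1, Finset.mul_sum]
      refine sum_mem fun j _ ↦ ?_
      have h2 := mul_mem (mul_mem (hregi y) (genericRow_div_mem y j)) (constFun_mem_reg ℓ
        ((Algebra.TensorProduct.basis ℓ bD).repr (S j) d) y)
      refine (congrArg (· ∈ reg y) ?_).mp h2
      change _ = C' y * _
      have h3 : w (coordAt y) ≠ 0 := genericRow_ne_zero _
      change _ * (w j / w (coordAt y)) * _ = _
      field_simp)
  -- its expansion with coefficients over `X`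
  let t : _ →₀ FunField X ⊗[k] D := ∑ d, (a d).mapRange
    (fun x ↦ x • Algebra.TensorProduct.basis (FunField X) bD d) (zero_smul _ _)
  have htj (j d) : (Algebra.TensorProduct.basis (FunField X) bD).repr (t j) d = a d j := by
    simp [t, Finsupp.finsetSum_apply, Finsupp.single_apply]
  have htz : expandD P hc ψ b t = z := by
    refine (Algebra.TensorProduct.basis K bD).repr.injective (Finsupp.ext fun d ↦ ?_)
    rw [repr_expandD, ← ha d]
    congr 1
    exact Finsupp.ext fun j ↦ htj j d
  obtain ⟨U, hU, ⟨f⟩⟩ := exists_frame (P := P) hc hσ (genericPoint X.left)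
  -- An idempotent generator `ε` of `T` detects that the coefficients `t j` lie in `T`.
  obtain ⟨ε, hε, hε0, hεT⟩ := f.exists_idempotent hc hU
  obtain ⟨e, he⟩ := liftHom_rowFun P hc ψ hε
  have hwe : w ⬝ᵥ e = 1 := by
    have h1 : Φ (extD D (rowFun P hc ψ) ε) * Φ (extD D (rowFun P hc ψ) ε) =
        Φ (extD D (rowFun P hc ψ) ε) := by
      rw [← map_mul, ← map_mul, (hεT ε).1 hε]
    have h2 : Φ (extD D (rowFun P hc ψ) ε) ≠ 0 := fun h0 ↦ hε0 <|
      extD_injective (rowFun P hc ψ).toRingHom.injective <|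
        (bijective_liftHom hc (mapRep (constHom k ℓ n) ψ)).1 <| by
          rw [map_zero, map_zero]; exact h0
    rw [show Φ (extD D (rowFun P hc ψ) ε) = _ from he, Matrix.vecMulVec_mul_vecMulVec,
      Matrix.vecMulVec_smul] at h1
    rw [show Φ (extD D (rowFun P hc ψ) ε) = _ from he] at h2
    have h3 := sub_eq_zero.2 h1
    rw [← one_smul K (Matrix.vecMulVec e (genericRow ℓ n)), smul_smul, mul_one, ← sub_smul] at h3
    exact sub_eq_zero.1 ((smul_eq_zero.1 h3).resolve_right h2)
  have hzε : z * extD D (rowFun P hc ψ) ε = z := by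
    apply (bijective_liftHom hc (mapRep (constHom k ℓ n) ψ)).1
    rw [map_mul, he]
    change Φ z * _ = Φ z
    rw [hΦz, Matrix.vecMulVec_mul_vecMulVec]
    change Matrix.vecMulVec _ ((w ⬝ᵥ e) • w) = _
    rw [hwe, one_smul]
  have htT (j) : t j ∈ P.T := by
    rw [hεT]
    have h1 := expandD_mul P hc ψ b t ε
    rw [htz, hzε, ← htz] at h1
    exact DFunLike.congr_fun (expandD_injective P hc ψ b h1) j
  -- The columns of the coefficients are regular up to the factor `h`, hence constant up to it.
  have ht0 (j) : t j = 0 := by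
    obtain ⟨v, hv⟩ := liftHom_rowFun P hc ψ (htT j)
    have h1 (i) : ∃ s, constFun ℓ n s = h * v i := by
      refine exists_constFun_eq ℓ hn fun y ↦ ?_
      have h2 : C' y * (v i * w (coordAt y)) ∈ reg y := by
        have h3 := congrFun (congrFun hv i) (coordAt y)
        rw [Matrix.vecMulVec_apply, liftHom_eq_sum bD, Matrix.sum_apply] at h3
        change _ = v i * w (coordAt y) at h3
        rw [← h3, Finset.mul_sum]
        refine sum_mem fun d _ ↦ ?_
        rw [Matrix.smul_apply, smul_eq_mul, repr_extD, htj, ← mul_assoc]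
        refine mul_mem ?_ (constFun_mem_reg ℓ _ y)
        have h4 := funMap_mem_reg g (hareg d (g y) j)
        rw [map_mul] at h4
        exact h4
      have h5 := mul_mem (hreg y).2.1 h2
      refine (congrArg (· ∈ reg y) ?_).mp h5
      have h6 : w (coordAt y) ≠ 0 := genericRow_ne_zero _
      calc _ = (C y * C' y) * (h * v i * (w (coordAt y) / w (coordAt y))) := by ring
        _ = h * v i := by rw [hC, div_self h6, one_mul, mul_one]
    choose s hs using h1
    refine eq_zero_of_liftHom_eq P hc ψ hn s (h : K)⁻¹ w (hv.trans ?_)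
    congr 1
    funext i
    rw [hs, inv_mul_cancel_left₀ h.ne_zero]
  have h1 : z = 0 := by
    rw [← htz, show t = 0 from Finsupp.ext ht0, map_zero]
  rw [h1, map_zero] at hΦz
  have h2 := congrFun (congrFun hΦz.symm 0) 0
  rw [Matrix.vecMulVec_apply, Pi.single_eq_same] at h2
  exact mul_ne_zero (inv_ne_zero h.ne_zero) (genericRow_ne_zero 0) h2

/-- An invertible sheaf on `X` that becomes `𝒪(-2)` over a splitting field generates the Picard
group: the restriction of `Pic X` to `ℙ^{n-1}_ℓ` is injective, and its image does not contain
`𝒪(1)`. -/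
lemma generatesPic_of_linEquiv {σ : D →ₗ[k] D} (hσ : IsInvolution σ) (hn : 2 ≤ n)
    {M : X.left.Modules} {c : divisors X.left} (e : M ≅ divSheaf c)
    (h : LinEquiv (pullDiv (rowMap P hc ψ) c) (hyperplane ℓ n ^ (-2 : ℤ))) : GeneratesPic M := by
  refine ⟨isInvertible_of_iso_divSheaf e, fun N hN ↦ ?_⟩
  obtain ⟨d, ⟨i⟩⟩ := exists_iso_divSheaf hN
  obtain ⟨j, hj⟩ := exists_linEquiv_zpow hn (pullDiv (rowMap P hc ψ) d)
  have hpow (m : ℤ) :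
      LinEquiv (pullDiv (rowMap P hc ψ) (d * c ^ m)) (hyperplane ℓ n ^ (j - 2 * m)) := by
    have h1 := hj.mul (h.zpow m)
    rw [← zpow_mul, ← zpow_add, neg_mul, ← sub_eq_add_neg] at h1
    rwa [map_mul, map_zpow]
  obtain ⟨m, rfl | rfl⟩ := j.even_or_odd'
  · have h1 := hpow m
    rw [sub_self, zpow_zero] at h1
    have h2 := linEquiv_one_of_pullDiv P hc ψ hn h1
    obtain hm | hm := le_total 0 m
    · lift m to ℕ using hm
      refine ⟨m, .inr ?_⟩
      obtain ⟨i₁⟩ := tensorPow_divSheaf e m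
      obtain ⟨i₂⟩ := tensor_divSheaf i i₁
      rw [zpow_natCast] at h2
      obtain ⟨i₃⟩ := divSheaf_iso_of_linEquiv h2
      obtain ⟨i₄⟩ := divSheaf_one (X := X.left)
      exact ⟨i₂ ≪≫ i₃ ≪≫ i₄.symm⟩
    · obtain ⟨m, rfl⟩ := Int.exists_eq_neg_ofNat hm
      refine ⟨m, .inl ?_⟩
      obtain ⟨i₁⟩ := tensorPow_divSheaf e m
      have h3 := h2.mul (LinEquiv.refl (c ^ m))
      rw [zpow_neg, zpow_natCast, inv_mul_cancel_right, one_mul] at h3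
      obtain ⟨i₃⟩ := divSheaf_iso_of_linEquiv h3
      exact ⟨i ≪≫ i₃ ≪≫ i₁.symm⟩
  · have h1 := hpow m
    rw [add_sub_cancel_left, zpow_one] at h1
    exact (not_linEquiv_hyperplane hc ψ hσ hn _ h1).elim

end PicardDescent

end SeveriBrauer
end

theorem proposition2p4 {k D : Type u} [Field k] (hchar : ringChar k ≠ 2) [DivisionRing D]
    [Algebra k D] [Algebra.IsCentral k D] [FiniteDimensional k D] (d n : ℕ) (hd : 1 ≤ d)
    (hn : n = 2 ^ d) (hD : Module.finrank k D = n ^ 2)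
    (σ : D →ₗ[k] D) (hσ : IsSymplecticInvolution k D n σ)
    (X : Over (Spec (.of k))) (P : SeveriBrauerVariety k D n X) :
    ∃ _ : IsIntegral X.left,
      IsInvertible (P.sheafL σ) ∧
      (∀ (ℓ : Type u) [Field ℓ] [Algebra k ℓ], IsSplittingField k D n ℓ →
        IsTwistAfter (P.sheafL σ) n ℓ (-2)) ∧
      GeneratesPic (P.sheafL σ) ∧
      -- the isomorphisms `mult` and `can` over the function field
      ∃ (mult : BalancedTensor (P.sigmaT σ) P.T ≃ₗ[FunField X] P.L σ)
        (can : (P.T ⊗[FunField X] P.sigmaT σ) ≃ₗ[FunField X]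
          (P.L σ ⊗[FunField X] (FunField X ⊗[k] D))),
        (∀ (s : P.sigmaT σ) (t : P.T),
          (mult (BalancedTensor.tmul s t) : FunField X ⊗[k] D) = s * t) ∧
        (∃ (l : P.L σ) (m : FunField X ⊗[k] D),
          HasReducedTrace n ((l : FunField X ⊗[k] D) * m) (1 : FunField X)) ∧
        (∀ (l : P.L σ) (m : FunField X ⊗[k] D),
          HasReducedTrace n ((l : FunField X ⊗[k] D) * m) (1 : FunField X) →
          ∀ (t : P.T) (s : P.sigmaT σ),
            can (t ⊗ₜ s) = l ⊗ₜ ((t : FunField X ⊗[k] D) * m * s)) ∧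
        -- the isomorphisms of sheaves, and the identifications `κ` of the generic fibers
        ∃ (multX : balancedTensor (P.sigmaT σ) P.T ≅ P.sheafL σ)
          (canX : tensor P.sheafT (P.sheafSigmaT σ) ≅ tensor (P.sheafL σ) (azumaya D X))
          (κ₁ : modStalk (balancedTensor (P.sigmaT σ) P.T) (genericPoint X.left) ≃+
            BalancedTensor (P.sigmaT σ) P.T)
          (κ₂ : modStalk (P.sheafL σ) (genericPoint X.left) ≃+ P.L σ)
          (κ₃ : modStalk (tensor P.sheafT (P.sheafSigmaT σ)) (genericPoint X.left) ≃+
            P.T ⊗[FunField X] P.sigmaT σ)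
          (κ₄ : modStalk (tensor (P.sheafL σ) (azumaya D X)) (genericPoint X.left) ≃+
            P.L σ ⊗[FunField X] (FunField X ⊗[k] D)),
          (∀ (U : X.left.Opens) (hU : genericPoint X.left ∈ U)
            (s : Γ(P.sheafSigmaT σ, U)) (t : Γ(P.sheafT, U)),
            κ₁ (modGerm _ U _ hU (balancedTmul (P.sigmaT σ) P.T U s t)) =
              BalancedTensor.tmul (interGerm _ U hU s) (interGerm _ U hU t)) ∧
          (∀ (U : X.left.Opens) (hU : genericPoint X.left ∈ U) (s : Γ(P.sheafL σ, U)),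
            κ₂ (modGerm _ U _ hU s) = interGerm _ U hU s) ∧
          (∀ (U : X.left.Opens) (hU : genericPoint X.left ∈ U)
            (t : Γ(P.sheafT, U)) (s : Γ(P.sheafSigmaT σ, U)),
            κ₃ (modGerm _ U _ hU (tmul P.sheafT (P.sheafSigmaT σ) U t s)) =
              interGerm _ U hU t ⊗ₜ interGerm _ U hU s) ∧
          (∀ (U : X.left.Opens) (hU : genericPoint X.left ∈ U)
            (l : Γ(P.sheafL σ, U)) (a : Γ(azumaya D X, U)),
            κ₄ (modGerm _ U _ hU (tmul (P.sheafL σ) (azumaya D X) U l a)) =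
              interGerm _ U hU l ⊗ₜ azumayaGerm U hU a) ∧
          -- on the generic fiber, `multX` is `mult` and `canX` is `can`
          (∀ z, κ₂ (modStalkMap multX.hom (genericPoint X.left) z) = mult (κ₁ z)) ∧
          (∀ z, κ₄ (modStalkMap canX.hom (genericPoint X.left) z) = can (κ₃ z)) := by
  have hn2 : 2 ≤ n := hn ▸ (pow_one 2).symm.le.trans (Nat.pow_le_pow_right two_pos hd)
  have hn0 : NeZero n := ⟨by omega⟩
  have hc : IsCSA k D n :=
    ⟨by omega, hD, let ⟨φ, _⟩ := hσ.symplectic; ⟨φ⟩⟩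
  have hσ' : IsInvolution σ := ⟨hσ.map_mul, hσ.involutive⟩
  have hX : IsIntegral X.left := isIntegral_severiBrauer P hc
  obtain ⟨c, l, ⟨e⟩, hl⟩ := exists_sheafL_iso (P := P) hc hσ'
  refine ⟨hX, isInvertible_of_iso_divSheaf e, ?_, ?_, exists_mult_can P hc hσ'⟩
  · rintro ℓ _ _ ⟨φ⟩
    exact isTwistAfter_of_linEquiv P hc hn2 (splitRep φ) e
      (linEquiv_pullDiv_sheafL hc (splitRep φ) hσ' c l hl)
  · obtain ⟨φ⟩ := hc.split
    exact generatesPic_of_linEquiv P hc (splitRep φ) hσ' hn2 e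
      (linEquiv_pullDiv_sheafL hc (splitRep φ) hσ' c l hl)
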